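/- **Setting.** Let $M$ be an $n$-dimensional real-analytic (Hausdorff, second countable) manifold, connected if $n=1$; let $G$ be a compact connected Lie group and $B\to M$ a smooth principal $G$-bundle with fibres $B_x$. A *graph* $\gamma$ in $M$ is a non-empty finite set of unparametrized analytic edges, each diffeomorphic to $[0,1]$, such that two distinct edges meet at most in common end points and each edge is connected at both ends with another edge of $\gamma$; $\gamma'\ge\gamma$ means that each edge of $\gamma$ is a composition of edges of $\gamma'$ and each vertex of $\gamma$ is a vertex of $\gamma'$. Let $\mathcal A_\gamma$ be the set of all assignments to each edge $e$ of $\gamma$ (with an orientation) of a parallel transport, i.e. of a $G$-equivariant bijection $B_{e_-}\to B_{e_+}$ from the fibre over its initial to the fibre over its final vertex; points in the fibres over the vertices identify $\mathcal A_\gamma$ with $G^{E}$, $E$ the number of edges, whence its manifold structure and its normalized Haar measure $\mu_\gamma$. Composition of parallel transports gives projections $p_{\gamma\gamma'}:\mathcal A_{\gamma'}\to\mathcal A_\gamma$ for $\gamma'\ge\gamma$; $\overline{\mathcal A}$ is the projective limit, with projections $p_\gamma:\overline{\mathcal A}\to\mathcal A_\gamma$. The group $\overline{\mathcal G}=\prod_{x\in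 M}\mathrm{Aut}_G(B_x)$ acts on each $\mathcal A_\gamma$ (through the vertices of $\gamma$) and on $\overline{\mathcal A}$. $\mathrm{Cyl}^k(\overline{\mathcal A})$ is the set of functions $f_\gamma\circ p_\gamma$ with $f_\gamma\in C^k(\mathcal A_\gamma,\mathbb C)$, and $\mathrm{Cyl}^k(\overline{\mathcal A}/\overline{\mathcal G})$ is the set of its $\overline{\mathcal G}$-invariant elements. A *(smooth) vector field* on $\overline{\mathcal A}$ is a family $X=(X_\gamma)_{\gamma\ge\gamma_0}$, for some graph $\gamma_0$, of smooth vector fields $X_\gamma$ on $\mathcal A_\gamma$ with $(p_{\gamma\gamma'})_*X_{\gamma'}=X_\gamma$ for $\gamma'\ge\gamma\ge\gamma_0$; it acts on cylindrical functions by $X(f_\gamma\circ p_\gamma)=(X_\gamma f_\gamma)\circ p_\gamma$ ($\gamma\ge\gamma_0$), and it is $\overline{\mathcal G}$-invariant if all $X_\gamma$, $\gamma\ge\gamma_0$, are. The commutator is $[X,Y]=([X_\gamma,Y_\gamma])_{\gamma\ge\gamma_3}$, where $\gamma_3$ is any graph above the initial graphs $\gamma_1$ of $X$ and $\gamma_2$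 of $Y$. **Theorem 4.** There is a regular Borel probability measure $\mu_o$ on $\overline{\mathcal A}$ with $(p_\gamma)_*\mu_o=\mu_\gamma$ for all $\gamma$; denote its image on $\overline{\mathcal A}/\overline{\mathcal G}$ by $\mu_o$ too. (i) Let $X=(X_\gamma)_{\gamma\ge\gamma_0}$ be a $\overline{\mathcal G}$-invariant vector field on $\overline{\mathcal A}$. Then $X$ has a divergence with respect to $\mu_o$, i.e. there is a function $\operatorname{div}X$ on $\overline{\mathcal A}$ with $\operatorname{div}X=(\operatorname{div}_{\mu_\gamma}X_\gamma)\circ p_\gamma$ for every $\gamma\ge\gamma_0$; it is a $\overline{\mathcal G}$-invariant smooth cylindrical function, and the operator $$P(X)=i\left(X+\tfrac12\operatorname{div}X\right)$$ with domain $\mathrm{Cyl}^1(\overline{\mathcal A}/\overline{\mathcal G})$ is well defined and essentially self-adjoint on $L^2(\overline{\mathcal A}/\overline{\mathcal G},\mu_o)$. (ii) Let $X=(X_\gamma)_{\gamma\ge\gamma_1}$ and $Y=(Y_\gamma)_{\gamma\ge\gamma_2}$ be $\overline{\mathcal G}$-invariant vector fields on $\overline{\mathcal A}$. There is a graph $\gamma_3\ge\gamma_1,\gamma_2$,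 and for each such $\gamma_3$ the commutator $[X,Y]$ is again a $\overline{\mathcal G}$-invariant vector field on $\overline{\mathcal A}$; the operators $P(X)$ and $P(Y)$ map $\mathrm{Cyl}^2(\overline{\mathcal A}/\overline{\mathcal G})$ into $\mathrm{Cyl}^1(\overline{\mathcal A}/\overline{\mathcal G})$, and $$P([X,Y])=-i\,[P(X),P(Y)]\qquad\text{on }\mathrm{Cyl}^2(\overline{\mathcal A}/\overline{\mathcal G}).$$ -/

import Mathlib

open scoped Manifold ContDiff
open MeasureTheory Set

noncomputable section

namespace GenConn

/-! ### Finite products of manifolds -/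

/-- A finite product of `C^k` manifolds, with the product atlas, is a `C^k` manifold. -/
instance isManifold_pi {ι : Type*} [Fintype ι] {E : Type*} [NormedAddCommGroup E] [NormedSpace ℝ E]
    {k : WithTop ℕ∞} (N : ι → Type*) [∀ i, TopologicalSpace (N i)] [∀ i, ChartedSpace E (N i)]
    [∀ i, IsManifold 𝓘(ℝ, E) k (N i)] :
    IsManifold (ModelWithCorners.pi fun _ : ι => 𝓘(ℝ, E)) k (∀ i, N i) := by
  apply isManifold_of_contDiffOn
  rintro _ _ ⟨e, he, rfl⟩ ⟨e', he', rfl⟩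
  have key : ∀ i, ContDiffOn ℝ k ((e i).symm ≫ₕ e' i) ((e i).symm ≫ₕ e' i).source := by
    intro i
    have h := (contDiffGroupoid k 𝓘(ℝ, E)).compatible (he i trivial) (he' i trivial)
    rw [contDiffGroupoid, mem_groupoid_of_pregroupoid] at h
    simpa [contDiffPregroupoid] using h.1
  refine contDiffOn_pi.2 fun i => ?_
  refine (key i).comp (f := fun x : ι → E => x i) ?_ ?_
  · exact (contDiff_apply ℝ E i).contDiffOn
  · rintro x ⟨⟨hx1, hx2⟩, -⟩
    exact ⟨hx1 i trivial, hx2 i trivial⟩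

/-! ### Analytic edges and graphs in the base manifold -/

section Graphs

variable (n : ℕ) {M : Type*} [TopologicalSpace M] [ChartedSpace (EuclideanSpace ℝ (Fin n)) M]

/-- An analytic embedding of the closed interval `[0,1]` into `M`. -/
def IsAnalyticArc (c : ℝ → M) : Prop :=
  ContMDiffOn 𝓘(ℝ, ℝ) (𝓡 n) ω c (Icc 0 1) ∧
    (∀ t ∈ Icc (0 : ℝ) 1, mfderivWithin 𝓘(ℝ, ℝ) (𝓡 n) c (Icc 0 1) t ≠ 0) ∧
    InjOn c (Icc 0 1)

/-- An unparametrized, unoriented analytic edge diffeomorphic to `[0,1]`. Two analytic embeddings of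
`[0,1]` differ by an analytic reparametrization (possibly reversing the orientation) if and only if
they have the same image, so such an edge is the same thing as that image. -/
def IsEdge (e : Set M) : Prop := ∃ c : ℝ → M, IsAnalyticArc n c ∧ c '' Icc 0 1 = e

/-- The two end points of an edge. -/
def endpoints (e : Set M) : Set M :=
  {v | ∃ c : ℝ → M, IsAnalyticArc n c ∧ c '' Icc 0 1 = e ∧ (v = c 0 ∨ v = c 1)}

variable (M) in
/-- A graph in `M`: a (non-empty) finite set of analytic edges, two of which meet at most in common
end points, and each of which is connected at both ends with another edge of the set. -/
structure Graph where
  edges : Finset (Set M)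
  nonempty : edges.Nonempty
  isEdge : ∀ e ∈ edges, IsEdge n e
  inter_subset : ∀ e ∈ edges, ∀ e' ∈ edges, e ≠ e' → e ∩ e' ⊆ endpoints n e ∩ endpoints n e'
  closed : ∀ e ∈ edges, ∀ v ∈ endpoints n e, ∃ e' ∈ edges, e' ≠ e ∧ v ∈ endpoints n e'

variable {n}

namespace Graph

/-- The vertices of a graph. -/
def vertices (γ : Graph n M) : Set M := {v | ∃ e ∈ γ.edges, v ∈ endpoints n e}

/-- The type of edges of a graph. -/
abbrev Edge (γ : Graph n M) : Type _ := {e : Set M // e ∈ γ.edges}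

/-- A parametrization of an edge, which also fixes an orientation of it. (It depends only on the
edge as a subset of `M`, not on the graph.) -/
def param (γ : Graph n M) (e : γ.Edge) : ℝ → M := (γ.isEdge e.1 e.2).choose

/-- The initial vertex of an edge, in the chosen orientation. -/
def src (γ : Graph n M) (e : γ.Edge) : M := γ.param e 0

/-- The final vertex of an edge, in the chosen orientation. -/
def tgt (γ : Graph n M) (e : γ.Edge) : M := γ.param e 1

/-- Edge paths of a graph starting at the point `x`: compositions of edges, each of which is
traversed either along its chosen orientation or against it. -/
inductive Walk (γ : Graph n M) (x : M) : M → Type _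
  | nil : Walk γ x x
  | forward (e : γ.Edge) (w : Walk γ x (γ.src e)) : Walk γ x (γ.tgt e)
  | backward (e : γ.Edge) (w : Walk γ x (γ.tgt e)) : Walk γ x (γ.src e)

/-- The list of the edges traversed by an edge path. -/
def Walk.edgeList {γ : Graph n M} {x : M} : {y : M} → γ.Walk x y → List γ.Edge
  | _, .nil => []
  | _, .forward e w => e :: w.edgeList
  | _, .backward e w => e :: w.edgeList

/-- The edge path `w` of `γ` is a decomposition of the edge `e` of `M`, i.e. `e` is the composition
of the (distinct) edges of `γ` traversed by `w`. -/
def Walk.Composes {γ : Graph n M} {x y : M} (w : γ.Walk x y) (e : Set M) : Prop :=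
  w.edgeList.Nodup ∧ ⋃ d ∈ w.edgeList, (d : Set M) = e

/-- `γ ≤ γ'`: each edge of `γ` is a composition of edges of `γ'` and each vertex of `γ` is a
vertex of `γ'`. -/
instance : LE (Graph n M) where
  le γ γ' :=
    (∀ e : γ.Edge, ∃ w : γ'.Walk (γ.src e) (γ.tgt e), w.Composes (e : Set M)) ∧
      γ.vertices ⊆ γ'.vertices

/-- A decomposition of an edge of `γ` into edges of a larger graph `γ'`. -/
def walk {γ γ' : Graph n M} (h : γ ≤ γ') (e : γ.Edge) : γ'.Walk (γ.src e) (γ.tgt e) :=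
  (h.1 e).choose

end Graph

end Graphs

/-! ### Principal bundles and isomorphisms between their fibres -/

section Bundle

/-- A smooth principal `G`-bundle with base `M` (of dimension `n`) and total space `P`. -/
structure PrincipalBundle (n : ℕ) (M : Type*) [TopologicalSpace M]
    [ChartedSpace (EuclideanSpace ℝ (Fin n)) M]
    (E : Type*) [NormedAddCommGroup E] [NormedSpace ℝ E]
    (G : Type*) [Group G] [TopologicalSpace G] [ChartedSpace E G]
    (F : Type*) [NormedAddCommGroup F] [NormedSpace ℝ F]
    (P : Type*) [TopologicalSpace P] [ChartedSpace F P] where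
  /-- the bundle projection -/
  proj : P → M
  /-- the right action of the structure group -/
  act : P → G → P
  contMDiff_proj : ContMDiff 𝓘(ℝ, F) (𝓡 n) ∞ proj
  contMDiff_act :
    ContMDiff (𝓘(ℝ, F).prod 𝓘(ℝ, E)) 𝓘(ℝ, F) ∞ fun z : P × G => act z.1 z.2
  act_one : ∀ p, act p 1 = p
  act_mul : ∀ p g h, act p (g * h) = act (act p g) h
  proj_act : ∀ p g, proj (act p g) = proj p
  /-- Local triviality: near each point of the base there are a smooth section `s` and a smooth
  `G`-valued function `τ` such that `(y, g) ↦ s y · g` and `p ↦ (proj p, τ p)` are mutually inverse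
  diffeomorphisms. -/
  locally_trivial : ∀ x : M, ∃ U : Set M, IsOpen U ∧ x ∈ U ∧ ∃ (s : M → P) (τ : P → G),
    ContMDiffOn (𝓡 n) 𝓘(ℝ, F) ∞ s U ∧ ContMDiffOn 𝓘(ℝ, F) 𝓘(ℝ, E) ∞ τ (proj ⁻¹' U) ∧
    (∀ y ∈ U, proj (s y) = y) ∧ (∀ p ∈ proj ⁻¹' U, act (s (proj p)) (τ p) = p) ∧
    ∀ y ∈ U, ∀ g, τ (act (s y) g) = g

variable {n : ℕ} {M : Type*} [TopologicalSpace M] [ChartedSpace (EuclideanSpace ℝ (Fin n)) M]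
  {E : Type*} [NormedAddCommGroup E] [NormedSpace ℝ E]
  {G : Type*} [Group G] [TopologicalSpace G] [ChartedSpace E G]
  {F : Type*} [NormedAddCommGroup F] [NormedSpace ℝ F]
  {P : Type*} [TopologicalSpace P] [ChartedSpace F P]

namespace PrincipalBundle

/-- The fibre over `x`. -/
abbrev Fiber (B : PrincipalBundle n M E G F P) (x : M) : Type _ := {p : P // B.proj p = x}

/-- The right action of `G` on a fibre. -/
def actFiber (B : PrincipalBundle n M E G F P) {x : M} (p : B.Fiber x) (g : G) : B.Fiber x :=
  ⟨B.act p.1 g, (B.proj_act p.1 g).trans p.2⟩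

theorem nonempty_fiber (B : PrincipalBundle n M E G F P) (x : M) : Nonempty (B.Fiber x) := by
  obtain ⟨U, -, hx, s, -, -, -, hs, -⟩ := B.locally_trivial x
  exact ⟨⟨s x, hs x hx⟩⟩

/-- `G` acts simply transitively on each fibre. -/
theorem existsUnique_act (B : PrincipalBundle n M E G F P) {x : M} (p q : B.Fiber x) :
    ∃! g : G, B.actFiber p g = q := by
  obtain ⟨U, -, hx, s, τ, -, -, -, h1, h2⟩ := B.locally_trivial x
  obtain ⟨p, rfl⟩ := p
  obtain ⟨q, hq⟩ := q
  have hp : B.act (s (B.proj p)) (τ p) = p := h1 p hx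
  have hq' : B.act (s (B.proj p)) (τ q) = q := by
    have := h1 q (by simpa [hq] using hx)
    rwa [hq] at this
  refine ⟨(τ p)⁻¹ * τ q, ?_, ?_⟩
  · apply Subtype.ext
    change B.act p _ = q
    have h3 : B.act (B.act (s (B.proj p)) (τ p)) ((τ p)⁻¹ * τ q) = q := by
      rw [← B.act_mul, mul_inv_cancel_left, hq']
    rwa [hp] at h3
  · intro g hg
    have hg' : B.act p g = q := congrArg Subtype.val hg
    rw [← hp, ← B.act_mul] at hg'
    have := congrArg τ hg'
    rw [h2 _ hx] at this
    rw [← this]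
    simp

/-- The element of `G` that carries `p` to `q`. -/
def fiberDiv (B : PrincipalBundle n M E G F P) {x : M} (p q : B.Fiber x) : G :=
  (B.existsUnique_act p q).choose

theorem act_fiberDiv (B : PrincipalBundle n M E G F P) {x : M} (p q : B.Fiber x) :
    B.actFiber p (B.fiberDiv p q) = q :=
  (B.existsUnique_act p q).choose_spec.1

theorem fiberDiv_eq (B : PrincipalBundle n M E G F P) {x : M} {p q : B.Fiber x} {g : G}
    (h : B.actFiber p g = q) : B.fiberDiv p q = g :=
  (B.existsUnique_act p q).unique (B.act_fiberDiv p q) h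

theorem actFiber_mul (B : PrincipalBundle n M E G F P) {x : M} (p : B.Fiber x) (g h : G) :
    B.actFiber p (g * h) = B.actFiber (B.actFiber p g) h :=
  Subtype.ext (B.act_mul p.1 g h)

/-- An isomorphism of the fibre over `x` with the fibre over `y`, i.e. a bijection which commutes
with the action of `G`. -/
@[ext]
structure FiberIso (B : PrincipalBundle n M E G F P) (x y : M) where
  toEquiv : B.Fiber x ≃ B.Fiber y
  map_act : ∀ p g, toEquiv (B.actFiber p g) = B.actFiber (toEquiv p) g

namespace FiberIso

variable {B : PrincipalBundle n M E G F P} {x y z : M}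

/-- The identity isomorphism. -/
def refl (B : PrincipalBundle n M E G F P) (x : M) : B.FiberIso x x := ⟨Equiv.refl _, fun _ _ => rfl⟩

/-- The inverse isomorphism. -/
def symm (φ : B.FiberIso x y) : B.FiberIso y x :=
  ⟨φ.toEquiv.symm, fun p g => by
    rw [Equiv.symm_apply_eq, φ.map_act, Equiv.apply_symm_apply]⟩

/-- Composition of isomorphisms: first `φ`, then `ψ`. -/
def trans (φ : B.FiberIso x y) (ψ : B.FiberIso y z) : B.FiberIso x z :=
  ⟨φ.toEquiv.trans ψ.toEquiv, fun p g => by simp [φ.map_act, ψ.map_act]⟩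

/-- A point in the fibre over `x`. -/
def basePoint (B : PrincipalBundle n M E G F P) (x : M) : B.Fiber x := (B.nonempty_fiber x).some

/-- The group valued chart: given points `p` over `x` and `q` over `y`, the isomorphism `φ` is
identified with the `g : G` such that `φ p = q · g`. -/
def chart (B : PrincipalBundle n M E G F P) (x y : M) : B.FiberIso x y ≃ G where
  toFun φ := B.fiberDiv (basePoint B y) (φ.toEquiv (basePoint B x))
  invFun g :=
    { toEquiv :=
        { toFun := fun p => B.actFiber (basePoint B y) (g * B.fiberDiv (basePoint B x) p)
          invFun := fun q => B.actFiber (basePoint B x) (g⁻¹ * B.fiberDiv (basePoint B y) q)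
          left_inv := fun p => by
            beta_reduce
            rw [B.fiberDiv_eq rfl, inv_mul_cancel_left, B.act_fiberDiv]
          right_inv := fun q => by
            beta_reduce
            rw [B.fiberDiv_eq rfl, mul_inv_cancel_left, B.act_fiberDiv] }
      map_act := fun p h => by
        have : B.fiberDiv (basePoint B x) (B.actFiber p h)
            = B.fiberDiv (basePoint B x) p * h := by
          apply B.fiberDiv_eq
          rw [B.actFiber_mul, B.act_fiberDiv]
        simp only [Equiv.coe_fn_mk]
        rw [this, ← mul_assoc, B.actFiber_mul] }
  left_inv φ := by
    ext p : 2
    simp only [Equiv.coe_fn_mk]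
    rw [B.actFiber_mul, B.act_fiberDiv, ← φ.map_act, B.act_fiberDiv]
  right_inv g := by
    apply B.fiberDiv_eq
    simp only [Equiv.coe_fn_mk]
    rw [B.fiberDiv_eq (p := basePoint B x) (g := 1) (Subtype.ext (B.act_one _)), mul_one]

/-- The topology of `FiberIso x y`, transported from `G`. -/
instance : TopologicalSpace (B.FiberIso x y) := TopologicalSpace.induced (chart B x y) inferInstance

/-- The group valued chart as a homeomorphism. -/
def chartHomeo (B : PrincipalBundle n M E G F P) (x y : M) : B.FiberIso x y ≃ₜ G :=
  (chart B x y).toHomeomorphOfIsInducing ⟨rfl⟩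

/-- The manifold structure of `FiberIso x y`, transported from `G`. -/
instance : ChartedSpace E (B.FiberIso x y) where
  atlas := {c | ∃ e ∈ atlas E G, c = (chartHomeo B x y).toOpenPartialHomeomorph ≫ₕ e}
  chartAt φ := (chartHomeo B x y).toOpenPartialHomeomorph ≫ₕ chartAt E (chartHomeo B x y φ)
  mem_chart_source φ := by
    simp
  chart_mem_atlas φ := ⟨_, chart_mem_atlas E _, rfl⟩

instance {k : WithTop ℕ∞} [IsManifold 𝓘(ℝ, E) k G] :
    IsManifold 𝓘(ℝ, E) k (B.FiberIso x y) := by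
  apply isManifold_of_contDiffOn
  rintro _ _ ⟨e, he, rfl⟩ ⟨e', he', rfl⟩
  have h := (contDiffGroupoid k 𝓘(ℝ, E)).compatible he he'
  rw [contDiffGroupoid, mem_groupoid_of_pregroupoid] at h
  have h1 := h.1
  simp only [contDiffPregroupoid] at h1
  refine (h1.mono ?_).congr ?_
  · rintro u hu
    simpa using hu
  · rintro u hu
    simp

instance : MeasurableSpace (B.FiberIso x y) := borel _

instance : BorelSpace (B.FiberIso x y) := ⟨rfl⟩

/-- The normalized Haar measure, transported from `G`. -/
def haar [IsTopologicalGroup G] [CompactSpace G] [MeasurableSpace G] [BorelSpace G]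
    (B : PrincipalBundle n M E G F P) (x y : M) : Measure (B.FiberIso x y) :=
  (Measure.haarMeasure (⊤ : TopologicalSpace.PositiveCompacts G)).map (chart B x y).symm

end FiberIso

end PrincipalBundle

/-! ### The projective family of the spaces `A_γ`, its limit, and the gauge group -/

open PrincipalBundle

/-- The space `A_γ` of connections on a graph: a point of `A_γ` assigns to each (oriented) edge of
`γ` a parallel transport, i.e. an isomorphism of the fibre over the initial vertex with the fibre
over the final vertex. It is a compact manifold, diffeomorphic to `G ^ (number of edges)`. -/
abbrev Conn (B : PrincipalBundle n M E G F P) (γ : Graph n M) : Type _ :=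
  ∀ e : γ.Edge, B.FiberIso (γ.src e) (γ.tgt e)

variable (E) in
/-- The model with corners of the manifold `A_γ`. -/
abbrev model (γ : Graph n M) :
    ModelWithCorners ℝ (γ.Edge → E) (ModelPi fun _ : γ.Edge => E) :=
  ModelWithCorners.pi fun _ : γ.Edge => 𝓘(ℝ, E)

/-- The parallel transport defined by a point of `A_γ` along an edge path of `γ`. -/
def transport {B : PrincipalBundle n M E G F P} {γ : Graph n M} (a : Conn B γ) {x : M} :
    {y : M} → γ.Walk x y → B.FiberIso x y
  | _, .nil => FiberIso.refl B x
  | _, .forward e w => (transport a w).trans (a e)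
  | _, .backward e w => (transport a w).trans (a e).symm

/-- The projection `A_γ' → A_γ` for `γ ≤ γ'`. -/
def project (B : PrincipalBundle n M E G F P) {γ γ' : Graph n M} (h : γ ≤ γ') (a : Conn B γ') :
    Conn B γ :=
  fun e => transport a (Graph.walk h e)

/-- The projective limit of the spaces `A_γ`: the space of generalized connections. -/
def Limit (B : PrincipalBundle n M E G F P) : Type _ :=
  {A : ∀ γ : Graph n M, Conn B γ // ∀ (γ γ' : Graph n M) (h : γ ≤ γ'), project B h (A γ') = A γ}

instance (B : PrincipalBundle n M E G F P) : TopologicalSpace (Limit B) := instTopologicalSpaceSubtype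

instance (B : PrincipalBundle n M E G F P) : MeasurableSpace (Limit B) := borel _

instance (B : PrincipalBundle n M E G F P) : BorelSpace (Limit B) := ⟨rfl⟩

/-- The projection of the limit to `A_γ`. -/
def Limit.at {B : PrincipalBundle n M E G F P} (A : Limit B) (γ : Graph n M) : Conn B γ := A.1 γ

/-- The generalized gauge group: a generalized gauge transformation is an arbitrary family of
automorphisms of the fibres. -/
abbrev Gauge (B : PrincipalBundle n M E G F P) : Type _ := ∀ x : M, B.FiberIso x x

/-- The (right) action of gauge transformations on `A_γ`; it only involves the automorphisms of the
fibres over the vertices of `γ`. -/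
def gaugeAct {B : PrincipalBundle n M E G F P} {γ : Graph n M} (g : Gauge B) (a : Conn B γ) :
    Conn B γ :=
  fun e => ((g (γ.src e)).trans (a e)).trans (g (γ.tgt e)).symm

theorem transport_gaugeAct {B : PrincipalBundle n M E G F P} {γ : Graph n M} (g : Gauge B)
    (a : Conn B γ) {x y : M} (w : γ.Walk x y) :
    transport (gaugeAct g a) w = ((g x).trans (transport a w)).trans (g y).symm := by
  induction w with
  | nil => ext p : 2; simp [transport, FiberIso.trans, FiberIso.refl, FiberIso.symm]
  | forward e w ih =>
    ext p : 2; simp [transport, ih, gaugeAct, FiberIso.trans, FiberIso.symm]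
  | backward e w ih =>
    ext p : 2; simp [transport, ih, gaugeAct, FiberIso.trans, FiberIso.symm]

/-- The action of the generalized gauge group on the limit. -/
def Limit.gaugeAct {B : PrincipalBundle n M E G F P} (g : Gauge B) (A : Limit B) : Limit B :=
  ⟨fun γ => GenConn.gaugeAct g (A.1 γ), fun γ γ' h => by
    funext e
    have := congrFun (A.2 γ γ' h) e
    simp only [project] at this ⊢
    rw [transport_gaugeAct, this]
    rfl⟩

/-- The quotient of the space of generalized connections by the generalized gauge group. -/
def Quotient (B : PrincipalBundle n M E G F P) : Type _ :=
  Quot fun A A' : Limit B => ∃ g : Gauge B, A' = A.gaugeAct g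

instance (B : PrincipalBundle n M E G F P) : TopologicalSpace (Quotient B) := instTopologicalSpaceQuot

instance (B : PrincipalBundle n M E G F P) : MeasurableSpace (Quotient B) := borel _

instance (B : PrincipalBundle n M E G F P) : BorelSpace (Quotient B) := ⟨rfl⟩

/-- The quotient map. -/
def toQuotient {B : PrincipalBundle n M E G F P} (A : Limit B) : Quotient B := Quot.mk _ A

/-! ### Cylindrical functions -/

/-- `Cyl^k` on the space of generalized connections. -/
def Cyl (B : PrincipalBundle n M E G F P) (k : WithTop ℕ∞) : Set (Limit B → ℂ) :=
  {f | ∃ (γ : Graph n M) (fγ : Conn B γ → ℂ),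
    ContMDiff (model E γ) 𝓘(ℝ, ℂ) k fγ ∧ ∀ A, f A = fγ (A.at γ)}

/-- `Cyl^k` on the quotient: the gauge invariant elements of `Cyl^k`. -/
def CylInv (B : PrincipalBundle n M E G F P) (k : WithTop ℕ∞) : Set (Limit B → ℂ) :=
  {f | f ∈ Cyl B k ∧ ∀ (g : Gauge B) (A : Limit B), f (A.gaugeAct g) = f A}

/-! ### Vector fields -/

section VectorFields

/-- A family consisting of a vector field on each `A_γ`. -/
abbrev Field (B : PrincipalBundle n M E G F P) : Type _ :=
  ∀ (γ : Graph n M) (a : Conn B γ), TangentSpace (model E γ) a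

/-- The family `(X_γ)_{γ ≥ γ₀}` is a smooth vector field on the space of generalized connections:
each `X_γ` is smooth, and `X_γ'` is projected to `X_γ` whenever `γ' ≥ γ ≥ γ₀`. (The members `X_γ`
with `γ` not above `γ₀` play no role.) -/
structure IsVectorField [IsManifold 𝓘(ℝ, E) ∞ G] {B : PrincipalBundle n M E G F P}
    (γ₀ : Graph n M) (X : Field B) : Prop where
  smooth : ∀ γ, γ₀ ≤ γ → ContMDiff (model E γ) (model E γ).tangent ∞
    fun a => (⟨a, X γ a⟩ : TangentBundle (model E γ) (Conn B γ))
  consistent : ∀ (γ γ' : Graph n M) (h : γ ≤ γ'), γ₀ ≤ γ → ∀ a : Conn B γ',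
    mfderiv (model E γ') (model E γ) (project B h) a (X γ' a) = X γ (project B h a)

/-- Invariance of the vector field `(X_γ)_{γ ≥ γ₀}` under the generalized gauge group. -/
def IsInvariant {B : PrincipalBundle n M E G F P} (γ₀ : Graph n M) (X : Field B) : Prop :=
  ∀ γ, γ₀ ≤ γ → ∀ (g : Gauge B) (a : Conn B γ),
    mfderiv (model E γ) (model E γ) (gaugeAct g) a (X γ a) = X γ (gaugeAct g a)

/-- The commutator `[X, Y]`, with members `[X_γ, Y_γ]`. -/
def bracket {B : PrincipalBundle n M E G F P} (X Y : Field B) : Field B :=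
  fun γ => VectorField.mlieBracket (model E γ) (X γ) (Y γ)

open Classical in
/-- The action of the vector field `(X_γ)_{γ ≥ γ₀}` on a `C¹` cylindrical function `f`: if `f` is
represented by `fγ` on `A_γ`, `γ ≥ γ₀`, then `X f` is represented by `X_γ fγ`. -/
def deriv {B : PrincipalBundle n M E G F P} (γ₀ : Graph n M) (X : Field B) (f : Limit B → ℂ) :
    Limit B → ℂ :=
  if h : ∃ γ, γ₀ ≤ γ ∧ ∃ fγ : Conn B γ → ℂ,
      ContMDiff (model E γ) 𝓘(ℝ, ℂ) 1 fγ ∧ ∀ A, f A = fγ (A.at γ) then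
    fun A => mfderiv (model E h.choose) 𝓘(ℝ, ℂ) h.choose_spec.2.choose (A.at h.choose)
      (X h.choose (A.at h.choose))
  else 0

end VectorFields

/-! ### The induced Haar measure, divergences and momentum operators -/

section Haar

variable [IsTopologicalGroup G] [CompactSpace G] [MeasurableSpace G] [BorelSpace G]

/-- The Haar measure of `A_γ`, i.e. the product of the Haar measures over the edges. -/
def haarOn (B : PrincipalBundle n M E G F P) (γ : Graph n M) : Measure (Conn B γ) :=
  Measure.pi fun e : γ.Edge => FiberIso.haar B (γ.src e) (γ.tgt e)

/-- `μ` is the regular Borel probability measure defined by the consistent family of the Haar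
measures of the `A_γ`. -/
structure IsInducedHaar (B : PrincipalBundle n M E G F P) (μ : Measure (Limit B)) : Prop where
  prob : IsProbabilityMeasure μ
  regular : μ.Regular
  marginal : ∀ γ : Graph n M, μ.map (fun A => A.at γ) = haarOn B γ

open Classical in
/-- The induced Haar measure `μ_o` on the space of generalized connections. -/
def inducedHaar (B : PrincipalBundle n M E G F P) : Measure (Limit B) :=
  if h : ∃ μ, IsInducedHaar B μ then h.choose else 0

/-- The measure on the quotient. -/
def quotientHaar (B : PrincipalBundle n M E G F P) : Measure (Quotient B) :=
  (inducedHaar B).map toQuotient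

/-- The continuous function `d` is the divergence of the vector field `V` on `A_γ` with respect to
the Haar measure `ν`: `L_V ν = d ν`, where the Lie derivative of the measure `ν` is the distribution
`f ↦ - ∫ V(f) dν`. -/
def IsDivergenceOn {B : PrincipalBundle n M E G F P} {γ : Graph n M}
    (V : ∀ a : Conn B γ, TangentSpace (model E γ) a) (d : Conn B γ → ℝ) : Prop :=
  Continuous d ∧ ∀ f : Conn B γ → ℝ, ContMDiff (model E γ) 𝓘(ℝ, ℝ) ∞ f →
    ∫ a, f a * d a ∂(haarOn B γ) =
      - ∫ a, (show ℝ from mfderiv (model E γ) 𝓘(ℝ, ℝ) f a (V a)) ∂(haarOn B γ)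

/-- The vector field `(X_γ)_{γ ≥ γ₀}` is compatible with the induced Haar measure, and `d` is its
divergence: `d` is a smooth cylindrical function represented by `div X_γ` for all `γ ≥ γ₀`. -/
def IsDivergence {B : PrincipalBundle n M E G F P} (γ₀ : Graph n M) (X : Field B)
    (d : Limit B → ℝ) : Prop :=
  ∀ γ, γ₀ ≤ γ → ∃ dγ : Conn B γ → ℝ, ContMDiff (model E γ) 𝓘(ℝ, ℝ) ∞ dγ ∧
    IsDivergenceOn (X γ) dγ ∧ ∀ A, d A = dγ (A.at γ)

open Classical in
/-- The divergence of a vector field which is compatible with the induced Haar measure. -/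
def divergence {B : PrincipalBundle n M E G F P} (γ₀ : Graph n M) (X : Field B) : Limit B → ℝ :=
  if h : ∃ d, IsDivergence γ₀ X d then h.choose else 0

/-- `P(X) f = i (X f + ½ (div X) f)`, on cylindrical functions. -/
def momentum {B : PrincipalBundle n M E G F P} (γ₀ : Graph n M) (X : Field B) (f : Limit B → ℂ) :
    Limit B → ℂ :=
  fun A => Complex.I * (deriv γ₀ X f A + 1 / 2 * (divergence γ₀ X A : ℂ) * f A)

/-- The Hilbert space `L²` of the quotient, with the induced Haar measure. -/
abbrev L2Quotient (B : PrincipalBundle n M E G F P) : Type _ := Lp ℂ 2 (quotientHaar B)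

/-- `ψ` is the element of `L²` of the quotient defined by the gauge invariant function `f`. -/
def IsClassOf {B : PrincipalBundle n M E G F P} (ψ : L2Quotient B) (f : Limit B → ℂ) : Prop :=
  (fun A => ψ (toQuotient A)) =ᵐ[inducedHaar B] f

/-- `T` is the operator `P(X)` in `L²` of the quotient, with domain `Cyl¹` of the quotient. -/
structure IsMomentumOperator {B : PrincipalBundle n M E G F P} (γ₀ : Graph n M) (X : Field B)
    (T : L2Quotient B →ₗ.[ℂ] L2Quotient B) : Prop where
  mem_domain_iff : ∀ ψ, ψ ∈ T.domain ↔ ∃ f ∈ CylInv B 1, IsClassOf ψ f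
  apply : ∀ ψ : T.domain, ∀ f ∈ CylInv B 1, IsClassOf ψ.1 f → IsClassOf (T ψ) (momentum γ₀ X f)

end Haar

end Bundle

/-- A densely defined operator is essentially self-adjoint if it is closable and its closure is
self-adjoint. -/
def IsEssentiallySelfAdjoint {H : Type*} [NormedAddCommGroup H] [InnerProductSpace ℂ H]
    [CompleteSpace H] (T : H →ₗ.[ℂ] H) : Prop :=
  Dense (T.domain : Set H) ∧ T.IsClosable ∧ IsSelfAdjoint T.closure

end GenConn

end

/-! Everything is reduced to analysis on one compact Lie group at a time. In the group valued charts
`Conn B γ` is a finite power of `G`, the projections to smaller graphs are smooth, and any two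
graphs have a common refinement (`Graph.exists_ge_pair`): the parameters at which one analytic arc
meets another form a set with finite frontier (`finite_frontier_arc`), so finitely many cuts turn
the union of two graphs into a graph. The decomposition of an edge into edges of a finer graph is
unique (`Walk.Composes.unique`), which makes the projections functorial.

Measure. A translation at one edge lifts to a translation at one edge of any finer graph
(`exists_lift`). Hence the projections are onto and, by uniqueness of Haar measure, preserve Haar
measure (`map_project`). The integral of continuous cylindrical functions is therefore well defined;
Hahn–Banach and Riesz–Markov produce the measure on the limit (`exists_isInducedHaar`), and
Stone–Weierstrass gives its uniqueness and with it gauge invariance.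

Divergence. Left invariant fields on a compact Lie group are divergence free, so a field with
coefficients `c k` in a left invariant frame `X k` has divergence the sum of the `X k (c k)`. The
geometric heart is consistency under projection (`divergence_consistent`). Let `γ ≤ γ'`, in
dimension at least two. Refine `γ'` to `Γ` so that each edge `e` not inside an edge of `γ` has an
end `v` at which just one other edge `e'` arrives, and so that both can be replaced by edges not
overlapping with `Γ`. By consistency of the field, replacing an edge shows that the components at
the other edges do not depend on the value at that edge. So the gauge transformations at `v`,
applied to `e` alone, still preserve the field and hence its divergence. They act transitively on
the values at `e`, so the divergence does not depend on that value. What remains are the edges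
inside `γ`, and there connections with equal projection to `γ` are gauge equivalent. Hence the
divergence descends to `γ`. In dimension one a graph covers the connected manifold, so no edge lies
outside `γ`; in dimension zero there are no graphs.

Essential self-adjointness. It suffices that the operator is symmetric and that adding `± i` gives
dense ranges. On one `Conn B γ` the operator `S = V + ½ d` is skew. Let `J` be convolution with a
symmetric mollifier; it commutes with the left invariant frame. Then `J S J` is bounded and skew, so
`J S J u + c u = g` is solvable, and for large `c` the first derivatives of `u` are bounded
independently of `J`, because commutators of `S` with the frame have order one. If `ψ` is orthogonal
to the range of `S + c`, then `⟪ψ, g⟫ = ⟪J ψ - ψ, S J u - c u⟫`, which is arbitrarily small. An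
elementary norm estimate passes from large `c` to `1`, and `-S` is treated in the same way. On the
quotient, averaging over the gauge transformations at the vertices commutes with the operator, so a
vector orthogonal to the range on invariant functions has components at each graph orthogonal to the
full range there. All components vanish, and cylindrical functions are dense.

Commutator. Brackets of related fields are related, act on functions as commutators of derivations,
and satisfy `div [X, Y] = X (div Y) - Y (div X)`; the rest is algebra at a single graph. -/

noncomputable section

namespace GenConn

/-! ### Smooth maps and Lie group structure on finite products -/

section Pi

variable {ι : Type*} [Fintype ι] {E : Type*} [NormedAddCommGroup E] [NormedSpace ℝ E]
  {N : ι → Type*} [∀ i, TopologicalSpace (N i)] [∀ i, ChartedSpace E (N i)]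
  {E' : Type*} [NormedAddCommGroup E'] [NormedSpace ℝ E'] {H' : Type*} [TopologicalSpace H']
  {I' : ModelWithCorners ℝ E' H'} {M' : Type*} [TopologicalSpace M'] [ChartedSpace H' M']
  {k : WithTop ℕ∞}

/-- The model with corners of a finite product of boundaryless manifolds modelled on `E`. -/
abbrev piModel (ι : Type*) [Fintype ι] (E : Type*) [NormedAddCommGroup E] [NormedSpace ℝ E] :
    ModelWithCorners ℝ (ι → E) (ModelPi fun _ : ι => E) :=
  ModelWithCorners.pi fun _ : ι => 𝓘(ℝ, E)

instance boundaryless_pi : (piModel ι E).Boundaryless where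
  range_eq_univ := by
    rw [eq_univ_iff_forall]
    intro x
    exact ⟨x, rfl⟩

/-- The extended charts of the product are by definition products of extended charts, so this is the
componentwise criterion in the model space. -/
theorem contMDiffWithinAt_pi_iff {f : M' → ∀ i, N i} {s : Set M'} {x : M'} :
    ContMDiffWithinAt I' (piModel ι E) k f s x ↔
      ∀ i, ContMDiffWithinAt I' 𝓘(ℝ, E) k (fun y => f y i) s x := by
  simp only [contMDiffWithinAt_iff, continuousWithinAt_pi, forall_and]
  refine and_congr Iff.rfl ?_
  exact contDiffWithinAt_pi

theorem contMDiffAt_pi_iff {f : M' → ∀ i, N i} {x : M'} :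
    ContMDiffAt I' (piModel ι E) k f x ↔
      ∀ i, ContMDiffAt I' 𝓘(ℝ, E) k (fun y => f y i) x :=
  contMDiffWithinAt_pi_iff

theorem contMDiff_pi_iff {f : M' → ∀ i, N i} :
    ContMDiff I' (piModel ι E) k f ↔ ∀ i, ContMDiff I' 𝓘(ℝ, E) k (fun y => f y i) := by
  simp only [ContMDiff, contMDiffAt_pi_iff]
  exact forall_comm

theorem contMDiff_eval (i : ι) :
    ContMDiff (piModel ι E) 𝓘(ℝ, E) k (fun a : ∀ i, N i => a i) :=
  contMDiff_pi_iff.1 contMDiff_id i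

/-- In the preferred charts, evaluation is literally the linear projection on the chart target. -/
theorem hasMFDerivAt_eval (a : ∀ i, N i) (i : ι) :
    HasMFDerivAt (piModel ι E) 𝓘(ℝ, E) (fun a : ∀ i, N i => a i) a
      (ContinuousLinearMap.proj (R := ℝ) (φ := fun _ : ι => E) i) := by
  refine ⟨(continuous_apply i).continuousAt, ?_⟩
  have h := (ContinuousLinearMap.proj (R := ℝ) (φ := fun _ : ι => E) i).hasFDerivWithinAt
    (s := range (piModel ι E)) (x := extChartAt (piModel ι E) a a)
  suffices hE : writtenInExtChartAt (piModel ι E) 𝓘(ℝ, E) a (fun a => a i)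
      =ᶠ[nhdsWithin (extChartAt (piModel ι E) a a) (range (piModel ι E))]
        (ContinuousLinearMap.proj (R := ℝ) (φ := fun _ : ι => E) i) from
    HasFDerivWithinAt.congr_of_eventuallyEq h hE (hE.eq_of_nhdsWithin ⟨_, rfl⟩)
  filter_upwards [extChartAt_target_mem_nhdsWithin (I := piModel ι E) a] with x hx
  have hx' : x i ∈ (extChartAt 𝓘(ℝ, E) (a i)).target := by
    have h2 := (extChartAt (piModel ι E) a).map_target hx
    have h3 := (extChartAt (piModel ι E) a).right_inv hx
    have h4 : (extChartAt 𝓘(ℝ, E) (a i)).symm (x i) ∈ (chartAt E (a i)).source := by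
      rw [extChartAt_source] at h2
      exact h2 i trivial
    have h5 : extChartAt 𝓘(ℝ, E) (a i) ((extChartAt 𝓘(ℝ, E) (a i)).symm (x i)) = x i :=
      congrFun h3 i
    rw [← h5]
    exact (extChartAt 𝓘(ℝ, E) (a i)).map_source (by rwa [extChartAt_source])
  exact (extChartAt 𝓘(ℝ, E) (a i)).right_inv hx'

theorem mfderiv_pi_apply {f : M' → ∀ i, N i} {x : M'}
    (hf : MDifferentiableAt I' (piModel ι E) f x) (v : TangentSpace I' x) (i : ι) :
    (mfderiv I' 𝓘(ℝ, E) (fun y => f y i) x v : E) = (mfderiv I' (piModel ι E) f x v : ι → E) i := by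
  have h := (hasMFDerivAt_eval (f x) i).comp x hf.hasMFDerivAt
  have h2 : mfderiv I' 𝓘(ℝ, E) (fun y => f y i) x = _ := h.mfderiv
  rw [h2]
  rfl

/-- Makes each `Conn B γ`, and the group of gauge transformations at the vertices of a graph, a Lie
group to which the analysis on compact groups applies. -/
instance lieGroup_pi {N : ι → Type*} [∀ i, Group (N i)] [∀ i, TopologicalSpace (N i)]
    [∀ i, ChartedSpace E (N i)] [∀ i, LieGroup 𝓘(ℝ, E) k (N i)] :
    LieGroup (piModel ι E) k (∀ i, N i) where
  toIsManifold := isManifold_pi N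
  contMDiff_mul := contMDiff_pi_iff.2 fun i =>
    ((contMDiff_eval i).comp contMDiff_fst).mul ((contMDiff_eval i).comp contMDiff_snd)
  contMDiff_inv := contMDiff_pi_iff.2 fun i => (contMDiff_eval i).inv

end Pi

/-! ### Derivatives of functions along vector fields -/

section TangentCalculus

variable {E : Type*} [NormedAddCommGroup E] [NormedSpace ℝ E] {H : Type*} [TopologicalSpace H]
  {I : ModelWithCorners ℝ E H} {M : Type*} [TopologicalSpace M] [ChartedSpace H M]
  {E' : Type*} [NormedAddCommGroup E'] [NormedSpace ℝ E'] {H' : Type*} [TopologicalSpace H']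
  {I' : ModelWithCorners ℝ E' H'} {M' : Type*} [TopologicalSpace M'] [ChartedSpace H' M']
  {F : Type*} [NormedAddCommGroup F] [NormedSpace ℝ F]

/-- The derivative of `f` along the vector field `V`. -/
def dirDeriv (I : ModelWithCorners ℝ E H) (V : ∀ x : M, TangentSpace I x) (f : M → F) (x : M) : F :=
  mfderiv I 𝓘(ℝ, F) f x (V x)

/-- A vector field is smooth. -/
def SmoothField (I : ModelWithCorners ℝ E H) [IsManifold I ∞ M]
    (V : ∀ x : M, TangentSpace I x) : Prop :=
  ContMDiff I I.tangent ∞ fun x => (⟨x, V x⟩ : TangentBundle I M)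

/-- The derivative is the fibre component of the tangent map of `f` composed with the section `V`;
only passing to the tangent map costs a derivative. -/
theorem contMDiffOn_dirDeriv [IsManifold I ∞ M] {V : ∀ x : M, TangentSpace I x}
    (hV : SmoothField I V) {f : M → F} {k m : WithTop ℕ∞} {U : Set M} (hU : IsOpen U)
    (hf : ContMDiffOn I 𝓘(ℝ, F) k f U) (hm : m + 1 ≤ k) (hm' : m ≤ ∞) :
    ContMDiffOn I 𝓘(ℝ, F) m (dirDeriv I V f) U := by
  have : IsManifold I 1 M := IsManifold.of_le (n := ∞) (by simp)
  have h1 := hf.contMDiffOn_tangentMapWithin hm hU.uniqueMDiffOn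
  have h2 := h1.comp ((hV.of_le hm').contMDiffOn (s := U)) (fun x hx => hx)
  have h3 := (contMDiff_snd_tangentBundle_modelSpace (n := m) F 𝓘(ℝ, F)).comp_contMDiffOn h2
  refine h3.congr fun x hx => ?_
  simp only [dirDeriv, Function.comp, tangentMapWithin]
  rw [mfderivWithin_of_isOpen hU hx]

theorem contMDiff_dirDeriv [IsManifold I ∞ M] {V : ∀ x : M, TangentSpace I x}
    (hV : SmoothField I V) {f : M → F} {k m : WithTop ℕ∞} (hf : ContMDiff I 𝓘(ℝ, F) k f)
    (hm : m + 1 ≤ k) (hm' : m ≤ ∞) : ContMDiff I 𝓘(ℝ, F) m (dirDeriv I V f) :=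
  contMDiffOn_univ.1 (contMDiffOn_dirDeriv hV isOpen_univ hf.contMDiffOn hm hm')

/-- The vector field on a product which is `V` on the second factor and `0` on the first one. -/
def sndField (I : ModelWithCorners ℝ E H) {M : Type*} [TopologicalSpace M] [ChartedSpace H M]
    {I' : ModelWithCorners ℝ E' H'} (V : ∀ x : M', TangentSpace I' x) (z : M × M') :
    TangentSpace (I.prod I') z :=
  ((0 : E), (V z.2 : E'))

theorem smoothField_sndField [IsManifold I ∞ M] [IsManifold I' ∞ M']
    {V : ∀ x : M', TangentSpace I' x} (hV : SmoothField I' V) :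
    SmoothField (M := M × M') (I.prod I') (sndField I V) := by
  have : IsManifold I 1 M := IsManifold.of_le (n := ∞) (by simp)
  have : IsManifold I' 1 M' := IsManifold.of_le (n := ∞) (by simp)
  have h1 := ((Bundle.contMDiff_zeroSection (n := ∞) (IB := I) (F := E) ℝ
    (TangentSpace I (M := M))).comp
    (contMDiff_fst (I := I) (J := I') (M := M) (N := M'))).prodMk (hV.comp contMDiff_snd)
  exact contMDiff_equivTangentBundleProd_symm.comp h1

theorem dirDeriv_sndField [IsManifold I ∞ M] [IsManifold I' ∞ M']
    {V : ∀ x : M', TangentSpace I' x} {f : M × M' → F} {z : M × M'}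
    (hf : MDifferentiableAt (I.prod I') 𝓘(ℝ, F) f z) :
    dirDeriv (I.prod I') (sndField I V) f z = dirDeriv I' V (fun y => f (z.1, y)) z.2 := by
  unfold dirDeriv
  rw [mfderiv_prod_eq_add_apply hf]
  simp only [sndField]
  erw [map_zero, zero_add]

/-- The derivative in the second variable is the derivative along a smooth field on the product,
hence jointly smooth before it is restricted to the diagonal. Used with `x⁻¹ * y` to see that left
trivialization is smooth. -/
theorem contMDiffOn_dirDeriv_diag [IsManifold I' ∞ M'] {V : ∀ x : M', TangentSpace I' x}
    (hV : SmoothField I' V) {f : M' × M' → F} {U : Set (M' × M')} (hU : IsOpen U)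
    (hf : ContMDiffOn (I'.prod I') 𝓘(ℝ, F) ∞ f U) (hd : ∀ x, (x, x) ∈ U) :
    ContMDiff I' 𝓘(ℝ, F) ∞ (fun x => dirDeriv I' V (fun y => f (x, y)) x) := by
  have h1 := contMDiffOn_dirDeriv (smoothField_sndField (I := I') (M := M') hV) hU hf
    (m := ∞) (by simp) le_rfl
  have h2 : ContMDiff I' (I'.prod I') ∞ (fun x : M' => (x, x)) := contMDiff_id.prodMk contMDiff_id
  refine (contMDiffOn_univ.1 (h1.comp h2.contMDiffOn (fun x _ => hd x))).congr fun x => ?_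
  have h3 : MDifferentiableAt (I'.prod I') 𝓘(ℝ, F) f (x, x) :=
    ((hf (x, x) (hd x)).contMDiffAt (hU.mem_nhds (hd x))).mdifferentiableAt (by simp)
  exact (dirDeriv_sndField (V := V) h3).symm

theorem dirDeriv_add {V : ∀ x : M, TangentSpace I x} {f g : M → F} {x : M}
    (hf : MDifferentiableAt I 𝓘(ℝ, F) f x) (hg : MDifferentiableAt I 𝓘(ℝ, F) g x) :
    dirDeriv I V (fun x => f x + g x) x = dirDeriv I V f x + dirDeriv I V g x := by
  have := (hf.hasMFDerivAt.add hg.hasMFDerivAt).mfderiv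
  unfold dirDeriv
  erw [this]
  rfl

theorem dirDeriv_smul {V : ∀ x : M, TangentSpace I x} {c : M → ℝ} {f : M → F} {x : M}
    (hc : MDifferentiableAt I 𝓘(ℝ, ℝ) c x) (hf : MDifferentiableAt I 𝓘(ℝ, F) f x) :
    dirDeriv I V (fun x => c x • f x) x = c x • dirDeriv I V f x + dirDeriv I V c x • f x := by
  have := (show HasMFDerivAt I 𝓘(ℝ, F) (fun x => c x • f x) x _ from
    ⟨hc.continuousAt.smul hf.continuousAt, hc.hasMFDerivAt.2.smul hf.hasMFDerivAt.2⟩).mfderiv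
  unfold dirDeriv
  erw [this]
  simp only [writtenInExtChartAt, Function.comp, extChartAt_to_inv]
  rfl

theorem dirDeriv_clm {F' : Type*} [NormedAddCommGroup F'] [NormedSpace ℝ F'] (L : F →L[ℝ] F')
    {V : ∀ x : M, TangentSpace I x} {f : M → F} {x : M} (hf : MDifferentiableAt I 𝓘(ℝ, F) f x) :
    dirDeriv I V (fun x => L (f x)) x = L (dirDeriv I V f x) := by
  have := (L.hasMFDerivAt.comp x hf.hasMFDerivAt).mfderiv
  unfold dirDeriv
  erw [this]
  rfl

/-- Relatedness is required only at `x`. Consistency under projections and gauge invariance both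
enter the proof in this form. -/
theorem dirDeriv_comp {V : ∀ x : M, TangentSpace I x} {W : ∀ x : M', TangentSpace I' x}
    {φ : M → M'} {x : M} (hφ : MDifferentiableAt I I' φ x) 
    (h : mfderiv I I' φ x (V x) = W (φ x)) {f : M' → F}
    (hf : MDifferentiableAt I' 𝓘(ℝ, F) f (φ x)) :
    dirDeriv I V (fun x => f (φ x)) x = dirDeriv I' W f (φ x) := by
  have := (hf.hasMFDerivAt.comp x hφ.hasMFDerivAt).mfderiv
  unfold dirDeriv
  erw [this, ← h]
  rfl

end TangentCalculus

end GenConn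

end

noncomputable section

namespace GenConn

/-! ### The Lie bracket as a commutator of derivations -/

section Commutator

variable {E : Type*} [NormedAddCommGroup E] [NormedSpace ℝ E] {H : Type*} [TopologicalSpace H]
  {I : ModelWithCorners ℝ E H} {M : Type*} [TopologicalSpace M] [ChartedSpace H M]
  {E' : Type*} [NormedAddCommGroup E'] [NormedSpace ℝ E'] {H' : Type*} [TopologicalSpace H']
  {I' : ModelWithCorners ℝ E' H'} {M' : Type*} [TopologicalSpace M'] [ChartedSpace H' M']
  {F : Type*} [NormedAddCommGroup F] [NormedSpace ℝ F]

/-- The second derivatives of `f` cancel by symmetry; only the derivatives of the two fields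
survive. -/
theorem fderiv_lieBracket {f : E → F} {V W : E → E} {x : E} (hf : ContDiffAt ℝ 2 f x)
    (hV : DifferentiableAt ℝ V x) (hW : DifferentiableAt ℝ W x) :
    fderiv ℝ f x (VectorField.lieBracket ℝ V W x) =
      fderiv ℝ (fun z => fderiv ℝ f z (W z)) x (V x) -
        fderiv ℝ (fun z => fderiv ℝ f z (V z)) x (W x) := by
  have h1 : DifferentiableAt ℝ (fderiv ℝ f) x :=
    (hf.fderiv_right (m := 1) (by norm_num)).differentiableAt (by norm_num)
  rw [(h1.hasFDerivAt.clm_apply hW.hasFDerivAt).fderiv,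
    (h1.hasFDerivAt.clm_apply hV.hasFDerivAt).fderiv]
  have h2 := (hf.isSymmSndFDerivAt (by simp)).eq (V x) (W x)
  simp [VectorField.lieBracket, h2]

/-- The representation of a vector field in the preferred chart at a point. -/
def fieldInChart (I : ModelWithCorners ℝ E H) (x₀ : M) (V : ∀ x : M, TangentSpace I x) (z : E) : E :=
  VectorField.mpullbackWithin 𝓘(ℝ, E) I (extChartAt I x₀).symm V (range I) z

theorem dirDeriv_extChartAt_symm [IsManifold I 1 M] [I.Boundaryless] (x₀ : M)
    (V : ∀ x : M, TangentSpace I x) {g : M → F} {z : E} (hz : z ∈ (extChartAt I x₀).target)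
    (hg : MDifferentiableAt I 𝓘(ℝ, F) g ((extChartAt I x₀).symm z)) :
    dirDeriv I V g ((extChartAt I x₀).symm z) =
      fderiv ℝ (fun y => g ((extChartAt I x₀).symm y)) z (fieldInChart I x₀ V z) := by
  have hinv := isInvertible_mfderivWithin_extChartAt_symm (I := I) hz
  have h1 : MDifferentiableAt 𝓘(ℝ, E) I (extChartAt I x₀).symm z := by
    have := mdifferentiableWithinAt_extChartAt_symm (I := I) hz
    rwa [I.range_eq_univ, mdifferentiableWithinAt_univ] at this
  have h2 := mfderiv_comp z hg h1
  have h3 : fderiv ℝ (fun y => g ((extChartAt I x₀).symm y)) z =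
      (mfderiv I 𝓘(ℝ, F) g ((extChartAt I x₀).symm z)).comp
        (mfderiv 𝓘(ℝ, E) I (extChartAt I x₀).symm z) := by
    rw [← h2, mfderiv_eq_fderiv]; rfl
  rw [h3]
  unfold fieldInChart dirDeriv
  rw [VectorField.mpullbackWithin_apply]
  rw [I.range_eq_univ, mfderivWithin_univ] at hinv ⊢
  obtain ⟨e, he⟩ := hinv
  rw [← he, ContinuousLinearMap.inverse_equiv]
  exact congrArg _ (e.apply_symm_apply _).symm

/-- The bracket on a manifold is defined by pulling back the bracket of the chart representatives,
so the derivative of the chart cancels against its inverse. -/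
theorem dirDeriv_mlieBracket_eq_fderiv_lieBracket [IsManifold I 1 M] [I.Boundaryless] (x₀ : M)
    (V W : ∀ x : M, TangentSpace I x) {f : M → F} (hf : MDifferentiableAt I 𝓘(ℝ, F) f x₀) :
    dirDeriv I (VectorField.mlieBracket I V W) f x₀ =
      fderiv ℝ (fun y => f ((extChartAt I x₀).symm y)) (extChartAt I x₀ x₀)
        (VectorField.lieBracket ℝ (fieldInChart I x₀ V) (fieldInChart I x₀ W)
          (extChartAt I x₀ x₀)) := by
  obtain ⟨e, he⟩ := isInvertible_mfderiv_extChartAt (I := I) (mem_extChartAt_source x₀)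
  have h1 : MDifferentiableAt I 𝓘(ℝ, E) (extChartAt I x₀) x₀ :=
    mdifferentiableAt_extChartAt (mem_chart_source H x₀)
  have h0 : MDifferentiableAt 𝓘(ℝ, E) 𝓘(ℝ, F) (fun y => f ((extChartAt I x₀).symm y))
      (extChartAt I x₀ x₀) := by
    have h2 := mdifferentiableWithinAt_extChartAt_symm (I := I) (mem_extChartAt_target x₀)
    rw [I.range_eq_univ, mdifferentiableWithinAt_univ] at h2
    refine MDifferentiableAt.comp (I' := I) _ ?_ h2
    rwa [extChartAt_to_inv]
  have h3 := mfderiv_comp x₀ h0 h1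
  have h4 : (fun y => f ((extChartAt I x₀).symm y)) ∘ extChartAt I x₀ =ᶠ[nhds x₀] f := by
    filter_upwards [extChartAt_source_mem_nhds (I := I) x₀] with y hy
    exact congrArg f ((extChartAt I x₀).left_inv hy)
  rw [h4.mfderiv_eq] at h3
  unfold dirDeriv
  erw [h3]
  rw [← VectorField.mlieBracketWithin_univ, VectorField.mlieBracketWithin_apply]
  rw [← he, ContinuousLinearMap.inverse_equiv]
  rw [preimage_univ, univ_inter]
  have h5 : VectorField.lieBracket ℝ (fieldInChart I x₀ V) (fieldInChart I x₀ W)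
      (extChartAt I x₀ x₀) = VectorField.lieBracketWithin ℝ (fieldInChart I x₀ V)
        (fieldInChart I x₀ W) (range I) (extChartAt I x₀ x₀) := by
    rw [I.range_eq_univ, VectorField.lieBracketWithin_univ]
  rw [h5, ← mfderiv_eq_fderiv]
  exact congrArg (mfderiv 𝓘(ℝ, E) 𝓘(ℝ, F) (fun y => f ((extChartAt I x₀).symm y))
    (extChartAt I x₀ x₀)) (e.apply_symm_apply _)

theorem two_le_infty : (2 : WithTop ℕ∞) ≤ ∞ := by
  exact WithTop.coe_le_coe.2 (le_top : (2 : ℕ∞) ≤ ⊤)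

theorem differentiableAt_fieldInChart [IsManifold I 2 M] [I.Boundaryless] [CompleteSpace E] (x₀ : M)
    (V : ∀ x : M, TangentSpace I x)
    (hV : MDifferentiableAt I I.tangent (fun x => (⟨x, V x⟩ : TangentBundle I M)) x₀) :
    DifferentiableAt ℝ (fieldInChart I x₀ V) (extChartAt I x₀ x₀) := by
  have := (mdifferentiableWithinAt_univ.2 hV).differentiableWithinAt_mpullbackWithin_vectorField
  rw [preimage_univ, univ_inter] at this
  exact DifferentiableWithinAt.differentiableAt (s := range I) this
    (by rw [I.range_eq_univ]; exact Filter.univ_mem)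

theorem dirDeriv_mlieBracket [IsManifold I ∞ M] [I.Boundaryless] [CompleteSpace E]
    {V W : ∀ x : M, TangentSpace I x} (hV : SmoothField I V) (hW : SmoothField I W)
    {f : M → F} (hf : ContMDiff I 𝓘(ℝ, F) 2 f) :
    dirDeriv I (VectorField.mlieBracket I V W) f =
      fun x => dirDeriv I V (dirDeriv I W f) x - dirDeriv I W (dirDeriv I V f) x := by
  have : IsManifold I 1 M := IsManifold.of_le (n := ∞) (by simp)
  have : IsManifold I 2 M := IsManifold.of_le (n := ∞) two_le_infty
  ext x₀
  set φ := extChartAt I x₀ with hφ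
  have hz : φ x₀ ∈ φ.target := mem_extChartAt_target x₀
  have hx : φ.symm (φ x₀) = x₀ := extChartAt_to_inv x₀
  have hop : φ.target ∈ nhds (φ x₀) := extChartAt_target_mem_nhds x₀
  have key : ∀ (U : ∀ x : M, TangentSpace I x) {g : M → F}, ContMDiff I 𝓘(ℝ, F) 1 g →
      dirDeriv I U g x₀ = fderiv ℝ (fun y => g (φ.symm y)) (φ x₀) (fieldInChart I x₀ U (φ x₀)) := by
    intro U g hg
    rw [← dirDeriv_extChartAt_symm x₀ U hz ((hg _).mdifferentiableAt (by simp)), hx]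
  have hfd : ContMDiff I 𝓘(ℝ, F) 1 f := hf.of_le (by norm_num)
  -- Needed on a neighbourhood and not just at the point, because both sides are differentiated once
  -- more.
  have hev : ∀ U : ∀ x : M, TangentSpace I x, (fun y => dirDeriv I U f (φ.symm y)) =ᶠ[nhds (φ x₀)]
      fun y => fderiv ℝ (fun y => f (φ.symm y)) y (fieldInChart I x₀ U y) := by
    intro U
    filter_upwards [hop] with y hy
    exact dirDeriv_extChartAt_symm x₀ U hy ((hfd _).mdifferentiableAt (by simp))
  have hW1 := contMDiff_dirDeriv hW hf (m := 1) (by norm_num) (by simp)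
  have hV1 := contMDiff_dirDeriv hV hf (m := 1) (by norm_num) (by simp)
  rw [dirDeriv_mlieBracket_eq_fderiv_lieBracket x₀ V W ((hfd _).mdifferentiableAt (by simp)), key V hW1, key W hV1, (hev V).fderiv_eq,
    (hev W).fderiv_eq, fderiv_lieBracket]
  · have h1 := (hf x₀)
    have h2 := (contMDiffAt_iff.1 h1).2
    simp only [I.range_eq_univ, contDiffWithinAt_univ] at h2
    exact h2
  · exact differentiableAt_fieldInChart x₀ V ((hV x₀).mdifferentiableAt (by simp))
  · exact differentiableAt_fieldInChart x₀ W ((hW x₀).mdifferentiableAt (by simp))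

/-- A bump function extends the chart at `x` to a global smooth function whose derivative at `x` is
invertible. This turns identities of derivations into identities of vectors. -/
theorem tangent_eq_zero [IsManifold I ∞ M] [I.Boundaryless] [FiniteDimensional ℝ E] [T2Space M]
    {x : M} (v : TangentSpace I x)
    (h : ∀ f : M → E, ContMDiff I 𝓘(ℝ, E) ∞ f → mfderiv I 𝓘(ℝ, E) f x v = 0) : v = 0 := by
  have : IsManifold I 1 M := IsManifold.of_le (n := ∞) (by simp)
  let b : SmoothBumpFunction I x := Classical.arbitrary _
  have h1 := h _ (b.contMDiff_smul (contMDiffOn_extChartAt (x := x) (n := ∞)))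
  have h2 : (fun y => b y • extChartAt I x y) =ᶠ[nhds x] extChartAt I x := by
    filter_upwards [b.eventuallyEq_one] with y hy
    simp [hy]
  rw [h2.mfderiv_eq] at h1
  obtain ⟨e, he⟩ := isInvertible_mfderiv_extChartAt (I := I) (mem_extChartAt_source x)
  rw [← he] at h1
  exact e.map_eq_zero_iff.1 h1

/-- Tested on smooth functions, both sides are commutators of derivations, and composition with `φ`
intertwines the derivations of related fields. Yields consistency and gauge invariance of brackets.
-/
theorem mfderiv_mlieBracket_of_related [IsManifold I ∞ M] [I.Boundaryless] [CompleteSpace E]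
    [IsManifold I' ∞ M'] [I'.Boundaryless] [FiniteDimensional ℝ E'] [T2Space M']
    {V W : ∀ x : M, TangentSpace I x} {V' W' : ∀ x : M', TangentSpace I' x}
    (hV : SmoothField I V) (hW : SmoothField I W) (hV' : SmoothField I' V')
    (hW' : SmoothField I' W') {φ : M → M'} (hφ : ContMDiff I I' ∞ φ)
    (h1 : ∀ x, mfderiv I I' φ x (V x) = V' (φ x)) (h2 : ∀ x, mfderiv I I' φ x (W x) = W' (φ x))
    (x : M) :
    mfderiv I I' φ x (VectorField.mlieBracket I V W x) =
      VectorField.mlieBracket I' V' W' (φ x) := by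
  have : CompleteSpace E' := FiniteDimensional.complete ℝ E'
  have hφd : ∀ x, MDifferentiableAt I I' φ x := fun x => (hφ x).mdifferentiableAt (by simp)
  rw [← sub_eq_zero]
  refine tangent_eq_zero _ fun f hf => ?_
  have hfd : ∀ (g : M' → E') (_ : ContMDiff I' 𝓘(ℝ, E') ∞ g) x, MDifferentiableAt I' 𝓘(ℝ, E') g x :=
    fun g hg x => (hg x).mdifferentiableAt (by simp)
  have h3 := congrFun (dirDeriv_mlieBracket hV hW (f := fun x => f (φ x))
    ((hf.comp hφ).of_le two_le_infty)) x
  have h4 := congrFun (dirDeriv_mlieBracket hV' hW' (f := f) (hf.of_le two_le_infty)) (φ x)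
  have hVf := contMDiff_dirDeriv hV' hf (m := ∞) (by simp) le_rfl
  have hWf := contMDiff_dirDeriv hW' hf (m := ∞) (by simp) le_rfl
  have e1 : dirDeriv I V (fun x => f (φ x)) = fun x => dirDeriv I' V' f (φ x) :=
    funext fun x => dirDeriv_comp (hφd x) (h1 x) (hfd f hf _)
  have e2 : dirDeriv I W (fun x => f (φ x)) = fun x => dirDeriv I' W' f (φ x) :=
    funext fun x => dirDeriv_comp (hφd x) (h2 x) (hfd f hf _)
  rw [e1, e2, dirDeriv_comp (hφd x) (h1 x) (hfd _ hWf _),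
    dirDeriv_comp (hφd x) (h2 x) (hfd _ hVf _), ← h4] at h3
  rw [map_sub, sub_eq_zero]
  refine Eq.trans ?_ h3
  unfold dirDeriv
  rw [show (fun x => f (φ x)) = f ∘ φ from rfl, mfderiv_comp x (hfd f hf _) (hφd x)]
  rfl

end Commutator

end GenConn

end

noncomputable section

set_option linter.unusedSectionVars false

namespace GenConn

/-! ### Differentiation under the integral sign over a compact space -/

section ParametricIntegral

/-- The constant vector field `v` on the first factor of a product. -/
def fstConst {E : Type*} [NormedAddCommGroup E] [NormedSpace ℝ E] {EY : Type*}
    [NormedAddCommGroup EY] [NormedSpace ℝ EY] {HY : Type*} [TopologicalSpace HY]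
    (J : ModelWithCorners ℝ EY HY) {Y : Type*} [TopologicalSpace Y] [ChartedSpace HY Y]
    (v : E) (z : E × Y) : TangentSpace (𝓘(ℝ, E).prod J) z := ((v : E), (0 : EY))

theorem smoothField_fstConst {E : Type*} [NormedAddCommGroup E] [NormedSpace ℝ E] {EY : Type*}
    [NormedAddCommGroup EY] [NormedSpace ℝ EY] {HY : Type*} [TopologicalSpace HY]
    {J : ModelWithCorners ℝ EY HY} {Y : Type*} [TopologicalSpace Y] [ChartedSpace HY Y]
    [IsManifold J ∞ Y] (v : E) :
    SmoothField (M := E × Y) (𝓘(ℝ, E).prod J) (fstConst J v) := by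
  have : IsManifold J 1 Y := IsManifold.of_le (n := ∞) (by simp)
  have h0 : ContMDiff 𝓘(ℝ, E) 𝓘(ℝ, E).tangent ∞
      (fun x : E => (⟨x, v⟩ : TangentBundle 𝓘(ℝ, E) E)) :=
    contMDiff_vectorSpace_iff_contDiff (V := fun _ => v).2 contDiff_const
  have h1 := (h0.comp (contMDiff_fst (I := 𝓘(ℝ, E)) (J := J) (M := E) (N := Y))).prodMk
    ((Bundle.contMDiff_zeroSection (n := ∞) (IB := J) (F := EY) ℝ
    (TangentSpace J (M := Y))).comp contMDiff_snd)
  exact contMDiff_equivTangentBundleProd_symm.comp h1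

variable {E : Type*} [NormedAddCommGroup E] [NormedSpace ℝ E] [FiniteDimensional ℝ E]
  {EY : Type*} [NormedAddCommGroup EY] [NormedSpace ℝ EY] {HY : Type*} [TopologicalSpace HY]
  {J : ModelWithCorners ℝ EY HY} {Y : Type*} [TopologicalSpace Y] [ChartedSpace HY Y]
  [IsManifold J ∞ Y]
  {F : Type*} [NormedAddCommGroup F] [NormedSpace ℝ F]

theorem dirDeriv_fstConst {f : E × Y → F} {z : E × Y} (v : E)
    (hf : MDifferentiableAt (𝓘(ℝ, E).prod J) 𝓘(ℝ, F) f z) :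
    dirDeriv (𝓘(ℝ, E).prod J) (fstConst J v) f z = fderiv ℝ (fun x => f (x, z.2)) z.1 v := by
  unfold dirDeriv
  rw [mfderiv_prod_eq_add_apply hf, ← mfderiv_eq_fderiv]
  simp only [fstConst]
  erw [map_zero, add_zero]
  rfl

/-- `E` is finite-dimensional, so continuity in operator norm can be checked on each vector `v`,
where it is smoothness of a derivative along a constant field. -/
theorem continuousOn_fderiv_fst {f : E × Y → F} {U : Set E} (hU : IsOpen U)
    (hf : ContMDiffOn (𝓘(ℝ, E).prod J) 𝓘(ℝ, F) 1 f (U ×ˢ univ)) :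
    ContinuousOn (fun z : E × Y => fderiv ℝ (fun x => f (x, z.2)) z.1) (U ×ˢ univ) := by
  have hop : IsOpen (U ×ˢ (univ : Set Y)) := hU.prod isOpen_univ
  rw [continuousOn_clm_apply]
  intro v
  refine (contMDiffOn_dirDeriv (smoothField_fstConst (J := J) v) hop hf
    (m := 0) (by simp) (by simp)).continuousOn.congr fun z hz => ?_
  exact (dirDeriv_fstConst v (((hf z hz).contMDiffAt (hop.mem_nhds hz)).mdifferentiableAt
    (by simp))).symm

theorem hasFDerivAt_fst {f : E × Y → F} {U : Set E} (hU : IsOpen U)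
    (hf : ContMDiffOn (𝓘(ℝ, E).prod J) 𝓘(ℝ, F) 1 f (U ×ˢ univ)) {z : E} (hz : z ∈ U) (y : Y) :
    HasFDerivAt (fun x => f (x, y)) (fderiv ℝ (fun x => f (x, y)) z) z := by
  have h1 := (hf (z, y) ⟨hz, trivial⟩).contMDiffAt ((hU.prod isOpen_univ).mem_nhds ⟨hz, trivial⟩)
  have h2 : ContMDiffAt 𝓘(ℝ, E) 𝓘(ℝ, F) 1 (fun x => f (x, y)) z :=
    h1.comp (f := fun x : E => (x, y)) z (contMDiffAt_id.prodMk contMDiffAt_const)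
  exact (h2.contDiffAt.differentiableAt (by simp)).hasFDerivAt

variable [CompactSpace Y] [SecondCountableTopology Y] [MeasurableSpace Y]
  [OpensMeasurableSpace Y] {ν : Measure Y}
  {𝕜 : Type*} [RCLike 𝕜] [NormedSpace 𝕜 F] [SMulCommClass ℝ 𝕜 F]

theorem integrable_smul_continuous {w : Y → 𝕜} (hw : Integrable w ν) {g : Y → F}
    (hg : Continuous g) : Integrable (fun y => w y • g y) ν := by
  obtain ⟨C, hC⟩ := isCompact_univ.exists_bound_of_continuousOn hg.continuousOn
  exact hw.smul_of_top_left (memLp_top_of_bound hg.aestronglyMeasurable C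
    (Filter.Eventually.of_forall fun y => hC y trivial))

/-- A closed ball times the compact `Y` bounds the derivative uniformly, so a multiple of `‖w‖`
dominates. The weight is merely integrable since it will be an `L²` function in convolutions. -/
theorem hasFDerivAt_parametric_integral {w : Y → 𝕜} (hw : Integrable w ν) {f : E × Y → F}
    {U : Set E} (hU : IsOpen U) (hf : ContMDiffOn (𝓘(ℝ, E).prod J) 𝓘(ℝ, F) 1 f (U ×ˢ univ))
    {z : E} (hz : z ∈ U) :
    HasFDerivAt (fun x => ∫ y, w y • f (x, y) ∂ν)
      (∫ y, w y • fderiv ℝ (fun x => f (x, y)) z ∂ν) z := by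
  have hD := continuousOn_fderiv_fst hU hf
  obtain ⟨r, hr, hrU⟩ := Metric.nhds_basis_closedBall.mem_iff.1 (hU.mem_nhds hz)
  have : ProperSpace E := FiniteDimensional.proper_real E
  obtain ⟨C, hC⟩ := ((isCompact_closedBall z r).prod
    (isCompact_univ (X := Y))).exists_bound_of_continuousOn (hD.mono (prod_mono_left hrU))
  have hc : ∀ x ∈ U, Continuous fun y => f (x, y) := fun x hx => continuousOn_univ.1
    (hf.continuousOn.comp (by fun_prop) (fun y _ => ⟨hx, trivial⟩))
  have hc' : Continuous fun y => fderiv ℝ (fun x => f (x, y)) z := continuousOn_univ.1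
    (hD.comp (f := fun y => (z, y)) (by fun_prop) (fun y _ => ⟨hz, trivial⟩))
  refine hasFDerivAt_integral_of_dominated_of_fderiv_le (bound := fun y => ‖w y‖ * C)
    (F' := fun x y => w y • fderiv ℝ (fun x => f (x, y)) x)
    (Metric.closedBall_mem_nhds z hr) ?_ (integrable_smul_continuous hw (hc z hz))
    (integrable_smul_continuous hw hc').aestronglyMeasurable ?_ (hw.norm.mul_const C) ?_
  · filter_upwards [hU.mem_nhds hz] with x hx
    exact (integrable_smul_continuous hw (hc x hx)).aestronglyMeasurable
  · refine Filter.Eventually.of_forall fun y x hx => ?_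
    rw [norm_smul]
    exact mul_le_mul_of_nonneg_left (hC (x, y) ⟨hx, trivial⟩) (norm_nonneg _)
  · exact Filter.Eventually.of_forall fun y x hx => (hasFDerivAt_fst hU hf (hrU hx) y).const_smul _

/-- Each directional derivative of the integral is again such an integral, with the derivative of
`f` along a constant field as kernel; hence the induction quantifies over all `f`. -/
theorem contDiffOn_parametric_integral [CompleteSpace F] {w : Y → 𝕜} (hw : Integrable w ν)
    {U : Set E} (hU : IsOpen U) (n : ℕ) : ∀ {f : E × Y → F}, ContMDiffOn (𝓘(ℝ, E).prod J) 𝓘(ℝ, F) ∞ f (U ×ˢ univ) →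
      ContDiffOn ℝ n (fun x => ∫ y, w y • f (x, y) ∂ν) U := by
  have hop : IsOpen (U ×ˢ (univ : Set Y)) := hU.prod isOpen_univ
  induction n with
  | zero =>
    intro f hf
    exact contDiffOn_zero.2 fun z hz =>
      (hasFDerivAt_parametric_integral hw hU (hf.of_le (by simp)) hz).continuousAt.continuousWithinAt
  | succ n ih =>
    intro f hf
    have hf1 : ContMDiffOn (𝓘(ℝ, E).prod J) 𝓘(ℝ, F) 1 f (U ×ˢ univ) := hf.of_le (by simp)
    have hf' := fun z hz => hasFDerivAt_parametric_integral hw hU hf1 (z := z) hz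
    push_cast
    rw [contDiffOn_succ_iff_fderiv_apply hU.uniqueDiffOn]
    refine ⟨fun z hz => (hf' z hz).differentiableAt.differentiableWithinAt, by simp, fun v => ?_⟩
    have h2 := contMDiffOn_dirDeriv (smoothField_fstConst (J := J) v) hop hf
      (m := ∞) (by simp) le_rfl
    refine (ih h2).congr fun z hz => ?_
    have hc' : Continuous fun y => fderiv ℝ (fun x => f (x, y)) z := continuousOn_univ.1
      ((continuousOn_fderiv_fst hU hf1).comp (f := fun y => (z, y)) (by fun_prop)
        (fun y _ => ⟨hz, trivial⟩))
    rw [fderivWithin_of_isOpen hU hz, (hf' z hz).fderiv,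
      ContinuousLinearMap.integral_apply (integrable_smul_continuous hw hc')]
    refine integral_congr_ae (Filter.Eventually.of_forall fun y => ?_)
    have h3 := dirDeriv_fstConst (J := J) (z := (z, y)) v
      (((hf (z, y) ⟨hz, trivial⟩).contMDiffAt (hop.mem_nhds ⟨hz, trivial⟩)).mdifferentiableAt
        (by simp))
    simp only [h3]
    rfl

variable {H : Type*} [TopologicalSpace H] {I : ModelWithCorners ℝ E H} [I.Boundaryless]
  {M : Type*} [TopologicalSpace M] [ChartedSpace H M] [IsManifold I ∞ M]

theorem contMDiffOn_in_chart {f : M × Y → F} {U : Set M} {k : WithTop ℕ∞} (hk : k ≤ ∞)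
    (hf : ContMDiffOn (I.prod J) 𝓘(ℝ, F) k f (U ×ˢ univ)) (x₀ : M) :
    ContMDiffOn (𝓘(ℝ, E).prod J) 𝓘(ℝ, F) k
      (fun z : E × Y => f ((extChartAt I x₀).symm z.1, z.2))
      (((extChartAt I x₀).target ∩ (extChartAt I x₀).symm ⁻¹' U) ×ˢ univ) := by
  have h1 : ContMDiffOn (𝓘(ℝ, E).prod J) (I.prod J) k
      (fun z : E × Y => ((extChartAt I x₀).symm z.1, z.2))
      (((extChartAt I x₀).target ∩ (extChartAt I x₀).symm ⁻¹' U) ×ˢ univ) := by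
    refine ContMDiffOn.prodMk ?_ contMDiffOn_snd
    exact ((contMDiffOn_extChartAt_symm (n := ∞) x₀).of_le hk).comp contMDiffOn_fst (fun z hz => hz.1.1)
  exact hf.comp h1 fun z hz => ⟨hz.1.2, trivial⟩

theorem isOpen_chart_inter {U : Set M} (hU : IsOpen U) (x₀ : M) :
    IsOpen ((extChartAt I x₀).target ∩ (extChartAt I x₀).symm ⁻¹' U) :=
  (continuousOn_extChartAt_symm x₀).isOpen_inter_preimage (isOpen_extChartAt_target x₀) hU

theorem contMDiffOn_parametric_integral [CompleteSpace F] {w : Y → 𝕜} (hw : Integrable w ν)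
    {f : M × Y → F} {U : Set M} (hU : IsOpen U)
    (hf : ContMDiffOn (I.prod J) 𝓘(ℝ, F) ∞ f (U ×ˢ univ)) :
    ContMDiffOn I 𝓘(ℝ, F) ∞ (fun x => ∫ y, w y • f (x, y) ∂ν) U := by
  intro x₀ hx₀
  have h1 := contDiffOn_infty.2 fun n =>
    contDiffOn_parametric_integral hw (isOpen_chart_inter hU x₀) n
      (contMDiffOn_in_chart le_rfl hf x₀)
  have hz : extChartAt I x₀ x₀ ∈ (extChartAt I x₀).target ∩ (extChartAt I x₀).symm ⁻¹' U :=
    ⟨mem_extChartAt_target x₀, by simpa using hx₀⟩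
  have h2 := (h1 _ hz).contDiffAt ((isOpen_chart_inter hU x₀).mem_nhds hz)
  have h3 := h2.contMDiffAt.comp x₀ (contMDiffAt_extChartAt (n := ∞) (x := x₀))
  refine (h3.congr_of_eventuallyEq ?_).contMDiffWithinAt
  filter_upwards [extChartAt_source_mem_nhds (I := I) x₀] with x hx
  simp only [Function.comp, (extChartAt I x₀).left_inv hx]

theorem mfderiv_eq_fderiv_in_chart {g : M → F} {x₀ : M} (hg : MDifferentiableAt I 𝓘(ℝ, F) g x₀)
    (v : TangentSpace I x₀) :
    mfderiv I 𝓘(ℝ, F) g x₀ v = fderiv ℝ (fun z => g ((extChartAt I x₀).symm z))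
      (extChartAt I x₀ x₀) (mfderiv I 𝓘(ℝ, E) (extChartAt I x₀) x₀ v) := by
  have h1 : MDifferentiableAt I 𝓘(ℝ, E) (extChartAt I x₀) x₀ :=
    mdifferentiableAt_extChartAt (mem_chart_source H x₀)
  have h0 : MDifferentiableAt 𝓘(ℝ, E) 𝓘(ℝ, F) (fun y => g ((extChartAt I x₀).symm y))
      (extChartAt I x₀ x₀) := by
    have h2 := mdifferentiableWithinAt_extChartAt_symm (I := I) (mem_extChartAt_target x₀)
    rw [I.range_eq_univ, mdifferentiableWithinAt_univ] at h2
    refine MDifferentiableAt.comp (I' := I) _ ?_ h2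
    rwa [extChartAt_to_inv]
  have h4 : (fun y => g ((extChartAt I x₀).symm y)) ∘ extChartAt I x₀ =ᶠ[nhds x₀] g := by
    filter_upwards [extChartAt_source_mem_nhds (I := I) x₀] with y hy
    exact congrArg g ((extChartAt I x₀).left_inv hy)
  have h3 := mfderiv_comp x₀ h0 h1
  rw [h4.mfderiv_eq] at h3
  erw [h3, ← mfderiv_eq_fderiv]
  rfl

/-- In the chart at `x` this is `hasFDerivAt_parametric_integral`, and evaluation at a vector
commutes with the integral. -/
theorem dirDeriv_parametric_integral [CompleteSpace F] {w : Y → 𝕜} (hw : Integrable w ν)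
    {f : M × Y → F} {U : Set M} (hU : IsOpen U)
    (hf : ContMDiffOn (I.prod J) 𝓘(ℝ, F) 1 f (U ×ˢ univ)) {x : M} (hx : x ∈ U)
    (V : ∀ x : M, TangentSpace I x) :
    dirDeriv I V (fun x => ∫ y, w y • f (x, y) ∂ν) x =
      ∫ y, w y • dirDeriv I V (fun x => f (x, y)) x ∂ν := by
  unfold dirDeriv
  have hz : extChartAt I x x ∈ (extChartAt I x).target ∩ (extChartAt I x).symm ⁻¹' U :=
    ⟨mem_extChartAt_target x, by simpa using hx⟩
  have hop := isOpen_chart_inter (I := I) hU x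
  have hfc := contMDiffOn_in_chart (by simp) hf x
  have h0 := hasFDerivAt_parametric_integral hw hop hfc hz
  have h1 : MDifferentiableAt I 𝓘(ℝ, F) (fun x => ∫ y, w y • f (x, y) ∂ν) x := by
    have : IsManifold I 1 M := IsManifold.of_le (n := ∞) (by simp)
    refine (h0.differentiableAt.mdifferentiableAt.comp x
      (mdifferentiableAt_extChartAt (mem_chart_source H x))).congr_of_eventuallyEq ?_
    filter_upwards [extChartAt_source_mem_nhds (I := I) x] with y hy
    simp only [Function.comp, (extChartAt I x).left_inv hy]
  have h2 := h0.fderiv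
  have hc' : Continuous fun y => fderiv ℝ (fun z => f ((extChartAt I x).symm z, y))
      (extChartAt I x x) := continuousOn_univ.1
    ((continuousOn_fderiv_fst hop hfc).comp (f := fun y => (extChartAt I x x, y)) (by fun_prop)
      (fun y _ => ⟨hz, trivial⟩))
  rw [mfderiv_eq_fderiv_in_chart h1, h2]
  refine (ContinuousLinearMap.integral_apply (integrable_smul_continuous hw hc')
    (show E from mfderiv I 𝓘(ℝ, E) (extChartAt I x) x (V x))).trans ?_
  refine integral_congr_ae (Filter.Eventually.of_forall fun y => ?_)
  have h3 : MDifferentiableAt I 𝓘(ℝ, F) (fun x => f (x, y)) x := by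
    have := (hf (x, y) ⟨hx, trivial⟩).contMDiffAt ((hU.prod isOpen_univ).mem_nhds ⟨hx, trivial⟩)
    exact (this.comp (f := fun x : M => (x, y)) x
      (contMDiffAt_id.prodMk contMDiffAt_const)).mdifferentiableAt (by simp)
  simp only [mfderiv_eq_fderiv_in_chart h3]
  rfl

end ParametricIntegral

end GenConn

end

noncomputable section

set_option linter.unusedSectionVars false

namespace GenConn

/-! ### Abstract range density for skew operators by regularization -/

section Resolvent

open scoped InnerProductSpace

variable {H : Type*} [NormedAddCommGroup H] [InnerProductSpace ℂ H] [CompleteSpace H]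

/-- `i A` is self-adjoint, so its spectrum is real and omits `-i c`; multiplying the resolvent
equation by `i` gives the claim. -/
theorem exists_add_smul_eq_of_skew (A : H →L[ℂ] H) (hA : ∀ x y, ⟪A x, y⟫_ℂ = -⟪x, A y⟫_ℂ)
    {c : ℝ} (hc : c ≠ 0) (g : H) : ∃ u, A u + (c : ℂ) • u = g := by
  have hsa : IsSelfAdjoint (Complex.I • A) := by
    rw [ContinuousLinearMap.isSelfAdjoint_iff']
    symm
    rw [ContinuousLinearMap.eq_adjoint_iff]
    intro x y
    simp only [_root_.smul_apply, inner_smul_left, inner_smul_right, hA x y,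
      Complex.conj_I]
    ring
  have h1 : IsUnit (algebraMap ℂ (H →L[ℂ] H) (-Complex.I * c) - Complex.I • A) := by
    by_contra h
    have h2 := hsa.mem_spectrum_eq_re (spectrum.mem_iff.2 h)
    have h3 := congrArg Complex.im h2
    simp at h3
    exact hc h3
  obtain ⟨e, he⟩ := h1
  refine ⟨(↑e⁻¹ : H →L[ℂ] H) (-Complex.I • g), ?_⟩
  have h4 := congrArg (fun T : H →L[ℂ] H => T (-Complex.I • g)) e.mul_inv
  simp only [he, mul_apply_eq_comp, one_apply_eq_self,
    _root_.sub_apply, _root_.smul_apply] at h4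
  set u := (↑e⁻¹ : H →L[ℂ] H) (-Complex.I • g)
  have h5 := congrArg (fun z => Complex.I • z) h4
  simp only [smul_sub, smul_smul, Algebra.algebraMap_eq_smul_one, _root_.smul_apply,
    one_apply_eq_self] at h5
  have h6 : Complex.I * (-Complex.I * (c : ℂ)) = c := by
    linear_combination (-(c : ℂ)) * Complex.I_mul_I
  have h7 : Complex.I * -Complex.I = 1 := by linear_combination (-1 : ℂ) * Complex.I_mul_I
  rw [h6, h7, Complex.I_mul_I, one_smul, neg_one_smul, sub_neg_eq_add, add_comm] at h5
  exact h5

theorem re_inner_self_eq_zero_of_skew {x y : H} (h : ⟪y, x⟫_ℂ = -⟪x, y⟫_ℂ) :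
    (⟪x, y⟫_ℂ).re = 0 := by
  have h1 := congrArg Complex.re h
  rw [← inner_conj_symm, Complex.conj_re, Complex.neg_re] at h1
  linarith

variable {𝒜 : Type*} [AddCommGroup 𝒜] [Module ℂ 𝒜] {κ : Type*} [Fintype κ]

/-- A smoothing operator `j` which is a symmetric contraction, which commutes with the derivations
`D k` and which maps all of the Hilbert space into the domain of `S`, boundedly. -/
structure IsSmoothing (ι : 𝒜 →ₗ[ℂ] H) (D : κ → 𝒜 →ₗ[ℂ] 𝒜) (S : 𝒜 →ₗ[ℂ] 𝒜)
    (j : H →ₗ[ℂ] 𝒜) : Prop where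
  contraction : ∀ f, ‖ι (j (ι f))‖ ≤ ‖ι f‖
  symmetric : ∀ f g, ⟪ι (j (ι f)), ι g⟫_ℂ = ⟪ι f, ι (j (ι g))⟫_ℂ
  comm : ∀ k f, D k (j (ι f)) = j (ι (D k f))
  bounded : ∃ C, ∀ x, ‖ι (j x)‖ ≤ C * ‖x‖
  bounded' : ∃ C, ∀ x, ‖ι (S (j x))‖ ≤ C * ‖x‖

/-- The a priori estimate for the regularized equation `J S J u + c u = g`, where `J = ι j`. -/
theorem regularized_estimate {ι : 𝒜 →ₗ[ℂ] H} (D : κ → 𝒜 →ₗ[ℂ] 𝒜) {S : 𝒜 →ₗ[ℂ] 𝒜}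
    {j : H →ₗ[ℂ] 𝒜} (hS : ∀ f g, ⟪ι (S f), ι g⟫_ℂ = -⟪ι f, ι (S g)⟫_ℂ) {C : ℝ} (hC : 0 ≤ C)
    (hcomm : ∀ k f, ‖ι (D k (S f)) - ι (S (D k f))‖ ≤ C * (∑ l, ‖ι (D l f)‖ + ‖ι f‖))
    (hj : IsSmoothing ι D S j) {c : ℝ} (hc : Fintype.card κ * C + 1 ≤ c) {u g : 𝒜}
    (hu : j (ι (S (j (ι u)))) + (c : ℂ) • u = g) :
    ‖ι u‖ ≤ ‖ι g‖ ∧ ∑ k, ‖ι (D k u)‖ ≤ ∑ k, ‖ι (D k g)‖ + Fintype.card κ * C * ‖ι g‖ := by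
  have hc1 : 1 ≤ c :=
    (le_add_of_nonneg_left (mul_nonneg (Nat.cast_nonneg (Fintype.card κ)) hC)).trans hc
  -- pairing with `v` and using the symmetry of the smoothing operator
  have key : ∀ v h r : 𝒜, j (ι (S (j (ι v)) + r)) + (c : ℂ) • v = h →
      c * ‖ι v‖ ≤ ‖ι h‖ + ‖ι r‖ := by
    intro v h r hv
    have h1 : (⟪ι v, ι (j (ι (S (j (ι v)))))⟫_ℂ).re = 0 := by
      rw [← hj.symmetric]
      exact re_inner_self_eq_zero_of_skew (by rw [hS])
    have h2 : ‖ι (j (ι r))‖ ≤ ‖ι r‖ := hj.contraction r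
    have h3 := congrArg (fun z => (⟪ι v, ι z⟫_ℂ).re) hv
    simp only [map_add, map_smul, inner_add_right, inner_smul_right, Complex.add_re, h1, zero_add,
      Complex.re_ofReal_mul, inner_self_eq_norm_sq_to_K] at h3
    have h4 : (((‖ι v‖ : ℂ)) ^ 2).re = ‖ι v‖ ^ 2 := by
      rw [← Complex.ofReal_pow, Complex.ofReal_re]
    have h5 : |(⟪ι v, ι (j (ι r))⟫_ℂ).re| ≤ ‖ι v‖ * ‖ι r‖ :=
      (Complex.abs_re_le_norm _).trans ((norm_inner_le_norm _ _).trans (by gcongr))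
    have h6 : (⟪ι v, ι h⟫_ℂ).re ≤ ‖ι v‖ * ‖ι h‖ :=
      (Complex.re_le_norm _).trans (norm_inner_le_norm _ _)
    have h7 : c * ‖ι v‖ ^ 2 ≤ ‖ι v‖ * (‖ι h‖ + ‖ι r‖) := by
      have h8 : c * ‖ι v‖ ^ 2 = (⟪ι v, ι h⟫_ℂ).re - (⟪ι v, ι (j (ι r))⟫_ℂ).re := by
        rw [← h3]
        simp only [Complex.coe_algebraMap] at *
        rw [h4]; ring
      have := neg_le_of_abs_le h5
      linarith
    rcases eq_or_lt_of_le (norm_nonneg (ι v)) with h0 | h0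
    · rw [← h0]; simp; positivity
    · nlinarith
  have h1 : ‖ι u‖ ≤ ‖ι g‖ := by
    have := key u g 0 (by simpa using hu)
    simp only [map_zero, norm_zero, add_zero] at this
    nlinarith [norm_nonneg (ι u)]
  refine ⟨h1, ?_⟩
  -- Since the smoothing commutes with `D k`, the function `D k u` solves the same equation with
  -- right side `D k g`, up to the commutator of `D k` and `S` applied to the smoothed `u`.
  have h2 : ∀ k, c * ‖ι (D k u)‖ ≤ ‖ι (D k g)‖ + C * (∑ l, ‖ι (D l u)‖ + ‖ι u‖) := by
    intro k
    have h3 := key (D k u) (D k g) (D k (S (j (ι u))) - S (D k (j (ι u)))) (by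
      have e : S (j (ι (D k u))) + (D k (S (j (ι u))) - S (D k (j (ι u)))) =
          D k (S (j (ι u))) := by rw [hj.comm]; abel
      rw [e, ← hj.comm, ← hu, map_add (D k), map_smul])
    rw [map_sub] at h3
    refine h3.trans (add_le_add_right ((hcomm k _).trans ?_) _)
    gcongr with l
    · rw [hj.comm]; exact hj.contraction _
    · exact hj.contraction _
  have h3 : c * ∑ k, ‖ι (D k u)‖ ≤
      ∑ k, ‖ι (D k g)‖ + Fintype.card κ * (C * (∑ l, ‖ι (D l u)‖ + ‖ι u‖)) := by
    rw [Finset.mul_sum]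
    refine (Finset.sum_le_sum fun k _ => h2 k).trans ?_
    rw [Finset.sum_add_distrib, Finset.sum_const, nsmul_eq_mul, Finset.card_univ]
  have h4 : 0 ≤ ∑ k, ‖ι (D k u)‖ := Finset.sum_nonneg fun _ _ => norm_nonneg _
  have h5 : (Fintype.card κ : ℝ) * C * ‖ι u‖ ≤ Fintype.card κ * C * ‖ι g‖ := by gcongr
  -- The sum on the right is absorbed: `c` minus the cardinality times `C` is at least one.
  nlinarith [mul_le_mul_of_nonneg_right hc h4]

/-- The range of `S + c` is dense for large `c`. -/
theorem eq_zero_of_orthogonal_range_large {ι : 𝒜 →ₗ[ℂ] H} (hι : Function.Injective ι)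
    (hd : DenseRange ι) (D : κ → 𝒜 →ₗ[ℂ] 𝒜) {S : 𝒜 →ₗ[ℂ] 𝒜}
    (hS : ∀ f g, ⟪ι (S f), ι g⟫_ℂ = -⟪ι f, ι (S g)⟫_ℂ) {C C' : ℝ} (hC : 0 ≤ C) (hC' : 0 ≤ C')
    (hcomm : ∀ k f, ‖ι (D k (S f)) - ι (S (D k f))‖ ≤ C * (∑ l, ‖ι (D l f)‖ + ‖ι f‖))
    (hbd : ∀ f, ‖ι (S f)‖ ≤ C' * (∑ l, ‖ι (D l f)‖ + ‖ι f‖))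
    (hj : ∀ f : 𝒜, ∀ ε > 0, ∃ j : H →ₗ[ℂ] 𝒜, IsSmoothing ι D S j ∧ ‖ι (j (ι f)) - ι f‖ < ε)
    {c : ℝ} (hc : Fintype.card κ * C + 1 ≤ c) {ψ : H}
    (hψ : ∀ f, ⟪ψ, ι (S f) + (c : ℂ) • ι f⟫_ℂ = 0) : ψ = 0 := by
  have hc1 : 1 ≤ c :=
    (le_add_of_nonneg_left (mul_nonneg (Nat.cast_nonneg (Fintype.card κ)) hC)).trans hc
  suffices h : ∀ g, ⟪ψ, ι g⟫_ℂ = 0 by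
    exact inner_self_eq_zero.1 (hd.induction_on (p := fun x => ⟪ψ, x⟫_ℂ = 0) ψ
      (isClosed_eq (by fun_prop) (by fun_prop)) h)
  intro g
  -- The bound of `regularized_estimate` on the derivatives of the solution. Neither it nor the
  -- resulting bound `B` on `S j u` depends on the smoothing `j`, which is chosen only afterwards.
  set N := ∑ k, ‖ι (D k g)‖ + Fintype.card κ * C * ‖ι g‖ with hN
  have hN0 : 0 ≤ N := add_nonneg (Finset.sum_nonneg fun _ _ => norm_nonneg _) (by positivity)
  set B := C' * (N + ‖ι g‖) with hB
  have hB0 : 0 ≤ B := by positivity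
  rw [← norm_le_zero_iff]
  refine le_of_forall_pos_le_add fun ε hε => ?_
  set δ := ε / (3 * (B + c * ‖ι g‖ + 1)) with hδ
  have hden : 0 < B + c * ‖ι g‖ + 1 := by positivity
  have hδ0 : 0 < δ := by positivity
  obtain ⟨f, hf⟩ := Metric.denseRange_iff.1 hd ψ δ hδ0
  obtain ⟨j, hjs, hjf⟩ := hj f δ hδ0
  obtain ⟨C₁, hC₁⟩ := hjs.bounded
  obtain ⟨C₂, hC₂⟩ := hjs.bounded'
  let J : H →L[ℂ] H := (ι ∘ₗ j).mkContinuous C₁ hC₁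
  let T : H →L[ℂ] H := (ι ∘ₗ S ∘ₗ j).mkContinuous C₂ hC₂
  have hJ : ∀ x, J x = ι (j x) := fun x => rfl
  have hT : ∀ x, T x = ι (S (j x)) := fun x => rfl
  have hJc : ∀ x, ‖J x‖ ≤ ‖x‖ := fun x => hd.induction_on (p := fun x => ‖J x‖ ≤ ‖x‖) x
    (isClosed_le (by fun_prop) (by fun_prop)) hjs.contraction
  have hJs : ∀ x y, ⟪J x, y⟫_ℂ = ⟪x, J y⟫_ℂ := fun x y =>
    hd.induction_on₂ (p := fun x y => ⟪J x, y⟫_ℂ = ⟪x, J y⟫_ℂ)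
      (isClosed_eq (by fun_prop) (by fun_prop)) hjs.symmetric x y
  have hskew : ∀ x y, ⟪J (T x), y⟫_ℂ = -⟪x, J (T y)⟫_ℂ := by
    intro x y
    rw [hJs, hT, hJ, hS, ← hJ, hJs, hT]
  obtain ⟨u, hu⟩ := exists_add_smul_eq_of_skew (J.comp T) hskew (c := c) (by linarith) (ι g)
  simp only [ContinuousLinearMap.comp_apply] at hu
  have hc0 : (c : ℂ) ≠ 0 := by exact_mod_cast (by linarith : c ≠ 0)
  -- The solution is regular because `c u` is `g` minus a smoothed vector.
  obtain ⟨u', rfl⟩ : ∃ u', ι u' = u := by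
    refine ⟨(c : ℂ)⁻¹ • (g - j (T u)), ?_⟩
    rw [map_smul, map_sub, ← hJ, ← hu, add_sub_cancel_left, smul_smul, inv_mul_cancel₀ hc0, one_smul]
  have hu' : j (ι (S (j (ι u')))) + (c : ℂ) • u' = g := hι (by rw [map_add, map_smul]; exact hu)
  obtain ⟨e1, e2⟩ := regularized_estimate D hS hC hcomm hjs hc hu'
  have e3 : ‖T (ι u')‖ ≤ B := by
    refine (hbd _).trans ?_
    rw [hB]
    gcongr
    · refine (Finset.sum_le_sum fun k _ => ?_).trans e2
      rw [hjs.comm]; exact hjs.contraction _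
    · exact (hjs.contraction _).trans e1
  have h1 := hψ (j (ι u'))
  -- Move `J` onto `ψ` in the regularized equation and subtract the orthogonality relation for the
  -- smoothed solution; only the error of the smoothing at `ψ` is left.
  have h2 : ⟪ψ, ι g⟫_ℂ = ⟪J ψ - ψ, T (ι u')⟫_ℂ - (c : ℂ) * ⟪J ψ - ψ, ι u'⟫_ℂ := by
    rw [← hu, inner_sub_left, inner_sub_left, inner_add_right, inner_smul_right, hJs, hJs]
    rw [inner_add_right, inner_smul_right, ← hT, ← hJ] at h1
    linear_combination h1
  -- `j` is known to be close to the identity only at the regular approximation `f` of `ψ`; the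
  -- contraction property transfers this to `ψ`.
  have h3 : ‖J ψ - ψ‖ ≤ 3 * δ := by
    have : J ψ - ψ = J (ψ - ι f) + (J (ι f) - ι f) - (ψ - ι f) := by rw [map_sub]; abel
    rw [this]
    have h4 : ‖ψ - ι f‖ < δ := by rw [← dist_eq_norm]; exact hf
    have h5 := hJc (ψ - ι f)
    have h6 : ‖J (ι f) - ι f‖ < δ := hjf
    calc _ ≤ ‖J (ψ - ι f)‖ + ‖J (ι f) - ι f‖ + ‖ψ - ι f‖ :=
          (norm_sub_le _ _).trans (add_le_add_left (norm_add_le _ _) _)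
      _ ≤ 3 * δ := by linarith
  calc ‖⟪ψ, ι g⟫_ℂ‖ ≤ ‖⟪J ψ - ψ, T (ι u')⟫_ℂ‖ + ‖(c : ℂ) * ⟪J ψ - ψ, ι u'⟫_ℂ‖ := by
        rw [h2]; exact norm_sub_le _ _
    _ ≤ (3 * δ) * B + c * ((3 * δ) * ‖ι g‖) := by
        rw [norm_mul, Complex.norm_real, Real.norm_of_nonneg (by linarith)]
        gcongr
        · exact (norm_inner_le_norm _ _).trans (by gcongr)
        · exact (norm_inner_le_norm _ _).trans (by gcongr)
    _ = 3 * δ * (B + c * ‖ι g‖) := by ring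
    _ ≤ 3 * δ * (B + c * ‖ι g‖ + 1) :=
        mul_le_mul_of_nonneg_left (by linarith) (by positivity)
    _ = ε := by rw [hδ]; field_simp
    _ = 0 + ε := (zero_add _).symm

/-- If the range of `S + c` is dense for one `c ≥ 1`, then that of `S + 1` is dense. -/
theorem eq_zero_of_orthogonal_range_one {ι : 𝒜 →ₗ[ℂ] H} {S : 𝒜 →ₗ[ℂ] 𝒜}
    (hS : ∀ f g, ⟪ι (S f), ι g⟫_ℂ = -⟪ι f, ι (S g)⟫_ℂ) {c : ℝ} (hc : 1 ≤ c)
    (hdense : ∀ ψ : H, (∀ f, ⟪ψ, ι (S f) + (c : ℂ) • ι f⟫_ℂ = 0) → ψ = 0) {ψ : H}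
    (hψ : ∀ f, ⟪ψ, ι (S f) + ι f⟫_ℂ = 0) : ψ = 0 := by
  let L : 𝒜 →ₗ[ℂ] H := ι ∘ₗ S + (c : ℂ) • ι
  have hL : ∀ f, L f = ι (S f) + (c : ℂ) • ι f := fun f => rfl
  -- Skewness makes the pairing of `f` with `S f` purely imaginary.
  have hLn : ∀ f, c * ‖ι f‖ ≤ ‖L f‖ := by
    intro f
    have h0 : (⟪ι f, ι (S f)⟫_ℂ).re = 0 := re_inner_self_eq_zero_of_skew (hS f f)
    have h1 : (⟪ι f, L f⟫_ℂ).re = c * ‖ι f‖ ^ 2 := by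
      rw [hL, inner_add_right, inner_smul_right, Complex.add_re, h0, zero_add,
        Complex.re_ofReal_mul, inner_self_eq_norm_sq_to_K]
      simp only [Complex.coe_algebraMap]
      rw [← Complex.ofReal_pow, Complex.ofReal_re]
    have h2 : (⟪ι f, L f⟫_ℂ).re ≤ ‖ι f‖ * ‖L f‖ :=
      (Complex.re_le_norm _).trans (norm_inner_le_norm _ _)
    rcases eq_or_lt_of_le (norm_nonneg (ι f)) with h | h
    · rw [← h]; simp
    · nlinarith
  have hdr : DenseRange L := by
    rw [DenseRange, ← LinearMap.coe_range, Submodule.dense_iff_topologicalClosure_eq_top,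
      Submodule.topologicalClosure_eq_top_iff]
    rw [Submodule.eq_bot_iff]
    intro x hx
    refine hdense x fun f => ?_
    rw [← hL]
    exact (Submodule.mem_orthogonal' _ _).1 hx _ ⟨f, rfl⟩
  -- On the dense range of `S + c`, orthogonality to the range of `S + 1` replaces the pairing by `c
  -- - 1` times the pairing with `f`, and `‖f‖ ≤ ‖L f‖ / c`. The factor is below one, so `x = ψ`
  -- forces `ψ = 0`.
  have h1 : ∀ x, ‖⟪ψ, x⟫_ℂ‖ ≤ (c - 1) / c * ‖ψ‖ * ‖x‖ := by
    intro x
    refine hdr.induction_on (p := fun x => ‖⟪ψ, x⟫_ℂ‖ ≤ (c - 1) / c * ‖ψ‖ * ‖x‖) x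
      (isClosed_le (by fun_prop) (by fun_prop)) fun f => ?_
    have h2 : ⟪ψ, L f⟫_ℂ = ((c - 1 : ℝ) : ℂ) * ⟪ψ, ι f⟫_ℂ := by
      have := hψ f
      rw [inner_add_right] at this
      rw [hL, inner_add_right, inner_smul_right]
      push_cast
      linear_combination this
    rw [h2, norm_mul, Complex.norm_real, Real.norm_of_nonneg (by linarith)]
    have h3 := hLn f
    have h4 : ‖ι f‖ ≤ ‖L f‖ / c := by rw [le_div_iff₀ (by linarith)]; linarith
    calc (c - 1) * ‖⟪ψ, ι f⟫_ℂ‖ ≤ (c - 1) * (‖ψ‖ * (‖L f‖ / c)) := by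
          refine mul_le_mul_of_nonneg_left ?_ (by linarith)
          exact (norm_inner_le_norm _ _).trans (by gcongr)
      _ = _ := by ring
  have h2 := h1 ψ
  rw [inner_self_eq_norm_sq_to_K] at h2
  simp only [Complex.coe_algebraMap, norm_pow, Complex.norm_real, norm_norm] at h2
  by_contra h
  have h3 : 0 < ‖ψ‖ := norm_pos_iff.2 h
  have h4 : (c - 1) / c < 1 := by rw [div_lt_one (by linarith)]; linarith
  nlinarith [mul_pos h3 h3]

end Resolvent

end GenConn

end

noncomputable section

set_option linter.unusedSectionVars false

namespace GenConn

/-! ### Left invariant frames on a Lie group -/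

section LieGroupFields

variable {E : Type*} [NormedAddCommGroup E] [NormedSpace ℝ E] {H : Type*} [TopologicalSpace H]
  {I : ModelWithCorners ℝ E H} {K : Type*} [TopologicalSpace K] [ChartedSpace H K] [Group K]
  [LieGroup I ∞ K]
  {F : Type*} [NormedAddCommGroup F] [NormedSpace ℝ F]

/-- The chain rule, with all tangent spaces identified with the model spaces. -/
theorem mfderiv_comp_model {E₁ E₂ E₃ : Type*} [NormedAddCommGroup E₁] [NormedSpace ℝ E₁]
    [NormedAddCommGroup E₂] [NormedSpace ℝ E₂] [NormedAddCommGroup E₃] [NormedSpace ℝ E₃]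
    {H₁ H₂ H₃ : Type*} [TopologicalSpace H₁] [TopologicalSpace H₂] [TopologicalSpace H₃]
    {I₁ : ModelWithCorners ℝ E₁ H₁} {I₂ : ModelWithCorners ℝ E₂ H₂} {I₃ : ModelWithCorners ℝ E₃ H₃}
    {M₁ M₂ M₃ : Type*} [TopologicalSpace M₁] [ChartedSpace H₁ M₁] [TopologicalSpace M₂]
    [ChartedSpace H₂ M₂] [TopologicalSpace M₃] [ChartedSpace H₃ M₃] {f : M₁ → M₂} {g : M₂ → M₃}
    {x : M₁} {y : M₂} (hg : MDifferentiableAt I₂ I₃ g y) (hf : MDifferentiableAt I₁ I₂ f x)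
    (hy : f x = y) {h : M₁ → M₃} (hh : ∀ x, g (f x) = h x) :
    (mfderiv I₁ I₃ h x : E₁ →L[ℝ] E₃) =
      (mfderiv I₂ I₃ g y : E₂ →L[ℝ] E₃).comp (mfderiv I₁ I₂ f x : E₁ →L[ℝ] E₂) := by
  subst hy
  obtain rfl : (fun x => g (f x)) = h := funext hh
  exact mfderiv_comp x hg hf

/-- The left invariant vector field with value `v` at the identity. -/
def invField (I : ModelWithCorners ℝ E H) {K : Type*} [TopologicalSpace K] [ChartedSpace H K]
    [Group K] (v : E) (x : K) : TangentSpace I x :=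
  show E from (mfderiv I I (fun y : K => x * y) 1 : E →L[ℝ] E) v

theorem mdifferentiable_mul_left' (x : K) : MDifferentiable I I (fun y : K => x * y) :=
  (contMDiff_mul_left (I := I) (n := ∞) (a := x)).mdifferentiable (by simp)

theorem mfderiv_mul_left_invField (g x : K) (v : E) :
    mfderiv I I (fun y : K => g * y) x (invField I v x) = invField I v (g * x) := by
  have h := mfderiv_comp_model (I₁ := I) (I₂ := I) (I₃ := I) (x := (1 : K))
    (g := fun y : K => g * y) (f := fun y : K => x * y)
    (mdifferentiable_mul_left' g _) (mdifferentiable_mul_left' x _) (mul_one x)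
    (h := fun y => g * x * y) (fun y => (mul_assoc g x y).symm)
  exact (congrArg (fun L : E →L[ℝ] E => L v) h).symm

/-- The value at `g` is the derivative of the multiplication at `(g, 1)` in the direction `(0, v)`,
hence the tangent map of a smooth map along a smooth section. -/
theorem smoothField_invField (v : E) : SmoothField I (invField I v : ∀ x : K, TangentSpace I x) := by
  have : IsManifold I 1 K := IsManifold.of_le (n := ∞) (by simp)
  let fg : K → TangentBundle I K := fun g => ⟨g, (0 : E)⟩
  have sfg : ContMDiff I I.tangent ∞ fg := Bundle.contMDiff_zeroSection _ _
  let fv : K → TangentBundle I K := fun _ => ⟨1, v⟩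
  have sfv : ContMDiff I I.tangent ∞ fv := contMDiff_const
  have S₂ : ContMDiff (I.tangent.prod I.tangent) (I.prod I).tangent ∞
    (equivTangentBundleProd I K I K).symm := contMDiff_equivTangentBundleProd_symm
  have S₃ : ContMDiff (I.prod I).tangent I.tangent ∞
      (tangentMap (I.prod I) I (fun p : K × K => p.1 * p.2)) :=
    ContMDiff.contMDiff_tangentMap (contMDiff_mul I ∞) (by simp)
  refine ((S₃.comp S₂).comp (sfg.prodMk sfv)).congr fun g => ?_
  have h := mfderiv_prod_eq_add_apply (I := I) (I' := I) (I'' := I)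
    (f := fun p : K × K => p.1 * p.2) (p := (g, 1)) (v := ((0 : E), v))
    ((contMDiff_mul I ∞).mdifferentiable (by simp) _)
  simp only [Function.comp, tangentMap, fg, fv]
  refine Bundle.TotalSpace.ext (mul_one g).symm ?_
  refine heq_of_eq ?_
  refine Eq.trans ?_ h.symm
  unfold invField
  erw [map_zero, zero_add]

theorem dirDeriv_invField_mul_left (v : E) (g : K) {f : K → F} {x : K}
    (hf : MDifferentiableAt I 𝓘(ℝ, F) f (g * x)) :
    dirDeriv I (invField I v) (fun x => f (g * x)) x = dirDeriv I (invField I v) f (g * x) :=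
  dirDeriv_comp (φ := fun x => g * x) (mdifferentiable_mul_left' g x)
    (mfderiv_mul_left_invField g x v) hf

/-- The vector field `V` in the left trivialization of the tangent bundle. -/
def leftTriv (I : ModelWithCorners ℝ E H) {K : Type*} [TopologicalSpace K] [ChartedSpace H K]
    [Group K] (V : ∀ x : K, TangentSpace I x) (x : K) : E :=
  (mfderiv I I (fun y : K => x⁻¹ * y) x : E →L[ℝ] E) (V x)

theorem invField_leftTriv (V : ∀ x : K, TangentSpace I x) (x : K) :
    invField I (leftTriv I V x) x = V x := by
  have h := mfderiv_comp_model (I₁ := I) (I₂ := I) (I₃ := I) (x := x)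
    (g := fun y : K => x * y) (f := fun y : K => x⁻¹ * y)
    (mdifferentiable_mul_left' x _) (mdifferentiable_mul_left' x⁻¹ _) (inv_mul_cancel x)
    (h := fun y => y) (fun y => mul_inv_cancel_left x y)
  have h2 : mfderiv I I (fun y : K => y) x = ContinuousLinearMap.id ℝ (TangentSpace I x) := mfderiv_id
  exact (congrArg (fun L : E →L[ℝ] E => L (V x)) h).symm.trans
    (congrArg (fun L : E →L[ℝ] E => L (V x)) h2)

/-- Read in the chart at the identity, this is the derivative of `x⁻¹ * y` in `y` along `V`, taken
on the diagonal. -/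
theorem contMDiff_leftTriv [I.Boundaryless] {V : ∀ x : K, TangentSpace I x} (hV : SmoothField I V) :
    ContMDiff I 𝓘(ℝ, E) ∞ (leftTriv I V : K → E) := by
  have : IsManifold I 1 K := IsManifold.of_le (n := ∞) (by simp)
  set χ := extChartAt I (1 : K)
  have hm : ContMDiff (I.prod I) I ∞ (fun z : K × K => z.1⁻¹ * z.2) :=
    (contMDiff_fst.inv).mul contMDiff_snd
  have h1 := contMDiffOn_dirDeriv_diag hV (f := fun z : K × K => χ (z.1⁻¹ * z.2))
    (U := (fun z : K × K => z.1⁻¹ * z.2) ⁻¹' (extChartAt I (1 : K)).source)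
    ((isOpen_extChartAt_source (1 : K)).preimage hm.continuous)
    (contMDiffOn_extChartAt.comp hm.contMDiffOn fun z hz => by simpa using hz)
    (fun x => by simp)
  -- Removes the derivative of the chart at the identity; it is a fixed map, so it does not affect
  -- smoothness in `x`.
  obtain ⟨L, hL⟩ : ∃ L : E →L[ℝ] E, ∀ w : E, L ((mfderiv I 𝓘(ℝ, E) χ 1 : E →L[ℝ] E) w) = w := by
    obtain ⟨e, he⟩ := isInvertible_mfderiv_extChartAt (I := I) (mem_extChartAt_source (1 : K))
    refine ⟨e.symm.toContinuousLinearMap, fun w => ?_⟩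
    exact (congrArg e.symm (congrArg (fun L : E →L[ℝ] E => L w) he).symm).trans
      (e.symm_apply_apply w)
  refine (L.contMDiff.comp h1).congr fun x => ?_
  have hd : MDifferentiableAt I 𝓘(ℝ, E) χ 1 :=
    mdifferentiableAt_extChartAt (mem_chart_source H (1 : K))
  have h3 := mfderiv_comp_model (I₁ := I) (I₂ := I) (I₃ := 𝓘(ℝ, E)) (x := x) (g := χ)
    (f := fun y : K => x⁻¹ * y) hd (mdifferentiable_mul_left' x⁻¹ _) (inv_mul_cancel x)
    (fun _ => rfl)
  have h4 := congrArg (fun L : E →L[ℝ] E => L (V x)) h3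
  exact ((congrArg L h4).trans (hL (leftTriv I V x))).symm

variable [FiniteDimensional ℝ E]

/-- A vector field in terms of the left invariant frame. -/
theorem exists_frame_coeff [I.Boundaryless] {V : ∀ x : K, TangentSpace I x} (hV : SmoothField I V) :
    ∃ c : Fin (Module.finrank ℝ E) → K → ℝ, (∀ k, ContMDiff I 𝓘(ℝ, ℝ) ∞ (c k)) ∧
      ∀ (F : Type) [NormedAddCommGroup F] [NormedSpace ℝ F] (f : K → F) (x : K),
        dirDeriv I V f x =
          ∑ k, c k x • dirDeriv I (invField I (Module.finBasis ℝ E k)) f x := by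
  set b := Module.finBasis ℝ E
  refine ⟨fun k x => b.repr (leftTriv I V x) k, fun k => ?_, fun F _ _ f x => ?_⟩
  · exact (LinearMap.toContinuousLinearMap ((Finsupp.lapply k).comp b.repr.toLinearMap)).contMDiff.comp
      (contMDiff_leftTriv hV)
  · have h1 : V x = (show E from ∑ k, b.repr (leftTriv I V x) k • 
        (show E from invField I (b k) x)) := by
      rw [← invField_leftTriv V x]
      conv_lhs => rw [← b.sum_repr (leftTriv I V x)]
      unfold invField
      refine (map_sum (mfderiv I I (fun y : K => x * y) 1 : E →L[ℝ] E) _ _).trans ?_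
      refine Finset.sum_congr rfl fun k _ => ?_
      exact map_smul (mfderiv I I (fun y : K => x * y) 1 : E →L[ℝ] E) _ _
    unfold dirDeriv
    rw [h1]
    refine (map_sum (show E →L[ℝ] F from mfderiv I 𝓘(ℝ, F) f x) _ _).trans ?_
    refine Finset.sum_congr rfl fun k _ => ?_
    exact map_smul (show E →L[ℝ] F from mfderiv I 𝓘(ℝ, F) f x) _ _

end LieGroupFields

end GenConn

end

noncomputable section

set_option linter.unusedSectionVars false
set_option linter.unusedVariables false

namespace GenConn

/-! ### Haar measure, divergence and smooth functions on a compact Lie group -/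

section CompactLieGroup

variable {E : Type*} [NormedAddCommGroup E] [NormedSpace ℝ E] [FiniteDimensional ℝ E]
  {H : Type*} [TopologicalSpace H]
  {I : ModelWithCorners ℝ E H} [I.Boundaryless]
  {K : Type*} [TopologicalSpace K] [ChartedSpace H K] [Group K]
  [LieGroup I ∞ K] [IsTopologicalGroup K] [T2Space K] [CompactSpace K] [SecondCountableTopology K]
  [MeasurableSpace K] [BorelSpace K] {μ : Measure K} [μ.IsHaarMeasure] [IsProbabilityMeasure μ]
  {F : Type*} [NormedAddCommGroup F] [NormedSpace ℝ F]

/-- A right translate of the measure is again a Haar probability measure, and there is only one. -/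
theorem isMulRightInvariant_of_compact (μ : Measure K) [μ.IsHaarMeasure] [IsProbabilityMeasure μ] :
    μ.IsMulRightInvariant where
  map_mul_right_eq_self g := by
    have : IsProbabilityMeasure (μ.map (· * g)) :=
      Measure.isProbabilityMeasure_map (by fun_prop)
    have h2 : (μ.map (· * g)).IsHaarMeasure := by infer_instance
    exact Measure.isHaarMeasure_eq_of_isProbabilityMeasure _ _

theorem isInvInvariant_of_compact (μ : Measure K) [μ.IsHaarMeasure] [IsProbabilityMeasure μ] :
    μ.IsInvInvariant where
  inv_eq_self := by
    have := isMulRightInvariant_of_compact μ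
    have h1 : IsProbabilityMeasure (μ.inv) :=
      Measure.isProbabilityMeasure_map (by fun_prop)
    have h2 : (μ.inv).IsHaarMeasure := Measure.isHaarMeasure_of_isCompact_nonempty_interior _ univ
      isCompact_univ (by simp) (by simp) (by simp)
    exact Measure.isHaarMeasure_eq_of_isProbabilityMeasure _ _

theorem integrable_of_continuous {f : K → F} (hf : Continuous f) : Integrable f μ := by
  have := integrable_smul_continuous (𝕜 := ℝ) (ν := μ) (integrable_const (1 : ℝ)) hf
  simpa using this

variable (μ) in
-- By right invariance the integral of `f (y * x)` over `y` is constant in `x`. Its derivative at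
-- the identity along `v` is the integral of the left invariant derivative of `f`.
theorem integral_dirDeriv_invField [CompleteSpace F] (v : E) {f : K → F}
    (hf : ContMDiff I 𝓘(ℝ, F) 1 f) : ∫ x, dirDeriv I (invField I v) f x ∂μ = 0 := by
  have := isMulRightInvariant_of_compact μ
  have hs : ContMDiff (I.prod I) 𝓘(ℝ, F) 1 (fun z : K × K => f (z.2 * z.1)) :=
    hf.comp (((contMDiff_snd (n := ∞)).mul contMDiff_fst).of_le (by simp))
  have h1 := dirDeriv_parametric_integral (𝕜 := ℝ) (ν := μ) (w := fun _ : K => (1 : ℝ))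
    (integrable_const _) isOpen_univ hs.contMDiffOn (mem_univ (1 : K)) (invField I v)
  have h2 : (fun x : K => ∫ y, (1 : ℝ) • f (y * x) ∂μ) = fun _ => ∫ y, f y ∂μ := by
    ext x
    simp only [one_smul]
    exact integral_mul_right_eq_self f x
  rw [h2] at h1
  simp only [one_smul] at h1
  have h3 : dirDeriv I (invField I v) (fun _ : K => ∫ y, f y ∂μ) 1 = 0 := by
    unfold dirDeriv
    rw [mfderiv_const]
    rfl
  rw [h3] at h1
  refine Eq.trans ?_ h1.symm
  refine integral_congr_ae (Filter.Eventually.of_forall fun y => ?_)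
  have h4 := dirDeriv_invField_mul_left (I := I) v y (f := f) (x := 1)
    (hf.mdifferentiable (by simp) _)
  rw [mul_one] at h4
  exact h4.symm

variable (μ) in
-- With `V = ∑ c k • X k` in the left invariant frame, integrate the Leibniz rule for `c k • f`
-- along the divergence free `X k`; this gives `d = ∑ X k (c k)`.
theorem exists_divergence {V : ∀ x : K, TangentSpace I x} (hV : SmoothField I V) :
    ∃ d : K → ℝ, ContMDiff I 𝓘(ℝ, ℝ) ∞ d ∧
      ∀ (F : Type) [NormedAddCommGroup F] [NormedSpace ℝ F] [CompleteSpace F] (f : K → F),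
        ContMDiff I 𝓘(ℝ, F) 1 f → ∫ x, dirDeriv I V f x ∂μ = - ∫ x, d x • f x ∂μ := by
  obtain ⟨c, hc, hcV⟩ := exists_frame_coeff hV
  set X : Fin (Module.finrank ℝ E) → ∀ x : K, TangentSpace I x :=
    fun k => invField I (Module.finBasis ℝ E k) with hX
  have hXs : ∀ k, SmoothField I (X k) := fun k => smoothField_invField _
  have hd1 : ∀ k, ContMDiff I 𝓘(ℝ, ℝ) ∞ (dirDeriv I (X k) (c k)) := fun k =>
    contMDiff_dirDeriv (hXs k) (hc k) (m := ∞) (by simp) le_rfl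
  refine ⟨fun x => ∑ k, dirDeriv I (X k) (c k) x, ContMDiff.sum fun k _ => hd1 k, ?_⟩
  intro F _ _ _ f hf
  have hD : ∀ k, ContMDiff I 𝓘(ℝ, F) 0 (dirDeriv I (X k) f) := fun k =>
    contMDiff_dirDeriv (hXs k) hf (m := 0) (by simp) (by simp)
  have key : ∀ k, ∫ x, c k x • dirDeriv I (X k) f x ∂μ = - ∫ x, dirDeriv I (X k) (c k) x • f x ∂μ := by
    intro k
    have h1 := integral_dirDeriv_invField μ (Module.finBasis ℝ E k) (((hc k).of_le (by simp)).smul hf)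
    have h2 : ∀ x, dirDeriv I (X k) (fun x => c k x • f x) x =
        c k x • dirDeriv I (X k) f x + dirDeriv I (X k) (c k) x • f x := fun x =>
      dirDeriv_smul ((hc k).mdifferentiable (by simp) x) (hf.mdifferentiable (by simp) x)
    have h3 : ∫ x, dirDeriv I (X k) (fun x => c k x • f x) x ∂μ = 0 := h1
    simp only [h2] at h3
    exact eq_neg_of_add_eq_zero_left ((integral_add
      (integrable_of_continuous ((hc k).continuous.smul (hD k).continuous))
      (integrable_of_continuous ((hd1 k).continuous.smul hf.continuous))).symm.trans h3)
  rw [show dirDeriv I V f = _ from funext (hcV F f)]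
  simp only [Finset.sum_smul]
  refine (integral_finsetSum _ fun k _ => integrable_of_continuous
    ((hc k).continuous.smul (hD k).continuous)).trans ?_
  refine (Finset.sum_congr rfl fun k _ => key k).trans ?_
  rw [Finset.sum_neg_distrib]
  exact congrArg _ (integral_finsetSum _ fun k _ => integrable_of_continuous
    ((hd1 k).continuous.smul hf.continuous)).symm

theorem dirDeriv_mul {V : ∀ x : K, TangentSpace I x} {f g : K → ℂ} {x : K}
    (hf : MDifferentiableAt I 𝓘(ℝ, ℂ) f x) (hg : MDifferentiableAt I 𝓘(ℝ, ℂ) g x) :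
    dirDeriv I V (fun x => f x * g x) x = f x * dirDeriv I V g x + dirDeriv I V f x * g x := by
  have := (show HasMFDerivAt I 𝓘(ℝ, ℂ) (fun x => f x * g x) x _ from
    ⟨hf.continuousAt.mul hg.continuousAt, hf.hasMFDerivAt.2.mul hg.hasMFDerivAt.2⟩).mfderiv
  unfold dirDeriv
  erw [this]
  simp only [writtenInExtChartAt, Function.comp, extChartAt_to_inv]
  exact congrArg₂ (fun a b : ℂ => a + b) rfl
    (mul_comm (g x) (show ℂ from mfderiv I 𝓘(ℝ, ℂ) f x (V x)))

/-- A symmetric approximate identity. -/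
theorem exists_mollifier (μ : Measure K) [μ.IsHaarMeasure] [IsProbabilityMeasure μ]
    {W : Set K} (hW : W ∈ nhds (1 : K)) :
    ∃ ρ : K → ℝ, ContMDiff I 𝓘(ℝ, ℝ) ∞ ρ ∧ (∀ x, 0 ≤ ρ x) ∧ (∀ x, ρ x⁻¹ = ρ x) ∧
      ∫ x, ρ x ∂μ = 1 ∧ ∀ x, x ∉ W → ρ x = 0 := by
  have hW' : W ∩ W⁻¹ ∈ nhds (1 : K) := Filter.inter_mem hW (inv_mem_nhds_one K hW)
  obtain ⟨b, -, hb⟩ := (SmoothBumpFunction.nhds_basis_support (I := I) hW').mem_iff.1 hW'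
  have hbs : ContMDiff I 𝓘(ℝ, ℝ) ∞ b := b.contMDiff
  -- Symmetric under inversion, so that convolution is self-adjoint. The support of `b` lies in `W ∩
  -- W⁻¹`, which keeps both summands inside `W`.
  set r : K → ℝ := fun x => b x + b x⁻¹ with hr
  have hrs : ContMDiff I 𝓘(ℝ, ℝ) ∞ r := hbs.add (hbs.comp (contMDiff_inv I ∞))
  have hr0 : ∀ x, 0 ≤ r x := fun x => add_nonneg b.nonneg b.nonneg
  have hpos : 0 < ∫ x, r x ∂μ := by
    refine (Continuous.integral_pos_of_hasCompactSupport_nonneg_nonzero hrs.continuous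
      (HasCompactSupport.of_compactSpace _) hr0 (x := 1) ?_)
    simp [hr]
  set c := ∫ x, r x ∂μ
  refine ⟨fun x => c⁻¹ * r x, contMDiff_const.mul hrs, fun x => mul_nonneg
    (inv_nonneg.2 hpos.le) (hr0 x), fun x => by simp [hr, add_comm], ?_, fun x hx => ?_⟩
  · rw [integral_const_mul, inv_mul_cancel₀ hpos.ne']
  · have h1 : b x = 0 := by
      by_contra h
      exact hx (hb h).1
    have h2 : b x⁻¹ = 0 := by
      by_contra h
      exact hx (by simpa using (hb h).2)
    simp [hr, h1, h2]

variable (K) in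
/-- The space of smooth complex functions. -/
def smoothFunctions (I : ModelWithCorners ℝ E H) : Submodule ℂ (K → ℂ) where
  carrier := {f | ContMDiff I 𝓘(ℝ, ℂ) ∞ f}
  add_mem' hf hg := hf.add hg
  zero_mem' := contMDiff_const
  smul_mem' c _ hf := (ContinuousLinearMap.mul ℝ ℂ c).contMDiff.comp hf

theorem smoothFunctions_mdiff (f : smoothFunctions K I) : MDifferentiable I 𝓘(ℝ, ℂ) (f : K → ℂ) :=
  f.2.mdifferentiable (by simp)

/-- A vector field as an operator on smooth functions. -/
def fieldOp {V : ∀ x : K, TangentSpace I x} (hV : SmoothField I V) :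
    smoothFunctions K I →ₗ[ℂ] smoothFunctions K I where
  toFun f := ⟨dirDeriv I V f, contMDiff_dirDeriv hV f.2 (m := ∞) (by simp) le_rfl⟩
  map_add' f g := Subtype.ext <| funext fun x =>
    dirDeriv_add (smoothFunctions_mdiff f x) (smoothFunctions_mdiff g x)
  map_smul' c f := Subtype.ext <| funext fun x =>
    dirDeriv_clm (ContinuousLinearMap.mul ℝ ℂ c) (smoothFunctions_mdiff f x)

/-- Multiplication by a real smooth function. -/
def mulOp {d : K → ℝ} (hd : ContMDiff I 𝓘(ℝ, ℝ) ∞ d) :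
    smoothFunctions K I →ₗ[ℂ] smoothFunctions K I where
  toFun f := ⟨fun x => d x • (f : K → ℂ) x, hd.smul f.2⟩
  map_add' f g := Subtype.ext <| funext fun x => smul_add _ _ _
  map_smul' c f := Subtype.ext <| funext fun x => smul_comm (d x) c ((f : K → ℂ) x)

/-- The inclusion of the smooth functions in the continuous ones. -/
def smoothToContinuous (I : ModelWithCorners ℝ E H) : smoothFunctions K I →ₗ[ℂ] C(K, ℂ) where
  toFun f := ⟨f, f.2.continuous⟩
  map_add' f g := rfl
  map_smul' c f := rfl

/-- The inclusion of the smooth functions in `L²`. -/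
def smoothToL2 (I : ModelWithCorners ℝ E H) (μ : Measure K) [IsFiniteMeasure μ] :
    smoothFunctions K I →ₗ[ℂ] Lp ℂ 2 μ :=
  (ContinuousMap.toLp (E := ℂ) 2 μ ℂ).toLinearMap ∘ₗ smoothToContinuous I

theorem coeFn_smoothToL2 (f : smoothFunctions K I) :
    (smoothToL2 I μ f : K → ℂ) =ᵐ[μ] (f : K → ℂ) :=
  ContinuousMap.coeFn_toLp (𝕜 := ℂ) μ (smoothToContinuous I f)

theorem smoothToL2_injective : Function.Injective (smoothToL2 (K := K) I μ) := by
  intro f g h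
  have := ContinuousMap.toLp_injective (𝕜 := ℂ) (p := 2) μ h
  exact Subtype.ext (congrArg (fun u : C(K, ℂ) => (u : K → ℂ)) this)

/-- Smooth functions are uniformly dense in the continuous ones, and these are dense in `L²`. -/
theorem denseRange_smoothToL2 : DenseRange (smoothToL2 (K := K) I μ) := by
  have h1 := ContinuousMap.toLp_denseRange (α := K) (p := 2) ℂ μ ℂ (by simp)
  have h2 : DenseRange (smoothToContinuous (K := K) I) := by
    intro f
    rw [Metric.mem_closure_iff]
    intro ε hε
    obtain ⟨g, hg, -⟩ := f.continuous.exists_contMDiff_approx I ⊤ (ε := fun _ => ε / 2)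
      continuous_const (fun _ => half_pos hε)
    refine ⟨_, ⟨⟨g, g.contMDiff⟩, rfl⟩, ?_⟩
    rw [dist_comm]
    refine lt_of_le_of_lt ((ContinuousMap.dist_le (half_pos hε).le).2 fun x => (hg x).le)
      (half_lt_self hε)
  exact h1.comp h2 (ContinuousMap.toLp 2 μ ℂ).continuous

theorem inner_smoothToL2 (f g : smoothFunctions K I) :
    inner ℂ (smoothToL2 I μ f) (smoothToL2 I μ g) =
      ∫ x, (starRingEnd ℂ) ((f : K → ℂ) x) * (g : K → ℂ) x ∂μ := by
  rw [L2.inner_def]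
  refine integral_congr_ae ?_
  filter_upwards [coeFn_smoothToL2 (μ := μ) f, coeFn_smoothToL2 (μ := μ) g] with x h1 h2
  rw [h1, h2]
  simp [mul_comm]

theorem norm_smoothToL2_le_of_bound {C : ℝ} (f : smoothFunctions K I)
    (h : ∀ x, ‖(f : K → ℂ) x‖ ≤ C) : ‖smoothToL2 I μ f‖ ≤ C := by
  have hC : 0 ≤ C := (norm_nonneg _).trans (h 1)
  have := Lp.norm_le_of_ae_bound (p := 2) (f := smoothToL2 I μ f) hC (by
    filter_upwards [coeFn_smoothToL2 (μ := μ) f] with x hx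
    rw [hx]
    exact h x)
  simpa [measureUnivNNReal] using this

theorem norm_smoothToL2_le_mul {C : ℝ} (f g : smoothFunctions K I)
    (h : ∀ x, ‖(f : K → ℂ) x‖ ≤ C * ‖(g : K → ℂ) x‖) :
    ‖smoothToL2 I μ f‖ ≤ C * ‖smoothToL2 I μ g‖ := by
  refine Lp.norm_le_mul_norm_of_ae_le_mul ?_
  filter_upwards [coeFn_smoothToL2 (μ := μ) f, coeFn_smoothToL2 (μ := μ) g] with x h1 h2
  rw [h1, h2]
  exact h x

theorem integral_norm_le_norm_L2 (w : Lp ℂ 2 μ) : ∫ x, ‖w x‖ ∂μ ≤ ‖w‖ := by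
  have h1 : eLpNorm w 1 μ ≤ eLpNorm w 2 μ :=
    eLpNorm_le_eLpNorm_of_exponent_le (by norm_num) (Lp.aestronglyMeasurable w)
  rw [integral_norm_eq_lintegral_enorm (Lp.aestronglyMeasurable w), ← eLpNorm_one_eq_lintegral_enorm,
    Lp.norm_def]
  exact ENNReal.toReal_mono (Lp.eLpNorm_ne_top w) h1

end CompactLieGroup

end GenConn

end

noncomputable section

set_option linter.unusedSectionVars false
set_option linter.unusedVariables false

namespace GenConn

/-! ### Convolution and range density on a compact Lie group -/

section Mollification

variable {E : Type*} [NormedAddCommGroup E] [NormedSpace ℝ E] [FiniteDimensional ℝ E]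
  {H : Type*} [TopologicalSpace H]
  {I : ModelWithCorners ℝ E H} [I.Boundaryless]
  {K : Type*} [TopologicalSpace K] [ChartedSpace H K] [Group K]
  [LieGroup I ∞ K] [IsTopologicalGroup K] [T2Space K] [CompactSpace K] [SecondCountableTopology K]
  [MeasurableSpace K] [BorelSpace K] {μ : Measure K} [μ.IsHaarMeasure] [IsProbabilityMeasure μ]
  {F : Type*} [NormedAddCommGroup F] [NormedSpace ℝ F]

theorem integrable_L2 (w : Lp ℂ 2 μ) : Integrable w μ :=
  (Lp.memLp w).integrable (by norm_num)

theorem contMDiff_convKernel {ρ : K → ℝ} (hρ : ContMDiff I 𝓘(ℝ, ℝ) ∞ ρ) :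
    ContMDiff (I.prod I) 𝓘(ℝ, ℂ) ∞ (fun z : K × K => ((ρ (z.1 * z.2⁻¹) : ℝ) : ℂ)) :=
  Complex.ofRealCLM.contMDiff.comp (hρ.comp (contMDiff_fst.mul contMDiff_snd.inv))

/-- Convolution with a smooth function. -/
def mollify (μ : Measure K) [μ.IsHaarMeasure] [IsProbabilityMeasure μ] {ρ : K → ℝ}
    (hρ : ContMDiff I 𝓘(ℝ, ℝ) ∞ ρ) : Lp ℂ 2 μ →ₗ[ℂ] smoothFunctions K I where
  toFun w := ⟨fun x => ∫ y, w y • ((ρ (x * y⁻¹) : ℝ) : ℂ) ∂μ, contMDiffOn_univ.1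
    (contMDiffOn_parametric_integral (integrable_L2 w) isOpen_univ
      (contMDiff_convKernel hρ).contMDiffOn)⟩
  map_add' w w' := Subtype.ext <| funext fun x => by
    have h := fun w : Lp ℂ 2 μ => integrable_smul_continuous (integrable_L2 w)
      (g := fun y => ((ρ (x * y⁻¹) : ℝ) : ℂ)) (by have := hρ.continuous; fun_prop)
    refine Eq.trans (integral_congr_ae ?_) (integral_add (h w) (h w'))
    filter_upwards [Lp.coeFn_add w w'] with y hy
    rw [hy, Pi.add_apply, add_smul]
  map_smul' c w := Subtype.ext <| funext fun x => by
    refine Eq.trans (integral_congr_ae ?_) (integral_smul c _)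
    filter_upwards [Lp.coeFn_smul c w] with y hy
    rw [hy, Pi.smul_apply, smul_assoc]

theorem mollify_apply {ρ : K → ℝ} (hρ : ContMDiff I 𝓘(ℝ, ℝ) ∞ ρ) (w : Lp ℂ 2 μ) (x : K) :
    (mollify μ hρ w : K → ℂ) x = ∫ y, w y • ((ρ (x * y⁻¹) : ℝ) : ℂ) ∂μ := rfl

/-- Substituting in the convolution moves the mollifier off `x`: the result is an average of left
translates of `f`. The kernel form of the definition gives smoothness, this form gives commutation
with left invariant fields, symmetry and contraction. -/
theorem mollify_smooth_apply {ρ : K → ℝ} (hρ : ContMDiff I 𝓘(ℝ, ℝ) ∞ ρ) (f : smoothFunctions K I)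
    (x : K) : (mollify μ hρ (smoothToL2 I μ f) : K → ℂ) x =
      ∫ y, ρ y • (f : K → ℂ) (y⁻¹ * x) ∂μ := by
  have := isInvInvariant_of_compact μ
  rw [mollify_apply, ← integral_mul_left_eq_self (fun y => ρ y • (f : K → ℂ) (y⁻¹ * x)) x,
    ← integral_inv_eq_self (fun y => ρ (x * y) • (f : K → ℂ) ((x * y)⁻¹ * x))]
  refine integral_congr_ae ?_
  filter_upwards [coeFn_smoothToL2 (μ := μ) f] with y hy
  rw [hy]
  simp [mul_comm]

theorem norm_integral_L2_le {k : K → K → ℂ} {C : ℝ} (hC : ∀ x y, ‖k x y‖ ≤ C) (w : Lp ℂ 2 μ) (x : K) :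
    ‖∫ y, w y • k x y ∂μ‖ ≤ C * ‖w‖ := by
  have hC0 : 0 ≤ C := (norm_nonneg _).trans (hC 1 1)
  calc ‖∫ y, w y • k x y ∂μ‖ ≤ ∫ y, C * ‖w y‖ ∂μ := by
        refine norm_integral_le_of_norm_le ((integrable_L2 w).norm.const_mul C)
          (Filter.Eventually.of_forall fun y => ?_)
        rw [norm_smul, mul_comm]
        exact mul_le_mul_of_nonneg_right (hC x y) (norm_nonneg _)
    _ = C * ∫ y, ‖w y‖ ∂μ := integral_const_mul _ _
    _ ≤ C * ‖w‖ := mul_le_mul_of_nonneg_left (integral_norm_le_norm_L2 w) hC0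

theorem exists_bound_kernel {k : K × K → ℂ} (hk : Continuous k) : ∃ C, ∀ x y, ‖k (x, y)‖ ≤ C := by
  obtain ⟨C, hC⟩ := isCompact_univ.exists_bound_of_continuousOn hk.continuousOn
  exact ⟨C, fun x y => hC (x, y) trivial⟩

theorem mollify_bounded {ρ : K → ℝ} (hρ : ContMDiff I 𝓘(ℝ, ℝ) ∞ ρ) :
    ∃ C, ∀ w : Lp ℂ 2 μ, ‖smoothToL2 I μ (mollify μ hρ w)‖ ≤ C * ‖w‖ := by
  obtain ⟨C, hC⟩ := exists_bound_kernel (contMDiff_convKernel hρ).continuous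
  exact ⟨C, fun w => norm_smoothToL2_le_of_bound _ fun x =>
    norm_integral_L2_le (k := fun x y => ((ρ (x * y⁻¹) : ℝ) : ℂ)) hC w x⟩

/-- The derivative falls on the smooth kernel, whose derivative is bounded because the group is
compact. -/
theorem fieldOp_mollify_bounded {V : ∀ x : K, TangentSpace I x} (hV : SmoothField I V) {ρ : K → ℝ}
    (hρ : ContMDiff I 𝓘(ℝ, ℝ) ∞ ρ) :
    ∃ C, ∀ w : Lp ℂ 2 μ, ‖smoothToL2 I μ (fieldOp hV (mollify μ hρ w))‖ ≤ C * ‖w‖ := by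
  -- The factors are swapped because `sndField` differentiates in the second one.
  have hs : ContMDiff (I.prod I) 𝓘(ℝ, ℂ) ∞ (fun z : K × K => ((ρ (z.2 * z.1⁻¹) : ℝ) : ℂ)) :=
    (contMDiff_convKernel hρ).comp (contMDiff_snd.prodMk contMDiff_fst)
  have h1 := contMDiff_dirDeriv (smoothField_sndField (I := I) (M := K) hV) hs
    (m := ∞) (by simp) le_rfl
  obtain ⟨C, hC⟩ := exists_bound_kernel h1.continuous
  refine ⟨C, fun w => norm_smoothToL2_le_of_bound _ fun x => ?_⟩
  have h2 : (fieldOp hV (mollify μ hρ w) : K → ℂ) x = _ := dirDeriv_parametric_integral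
    (integrable_L2 w) isOpen_univ ((contMDiff_convKernel hρ).of_le (by simp)).contMDiffOn (mem_univ x) V
  rw [h2]
  refine norm_integral_L2_le (k := fun x y => dirDeriv I V (fun x => ((ρ (x * y⁻¹) : ℝ) : ℂ)) x)
    (fun x y => ?_) w x
  have h3 := dirDeriv_sndField (I := I) (V := V) (z := (y, x)) (hs.mdifferentiable (by simp) _)
  rw [← h3]
  exact hC y x

theorem exists_norm_mulOp_le {c : K → ℝ} (hc : ContMDiff I 𝓘(ℝ, ℝ) ∞ c) :
    ∃ C, 0 ≤ C ∧ ∀ f, ‖smoothToL2 I μ (mulOp hc f)‖ ≤ C * ‖smoothToL2 I μ f‖ := by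
  obtain ⟨C, hC⟩ := isCompact_univ.exists_bound_of_continuousOn hc.continuous.continuousOn
  refine ⟨C, (norm_nonneg _).trans (hC 1 trivial), fun f => norm_smoothToL2_le_mul _ _ fun x => ?_⟩
  have : (mulOp hc f : K → ℂ) x = c x • (f : K → ℂ) x := rfl
  rw [this, norm_smul]
  exact mul_le_mul_of_nonneg_right (hC x trivial) (norm_nonneg _)

/-- A left invariant field commutes with each left translation, hence with their average. -/
theorem fieldOp_mollify_comm (v : E) {ρ : K → ℝ} (hρ : ContMDiff I 𝓘(ℝ, ℝ) ∞ ρ)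
    (f : smoothFunctions K I) :
    fieldOp (smoothField_invField v) (mollify μ hρ (smoothToL2 I μ f)) =
      mollify μ hρ (smoothToL2 I μ (fieldOp (smoothField_invField v) f)) := by
  ext x
  rw [mollify_smooth_apply]
  change dirDeriv I (invField I v) (mollify μ hρ (smoothToL2 I μ f) : K → ℂ) x = _
  rw [show (mollify μ hρ (smoothToL2 I μ f) : K → ℂ) = _ from funext (mollify_smooth_apply hρ f)]
  have hs : ContMDiff (I.prod I) 𝓘(ℝ, ℂ) ∞ (fun z : K × K => (f : K → ℂ) (z.2⁻¹ * z.1)) :=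
    f.2.comp (contMDiff_snd.inv.mul contMDiff_fst)
  rw [dirDeriv_parametric_integral (integrable_of_continuous hρ.continuous) isOpen_univ
    (hs.of_le (by simp)).contMDiffOn (mem_univ x) (invField I v)]
  refine integral_congr_ae (Filter.Eventually.of_forall fun y => ?_)
  have h4 := dirDeriv_invField_mul_left (I := I) v y⁻¹ (f := (f : K → ℂ)) (x := x)
    (f.2.mdifferentiable (by simp) _)
  simp only
  rw [h4]
  rfl

theorem integral_swap_of_continuous {k : K → K → ℂ} (hk : Continuous (Function.uncurry k)) :
    ∫ x, ∫ y, k x y ∂μ ∂μ = ∫ y, ∫ x, k x y ∂μ ∂μ :=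
  integral_integral_swap_of_hasCompactSupport hk (HasCompactSupport.of_compactSpace _)

/-- Exchange the integrals, translate in `x`, then replace `y` by `y⁻¹`, under which `ρ` and the
measure are invariant. -/
theorem integral_mollify_symm {ρ : K → ℝ} (hρ : ContMDiff I 𝓘(ℝ, ℝ) ∞ ρ) (hsymm : ∀ x, ρ x⁻¹ = ρ x)
    {f g : K → ℂ} (hf : Continuous f) (hg : Continuous g) :
    ∫ x, (∫ y, ρ y • f (y⁻¹ * x) ∂μ) * g x ∂μ = ∫ x, f x * ∫ y, ρ y • g (y⁻¹ * x) ∂μ ∂μ := by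
  have := isInvInvariant_of_compact μ
  have hρc := hρ.continuous
  calc ∫ x, (∫ y, ρ y • f (y⁻¹ * x) ∂μ) * g x ∂μ
      = ∫ x, ∫ y, ρ y • f (y⁻¹ * x) * g x ∂μ ∂μ := by simp only [← integral_mul_const]
    _ = ∫ y, ∫ x, ρ y • f (y⁻¹ * x) * g x ∂μ ∂μ := integral_swap_of_continuous (by
        simp only [Function.uncurry_def]; fun_prop)
    _ = ∫ y, ∫ x, ρ y • f x * g (y * x) ∂μ ∂μ := by
        refine integral_congr_ae (Filter.Eventually.of_forall fun y => ?_)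
        simp only
        rw [← integral_mul_left_eq_self (fun x => ρ y • f (y⁻¹ * x) * g x) y]
        simp
    _ = ∫ y, ∫ x, ρ y • f x * g (y⁻¹ * x) ∂μ ∂μ := by
        rw [← integral_inv_eq_self (fun y => ∫ x, ρ y • f x * g (y * x) ∂μ)]
        simp only [hsymm]
    _ = ∫ x, ∫ y, ρ y • f x * g (y⁻¹ * x) ∂μ ∂μ := (integral_swap_of_continuous (by
        simp only [Function.uncurry_def]; fun_prop)).symm
    _ = _ := by
        simp only [← integral_const_mul, smul_mul_assoc, mul_smul_comm]

theorem inner_mollify_symm {ρ : K → ℝ} (hρ : ContMDiff I 𝓘(ℝ, ℝ) ∞ ρ) (hsymm : ∀ x, ρ x⁻¹ = ρ x)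
    (f g : smoothFunctions K I) :
    inner ℂ (smoothToL2 I μ (mollify μ hρ (smoothToL2 I μ f))) (smoothToL2 I μ g) =
      inner ℂ (smoothToL2 I μ f) (smoothToL2 I μ (mollify μ hρ (smoothToL2 I μ g))) := by
  rw [inner_smoothToL2, inner_smoothToL2]
  simp only [mollify_smooth_apply, ← integral_conj]
  have h := integral_mollify_symm (μ := μ) hρ hsymm (f := fun x => (starRingEnd ℂ) ((f : K → ℂ) x))
    (Complex.continuous_conj.comp f.2.continuous) g.2.continuous
  refine Eq.trans ?_ h
  refine integral_congr_ae (Filter.Eventually.of_forall fun x => ?_)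
  simp only
  congr 1
  refine integral_congr_ae (Filter.Eventually.of_forall fun y => ?_)
  simp [Complex.real_smul]

/-- `ρ` is a probability density, so the convolution `u` is an average of translates of `f`.
Pointwise, `|f| |u| ≤ (|f|² + |u|²) / 2` and integration yield `‖u‖² ≤ ‖f‖² / 2 + ‖u‖² / 2`. -/
theorem norm_mollify_le {ρ : K → ℝ} (hρ : ContMDiff I 𝓘(ℝ, ℝ) ∞ ρ) (hρ0 : ∀ x, 0 ≤ ρ x)
    (hint : ∫ x, ρ x ∂μ = 1) (f : smoothFunctions K I) :
    ‖smoothToL2 I μ (mollify μ hρ (smoothToL2 I μ f))‖ ≤ ‖smoothToL2 I μ f‖ := by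
  set u := mollify μ hρ (smoothToL2 I μ f) with hu
  have hρc := hρ.continuous
  have hfc := f.2.continuous
  have huc := u.2.continuous
  have hn : ∀ g : smoothFunctions K I, ‖smoothToL2 I μ g‖ ^ 2 = ∫ x, ‖(g : K → ℂ) x‖ ^ 2 ∂μ := by
    intro g
    have h1 := inner_self_eq_norm_sq_to_K (𝕜 := ℂ) (smoothToL2 I μ g)
    rw [inner_smoothToL2] at h1
    simp only [Complex.conj_mul'] at h1
    have h2 : ((∫ x, ‖(g : K → ℂ) x‖ ^ 2 ∂μ : ℝ) : ℂ) = ((‖smoothToL2 I μ g‖ ^ 2 : ℝ) : ℂ) := by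
      rw [← integral_complex_ofReal]
      push_cast
      exact h1
    exact (Complex.ofReal_injective h2).symm
  have hpt : ∀ x, ‖(u : K → ℂ) x‖ ^ 2 ≤
      ∫ y, ρ y * ((‖(f : K → ℂ) (y⁻¹ * x)‖ ^ 2 + ‖(u : K → ℂ) x‖ ^ 2) / 2) ∂μ := by
    intro x
    have h1 : ‖(u : K → ℂ) x‖ ≤ ∫ y, ρ y * ‖(f : K → ℂ) (y⁻¹ * x)‖ ∂μ := by
      rw [hu, mollify_smooth_apply]
      refine (norm_integral_le_integral_norm _).trans (le_of_eq ?_)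
      refine integral_congr_ae (Filter.Eventually.of_forall fun y => ?_)
      simp [abs_of_nonneg (hρ0 y)]
    calc ‖(u : K → ℂ) x‖ ^ 2 ≤ (∫ y, ρ y * ‖(f : K → ℂ) (y⁻¹ * x)‖ ∂μ) * ‖(u : K → ℂ) x‖ := by
          rw [sq]; exact mul_le_mul_of_nonneg_right h1 (norm_nonneg _)
      _ = ∫ y, ρ y * ‖(f : K → ℂ) (y⁻¹ * x)‖ * ‖(u : K → ℂ) x‖ ∂μ := (integral_mul_const _ _).symm
      _ ≤ _ := by
          refine integral_mono (integrable_of_continuous (by fun_prop))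
            (integrable_of_continuous (by fun_prop)) fun y => ?_
          simp only
          rw [mul_assoc]
          refine mul_le_mul_of_nonneg_left ?_ (hρ0 y)
          nlinarith [sq_nonneg (‖(f : K → ℂ) (y⁻¹ * x)‖ - ‖(u : K → ℂ) x‖)]
  have hsum : ∀ x, ∫ y, ρ y * ((‖(f : K → ℂ) (y⁻¹ * x)‖ ^ 2 + ‖(u : K → ℂ) x‖ ^ 2) / 2) ∂μ =
      (∫ y, ρ y * ‖(f : K → ℂ) (y⁻¹ * x)‖ ^ 2 ∂μ) / 2 + ‖(u : K → ℂ) x‖ ^ 2 / 2 := by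
    intro x
    have h1 : ∀ y, ρ y * ((‖(f : K → ℂ) (y⁻¹ * x)‖ ^ 2 + ‖(u : K → ℂ) x‖ ^ 2) / 2) =
      ρ y * ‖(f : K → ℂ) (y⁻¹ * x)‖ ^ 2 / 2 + ρ y * (‖(u : K → ℂ) x‖ ^ 2 / 2) := fun y => by ring
    simp only [h1]
    rw [integral_add (integrable_of_continuous (by fun_prop))
      (integrable_of_continuous (by fun_prop)), integral_div, integral_mul_const, hint, one_mul]
  have hcont : Continuous fun x => ∫ y, ρ y * ‖(f : K → ℂ) (y⁻¹ * x)‖ ^ 2 ∂μ := by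
    have := continuous_parametric_integral_of_continuous (μ := μ)
      (f := fun x y => ρ y * ‖(f : K → ℂ) (y⁻¹ * x)‖ ^ 2)
      (by simp only [Function.uncurry_def]; fun_prop) isCompact_univ
    simpa using this
  have hswap : ∫ x, ∫ y, ρ y * ‖(f : K → ℂ) (y⁻¹ * x)‖ ^ 2 ∂μ ∂μ = ∫ x, ‖(f : K → ℂ) x‖ ^ 2 ∂μ := by
    rw [integral_integral_swap_of_hasCompactSupport (by simp only [Function.uncurry_def]; fun_prop)
      (HasCompactSupport.of_compactSpace _)]
    simp only [integral_const_mul]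
    have h1 : ∀ y, ∫ x, ‖(f : K → ℂ) (y⁻¹ * x)‖ ^ 2 ∂μ = ∫ x, ‖(f : K → ℂ) x‖ ^ 2 ∂μ := fun y =>
      integral_mul_left_eq_self (fun x => ‖(f : K → ℂ) x‖ ^ 2) y⁻¹
    simp only [h1]
    rw [integral_mul_const, hint, one_mul]
  have h3 : ‖smoothToL2 I μ u‖ ^ 2 ≤ ‖smoothToL2 I μ f‖ ^ 2 / 2 + ‖smoothToL2 I μ u‖ ^ 2 / 2 := by
    rw [hn, hn]
    calc ∫ x, ‖(u : K → ℂ) x‖ ^ 2 ∂μ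
        ≤ ∫ x, ((∫ y, ρ y * ‖(f : K → ℂ) (y⁻¹ * x)‖ ^ 2 ∂μ) / 2 + ‖(u : K → ℂ) x‖ ^ 2 / 2) ∂μ := by
          refine integral_mono (integrable_of_continuous (by fun_prop))
            (integrable_of_continuous (by fun_prop)) fun x => ?_
          exact (hpt x).trans (hsum x).le
      _ = _ := by
          rw [integral_add (integrable_of_continuous (by fun_prop))
            (integrable_of_continuous (by fun_prop)), integral_div, integral_div, hswap]
  exact (sq_le_sq₀ (norm_nonneg _) (norm_nonneg _)).1 (by linarith)

/-- By compactness a small translation changes `f` by little uniformly; take a mollifier supported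
among such translations. -/
theorem exists_mollify_close (f : smoothFunctions K I) {ε : ℝ} (hε : 0 < ε) :
    ∃ (ρ : K → ℝ) (hρ : ContMDiff I 𝓘(ℝ, ℝ) ∞ ρ), (∀ x, 0 ≤ ρ x) ∧ (∀ x, ρ x⁻¹ = ρ x) ∧
      ∫ x, ρ x ∂μ = 1 ∧ ‖smoothToL2 I μ (mollify μ hρ (smoothToL2 I μ f)) - smoothToL2 I μ f‖ < ε := by
  have hfc := f.2.continuous
  have h1 : ∀ᶠ y in nhds (1 : K), ∀ x ∈ (univ : Set K),
      ‖(f : K → ℂ) (y⁻¹ * x) - (f : K → ℂ) x‖ < ε / 2 := by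
    refine isCompact_univ.eventually_forall_of_forall_eventually fun x _ => ?_
    have hc : Continuous fun z : K × K => ‖(f : K → ℂ) (z.1⁻¹ * z.2) - (f : K → ℂ) z.2‖ := by
      fun_prop
    refine hc.continuousAt.eventually_lt continuousAt_const ?_
    simp [half_pos hε]
  obtain ⟨ρ, hρ, h0, hs, hi, hsupp⟩ := exists_mollifier (I := I) μ h1
  refine ⟨ρ, hρ, h0, hs, hi, ?_⟩
  have hρc := hρ.continuous
  rw [← map_sub]
  refine lt_of_le_of_lt (norm_smoothToL2_le_of_bound (C := ε / 2) _ fun x => ?_) (half_lt_self hε)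
  have h2 : ((mollify μ hρ (smoothToL2 I μ f) - f : smoothFunctions K I) : K → ℂ) x =
      ∫ y, ρ y • ((f : K → ℂ) (y⁻¹ * x) - (f : K → ℂ) x) ∂μ := by
    change (mollify μ hρ (smoothToL2 I μ f) : K → ℂ) x - (f : K → ℂ) x = _
    rw [mollify_smooth_apply]
    simp only [smul_sub]
    rw [integral_sub (integrable_of_continuous (by fun_prop))
      (integrable_of_continuous (by fun_prop)), integral_smul_const, hi, one_smul]
  rw [h2]
  calc _ ≤ ∫ y, ρ y * (ε / 2) ∂μ := by
        refine norm_integral_le_of_norm_le (integrable_of_continuous (by fun_prop))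
          (Filter.Eventually.of_forall fun y => ?_)
        rw [norm_smul, Real.norm_of_nonneg (h0 y)]
        by_cases hy : y ∈ {y : K | ∀ x ∈ (univ : Set K),
            ‖(f : K → ℂ) (y⁻¹ * x) - (f : K → ℂ) x‖ < ε / 2}
        · exact mul_le_mul_of_nonneg_left (hy x trivial).le (h0 y)
        · rw [hsupp y hy]; simp
    _ = ε / 2 := by rw [integral_mul_const, hi, one_mul]

/-- The left invariant fields of a basis of the Lie algebra. -/
def frameOp (k : Fin (Module.finrank ℝ E)) : smoothFunctions K I →ₗ[ℂ] smoothFunctions K I :=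
  fieldOp (smoothField_invField (Module.finBasis ℝ E k))

/-- `V` has bounded coefficients in the frame. Stated for an arbitrary function `d`, so that it also
covers commutators. -/
theorem exists_norm_fieldOp_le (μ : Measure K) [μ.IsHaarMeasure] [IsProbabilityMeasure μ]
    {V : ∀ x : K, TangentSpace I x} (hV : SmoothField I V) {d : K → ℝ}
    (hd : ContMDiff I 𝓘(ℝ, ℝ) ∞ d) : ∃ C, 0 ≤ C ∧ ∀ f,
      ‖smoothToL2 I μ (fieldOp hV f + (1 / 2 : ℂ) • mulOp hd f)‖ ≤
        C * (∑ k, ‖smoothToL2 I μ (frameOp k f)‖ + ‖smoothToL2 I μ f‖) := by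
  obtain ⟨c, hc, hcV⟩ := exists_frame_coeff hV
  choose Cc hCc0 hCc using fun k => exists_norm_mulOp_le (μ := μ) (hc k)
  obtain ⟨Cd, hCd0, hCd⟩ := exists_norm_mulOp_le (μ := μ) hd
  have hs : 0 ≤ ∑ k, Cc k := Finset.sum_nonneg fun k _ => hCc0 k
  refine ⟨∑ k, Cc k + Cd, add_nonneg hs hCd0, fun f => ?_⟩
  have h1 : fieldOp hV f = ∑ k, mulOp (hc k) (frameOp k f) := by
    ext x
    rw [Submodule.coe_sum, Finset.sum_apply]
    exact hcV ℂ f x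
  rw [h1, map_add, map_sum, map_smul]
  have h2 : ‖∑ k, smoothToL2 I μ (mulOp (hc k) (frameOp k f))‖ ≤
      (∑ k, Cc k) * ∑ k, ‖smoothToL2 I μ (frameOp k f)‖ := by
    refine (norm_sum_le _ _).trans ?_
    rw [Finset.sum_mul]
    refine Finset.sum_le_sum fun k _ => (hCc k _).trans ?_
    exact mul_le_mul_of_nonneg_left (Finset.single_le_sum
      (f := fun k => ‖smoothToL2 I μ (frameOp k f)‖) (fun _ _ => norm_nonneg _)
      (Finset.mem_univ k)) (hCc0 k)
  have h3 : ‖(1 / 2 : ℂ) • smoothToL2 I μ (mulOp hd f)‖ ≤ Cd * ‖smoothToL2 I μ f‖ := by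
    rw [norm_smul]
    have := hCd f
    have h4 : ‖(1 / 2 : ℂ)‖ = 1 / 2 := by norm_num
    rw [h4]
    have := norm_nonneg (smoothToL2 I μ (mulOp hd f))
    linarith
  have h5 : 0 ≤ ∑ k, ‖smoothToL2 I μ (frameOp k f)‖ := Finset.sum_nonneg fun _ _ => norm_nonneg _
  refine (norm_add_le _ _).trans ((add_le_add h2 h3).trans ?_)
  have h6 := mul_nonneg hs (norm_nonneg (smoothToL2 I μ f))
  have h7 := mul_nonneg hCd0 h5
  nlinarith

theorem smoothField_mlieBracket {V W : ∀ x : K, TangentSpace I x} (hV : SmoothField I V)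
    (hW : SmoothField I W) : SmoothField I (VectorField.mlieBracket I V W) := by
  have : CompleteSpace E := FiniteDimensional.complete ℝ E
  have : IsManifold I (((⊤ : ℕ∞) : WithTop ℕ∞) + 1) K := inferInstanceAs (IsManifold I ∞ K)
  have : IsManifold I (minSmoothness ℝ 2) K := by
    rw [minSmoothness_of_isRCLikeNormedField]
    exact IsManifold.of_le two_le_infty
  exact ContDiff.mlieBracket_vectorField (m := ⊤) (n := ⊤) hV hW (by simp)

/-- The operator `V + ½ d` on smooth functions. -/
def momentumOp {V : ∀ x : K, TangentSpace I x} (hV : SmoothField I V) {d : K → ℝ}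
    (hd : ContMDiff I 𝓘(ℝ, ℝ) ∞ d) : smoothFunctions K I →ₗ[ℂ] smoothFunctions K I :=
  fieldOp hV + (1 / 2 : ℂ) • mulOp hd

/-- The commutator of `X k` with `V + ½ d` is `[X k, V] + ½ X k d`, again a field plus half a
function, so `exists_norm_fieldOp_le` applies. That no second derivatives appear is what lets the a
priori estimate close. -/
theorem exists_norm_commutator_le (μ : Measure K) [μ.IsHaarMeasure] [IsProbabilityMeasure μ]
    {V : ∀ x : K, TangentSpace I x} (hV : SmoothField I V) {d : K → ℝ}
    (hd : ContMDiff I 𝓘(ℝ, ℝ) ∞ d) : ∃ C, 0 ≤ C ∧ ∀ k f,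
      ‖smoothToL2 I μ (frameOp k (momentumOp hV hd f)) -
          smoothToL2 I μ (momentumOp hV hd (frameOp k f))‖ ≤
        C * (∑ k, ‖smoothToL2 I μ (frameOp k f)‖ + ‖smoothToL2 I μ f‖) := by
  have : CompleteSpace E := FiniteDimensional.complete ℝ E
  have hX : ∀ k, SmoothField I (invField I (Module.finBasis ℝ E k) : ∀ x : K, TangentSpace I x) :=
    fun k => smoothField_invField _
  have hdk : ∀ k, ContMDiff I 𝓘(ℝ, ℝ) ∞ (dirDeriv I (invField I (Module.finBasis ℝ E k)) d) :=
    fun k => contMDiff_dirDeriv (hX k) hd (m := ∞) (by simp) le_rfl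
  choose C hC0 hC using fun k =>
    exists_norm_fieldOp_le μ (smoothField_mlieBracket (hX k) hV) (hdk k)
  refine ⟨∑ k, C k, Finset.sum_nonneg fun k _ => hC0 k, fun k f => ?_⟩
  have h0 : 0 ≤ ∑ k, ‖smoothToL2 I μ (frameOp k f)‖ + ‖smoothToL2 I μ f‖ :=
    add_nonneg (Finset.sum_nonneg fun _ _ => norm_nonneg _) (norm_nonneg _)
  refine le_trans (le_of_eq_of_le ?_ (hC k f))
    (mul_le_mul_of_nonneg_right (Finset.single_le_sum (fun k _ => hC0 k) (Finset.mem_univ k)) h0)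
  rw [← map_sub]
  congr 2
  ext x
  have e1 : dirDeriv I (VectorField.mlieBracket I (invField I (Module.finBasis ℝ E k)) V)
      (f : K → ℂ) x = _ :=
    congrFun (dirDeriv_mlieBracket (hX k) hV (f := (f : K → ℂ)) (f.2.of_le two_le_infty)) x
  have e2 : dirDeriv I (invField I (Module.finBasis ℝ E k))
      (fun x => d x • (f : K → ℂ) x) x = _ :=
    dirDeriv_smul (hd.mdifferentiable (by simp) x) (smoothFunctions_mdiff f x)
  have e3 : ((frameOp k (momentumOp hV hd f) : smoothFunctions K I) : K → ℂ) x =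
      dirDeriv I (invField I (Module.finBasis ℝ E k)) (dirDeriv I V (f : K → ℂ)) x +
        (1 / 2 : ℂ) * dirDeriv I (invField I (Module.finBasis ℝ E k))
          (fun x => d x • (f : K → ℂ) x) x := by
    have : frameOp k (momentumOp hV hd f) = frameOp k (fieldOp hV f) +
      (1 / 2 : ℂ) • frameOp k (mulOp hd f) := by
      simp only [momentumOp, LinearMap.add_apply, LinearMap.smul_apply, map_add, map_smul]
    rw [this]
    rfl
  change ((frameOp k (momentumOp hV hd f) : smoothFunctions K I) : K → ℂ) x -
    ((dirDeriv I V (dirDeriv I (invField I (Module.finBasis ℝ E k)) (f : K → ℂ)) x) +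
      (1 / 2 : ℂ) * d x • dirDeriv I (invField I (Module.finBasis ℝ E k)) (f : K → ℂ) x) =
    dirDeriv I (VectorField.mlieBracket I (invField I (Module.finBasis ℝ E k)) V) (f : K → ℂ) x +
      (1 / 2 : ℂ) * (dirDeriv I (invField I (Module.finBasis ℝ E k)) d x • (f : K → ℂ) x)
  rw [e3, e2, e1]
  simp only [Complex.real_smul]
  ring

/-- The divergence identity for `conj f * g`, with the term in `d` split evenly between the two
factors. -/
theorem inner_momentumOp {V : ∀ x : K, TangentSpace I x} (hV : SmoothField I V) {d : K → ℝ}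
    (hd : ContMDiff I 𝓘(ℝ, ℝ) ∞ d)
    (hdiv : ∀ f : K → ℂ, ContMDiff I 𝓘(ℝ, ℂ) ∞ f →
      ∫ x, dirDeriv I V f x ∂μ = - ∫ x, d x • f x ∂μ) (f g : smoothFunctions K I) :
    inner ℂ (smoothToL2 I μ (momentumOp hV hd f)) (smoothToL2 I μ g) =
      -inner ℂ (smoothToL2 I μ f) (smoothToL2 I μ (momentumOp hV hd g)) := by
  rw [inner_smoothToL2, inner_smoothToL2, ← integral_neg, ← sub_eq_zero]
  have hcf : ContMDiff I 𝓘(ℝ, ℂ) ∞ fun x => (starRingEnd ℂ) ((f : K → ℂ) x) :=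
    Complex.conjCLE.contDiff.contMDiff.comp f.2
  have h1 := hdiv _ ((contDiff_mul (𝕜 := ℝ) (𝔸 := ℂ)).contMDiff.comp (hcf.prodMk_space g.2))
  have h2 : ∀ x, dirDeriv I V (fun x => (starRingEnd ℂ) ((f : K → ℂ) x) * (g : K → ℂ) x) x =
      (starRingEnd ℂ) ((f : K → ℂ) x) * dirDeriv I V (g : K → ℂ) x +
        (starRingEnd ℂ) (dirDeriv I V (f : K → ℂ) x) * (g : K → ℂ) x := fun x => by
    rw [dirDeriv_mul (hcf.mdifferentiable (by simp) x) (smoothFunctions_mdiff g x)]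
    congr 2
    exact dirDeriv_clm (Complex.conjCLE : ℂ →L[ℝ] ℂ) (smoothFunctions_mdiff f x)
  have h3 : ∫ x, ((starRingEnd ℂ) ((f : K → ℂ) x) * dirDeriv I V (g : K → ℂ) x +
        (starRingEnd ℂ) (dirDeriv I V (f : K → ℂ) x) * (g : K → ℂ) x) ∂μ =
      - ∫ x, d x • ((starRingEnd ℂ) ((f : K → ℂ) x) * (g : K → ℂ) x) ∂μ := by
    simp only [← h2]
    exact h1
  have hfc := f.2.continuous
  have hgc := g.2.continuous
  have hdc := hd.continuous
  have hVf : Continuous (dirDeriv I V (f : K → ℂ)) := (fieldOp hV f).2.continuous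
  have hVg : Continuous (dirDeriv I V (g : K → ℂ)) := (fieldOp hV g).2.continuous
  have hconj := Complex.continuous_conj
  have hSf : ∀ f : smoothFunctions K I, ∀ x, (momentumOp hV hd f : K → ℂ) x =
      dirDeriv I V (f : K → ℂ) x + (1 / 2 : ℂ) * (d x • (f : K → ℂ) x) := fun f x => rfl
  simp only [hSf]
  rw [← integral_sub (integrable_of_continuous (by fun_prop))
    (integrable_of_continuous (by fun_prop))]
  rw [← sub_eq_zero, sub_neg_eq_add, ← integral_add (integrable_of_continuous (by fun_prop))
    (integrable_of_continuous (by fun_prop))] at h3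
  rw [← h3]
  refine integral_congr_ae (Filter.Eventually.of_forall fun x => ?_)
  simp only [map_add, map_mul, map_div₀, map_one, Complex.real_smul, Complex.conj_ofReal]
  have : (starRingEnd ℂ) 2 = 2 := by exact_mod_cast Complex.conj_ofReal 2
  rw [this]
  ring

theorem eq_zero_of_orthogonal_range_aux {S : smoothFunctions K I →ₗ[ℂ] smoothFunctions K I}
    (hS : ∀ f g, inner ℂ (smoothToL2 I μ (S f)) (smoothToL2 I μ g) =
      -inner ℂ (smoothToL2 I μ f) (smoothToL2 I μ (S g)))
    {C C' : ℝ} (hC : 0 ≤ C) (hC' : 0 ≤ C')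
    (hcomm : ∀ k f, ‖smoothToL2 I μ (frameOp k (S f)) - smoothToL2 I μ (S (frameOp k f))‖ ≤
      C * (∑ k, ‖smoothToL2 I μ (frameOp k f)‖ + ‖smoothToL2 I μ f‖))
    (hbd : ∀ f, ‖smoothToL2 I μ (S f)‖ ≤
      C' * (∑ k, ‖smoothToL2 I μ (frameOp k f)‖ + ‖smoothToL2 I μ f‖))
    (hbd' : ∀ (ρ : K → ℝ) (hρ : ContMDiff I 𝓘(ℝ, ℝ) ∞ ρ), ∃ C, ∀ w : Lp ℂ 2 μ,
      ‖smoothToL2 I μ (S (mollify μ hρ w))‖ ≤ C * ‖w‖)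
    {ψ : Lp ℂ 2 μ} (hψ : ∀ f, inner ℂ ψ (smoothToL2 I μ (S f) + smoothToL2 I μ f) = 0) : ψ = 0 := by
  refine eq_zero_of_orthogonal_range_one (c := Fintype.card (Fin (Module.finrank ℝ E)) * C + 1) hS
    (le_add_of_nonneg_left (by positivity)) (fun ψ hψ => ?_) hψ
  refine eq_zero_of_orthogonal_range_large smoothToL2_injective denseRange_smoothToL2 frameOp hS
    hC hC' hcomm hbd (fun f ε hε => ?_) le_rfl hψ
  obtain ⟨ρ, hρ, h0, hs, hi, hlt⟩ := exists_mollify_close (I := I) (μ := μ) f hε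
  exact ⟨mollify μ hρ, ⟨norm_mollify_le hρ h0 hi, inner_mollify_symm hρ hs,
    fun k f => fieldOp_mollify_comm _ hρ f, mollify_bounded hρ, hbd' ρ hρ⟩, hlt⟩

/-- A smooth vector field `V` with divergence `d` on a compact Lie group: the ranges of
`V + ½ d + 1` and `V + ½ d - 1` on smooth functions are dense. -/
theorem eq_zero_of_orthogonal_range {V : ∀ x : K, TangentSpace I x} (hV : SmoothField I V)
    {d : K → ℝ} (hd : ContMDiff I 𝓘(ℝ, ℝ) ∞ d)
    (hdiv : ∀ f : K → ℂ, ContMDiff I 𝓘(ℝ, ℂ) ∞ f →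
      ∫ x, dirDeriv I V f x ∂μ = - ∫ x, d x • f x ∂μ) {ψ : Lp ℂ 2 μ}
    (hψ : (∀ f, inner ℂ ψ (smoothToL2 I μ (momentumOp hV hd f) + smoothToL2 I μ f) = 0) ∨
      ∀ f, inner ℂ ψ (smoothToL2 I μ (momentumOp hV hd f) - smoothToL2 I μ f) = 0) : ψ = 0 := by
  have hS := inner_momentumOp (μ := μ) hV hd hdiv
  obtain ⟨C, hC, hcomm⟩ := exists_norm_commutator_le μ hV hd
  obtain ⟨C', hC', hbd⟩ := exists_norm_fieldOp_le μ hV hd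
  have hbd' : ∀ (ρ : K → ℝ) (hρ : ContMDiff I 𝓘(ℝ, ℝ) ∞ ρ), ∃ C, ∀ w : Lp ℂ 2 μ,
      ‖smoothToL2 I μ (momentumOp hV hd (mollify μ hρ w))‖ ≤ C * ‖w‖ := by
    intro ρ hρ
    obtain ⟨C1, hC1⟩ := fieldOp_mollify_bounded (μ := μ) hV hρ
    obtain ⟨C2, hC2⟩ := mollify_bounded (μ := μ) hρ
    obtain ⟨C3, hC30, hC3⟩ := exists_norm_mulOp_le (μ := μ) hd
    refine ⟨C1 + ‖(1 / 2 : ℂ)‖ * (C3 * C2), fun w => ?_⟩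
    simp only [momentumOp, LinearMap.add_apply, LinearMap.smul_apply, map_add, map_smul]
    refine (norm_add_le _ _).trans ?_
    rw [add_mul, norm_smul, mul_assoc, mul_assoc]
    refine add_le_add (hC1 w) (mul_le_mul_of_nonneg_left ?_ (norm_nonneg _))
    exact (hC3 _).trans (mul_le_mul_of_nonneg_left (hC2 w) hC30)
  rcases hψ with hψ | hψ
  · exact eq_zero_of_orthogonal_range_aux hS hC hC' hcomm hbd hbd' hψ
  -- All hypotheses on the operator are insensitive to its sign.
  · refine eq_zero_of_orthogonal_range_aux (S := -momentumOp hV hd) ?_ hC hC' ?_ ?_ ?_ (ψ := ψ) ?_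
    · intro f g
      simp only [LinearMap.neg_apply, map_neg, inner_neg_left, inner_neg_right, hS]
    · intro k f
      simp only [LinearMap.neg_apply, map_neg]
      rw [← neg_sub', norm_neg]
      exact hcomm k f
    · intro f
      simp only [LinearMap.neg_apply, map_neg, norm_neg]
      exact hbd f
    · intro ρ hρ
      simp only [LinearMap.neg_apply, map_neg, norm_neg]
      exact hbd' ρ hρ
    · intro f
      have := hψ f
      rw [LinearMap.neg_apply, map_neg, neg_add_eq_sub, ← neg_sub, inner_neg_right, this, neg_zero]

end Mollification

end GenConn

end

noncomputable section

set_option linter.unusedSectionVars false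
set_option linter.unusedVariables false

namespace GenConn

/-! ### Analytic arcs and their parametrizations -/

section Arcs

open Filter Topology

variable {n : ℕ} {M : Type*} [TopologicalSpace M] [T2Space M]
  [ChartedSpace (EuclideanSpace ℝ (Fin n)) M] [IsManifold (𝓡 n) ω M] {c c' : ℝ → M} {a b : ℝ}

theorem IsAnalyticArc.continuousOn (hc : IsAnalyticArc n c) : ContinuousOn c (Icc 0 1) :=
  hc.1.continuousOn

theorem IsAnalyticArc.injOn (hc : IsAnalyticArc n c) : InjOn c (Icc 0 1) := hc.2.2

theorem affine_mem_Icc (ha : a ∈ Icc (0 : ℝ) 1) (hb : b ∈ Icc (0 : ℝ) 1) {t : ℝ}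
    (ht : t ∈ Icc (0 : ℝ) 1) : a + t * (b - a) ∈ Icc (0 : ℝ) 1 := by
  constructor <;> nlinarith [ha.1, ha.2, hb.1, hb.2, ht.1, ht.2,
    mul_nonneg ht.1 hb.1, mul_nonneg (sub_nonneg.2 ht.2) ha.1,
    mul_nonneg ht.1 (sub_nonneg.2 hb.2), mul_nonneg (sub_nonneg.2 ht.2) (sub_nonneg.2 ha.2)]

theorem affine_image_Icc (hab : a < b) : (fun t : ℝ => a + t * (b - a)) '' Icc 0 1 = Icc a b := by
  have hp : 0 < b - a := sub_pos.2 hab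
  ext x
  constructor
  · rintro ⟨t, ht, rfl⟩
    constructor <;> simp only <;> nlinarith [ht.1, ht.2]
  · intro hx
    refine ⟨(x - a) / (b - a), ⟨div_nonneg (by linarith [hx.1]) hp.le, ?_⟩, ?_⟩
    · rw [div_le_one hp]; linarith [hx.2]
    · field_simp; ring

/-- Only `a ≠ b` is asked for, so that `a = 1`, `b = 0` reverses the arc. -/
theorem IsAnalyticArc.comp_affine (hc : IsAnalyticArc n c) (ha : a ∈ Icc (0 : ℝ) 1)
    (hb : b ∈ Icc (0 : ℝ) 1) (hab : a ≠ b) : IsAnalyticArc n fun t => c (a + t * (b - a)) := by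
  have hm : MapsTo (fun t : ℝ => a + t * (b - a)) (Icc 0 1) (Icc 0 1) :=
    fun t ht => affine_mem_Icc ha hb ht
  have hba : b - a ≠ 0 := sub_ne_zero.2 hab.symm
  have hsm : ContDiff ℝ ω (fun t : ℝ => a + t * (b - a)) := by fun_prop
  refine ⟨hc.1.comp hsm.contMDiff.contMDiffOn hm, fun t ht h => hc.2.1 _ (hm ht) ?_, ?_⟩
  · have hu : UniqueMDiffWithinAt 𝓘(ℝ, ℝ) (Icc (0 : ℝ) 1) t :=
      (uniqueDiffOn_Icc zero_lt_one t ht).uniqueMDiffWithinAt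
    have h1 := mfderivWithin_comp (I := 𝓘(ℝ, ℝ)) (I' := 𝓘(ℝ, ℝ)) (I'' := 𝓡 n) t (g := c)
      (f := fun t : ℝ => a + t * (b - a)) (s := Icc 0 1) (u := Icc 0 1)
      ((hc.1 _ (hm ht)).mdifferentiableWithinAt (by simp))
      ((hsm.contMDiff t).mdifferentiableAt (by simp)).mdifferentiableWithinAt hm hu
    have h2 : mfderivWithin 𝓘(ℝ, ℝ) 𝓘(ℝ, ℝ) (fun t : ℝ => a + t * (b - a)) (Icc 0 1) t
        = (b - a) • ContinuousLinearMap.id ℝ ℝ := by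
      rw [mfderivWithin_eq_fderivWithin, fderivWithin_eq_fderiv
        (uniqueDiffOn_Icc zero_lt_one t ht) (by fun_prop)]
      ext
      simp
    rw [h2] at h1
    have h3 : (mfderivWithin 𝓘(ℝ, ℝ) (𝓡 n) c (Icc 0 1) (a + t * (b - a)) :
      ℝ →L[ℝ] EuclideanSpace ℝ (Fin n)).comp ((b - a) • ContinuousLinearMap.id ℝ ℝ) = 0 := h1.symm.trans h
    have h4 : ∀ L : ℝ →L[ℝ] EuclideanSpace ℝ (Fin n),
        L.comp ((b - a) • ContinuousLinearMap.id ℝ ℝ) = 0 → L = 0 := fun L hL => by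
      rw [ContinuousLinearMap.comp_smul, ContinuousLinearMap.comp_id] at hL
      exact (smul_eq_zero.1 hL).resolve_left hba
    exact h4 _ h3
  · intro s hs t ht hst
    have h1 := hc.injOn (hm hs) (hm ht) hst
    have : s * (b - a) = t * (b - a) := by simpa using h1
    exact mul_right_cancel₀ hba this

theorem IsAnalyticArc.isEdge (hc : IsAnalyticArc n c) : IsEdge n (c '' Icc 0 1) := ⟨c, hc, rfl⟩

theorem IsAnalyticArc.exists_subarc (hc : IsAnalyticArc n c) (ha : 0 ≤ a) (hab : a < b)
    (hb : b ≤ 1) : ∃ c' : ℝ → M, IsAnalyticArc n c' ∧ c' '' Icc 0 1 = c '' Icc a b ∧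
      c' 0 = c a ∧ c' 1 = c b ∧ c' '' Ioo 0 1 = c '' Ioo a b := by
  refine ⟨_, hc.comp_affine ⟨ha, hab.le.trans hb⟩ ⟨ha.trans hab.le, hb⟩ hab.ne, ?_, by simp,
    by simp, ?_⟩
  · rw [← affine_image_Icc hab, image_image]
  · have hp : 0 < b - a := sub_pos.2 hab
    ext x
    constructor
    · rintro ⟨t, ht, rfl⟩
      refine ⟨_, ⟨?_, ?_⟩, rfl⟩ <;> nlinarith [ht.1, ht.2]
    · rintro ⟨s, hs, rfl⟩
      refine ⟨(s - a) / (b - a), ⟨div_pos (by linarith [hs.1]) hp, ?_⟩, ?_⟩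
      · rw [div_lt_one hp]; linarith [hs.2]
      · simp only
        congr 1
        field_simp
        ring

theorem Icc_subset_unit (ha : 0 ≤ a) (hb : b ≤ 1) : Icc a b ⊆ Icc (0 : ℝ) 1 :=
  Icc_subset_Icc ha hb

theorem IsAnalyticArc.infinite (hc : IsAnalyticArc n c) (ha : 0 ≤ a) (hab : a < b)
    (hb : b ≤ 1) : (c '' Icc a b).Infinite :=
  (Icc_infinite hab).image (hc.injOn.mono (Icc_subset_unit ha hb))

theorem IsEdge.infinite {e : Set M} (he : IsEdge n e) : e.Infinite := by
  obtain ⟨c, hc, rfl⟩ := he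
  exact hc.infinite le_rfl zero_lt_one le_rfl

theorem IsEdge.isCompact {e : Set M} (he : IsEdge n e) : IsCompact e := by
  obtain ⟨c, hc, rfl⟩ := he
  exact isCompact_Icc.image_of_continuousOn hc.continuousOn

theorem IsEdge.isClosed {e : Set M} (he : IsEdge n e) : IsClosed e := he.isCompact.isClosed

/-- An injective parametrization of a compact arc is a topological embedding. -/
theorem continuousOn_of_comp_arc (hc : IsAnalyticArc n c) {X : Type*} [TopologicalSpace X] {s : Set X}
    {φ : X → ℝ} (hφ : ∀ x ∈ s, φ x ∈ Icc (0 : ℝ) 1) (h : ContinuousOn (fun x => c (φ x)) s) :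
    ContinuousOn φ s := by
  have he : Topology.IsClosedEmbedding ((Icc (0 : ℝ) 1).domRestrict c) :=
    (continuousOn_iff_continuous_domRestrict.1 hc.continuousOn).isClosedEmbedding
      (injOn_iff_injective.1 hc.injOn)
  rw [continuousOn_iff_continuous_domRestrict] at h ⊢
  have h1 : Continuous (fun x : s => (⟨φ x, hφ x x.2⟩ : Icc (0 : ℝ) 1)) :=
    he.isInducing.continuous_iff.2 h
  exact continuous_subtype_val.comp h1

/-- The change of parameter is continuous and injective on an interval, hence strictly monotone, so
its image is an interval with the images of `0` and `1` as end points. -/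
theorem edge_in_arc (hc : IsAnalyticArc n c) (hc' : IsAnalyticArc n c')
    (h : c' '' Icc 0 1 ⊆ c '' Icc 0 1) : ∃ a b, 0 ≤ a ∧ a < b ∧ b ≤ 1 ∧
      c' '' Icc 0 1 = c '' Icc a b ∧ ({c' 0, c' 1} : Set M) = {c a, c b} := by
  have h1 : ∀ t, ∃ s, t ∈ Icc (0 : ℝ) 1 → s ∈ Icc (0 : ℝ) 1 ∧ c s = c' t := by
    intro t
    by_cases ht : t ∈ Icc (0 : ℝ) 1
    · obtain ⟨s, hs, hst⟩ := h ⟨t, ht, rfl⟩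
      exact ⟨s, fun _ => ⟨hs, hst⟩⟩
    · exact ⟨0, fun h => absurd h ht⟩
  choose φ hφ using h1
  have hcont : ContinuousOn φ (Icc 0 1) := continuousOn_of_comp_arc hc (fun t ht => (hφ t ht).1)
    (hc'.continuousOn.congr fun t ht => (hφ t ht).2)
  have hinj : InjOn φ (Icc 0 1) := fun s hs t ht hst => hc'.injOn hs ht (by
    rw [← (hφ s hs).2, ← (hφ t ht).2, hst])
  have h0 : (0 : ℝ) ∈ Icc (0 : ℝ) 1 := by simp
  have h1 : (1 : ℝ) ∈ Icc (0 : ℝ) 1 := by simp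
  have himg : c' '' Icc 0 1 = c '' (φ '' Icc 0 1) := by
    rw [image_image]
    exact image_congr fun t ht => ((hφ t ht).2).symm
  rcases hcont.strictMonoOn_of_injOn_Icc' zero_le_one hinj with hm | hm
  · refine ⟨φ 0, φ 1, (hφ 0 h0).1.1, hm h0 h1 zero_lt_one, (hφ 1 h1).1.2, ?_, ?_⟩
    · rw [himg]
      congr 1
      refine Subset.antisymm ?_ (intermediate_value_Icc zero_le_one hcont)
      rintro _ ⟨t, ht, rfl⟩
      exact ⟨hm.monotoneOn h0 ht ht.1, hm.monotoneOn ht h1 ht.2⟩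
    · rw [(hφ 0 h0).2, (hφ 1 h1).2]
  · refine ⟨φ 1, φ 0, (hφ 1 h1).1.1, hm h0 h1 zero_lt_one, (hφ 0 h0).1.2, ?_, ?_⟩
    · rw [himg]
      congr 1
      refine Subset.antisymm ?_ (intermediate_value_Icc' zero_le_one hcont)
      rintro _ ⟨t, ht, rfl⟩
      exact ⟨hm.antitoneOn ht h1 ht.2, hm.antitoneOn h0 ht ht.1⟩
    · rw [(hφ 0 h0).2, (hφ 1 h1).2, pair_comm]

/-- Independence of the parametrization: by `edge_in_arc` a second one has its ends at the ends of a
parameter interval with the same image, which injectivity forces to be all of `[0,1]`. -/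
theorem IsAnalyticArc.endpoints_eq (hc : IsAnalyticArc n c) :
    endpoints n (c '' Icc 0 1) = {c 0, c 1} := by
  ext v
  constructor
  · rintro ⟨c', hc', h, hv⟩
    obtain ⟨a, b, ha, hab, hb, him, hend⟩ := edge_in_arc hc hc' h.le
    have hv' : v ∈ ({c' 0, c' 1} : Set M) := by simpa using hv
    have heq : Icc a b = Icc 0 1 := by
      have h3 := him.symm.trans h
      exact (hc.injOn.image_eq_image_iff (Icc_subset_unit ha hb) Subset.rfl).1 h3
    have h0 : a = 0 := by
      have : (0 : ℝ) ∈ Icc a b := by rw [heq]; simp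
      exact le_antisymm this.1 ha
    have h1 : b = 1 := by
      have : (1 : ℝ) ∈ Icc a b := by rw [heq]; simp
      exact le_antisymm hb this.2
    rwa [hend, h0, h1] at hv'
  · intro hv
    exact ⟨c, hc, rfl, by simpa using hv⟩

theorem IsAnalyticArc.endpoints_image_Icc (hc : IsAnalyticArc n c) (ha : 0 ≤ a) (hab : a < b)
    (hb : b ≤ 1) : endpoints n (c '' Icc a b) = {c a, c b} := by
  obtain ⟨c', hc', h, h0, h1, -⟩ := hc.exists_subarc ha hab hb
  rw [← h, hc'.endpoints_eq, h0, h1]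

theorem IsAnalyticArc.isEdge_image_Icc (hc : IsAnalyticArc n c) (ha : 0 ≤ a) (hab : a < b)
    (hb : b ≤ 1) : IsEdge n (c '' Icc a b) := by
  obtain ⟨c', hc', h, -⟩ := hc.exists_subarc ha hab hb
  exact ⟨c', hc', h⟩

theorem IsEdge.exists_Icc_of_subset {e : Set M} (he : IsEdge n e) (hc : IsAnalyticArc n c)
    (h : e ⊆ c '' Icc 0 1) : ∃ a b, 0 ≤ a ∧ a < b ∧ b ≤ 1 ∧ e = c '' Icc a b ∧
      endpoints n e = {c a, c b} := by
  obtain ⟨c', hc', rfl⟩ := he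
  obtain ⟨a, b, ha, hab, hb, h1, h2⟩ := edge_in_arc hc hc' h
  exact ⟨a, b, ha, hab, hb, h1, by rw [hc'.endpoints_eq, h2]⟩

theorem endpoints_subset (e : Set M) : endpoints n e ⊆ e := by
  rintro v ⟨c, hc, rfl, rfl | rfl⟩
  · exact ⟨0, by simp, rfl⟩
  · exact ⟨1, by simp, rfl⟩

theorem finite_endpoints {e : Set M} (he : IsEdge n e) : (endpoints n e).Finite := by
  obtain ⟨c, hc, rfl⟩ := he
  rw [hc.endpoints_eq]
  exact toFinite _

/-! ### Intersections of analytic arcs -/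

/-- Unless it vanishes near `t₀`, the function is a power of `t - t₀` times a factor of constant
sign near `t₀`. -/
theorem eventually_nonneg_or_not_nonneg {f : ℝ → ℝ} {t₀ : ℝ} (hf : AnalyticAt ℝ f t₀) :
    (∀ᶠ t in 𝓝[>] t₀, 0 ≤ f t) ∨ ∀ᶠ t in 𝓝[>] t₀, ¬ 0 ≤ f t := by
  by_cases h : ∀ᶠ z in 𝓝 t₀, f z = 0
  · left
    filter_upwards [nhdsWithin_le_nhds h] with t ht
    exact ht.ge
  · obtain ⟨m, g, hg, hg0, hev⟩ := hf.exists_eventuallyEq_pow_smul_nonzero_iff.2 h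
    rcases lt_or_gt_of_ne hg0 with hneg | hpos
    · right
      filter_upwards [nhdsWithin_le_nhds hev, nhdsWithin_le_nhds
        (hg.continuousAt.eventually_lt continuousAt_const hneg), self_mem_nhdsWithin] with t h1 h2 h3
      rw [h1, not_le]
      exact mul_neg_of_pos_of_neg (pow_pos (sub_pos.2 h3) _) h2
    · left
      filter_upwards [nhdsWithin_le_nhds hev, nhdsWithin_le_nhds
        (continuousAt_const.eventually_lt hg.continuousAt hpos), self_mem_nhdsWithin] with t h1 h2 h3
      rw [h1]
      exact (mul_pos (pow_pos (sub_pos.2 h3) _) h2).le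

theorem eventually_or_not_of_analytic {E : Type*} [NormedAddCommGroup E] [NormedSpace ℝ E]
    {D : ℝ → E} {κ : ℝ → ℝ} {t₀ : ℝ} (hD : AnalyticAt ℝ D t₀) (hκ : AnalyticAt ℝ κ t₀) :
    (∀ᶠ t in 𝓝[>] t₀, D t = 0 ∧ κ t ∈ Icc (0 : ℝ) 1) ∨
      ∀ᶠ t in 𝓝[>] t₀, ¬ (D t = 0 ∧ κ t ∈ Icc (0 : ℝ) 1) := by
  rcases hD.eventually_eq_zero_or_eventually_ne_zero with h1 | h1
  · rcases eventually_nonneg_or_not_nonneg hκ with h2 | h2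
    · rcases eventually_nonneg_or_not_nonneg ((analyticAt_const (v := (1 : ℝ))).sub hκ) with h3 | h3
      · left
        filter_upwards [nhdsWithin_le_nhds h1, h2, h3] with t h1 h2 h3
        exact ⟨h1, h2, sub_nonneg.1 h3⟩
      · right
        filter_upwards [h3] with t h3 h
        exact h3 (sub_nonneg.2 h.2.2)
    · right
      filter_upwards [h2] with t h2 h
      exact h2 h.2.1
  · right
    filter_upwards [nhdsWithin_mono t₀ (fun t (ht : t₀ < t) => ht.ne') h1] with t h1 h
    exact h1 h.1

/-- An analytic arc in a chart, extended to an analytic map near the given parameter value. -/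
theorem IsAnalyticArc.exists_analytic_extension (hc : IsAnalyticArc n c) {t₀ : ℝ}
    (ht₀ : t₀ ∈ Icc (0 : ℝ) 1) : ∃ U : ℝ → EuclideanSpace ℝ (Fin n), AnalyticAt ℝ U t₀ ∧
      (∀ᶠ t in 𝓝[Icc 0 1] t₀, extChartAt (𝓡 n) (c t₀) (c t) = U t) ∧ fderiv ℝ U t₀ ≠ 0 := by
  have h1 : ContDiffWithinAt ℝ ω (fun t => extChartAt (𝓡 n) (c t₀) (c t)) (Icc 0 1) t₀ := by
    have := (contMDiffWithinAt_iff.1 (hc.1 t₀ ht₀)).2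
    simp only [extChartAt_model_space_eq_id, modelWithCornersSelf_coe, range_id, inter_univ] at this
    exact this
  have h2 := (contDiffWithinAt_omega_iff_analyticWithinAt.1 h1)
  obtain ⟨U, hU, hUa⟩ := analyticWithinAt_iff_exists_analyticAt.1 h2
  rw [insert_eq_of_mem ht₀] at hU
  refine ⟨U, hUa, hU, fun h0 => hc.2.1 t₀ ht₀ ?_⟩
  have h3 : MDifferentiableWithinAt 𝓘(ℝ, ℝ) (𝓡 n) c (Icc 0 1) t₀ :=
    (hc.1 t₀ ht₀).mdifferentiableWithinAt (by simp)
  have h4 : fderivWithin ℝ (fun t => extChartAt (𝓡 n) (c t₀) (c t)) (Icc 0 1) t₀ = 0 := by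
    rw [Filter.EventuallyEq.fderivWithin_eq hU (hU.self_of_nhdsWithin ht₀),
      fderivWithin_eq_fderiv (uniqueDiffOn_Icc zero_lt_one t₀ ht₀) hUa.differentiableAt, h0]
  have h5 : fderivWithin ℝ (fun t => extChartAt (𝓡 n) (c t₀) (c t))
      (Icc 0 1 ∩ range (𝓘(ℝ, ℝ))) t₀ = 0 := by
    simpa only [modelWithCornersSelf_coe, range_id, inter_univ] using h4
  unfold mfderivWithin
  exact (if_pos h3).trans h5

/-- In a chart, `U` and `W` extend the two arcs analytically. The functional `lam` has an analytic
local inverse `k` along `W`, so the point `U t` can only lie on the second arc at the parameter `k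
(lam (U t))`. It does so exactly if an analytic function vanishes and this parameter is in `[0,1]`,
and to the right of `t₀` such conditions eventually hold or eventually fail. -/
theorem eventually_mem_or_not_mem (hc : IsAnalyticArc n c) (hc' : IsAnalyticArc n c') {t₀ : ℝ}
    (ht₀ : t₀ ∈ Ico (0 : ℝ) 1) :
    (∀ᶠ t in 𝓝[>] t₀, c t ∈ c' '' Icc 0 1) ∨ ∀ᶠ t in 𝓝[>] t₀, c t ∉ c' '' Icc 0 1 := by
  have ht₀' : t₀ ∈ Icc (0 : ℝ) 1 := Ico_subset_Icc_self ht₀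
  have hle : 𝓝[>] t₀ ≤ 𝓝[Icc 0 1] t₀ := by
    rw [← nhdsWithin_Ioo_eq_nhdsGT ht₀.2]
    exact nhdsWithin_mono _ fun t ht => ⟨ht₀.1.trans ht.1.le, ht.2.le⟩
  have htend : Tendsto c (𝓝[>] t₀) (𝓝 (c t₀)) := (hc.continuousOn t₀ ht₀').mono_left hle
  by_cases hmem : c t₀ ∈ c' '' Icc 0 1
  swap
  · right
    exact htend.eventually (hc'.isEdge.isClosed.isOpen_compl.mem_nhds hmem)
  obtain ⟨s₀, hs₀, hs⟩ := hmem
  obtain ⟨U, hU, hUc, -⟩ := hc.exists_analytic_extension ht₀'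
  obtain ⟨W, hW, hWc, hWd⟩ := hc'.exists_analytic_extension hs₀
  rw [hs] at hWc
  set χ := extChartAt (𝓡 n) (c t₀) with hχ
  -- a linear functional which is a local coordinate on the second arc
  have hw : fderiv ℝ W s₀ 1 ≠ 0 := fun h => hWd (by ext1; simpa using h)
  set w := fderiv ℝ W s₀ 1 with hwdef
  let lam : EuclideanSpace ℝ (Fin n) →L[ℝ] ℝ := (‖w‖ ^ 2)⁻¹ • innerSL ℝ w
  have hlam : lam w = 1 := by
    simp only [lam, _root_.smul_apply, innerSL_apply_apply, real_inner_self_eq_norm_sq, smul_eq_mul]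
    exact inv_mul_cancel₀ (pow_ne_zero 2 (norm_ne_zero_iff.2 hw))
  have hh : AnalyticAt ℝ (fun s => lam (W s)) s₀ := (lam.analyticAt _).comp hW
  have hhd : HasFDerivAt (fun s => lam (W s))
      ((ContinuousLinearEquiv.refl ℝ ℝ : ℝ ≃L[ℝ] ℝ) : ℝ →L[ℝ] ℝ) s₀ := by
    have h1 := lam.hasFDerivAt.comp s₀ hW.differentiableAt.hasFDerivAt
    convert! h1 using 1
    ext
    simp [← hwdef, hlam]
  have hhc : ContDiffAt ℝ ω (fun s => lam (W s)) s₀ := hh.contDiffAt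
  set k := hhc.localInverse hhd (by simp) with hk
  have hka : AnalyticAt ℝ k (lam (W s₀)) :=
    (hhc.to_localInverse hhd (by simp)).analyticAt
  have hkl : ∀ᶠ s in 𝓝 s₀, k (lam (W s)) = s :=
    (hhc.hasStrictFDerivAt' hhd (by simp)).eventually_left_inverse
  have hUW : U t₀ = W s₀ := by
    rw [← hUc.self_of_nhdsWithin ht₀', ← hWc.self_of_nhdsWithin hs₀, hs]
  have hk0 : k (lam (W s₀)) = s₀ := hkl.self_of_nhds
  have hκ : AnalyticAt ℝ (fun t => k (lam (U t))) t₀ := by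
    have h1 : AnalyticAt ℝ (fun t => lam (U t)) t₀ := (lam.analyticAt _).comp hU
    refine AnalyticAt.fun_comp (f := fun t => lam (U t)) (g := k) ?_ h1
    rw [hUW]; exact hka
  have hD : AnalyticAt ℝ (fun t => U t - W (k (lam (U t)))) t₀ := by
    refine hU.sub (AnalyticAt.fun_comp (f := fun t => k (lam (U t))) (g := W) ?_ hκ)
    rw [hUW, hk0]; exact hW
  -- near `t₀` the arc lies in `c'` iff these functions satisfy the conditions
  have hWs : ∃ N ∈ 𝓝 s₀, ∀ s ∈ N, s ∈ Icc (0 : ℝ) 1 →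
      c' s ∈ χ.source ∧ χ (c' s) = W s ∧ k (lam (W s)) = s := by
    have h2 : ∀ᶠ s in 𝓝[Icc 0 1] s₀, c' s ∈ χ.source := by
      have := hc'.continuousOn s₀ hs₀
      refine this.eventually ?_
      rw [hs]
      exact extChartAt_source_mem_nhds (c t₀)
    have h3 := h2.and (hWc.and (nhdsWithin_le_nhds hkl))
    rw [eventually_nhdsWithin_iff] at h3
    exact ⟨_, h3, fun s hs hs' => hs hs'⟩
  obtain ⟨N, hN, hNs⟩ := hWs
  -- points of `c'` near `c t₀` have parameter near `s₀`
  have hfar : ∀ᶠ x in 𝓝 (c t₀), x ∉ c' '' (Icc 0 1 \ interior N) := by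
    have hcl : IsClosed (c' '' (Icc 0 1 \ interior N)) :=
      ((isCompact_Icc.diff isOpen_interior).image_of_continuousOn
        (hc'.continuousOn.mono sdiff_subset)).isClosed
    refine hcl.isOpen_compl.mem_nhds ?_
    rintro ⟨s, ⟨hs1, hs2⟩, hs3⟩
    exact hs2 (by
      rw [hc'.injOn hs1 hs₀ (hs3.trans hs.symm)]
      exact mem_interior_iff_mem_nhds.2 hN)
  have hsrc : ∀ᶠ x in 𝓝 (c t₀), x ∈ χ.source := extChartAt_source_mem_nhds (c t₀)
  have hκN : ∀ᶠ t in 𝓝 t₀, k (lam (U t)) ∈ N := by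
    refine hκ.continuousAt.eventually_mem ?_
    rw [hUW, hk0]; exact hN
  have hiff : ∀ᶠ t in 𝓝[>] t₀, (c t ∈ c' '' Icc 0 1 ↔
      U t - W (k (lam (U t))) = 0 ∧ k (lam (U t)) ∈ Icc (0 : ℝ) 1) := by
    filter_upwards [hle hUc, htend.eventually hfar, htend.eventually hsrc,
      nhdsWithin_le_nhds hκN] with t h1 h2 h3 h4
    constructor
    · rintro ⟨s, hs1, hs2⟩
      have hsN : s ∈ N := by
        by_contra h
        exact h2 ⟨s, ⟨hs1, fun h' => h (interior_subset h')⟩, hs2⟩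
      obtain ⟨-, h6, h7⟩ := hNs s hsN hs1
      have h8 : U t = W s := by rw [← h1, ← hs2, h6]
      rw [h8, h7, sub_self]
      exact ⟨rfl, hs1⟩
    · rintro ⟨h5, h6⟩
      obtain ⟨h7, h8, -⟩ := hNs _ h4 h6
      refine ⟨_, h6, χ.injOn h7 h3 ?_⟩
      rw [h8, h1]
      exact (sub_eq_zero.1 h5).symm
  rcases eventually_or_not_of_analytic hD hκ with h | h
  · left
    filter_upwards [hiff, h] with t h1 h2
    exact h1.2 h2
  · right
    filter_upwards [hiff, h] with t h1 h2
    exact fun h3 => h2 (h1.1 h3)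

theorem eventually_mem_or_not_mem_left (hc : IsAnalyticArc n c) (hc' : IsAnalyticArc n c') {t₀ : ℝ}
    (ht₀ : t₀ ∈ Ioc (0 : ℝ) 1) :
    (∀ᶠ t in 𝓝[<] t₀, c t ∈ c' '' Icc 0 1) ∨ ∀ᶠ t in 𝓝[<] t₀, c t ∉ c' '' Icc 0 1 := by
  have hr := hc.comp_affine (a := 1) (b := 0) (by simp) (by simp) one_ne_zero
  have h1 := eventually_mem_or_not_mem hr hc' (t₀ := 1 - t₀) ⟨by linarith [ht₀.2], by linarith [ht₀.1]⟩
  have hm : Tendsto (fun t : ℝ => 1 - t) (𝓝[<] t₀) (𝓝[>] (1 - t₀)) := by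
    refine tendsto_nhdsWithin_iff.2 ⟨?_, ?_⟩
    · exact ((continuous_const.sub continuous_id).tendsto t₀).mono_left nhdsWithin_le_nhds
    · filter_upwards [self_mem_nhdsWithin] with t ht
      simpa using ht
  refine h1.imp (fun h => ?_) (fun h => ?_)
  · filter_upwards [hm.eventually h] with t ht
    simpa using ht
  · filter_upwards [hm.eventually h] with t ht
    simpa using ht

/-- The set of parameters at which an analytic arc meets another one has a finite frontier. -/
theorem finite_frontier_arc (hc : IsAnalyticArc n c) (hc' : IsAnalyticArc n c') :
    (frontier {t : ℝ | t ∈ Icc (0 : ℝ) 1 ∧ c t ∈ c' '' Icc 0 1}).Finite := by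
  set A := {t : ℝ | t ∈ Icc (0 : ℝ) 1 ∧ c t ∈ c' '' Icc 0 1} with hA
  have hsub : frontier A ⊆ Icc 0 1 :=
    frontier_subset_closure.trans (closure_minimal (fun t ht => ht.1) isClosed_Icc)
  by_contra hinf
  -- On either side of an accumulation point membership is eventually constant, and where it is
  -- locally constant there are no frontier points.
  obtain ⟨t₀, ht₀, hacc⟩ := Set.Infinite.exists_accPt_of_subset_isCompact hinf isCompact_Icc hsub
  have key : ∀ l : Filter ℝ, (∀ᶠ t in l, t ∈ A) ∨ (∀ᶠ t in l, t ∉ A) →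
      (∀ {p : ℝ → Prop}, (∀ᶠ t in l, p t) → ∀ᶠ t in l, ∀ᶠ s in 𝓝 t, p s) →
      ∀ᶠ t in l, t ∉ frontier A := by
    rintro l (h | h) hl
    · filter_upwards [hl h] with t ht hf
      exact hf.2 (mem_interior_iff_mem_nhds.2 ht)
    · filter_upwards [hl h] with t ht hf
      have h2 : t ∈ interior Aᶜ := mem_interior_iff_mem_nhds.2 ht
      rw [interior_compl] at h2
      exact h2 hf.1
  have hgt : ∀ᶠ t in 𝓝[>] t₀, t ∉ frontier A := by
    refine key _ ?_ fun {p} hp => eventually_eventually_nhdsWithin.2 hp |>.mp ?_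
    · rcases lt_or_eq_of_le ht₀.2 with h1 | h1
      · have hI : ∀ᶠ t in 𝓝[>] t₀, t ∈ Icc (0 : ℝ) 1 := by
          rw [← nhdsWithin_Ioo_eq_nhdsGT h1]
          filter_upwards [self_mem_nhdsWithin] with t ht
          exact ⟨ht₀.1.trans ht.1.le, ht.2.le⟩
        refine (eventually_mem_or_not_mem hc hc' ⟨ht₀.1, h1⟩).imp (fun h => ?_) fun h => ?_
        · filter_upwards [h, hI] with t h1 h2
          exact ⟨h2, h1⟩
        · filter_upwards [h] with t h1 h2
          exact h1 h2.2
      · right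
        filter_upwards [self_mem_nhdsWithin] with t ht h
        exact absurd h.1.2 (not_le.2 (h1 ▸ ht))
    · filter_upwards [self_mem_nhdsWithin] with t ht h
      rwa [isOpen_Ioi.nhdsWithin_eq ht] at h
  have hlt : ∀ᶠ t in 𝓝[<] t₀, t ∉ frontier A := by
    refine key _ ?_ fun {p} hp => eventually_eventually_nhdsWithin.2 hp |>.mp ?_
    · rcases lt_or_eq_of_le ht₀.1 with h1 | h1
      · have hI : ∀ᶠ t in 𝓝[<] t₀, t ∈ Icc (0 : ℝ) 1 := by
          rw [← nhdsWithin_Ioo_eq_nhdsLT h1]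
          filter_upwards [self_mem_nhdsWithin] with t ht
          exact ⟨ht.1.le, ht.2.le.trans ht₀.2⟩
        refine (eventually_mem_or_not_mem_left hc hc' ⟨h1, ht₀.2⟩).imp (fun h => ?_) fun h => ?_
        · filter_upwards [h, hI] with t h1 h2
          exact ⟨h2, h1⟩
        · filter_upwards [h] with t h1 h2
          exact h1 h2.2
      · right
        filter_upwards [self_mem_nhdsWithin] with t ht h
        exact absurd h.1.1 (not_le.2 (h1 ▸ ht))
    · filter_upwards [self_mem_nhdsWithin] with t ht h
      rwa [isOpen_Iio.nhdsWithin_eq ht] at h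
  have hne : ∀ᶠ t in 𝓝[≠] t₀, t ∉ frontier A := by
    rw [← Iio_union_Ioi, nhdsWithin_union]
    exact Filter.eventually_sup.2 ⟨hlt, hgt⟩
  rw [accPt_iff_frequently_nhdsNE] at hacc
  exact hacc (hne.mono fun t ht h => ht h)

end Arcs

end GenConn

end

noncomputable section

set_option linter.unusedSectionVars false
set_option linter.unusedVariables false

namespace GenConn

/-! ### Cutting finitely many edges into the edges of a graph -/

section Pieces

open Filter Topology

variable {n : ℕ} {M : Type*} [TopologicalSpace M] [T2Space M]
  [ChartedSpace (EuclideanSpace ℝ (Fin n)) M] [IsManifold (𝓡 n) ω M] {c c' : ℝ → M} {a b : ℝ}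

theorem exists_gap_right {T : Set ℝ} (hT : T.Finite) (h0 : (0 : ℝ) ∈ T) (h1 : (1 : ℝ) ∈ T) {t : ℝ}
    (ht : t ∈ Ico (0 : ℝ) 1) : ∃ a ∈ T, ∃ b ∈ T, 0 ≤ a ∧ a ≤ t ∧ t < b ∧ b ≤ 1 ∧
      (∀ s ∈ Ioo a b, s ∉ T) ∧ (t ∈ T → a = t) := by
  obtain ⟨b, hb, hbm⟩ := (hT.inter_of_left (Ioi t)).exists_minimal ⟨1, h1, ht.2⟩
  obtain ⟨a, ha, ham⟩ := (hT.inter_of_left (Iic t)).exists_maximal ⟨0, h0, ht.1⟩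
  refine ⟨a, ha.1, b, hb.1, ?_, ha.2, hb.2, ?_, fun s hs hsT => ?_, fun htT => ?_⟩
  · by_contra h
    exact h (ham ⟨h0, ht.1⟩ (not_le.1 h).le)
  · by_contra h
    exact h (hbm ⟨h1, ht.2⟩ (not_le.1 h).le)
  · rcases le_or_gt s t with h | h
    · exact absurd (ham ⟨hsT, h⟩ hs.1.le) (not_le.2 hs.1)
    · exact absurd (hbm ⟨hsT, h⟩ hs.2.le) (not_le.2 hs.2)
  · exact le_antisymm ha.2 (ham ⟨htT, le_refl t⟩ ha.2)

theorem exists_gap_left {T : Set ℝ} (hT : T.Finite) (h0 : (0 : ℝ) ∈ T) (h1 : (1 : ℝ) ∈ T) {t : ℝ}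
    (ht : t ∈ Ioc (0 : ℝ) 1) : ∃ a ∈ T, ∃ b ∈ T, 0 ≤ a ∧ a < t ∧ t ≤ b ∧ b ≤ 1 ∧
      (∀ s ∈ Ioo a b, s ∉ T) ∧ (t ∈ T → b = t) := by
  obtain ⟨b, hb, hbm⟩ := (hT.inter_of_left (Ici t)).exists_minimal ⟨1, h1, ht.2⟩
  obtain ⟨a, ha, ham⟩ := (hT.inter_of_left (Iio t)).exists_maximal ⟨0, h0, ht.1⟩
  refine ⟨a, ha.1, b, hb.1, ?_, ha.2, hb.2, ?_, fun s hs hsT => ?_, fun htT => ?_⟩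
  · by_contra h
    exact h (ham ⟨h0, ht.1⟩ (not_le.1 h).le)
  · by_contra h
    exact h (hbm ⟨h1, ht.2⟩ (not_le.1 h).le)
  · rcases lt_or_ge s t with h | h
    · exact absurd (ham ⟨hsT, h⟩ hs.1.le) (not_le.2 hs.1)
    · exact absurd (hbm ⟨hsT, h⟩ hs.2.le) (not_le.2 hs.2)
  · exact le_antisymm (hbm ⟨htT, le_refl t⟩ hb.2) hb.2

/-- An edge which meets the set `V` exactly in its end points. -/
def IsPiece (n : ℕ) {M : Type*} [TopologicalSpace M] [ChartedSpace (EuclideanSpace ℝ (Fin n)) M]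
    (V p : Set M) : Prop :=
  IsEdge n p ∧ p ∩ V = endpoints n p

theorem isPiece_of_gap (hc : IsAnalyticArc n c) {V : Set M} (ha : 0 ≤ a) (hab : a < b) (hb : b ≤ 1)
    (hVa : c a ∈ V) (hVb : c b ∈ V) (h : ∀ t ∈ Ioo a b, c t ∉ V) : IsPiece n V (c '' Icc a b) := by
  refine ⟨hc.isEdge_image_Icc ha hab hb, ?_⟩
  rw [hc.endpoints_image_Icc ha hab hb]
  ext x
  constructor
  · rintro ⟨⟨t, ht, rfl⟩, hx⟩
    rcases eq_or_lt_of_le ht.1 with h1 | h1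
    · left; rw [h1]
    rcases eq_or_lt_of_le ht.2 with h2 | h2
    · right; rw [mem_singleton_iff, h2]
    exact absurd hx (h t ⟨h1, h2⟩)
  · rintro (rfl | rfl)
    · exact ⟨⟨a, ⟨le_rfl, hab.le⟩, rfl⟩, hVa⟩
    · exact ⟨⟨b, ⟨hab.le, le_rfl⟩, rfl⟩, hVb⟩

theorem IsPiece.exists_Icc {V p : Set M} (hp : IsPiece n V p) (hc : IsAnalyticArc n c)
    (h : p ⊆ c '' Icc 0 1) : ∃ a b, 0 ≤ a ∧ a < b ∧ b ≤ 1 ∧ p = c '' Icc a b ∧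
      endpoints n p = {c a, c b} ∧ c a ∈ V ∧ c b ∈ V ∧ ∀ t ∈ Ioo a b, c t ∉ V := by
  obtain ⟨a, b, ha, hab, hb, h1, h2⟩ := hp.1.exists_Icc_of_subset hc h
  have h3 := hp.2
  rw [h2] at h3
  refine ⟨a, b, ha, hab, hb, h1, h2, ?_, ?_, fun t ht htV => ?_⟩
  · exact ((h3.symm ▸ (by simp : c a ∈ ({c a, c b} : Set M))) : c a ∈ p ∩ V).2
  · exact ((h3.symm ▸ (by simp : c b ∈ ({c a, c b} : Set M))) : c b ∈ p ∩ V).2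
  · have h4 : c t ∈ p ∩ V := ⟨by rw [h1]; exact ⟨t, Ioo_subset_Icc_self ht, rfl⟩, htV⟩
    rw [h3] at h4
    have hI := Icc_subset_unit ha hb
    have htI : t ∈ Icc (0 : ℝ) 1 := hI (Ioo_subset_Icc_self ht)
    rcases h4 with h4 | h4
    · exact ht.1.ne' (hc.injOn htI (hI ⟨le_rfl, hab.le⟩) h4)
    · exact ht.2.ne (hc.injOn htI (hI ⟨hab.le, le_rfl⟩) h4)

/-- A piece which meets the interior of another one contains it. -/
theorem image_subset_of_meets (hc : IsAnalyticArc n c) (hc' : IsAnalyticArc n c') {V : Set M}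
    {a' b' : ℝ} (ha : 0 ≤ a) (hab : a < b) (hb : b ≤ 1) (ha' : 0 ≤ a') (hb' : b' ≤ 1)
    (hVa' : c' a' ∈ V) (hVb' : c' b' ∈ V) (h : ∀ t ∈ Ioo a b, c t ∉ V)
    (hF : ∀ t ∈ frontier {t : ℝ | t ∈ Icc (0 : ℝ) 1 ∧ c t ∈ c' '' Icc 0 1}, c t ∈ V)
    {t : ℝ} (ht : t ∈ Ioo a b) (hct : c t ∈ c' '' Icc a' b') :
    c '' Icc a b ⊆ c' '' Icc a' b' := by
  -- The gap contains no frontier point and meets the set, so by connectedness it lies in it.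
  have hsub : Ioo a b ⊆ {t : ℝ | t ∈ Icc (0 : ℝ) 1 ∧ c t ∈ c' '' Icc 0 1} := by
    set A := {t : ℝ | t ∈ Icc (0 : ℝ) 1 ∧ c t ∈ c' '' Icc 0 1}
    have hnf : ∀ r ∈ Ioo a b, r ∉ frontier A := fun r hr hrA => h r hr (hF r hrA)
    have htA : t ∈ A := ⟨Icc_subset_unit ha hb (Ioo_subset_Icc_self ht),
        image_mono (Icc_subset_unit ha' hb') hct⟩
    refine (isPreconnected_Ioo.subset_left_of_subset_union isOpen_interior
      isClosed_closure.isOpen_compl (disjoint_compl_right.mono_left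
        (interior_subset.trans subset_closure)) (fun r hr => ?_) ⟨t, ht, ?_⟩).trans interior_subset
    · by_cases hrc : r ∈ closure A
      · exact Or.inl (by_contra fun hri => hnf r hr ⟨hrc, hri⟩)
      · exact Or.inr hrc
    · exact by_contra fun hri => hnf t ht ⟨subset_closure htA, hri⟩
  have h1 : ∀ s, ∃ r, s ∈ Ioo a b → r ∈ Icc (0 : ℝ) 1 ∧ c' r = c s := by
    intro s
    by_cases hs : s ∈ Ioo a b
    · obtain ⟨r, hr, hrs⟩ := (hsub hs).2
      exact ⟨r, fun _ => ⟨hr, hrs⟩⟩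
    · exact ⟨0, fun h => absurd h hs⟩
  choose φ hφ using h1
  have hIoo : Ioo a b ⊆ Icc 0 1 := Ioo_subset_Icc_self.trans (Icc_subset_unit ha hb)
  have hcont : ContinuousOn φ (Ioo a b) := continuousOn_of_comp_arc hc' (fun s hs => (hφ s hs).1)
    ((hc.continuousOn.mono hIoo).congr fun s hs => (hφ s hs).2)
  -- The change of parameter `φ` maps the gap to an interval that avoids `a'` and `b'`, because
  -- these parameters belong to points of `V`; having one point between them, it stays between them.
  have hord := (isPreconnected_Ioo.image φ hcont).ordConnected
  have hna : ∀ s ∈ Ioo a b, φ s ≠ a' := fun s hs hsa => h s hs (by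
    rw [← (hφ s hs).2, hsa]; exact hVa')
  have hnb : ∀ s ∈ Ioo a b, φ s ≠ b' := fun s hs hsb => h s hs (by
    rw [← (hφ s hs).2, hsb]; exact hVb')
  have hφt : φ t ∈ Icc a' b' := by
    obtain ⟨r, hr, hrt⟩ := hct
    rwa [hc'.injOn (hφ t ht).1 (Icc_subset_unit ha' hb' hr) ((hφ t ht).2.trans hrt.symm)]
  have hsub' : c '' Ioo a b ⊆ c' '' Icc a' b' := by
    rintro _ ⟨s, hs, rfl⟩
    refine ⟨φ s, ⟨?_, ?_⟩, (hφ s hs).2⟩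
    · by_contra hlt
      obtain ⟨r, hr, hra⟩ := hord.out ⟨s, hs, rfl⟩ ⟨t, ht, rfl⟩ ⟨(not_le.1 hlt).le, hφt.1⟩
      exact hna r hr hra
    · by_contra hlt
      obtain ⟨r, hr, hra⟩ := hord.out ⟨t, ht, rfl⟩ ⟨s, hs, rfl⟩ ⟨hφt.2, (not_le.1 hlt).le⟩
      exact hnb r hr hra
  have hcl : IsClosed (c' '' Icc a' b') := (isCompact_Icc.image_of_continuousOn
    (hc'.continuousOn.mono (Icc_subset_unit ha' hb'))).isClosed
  have := ContinuousOn.image_closure (s := Ioo a b) (f := c) (by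
    rw [closure_Ioo hab.ne]
    exact hc.continuousOn.mono (Icc_subset_unit ha hb))
  rw [closure_Ioo hab.ne] at this
  exact this.trans (closure_minimal hsub' hcl)

/-- `V` contains the frontiers of the intersections of the edges in `S`. -/
def CutsIntersections (n : ℕ) {M : Type*} [TopologicalSpace M]
    [ChartedSpace (EuclideanSpace ℝ (Fin n)) M] (S : Set (Set M)) (V : Set M) : Prop :=
  ∀ e ∈ S, ∃ c, IsAnalyticArc n c ∧ c '' Icc 0 1 = e ∧ c 0 ∈ V ∧ c 1 ∈ V ∧ ∀ e' ∈ S,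
    ∀ t ∈ frontier {t : ℝ | t ∈ Icc (0 : ℝ) 1 ∧ c t ∈ e'}, c t ∈ V

/-- A common point outside `V` is interior to both pieces; then each contains the other by
`image_subset_of_meets`. -/
theorem IsPiece.eq_or_inter_subset {S : Set (Set M)} {V : Set M} (hS : CutsIntersections n S V)
    {p q e e' : Set M} (hp : IsPiece n V p) (hq : IsPiece n V q) (he : e ∈ S) (he' : e' ∈ S)
    (hpe : p ⊆ e) (hqe : q ⊆ e') (hpq : p ≠ q) : p ∩ q ⊆ V := by
  obtain ⟨c, hc, rfl, -, -, hF⟩ := hS e he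
  obtain ⟨c', hc', rfl, -, -, hF'⟩ := hS e' he'
  obtain ⟨a, b, ha, hab, hb, rfl, -, hVa, hVb, hno⟩ := hp.exists_Icc hc hpe
  obtain ⟨a', b', ha', hab', hb', rfl, -, hVa', hVb', hno'⟩ := hq.exists_Icc hc' hqe
  rintro x ⟨⟨t, ht, rfl⟩, ⟨t', ht', hx⟩⟩
  by_contra hxV
  have htI : t ∈ Ioo a b := by
    refine ⟨lt_of_le_of_ne ht.1 ?_, lt_of_le_of_ne ht.2 ?_⟩
    · rintro rfl; exact hxV hVa
    · rintro rfl; exact hxV hVb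
  have htI' : t' ∈ Ioo a' b' := by
    refine ⟨lt_of_le_of_ne ht'.1 ?_, lt_of_le_of_ne ht'.2 ?_⟩
    · rintro rfl; exact hxV (hx ▸ hVa')
    · rintro rfl; exact hxV (hx ▸ hVb')
  refine hpq (Subset.antisymm ?_ ?_)
  · exact image_subset_of_meets hc hc' ha hab hb ha' hb' hVa' hVb' hno (hF _ he') htI ⟨t', ht', hx⟩
  · exact image_subset_of_meets hc' hc ha' hab' hb' ha hb hVa hVb hno' (hF' _ he) htI'
      ⟨t, ht, hx.symm⟩

theorem finite_preimage_arc (hc : IsAnalyticArc n c) {V : Set M} (hV : V.Finite) :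
    (Icc (0 : ℝ) 1 ∩ c ⁻¹' V).Finite := by
  refine Set.Finite.of_finite_image (hV.subset ?_) (hc.injOn.mono inter_subset_left)
  rintro _ ⟨t, ht, rfl⟩
  exact ht.2

theorem exists_piece_right (hc : IsAnalyticArc n c) {V : Set M} (hV : V.Finite) (h0 : c 0 ∈ V)
    (h1 : c 1 ∈ V) {t : ℝ} (ht : t ∈ Ico (0 : ℝ) 1) : ∃ a b, 0 ≤ a ∧ a ≤ t ∧ t < b ∧ b ≤ 1 ∧
      IsPiece n V (c '' Icc a b) ∧ (c t ∈ V → a = t) := by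
  obtain ⟨a, ha, b, hb, ha0, hat, htb, hb1, hno, heq⟩ := exists_gap_right
    (finite_preimage_arc hc hV) (t := t) ⟨by simp, h0⟩ ⟨by simp, h1⟩ ht
  refine ⟨a, b, ha0, hat, htb, hb1, isPiece_of_gap hc ha0 (hat.trans_lt htb) hb1 ha.2 hb.2
    (fun s hs hsV => hno s hs ⟨Icc_subset_unit ha0 hb1 (Ioo_subset_Icc_self hs), hsV⟩), fun h =>
    heq ⟨Ico_subset_Icc_self ht, h⟩⟩

theorem exists_piece_left (hc : IsAnalyticArc n c) {V : Set M} (hV : V.Finite) (h0 : c 0 ∈ V)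
    (h1 : c 1 ∈ V) {t : ℝ} (ht : t ∈ Ioc (0 : ℝ) 1) : ∃ a b, 0 ≤ a ∧ a < t ∧ t ≤ b ∧ b ≤ 1 ∧
      IsPiece n V (c '' Icc a b) ∧ (c t ∈ V → b = t) := by
  obtain ⟨a, ha, b, hb, ha0, hat, htb, hb1, hno, heq⟩ := exists_gap_left
    (finite_preimage_arc hc hV) (t := t) ⟨by simp, h0⟩ ⟨by simp, h1⟩ ht
  refine ⟨a, b, ha0, hat, htb, hb1, isPiece_of_gap hc ha0 (hat.trans_le htb) hb1 ha.2 hb.2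
    (fun s hs hsV => hno s hs ⟨Icc_subset_unit ha0 hb1 (Ioo_subset_Icc_self hs), hsV⟩), fun h =>
    heq ⟨Ioc_subset_Icc_self ht, h⟩⟩

/-- An edge is the union of its pieces. -/
theorem exists_piece_mem {S : Set (Set M)} {V : Set M} (hS : CutsIntersections n S V)
    (hV : V.Finite) {e : Set M} (he : e ∈ S) {x : M} (hx : x ∈ e) :
    ∃ p, IsPiece n V p ∧ p ⊆ e ∧ x ∈ p := by
  obtain ⟨c, hc, rfl, h0, h1, -⟩ := hS e he
  obtain ⟨t, ht, rfl⟩ := hx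
  rcases eq_or_lt_of_le ht.2 with h | h
  · obtain ⟨a, b, ha, hat, htb, hb, hp, -⟩ := exists_piece_left hc hV h0 h1 (t := t)
      ⟨by rw [h]; exact zero_lt_one, ht.2⟩
    exact ⟨_, hp, image_mono (Icc_subset_unit ha hb), ⟨t, ⟨hat.le, htb⟩, rfl⟩⟩
  · obtain ⟨a, b, ha, hat, htb, hb, hp, -⟩ := exists_piece_right hc hV h0 h1 (t := t) ⟨ht.1, h⟩
    exact ⟨_, hp, image_mono (Icc_subset_unit ha hb), ⟨t, ⟨hat, htb.le⟩, rfl⟩⟩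

theorem finite_pieces {S : Set (Set M)} (hfin : S.Finite) {V : Set M}
    (hS : CutsIntersections n S V) (hV : V.Finite) :
    {p | IsPiece n V p ∧ ∃ e ∈ S, p ⊆ e}.Finite := by
  have h1 : {p | IsPiece n V p ∧ ∃ e ∈ S, p ⊆ e} = ⋃ e ∈ S, {p | IsPiece n V p ∧ p ⊆ e} := by
    ext p; simp [mem_iUnion]
  rw [h1]
  refine hfin.biUnion fun e he => ?_
  obtain ⟨c, hc, rfl, -⟩ := hS e he
  have hT := finite_preimage_arc hc hV
  refine ((hT.prod hT).image fun z : ℝ × ℝ => c '' Icc z.1 z.2).subset ?_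
  rintro p ⟨hp, hpe⟩
  obtain ⟨a, b, ha, hab, hb, rfl, -, hVa, hVb, -⟩ := hp.exists_Icc hc hpe
  exact ⟨(a, b), ⟨⟨⟨ha, hab.le.trans hb⟩, hVa⟩, ⟨⟨ha.trans hab.le, hb⟩, hVb⟩⟩, rfl⟩

/-- The pieces into which the edges in `S` are cut by `V` form a graph. -/
theorem exists_graph_of_pieces {S : Set (Set M)} (hfin : S.Finite) (hne : S.Nonempty) {V : Set M}
    (hS : CutsIntersections n S V) (hV : V.Finite)
    (hcl : ∀ e ∈ S, ∀ v ∈ endpoints n e, ∃ e' ∈ S, v ∈ endpoints n e' ∧ (e ∩ e').Finite) :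
    ∃ γ : Graph n M, ∀ p, p ∈ γ.edges ↔ IsPiece n V p ∧ ∃ e ∈ S, p ⊆ e := by
  have hfp := finite_pieces hfin hS hV
  refine ⟨⟨hfp.toFinset, ?_, ?_, ?_, ?_⟩, fun p => hfp.mem_toFinset⟩
  · obtain ⟨e, he⟩ := hne
    have hee : e.Nonempty := by
      obtain ⟨c, hc, rfl, -⟩ := hS e he
      exact hc.isEdge.infinite.nonempty
    obtain ⟨x, hx⟩ := hee
    obtain ⟨p, hp, hpe, -⟩ := exists_piece_mem hS hV he hx
    exact ⟨p, hfp.mem_toFinset.2 ⟨hp, e, he, hpe⟩⟩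
  · intro p hp
    exact (hfp.mem_toFinset.1 hp).1.1
  · intro p hp q hq hpq
    obtain ⟨hp1, e, he, hpe⟩ := hfp.mem_toFinset.1 hp
    obtain ⟨hq1, e', he', hqe⟩ := hfp.mem_toFinset.1 hq
    have h := hp1.eq_or_inter_subset hS hq1 he he' hpe hqe hpq
    rw [← hp1.2, ← hq1.2]
    exact fun x hx => ⟨⟨hx.1, h hx⟩, ⟨hx.2, h hx⟩⟩
  · intro p hp v hv
    obtain ⟨hp1, e, he, hpe⟩ := hfp.mem_toFinset.1 hp
    have hvV : v ∈ V := by rw [← hp1.2] at hv; exact hv.2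
    suffices h : ∃ q e', IsPiece n V q ∧ e' ∈ S ∧ q ⊆ e' ∧ q ≠ p ∧ v ∈ q by
      obtain ⟨q, e', hq, he', hqe, hqp, hvq⟩ := h
      exact ⟨q, hfp.mem_toFinset.2 ⟨hq, e', he', hqe⟩, hqp, by rw [← hq.2]; exact ⟨hvq, hvV⟩⟩
    -- At an end of the original edge the neighbour is a piece of another edge, distinct because the
    -- overlap is finite. At an interior point it is the adjacent piece of the same edge.
    by_cases hve : v ∈ endpoints n e
    · obtain ⟨e', he', hve', hinter⟩ := hcl e he v hve
      obtain ⟨q, hq, hqe, hvq⟩ := exists_piece_mem hS hV he' (endpoints_subset _ hve')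
      refine ⟨q, e', hq, he', hqe, ?_, hvq⟩
      rintro rfl
      exact hq.1.infinite (hinter.subset (subset_inter hpe hqe))
    · obtain ⟨c, hc, rfl, h0, h1, -⟩ := hS e he
      rw [hc.endpoints_eq] at hve
      obtain ⟨a, b, ha, hab, hb, rfl, hend, hVa, hVb, -⟩ := hp1.exists_Icc hc hpe
      rw [hend] at hv
      have haI : a ∈ Icc (0 : ℝ) 1 := ⟨ha, hab.le.trans hb⟩
      have hbI : b ∈ Icc (0 : ℝ) 1 := ⟨ha.trans hab.le, hb⟩
      rcases hv with rfl | rfl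
      · have ha0 : 0 < a := lt_of_le_of_ne ha (by rintro rfl; exact hve (by simp))
        obtain ⟨a', b', ha', hat, htb, hb', hq, hbt⟩ := exists_piece_left hc hV h0 h1 ⟨ha0, haI.2⟩
        obtain rfl := hbt hvV
        refine ⟨_, _, hq, he, image_mono (Icc_subset_unit ha' hb'), fun h => ?_,
          ⟨b', ⟨hat.le, le_rfl⟩, rfl⟩⟩
        have h2 := (hc.injOn.image_eq_image_iff (Icc_subset_unit ha' hb')
          (Icc_subset_unit ha hb)).1 h
        have h3 : a' ∈ Icc b' b := by rw [← h2]; exact ⟨le_rfl, hat.le⟩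
        exact absurd h3.1 (not_le.2 hat)
      · have hb0 : b < 1 := lt_of_le_of_ne hb (by rintro rfl; exact hve (by simp))
        obtain ⟨a', b', ha', hat, htb, hb', hq, hbt⟩ := exists_piece_right hc hV h0 h1 ⟨hbI.1, hb0⟩
        obtain rfl := hbt hvV
        refine ⟨_, _, hq, he, image_mono (Icc_subset_unit ha' hb'), fun h => ?_,
          ⟨a', ⟨le_rfl, htb.le⟩, rfl⟩⟩
        have h2 := (hc.injOn.image_eq_image_iff (Icc_subset_unit ha' hb')
          (Icc_subset_unit ha hb)).1 h
        have h3 : b' ∈ Icc a a' := by rw [← h2]; exact ⟨htb.le, le_rfl⟩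
        exact absurd h3.2 (not_le.2 htb)

/-- The end points and the frontiers of all pairwise intersections suffice, and they are finitely
many by `finite_frontier_arc`. -/
theorem exists_cuts {S : Set (Set M)} (hfin : S.Finite) (hedge : ∀ e ∈ S, IsEdge n e) {V₀ : Set M}
    (hV₀ : V₀.Finite) : ∃ V, V.Finite ∧ V₀ ⊆ V ∧ CutsIntersections n S V := by
  rcases S.eq_empty_or_nonempty with rfl | ⟨e₀, he₀⟩
  · exact ⟨V₀, hV₀, Subset.rfl, fun e he => absurd he (notMem_empty e)⟩
  have hex : ∀ e, ∃ c : ℝ → M, e ∈ S → IsAnalyticArc n c ∧ c '' Icc 0 1 = e := by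
    intro e
    by_cases he : e ∈ S
    · obtain ⟨c, hc⟩ := hedge e he
      exact ⟨c, fun _ => hc⟩
    · exact ⟨(hedge e₀ he₀).choose, fun h => absurd h he⟩
  choose c hcc using hex
  have hc := fun e he => (hcc e he).1
  have hce := fun e he => (hcc e he).2
  refine ⟨V₀ ∪ ⋃ e ∈ S, ({c e 0, c e 1} ∪ ⋃ e' ∈ S,
    c e '' frontier {t : ℝ | t ∈ Icc (0 : ℝ) 1 ∧ c e t ∈ e'}), ?_, subset_union_left, ?_⟩
  · refine hV₀.union (hfin.biUnion fun e he => (toFinite _).union (hfin.biUnion fun e' he' => ?_))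
    refine Set.Finite.image _ ?_
    have := finite_frontier_arc (hc e he) (hc e' he')
    rwa [hce e' he'] at this
  · intro e he
    refine ⟨c e, hc e he, hce e he, ?_, ?_, ?_⟩
    · exact Or.inr (mem_biUnion he (Or.inl (by simp)))
    · exact Or.inr (mem_biUnion he (Or.inl (by simp)))
    · intro e' he' t ht
      exact Or.inr (mem_biUnion he (Or.inr (mem_biUnion he' ⟨t, ht, rfl⟩)))

end Pieces

/-! ### Edges avoiding overlaps in dimension at least two -/

section Overlaps

open Filter Topology

variable {n : ℕ} {M : Type*} [TopologicalSpace M] [T2Space M]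
  [ChartedSpace (EuclideanSpace ℝ (Fin n)) M] [IsManifold (𝓡 n) ω M] {c c' : ℝ → M}

/-- A set of parameters without interior is contained in its frontier, which is finite. -/
theorem interior_nonempty_of_infinite (hc : IsAnalyticArc n c) (hc' : IsAnalyticArc n c')
    (h : (c '' Icc 0 1 ∩ c' '' Icc 0 1).Infinite) :
    (interior {t : ℝ | t ∈ Icc (0 : ℝ) 1 ∧ c t ∈ c' '' Icc 0 1}).Nonempty := by
  by_contra hne
  rw [not_nonempty_iff_eq_empty] at hne
  refine h (((finite_frontier_arc hc hc').image c).subset ?_)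
  rintro _ ⟨⟨t, ht, rfl⟩, hx⟩
  refine ⟨t, ⟨subset_closure ⟨ht, hx⟩, ?_⟩, rfl⟩
  rw [hne]
  exact notMem_empty t

/-- In a family of arcs any two of which meet in a finite set only, only countably many overlap with
a given arc. -/
theorem countable_overlaps {κ : Type*} (hc : IsAnalyticArc n c) {J : Set κ} {d : κ → ℝ → M}
    (hd : ∀ s ∈ J, IsAnalyticArc n (d s))
    (hdis : ∀ s ∈ J, ∀ s' ∈ J, s ≠ s' → (d s '' Icc 0 1 ∩ d s' '' Icc 0 1).Finite) :
    {s ∈ J | (c '' Icc 0 1 ∩ d s '' Icc 0 1).Infinite}.Countable := by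
  -- Every overlapping arc occupies a non-empty open set of parameters of `c`. Two such sets are
  -- disjoint, as otherwise two arcs of the family would share infinitely many points.
  refine Set.PairwiseDisjoint.countable_of_isOpen
    (s := fun s => interior {t : ℝ | t ∈ Icc (0 : ℝ) 1 ∧ c t ∈ d s '' Icc 0 1}) ?_
    (fun s _ => isOpen_interior) (fun s hs => interior_nonempty_of_infinite hc (hd s hs.1) hs.2)
  intro s hs s' hs' hne
  rw [Function.onFun, disjoint_iff_inter_eq_empty]
  by_contra h
  obtain ⟨t, ht⟩ := nonempty_iff_ne_empty.2 h
  have h1 := infinite_of_mem_nhds t ((isOpen_interior.inter isOpen_interior).mem_nhds ht)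
  refine h1 ?_
  refine Set.Finite.of_finite_image ((hdis s hs.1 s' hs'.1 hne).subset ?_) (hc.injOn.mono ?_)
  · rintro _ ⟨r, hr, rfl⟩
    exact ⟨(interior_subset hr.1).2, (interior_subset hr.2).2⟩
  · exact fun r hr => (interior_subset hr.1).1

theorem IsAnalyticArc.of_chart {x₀ : M} {p : ℝ → EuclideanSpace ℝ (Fin n)} (hp : ContDiff ℝ ω p)
    (hmem : ∀ t ∈ Icc (0 : ℝ) 1, p t ∈ (extChartAt (𝓡 n) x₀).target)
    (hd : ∀ t ∈ Icc (0 : ℝ) 1, fderiv ℝ p t ≠ 0) (hinj : InjOn p (Icc 0 1)) :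
    IsAnalyticArc n fun t => (extChartAt (𝓡 n) x₀).symm (p t) := by
  set χ := extChartAt (𝓡 n) x₀
  have hs : ContMDiffOn 𝓘(ℝ, ℝ) (𝓡 n) ω (fun t => χ.symm (p t)) (Icc 0 1) :=
    (contMDiffOn_extChartAt_symm x₀).comp hp.contMDiff.contMDiffOn hmem
  refine ⟨hs, fun t ht h => hd t ht ?_, ?_⟩
  · have hu : UniqueDiffWithinAt ℝ (Icc (0 : ℝ) 1) t := uniqueDiffOn_Icc zero_lt_one t ht
    have hsrc : χ.symm (p t) ∈ (chartAt (EuclideanSpace ℝ (Fin n)) x₀).source := by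
      have := χ.map_target (hmem t ht)
      rwa [extChartAt_source] at this
    have h1 := mfderiv_comp_mfderivWithin t (I := 𝓘(ℝ, ℝ)) (I' := 𝓡 n)
      (I'' := 𝓘(ℝ, EuclideanSpace ℝ (Fin n))) (g := χ)
      (f := fun t => χ.symm (p t)) (s := Icc 0 1)
      (mdifferentiableAt_extChartAt hsrc) ((hs t ht).mdifferentiableWithinAt (by simp))
      hu.uniqueMDiffWithinAt
    have h2 : mfderivWithin 𝓘(ℝ, ℝ) 𝓘(ℝ, EuclideanSpace ℝ (Fin n)) (χ ∘ fun t => χ.symm (p t))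
        (Icc 0 1) t = fderiv ℝ p t := by
      have h3 : fderivWithin ℝ (χ ∘ fun t => χ.symm (p t)) (Icc 0 1) t
          = fderivWithin ℝ p (Icc 0 1) t :=
        fderivWithin_congr (fun s hs => χ.right_inv (hmem s hs)) (χ.right_inv (hmem t ht))
      exact mfderivWithin_eq_fderivWithin.trans
        (h3.trans (fderivWithin_eq_fderiv hu (hp.differentiable (by simp) t)))
    rw [← h2, h1]
    refine (congrArg (fun L => ContinuousLinearMap.comp (mfderiv (𝓡 n)
      𝓘(ℝ, EuclideanSpace ℝ (Fin n)) χ (χ.symm (p t))) L) h).trans ?_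
    exact ContinuousLinearMap.comp_zero _
  · intro s hs t ht hst
    exact hinj hs ht (χ.symm.injOn (hmem s hs) (hmem t ht) hst)

/-- Two points in a convex coordinate ball of a manifold of dimension at least two can be joined by
an edge which does not overlap with given edges. -/
theorem exists_edge_finite_inter (hn : 2 ≤ n) {x₀ v w : M} {r : ℝ}
    (hball : Metric.ball (extChartAt (𝓡 n) x₀ x₀) r ⊆ (extChartAt (𝓡 n) x₀).target)
    (hv : v ∈ (extChartAt (𝓡 n) x₀).source) (hw : w ∈ (extChartAt (𝓡 n) x₀).source)
    (hv' : extChartAt (𝓡 n) x₀ v ∈ Metric.ball (extChartAt (𝓡 n) x₀ x₀) r)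
    (hw' : extChartAt (𝓡 n) x₀ w ∈ Metric.ball (extChartAt (𝓡 n) x₀ x₀) r) (hvw : v ≠ w)
    {S : Set (Set M)} (hS : S.Finite) (hedge : ∀ e ∈ S, IsEdge n e) :
    ∃ e'', IsEdge n e'' ∧ endpoints n e'' = {v, w} ∧ ∀ e ∈ S, (e ∩ e'').Finite := by
  set χ := extChartAt (𝓡 n) x₀ with hχ
  set x := χ x₀
  have hd0 : χ w - χ v ≠ 0 := fun h => hvw (χ.injOn hv hw (sub_eq_zero.1 h).symm)
  set d := χ w - χ v with hd
  obtain ⟨u, hu⟩ := exists_linearIndependent_pair_of_one_lt_finrank (R := ℝ)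
    (M := EuclideanSpace ℝ (Fin n)) (by rw [finrank_euclideanSpace_fin]; exact hn) hd0
  rw [LinearIndependent.pair_iff] at hu
  have hu0 : u ≠ 0 := fun h => one_ne_zero (hu 0 1 (by simp [h])).2
  set ρ := max (dist (χ v) x) (dist (χ w) x)
  have hρ : ρ < r := max_lt hv' hw'
  -- Both end points lie in the closed ball of radius `ρ < r`; a deviation of norm below `r - ρ`
  -- from the segment between them stays in the ball.
  set ε := (r - ρ) / ‖u‖
  have hε : 0 < ε := div_pos (sub_pos.2 hρ) (norm_pos_iff.2 hu0)
  -- Parabolas in the plane of `d` and `u`. Distinct ones meet only at the ends, so among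
  -- uncountably many `s` only countably many overlap with the given edges.
  let p : ℝ → ℝ → EuclideanSpace ℝ (Fin n) := fun s t => χ v + t • d + (s * (t * (1 - t))) • u
  have hp : ∀ s, ContDiff ℝ ω (p s) := fun s => by fun_prop
  have hmem : ∀ s ∈ Ioo 0 ε, ∀ t ∈ Icc (0 : ℝ) 1, p s t ∈ χ.target := by
    intro s hs t ht
    refine hball ?_
    have h1 : χ v + t • d ∈ Metric.closedBall x ρ :=
      (convex_closedBall x ρ).add_smul_sub_mem (Metric.mem_closedBall.2 (le_max_left _ _))
        (Metric.mem_closedBall.2 (le_max_right _ _)) ht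
    rw [Metric.mem_closedBall, dist_eq_norm] at h1
    rw [Metric.mem_ball, dist_eq_norm]
    have h2 : p s t - x = (χ v + t • d - x) + (s * (t * (1 - t))) • u := by simp only [p]; abel
    rw [h2]
    have h3 : t * (1 - t) ≤ 1 := by nlinarith [ht.1, ht.2]
    have h4 : 0 ≤ t * (1 - t) := mul_nonneg ht.1 (sub_nonneg.2 ht.2)
    have h5 : ‖(s * (t * (1 - t))) • u‖ < r - ρ := by
      rw [norm_smul, Real.norm_of_nonneg (mul_nonneg hs.1.le h4)]
      calc s * (t * (1 - t)) * ‖u‖ ≤ s * 1 * ‖u‖ := by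
            gcongr
            exact hs.1.le
        _ < ε * ‖u‖ := by
            rw [mul_one]
            exact mul_lt_mul_of_pos_right hs.2 (norm_pos_iff.2 hu0)
        _ = r - ρ := div_mul_cancel₀ _ (norm_ne_zero_iff.2 hu0)
    linarith [norm_add_le (χ v + t • d - x) ((s * (t * (1 - t))) • u)]
  have hpeq : ∀ s s' t t', p s t = p s' t' → t = t' ∧ s * (t * (1 - t)) = s' * (t' * (1 - t')) := by
    intro s s' t t' h
    have h1 := hu (t - t') (s * (t * (1 - t)) - s' * (t' * (1 - t'))) (by
      simp only [sub_smul]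
      simp only [p] at h
      have h2 : χ v + t • d + (s * (t * (1 - t))) • u -
        (χ v + t' • d + (s' * (t' * (1 - t'))) • u) = 0 := sub_eq_zero.2 h
      rw [← h2]; abel)
    exact ⟨sub_eq_zero.1 h1.1, sub_eq_zero.1 h1.2⟩
  have hder : ∀ s t, fderiv ℝ (p s) t ≠ 0 := by
    intro s t h
    have h1 : HasDerivAt (p s) (d + (s * (1 - 2 * t)) • u) t := by
      have h2 : HasDerivAt (fun t : ℝ => s * (t * (1 - t))) (s * (1 - 2 * t)) t := by
        have := ((hasDerivAt_id t).mul ((hasDerivAt_id t).const_sub 1)).const_mul s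
        convert! this using 1
        simp only [id]; ring
      have h3 := ((hasDerivAt_id t).smul_const d).const_add (χ v)
      have h4 := h3.add (h2.smul_const u)
      convert! h4 using 1
      simp
    have h2 := h1.hasFDerivAt.fderiv
    rw [h] at h2
    have h3 := congrArg (fun L : ℝ →L[ℝ] EuclideanSpace ℝ (Fin n) => L 1) h2
    simp only [_root_.zero_apply, ContinuousLinearMap.toSpanSingleton_apply, one_smul] at h3
    exact one_ne_zero (hu 1 (s * (1 - 2 * t)) (by rw [one_smul]; exact h3.symm)).1
  have harc : ∀ s ∈ Ioo 0 ε, IsAnalyticArc n fun t => χ.symm (p s t) := fun s hs =>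
    IsAnalyticArc.of_chart (hp s) (hmem s hs) (fun t _ => hder s t)
      (fun t _ t' _ h => (hpeq s s t t' h).1)
  have h0 : ∀ s, χ.symm (p s 0) = v := fun s => by
    simp only [p, zero_smul, add_zero, zero_mul, mul_zero]
    exact χ.left_inv hv
  have h1 : ∀ s, χ.symm (p s 1) = w := fun s => by
    simp only [p, one_smul, sub_self, mul_zero, zero_smul, add_zero, hd, add_sub_cancel]
    exact χ.left_inv hw
  have hdis : ∀ s ∈ Ioo 0 ε, ∀ s' ∈ Ioo 0 ε, s ≠ s' →
      ((fun t => χ.symm (p s t)) '' Icc 0 1 ∩ (fun t => χ.symm (p s' t)) '' Icc 0 1).Finite := by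
    intro s hs s' hs' hne
    refine (toFinite ({v, w} : Set M)).subset ?_
    rintro _ ⟨⟨t, ht, rfl⟩, ⟨t', ht', hx⟩⟩
    have h2 : p s' t' = p s t := χ.symm.injOn (hmem s' hs' t' ht') (hmem s hs t ht) hx
    obtain ⟨rfl, h3⟩ := hpeq _ _ _ _ h2
    have h4 : (s' - s) * (t' * (1 - t')) = 0 := by rw [sub_mul, h3, sub_self]
    rcases mul_eq_zero.1 ((mul_eq_zero.1 h4).resolve_left (sub_ne_zero.2 hne.symm)) with h5 | h5
    · left; simp only [h5]; exact h0 s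
    · right
      have : t' = 1 := by linarith
      simp only [this]; exact h1 s
  have hcount : (⋃ e ∈ S, {s ∈ Ioo 0 ε |
      (e ∩ (fun t => χ.symm (p s t)) '' Icc 0 1).Infinite}).Countable := by
    refine hS.countable.biUnion fun e he => ?_
    obtain ⟨c, hc, rfl⟩ := hedge e he
    exact countable_overlaps hc harc hdis
  have hunc : ¬ (Ioo 0 ε).Countable := fun h => (not_le.2 hε) (Cardinal.Real.Ioo_countable_iff.1 h)
  obtain ⟨s, hs, hsn⟩ := not_subset.1 fun h => hunc (hcount.mono h)
  refine ⟨_, (harc s hs).isEdge, ?_, fun e he => ?_⟩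
  · rw [(harc s hs).endpoints_eq, h0, h1]
  · by_contra hinf
    exact hsn (mem_biUnion he ⟨hs, hinf⟩)

end Overlaps

end GenConn

end

noncomputable section

set_option linter.unusedSectionVars false
set_option linter.unusedVariables false

namespace GenConn

/-! ### Graphs in one-dimensional manifolds -/

section Line

open Filter Topology

variable {M : Type*} [TopologicalSpace M] [T2Space M]
  [ChartedSpace (EuclideanSpace ℝ (Fin 1)) M] [IsManifold (𝓡 1) ω M]

/-- The coordinate at `x` of a one-dimensional manifold. -/
def lineCoord (x z : M) : ℝ := chartAt (EuclideanSpace ℝ (Fin 1)) x z 0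

theorem lineCoord_injOn (x : M) :
    InjOn (lineCoord x) (chartAt (EuclideanSpace ℝ (Fin 1)) x).source := by
  intro z hz w hw h
  refine (chartAt (EuclideanSpace ℝ (Fin 1)) x).injOn hz hw ?_
  ext i
  rw [Subsingleton.elim i 0]
  exact h

theorem continuousOn_lineCoord (x : M) :
    ContinuousOn (lineCoord x) (chartAt (EuclideanSpace ℝ (Fin 1)) x).source := by
  have h : Continuous fun v : EuclideanSpace ℝ (Fin 1) => v 0 := by fun_prop
  exact h.comp_continuousOn (chartAt (EuclideanSpace ℝ (Fin 1)) x).continuousOn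

/-- An arc starting at `x` covers one of the sides of `x`. -/
theorem IsAnalyticArc.covers_side {d : ℝ → M} (hd : IsAnalyticArc 1 d) {x : M} (hx : d 0 = x) :
    (∃ ε > 0, ∀ z ∈ (chartAt (EuclideanSpace ℝ (Fin 1)) x).source,
      lineCoord x z ∈ Icc (lineCoord x x) (lineCoord x x + ε) → z ∈ d '' Icc 0 1) ∨
    (∃ ε > 0, ∀ z ∈ (chartAt (EuclideanSpace ℝ (Fin 1)) x).source,
      lineCoord x z ∈ Icc (lineCoord x x - ε) (lineCoord x x) → z ∈ d '' Icc 0 1) := by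
  set χ := chartAt (EuclideanSpace ℝ (Fin 1)) x
  have h0 : ∀ᶠ t in 𝓝[Icc 0 1] (0 : ℝ), d t ∈ χ.source := by
    have h1 := hd.continuousOn 0 ⟨le_rfl, zero_le_one⟩
    have h2 : χ.source ∈ 𝓝 (d 0) := by rw [hx]; exact chart_source_mem_nhds _ x
    exact h1.eventually_mem h2
  obtain ⟨b, hb0, hb1, hb⟩ : ∃ b, 0 < b ∧ b ≤ 1 ∧ ∀ t ∈ Icc 0 b, d t ∈ χ.source := by
    rw [eventually_nhdsWithin_iff, Metric.eventually_nhds_iff] at h0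
    obtain ⟨ε, hε, h⟩ := h0
    refine ⟨min (ε / 2) 1, by positivity, min_le_right _ _, fun t ht => h ?_ ?_⟩
    · rw [Real.dist_eq, sub_zero, abs_of_nonneg ht.1]
      linarith [ht.2.trans (min_le_left _ _)]
    · exact ⟨ht.1, ht.2.trans (min_le_right _ _)⟩
  have hsub : Icc 0 b ⊆ Icc (0 : ℝ) 1 := Icc_subset_Icc_right hb1
  have hcont : ContinuousOn (lineCoord x ∘ d) (Icc 0 b) :=
    (continuousOn_lineCoord x).comp (hd.continuousOn.mono hsub) hb
  have hinj : InjOn (lineCoord x ∘ d) (Icc 0 b) :=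
    (lineCoord_injOn x).comp (hd.injOn.mono hsub) hb
  have h0m : (0 : ℝ) ∈ Icc 0 b := ⟨le_rfl, hb0.le⟩
  have hbm : b ∈ Icc 0 b := ⟨hb0.le, le_rfl⟩
  have hlift : ∀ z ∈ χ.source, lineCoord x z ∈ (lineCoord x ∘ d) '' Icc 0 b →
      z ∈ d '' Icc 0 1 := by
    rintro z hz ⟨t, ht, htz⟩
    exact ⟨t, hsub ht, lineCoord_injOn x (hb t ht) hz htz⟩
  rcases hcont.strictMonoOn_of_injOn_Icc' hb0.le hinj with hm | hm
  · left
    have hlt := hm h0m hbm hb0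
    simp only [Function.comp_apply, hx] at hlt
    refine ⟨lineCoord x (d b) - lineCoord x x, sub_pos.2 hlt, fun z hz h => hlift z hz ?_⟩
    refine intermediate_value_Icc hb0.le hcont ?_
    simpa [hx] using h
  · right
    have hlt := hm h0m hbm hb0
    simp only [Function.comp_apply, hx] at hlt
    refine ⟨lineCoord x x - lineCoord x (d b), sub_pos.2 hlt, fun z hz h => hlift z hz ?_⟩
    refine intermediate_value_Icc' hb0.le hcont ?_
    simpa [hx] using h

theorem infinite_lineCoord_preimage (x : M) {U : Set ℝ} (hU : IsOpen U)
    (hx : lineCoord x x ∈ closure U) :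
    {z ∈ (chartAt (EuclideanSpace ℝ (Fin 1)) x).source | lineCoord x z ∈ U}.Infinite := by
  set χ := chartAt (EuclideanSpace ℝ (Fin 1)) x
  let j : ℝ → EuclideanSpace ℝ (Fin 1) := fun r => WithLp.toLp 2 fun _ => r
  have hj : Continuous j := by fun_prop
  have hjx : j (lineCoord x x) = χ x := by
    ext i; rw [Subsingleton.elim i 0]; rfl
  have h1 : j ⁻¹' χ.target ∈ 𝓝 (lineCoord x x) := by
    refine hj.continuousAt.preimage_mem_nhds ?_
    rw [hjx]
    exact chart_target_mem_nhds _ x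
  obtain ⟨O, hO, hOo, hOx⟩ := mem_nhds_iff.1 h1
  obtain ⟨r, hr⟩ := mem_closure_iff.1 hx O hOo hOx
  have h2 := infinite_of_mem_nhds r ((hOo.inter hU).mem_nhds hr)
  have hco : ∀ s ∈ O, lineCoord x (χ.symm (j s)) = s := fun s hs => by
    change χ (χ.symm (j s)) 0 = s
    rw [χ.right_inv (hO hs)]
  refine (h2.image (f := fun s => χ.symm (j s)) ?_).mono ?_
  · intro s hs t ht hst
    rw [← hco s hs.1, ← hco t ht.1]
    exact congrArg _ hst
  · rintro _ ⟨s, hs, rfl⟩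
    refine ⟨χ.map_target (hO hs.1), ?_⟩
    rw [hco s hs.1]
    exact hs.2

/-- Two arcs starting at `x` which do not overlap cover a neighbourhood of `x`. -/
theorem union_mem_nhds {d d' : ℝ → M} (hd : IsAnalyticArc 1 d) (hd' : IsAnalyticArc 1 d') {x : M}
    (hx : d 0 = x) (hx' : d' 0 = x) (h : (d '' Icc 0 1 ∩ d' '' Icc 0 1).Finite) :
    d '' Icc 0 1 ∪ d' '' Icc 0 1 ∈ 𝓝 x := by
  have hcoord : ContinuousAt (lineCoord x) x :=
    (continuousOn_lineCoord x).continuousAt (chart_source_mem_nhds _ x)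
  have key : ∀ {d d' : ℝ → M} {ε ε' : ℝ}, 0 < ε → 0 < ε' →
      (∀ z ∈ (chartAt (EuclideanSpace ℝ (Fin 1)) x).source,
        lineCoord x z ∈ Icc (lineCoord x x) (lineCoord x x + ε) → z ∈ d '' Icc 0 1) →
      (∀ z ∈ (chartAt (EuclideanSpace ℝ (Fin 1)) x).source,
        lineCoord x z ∈ Icc (lineCoord x x - ε') (lineCoord x x) → z ∈ d' '' Icc 0 1) →
      d '' Icc 0 1 ∪ d' '' Icc 0 1 ∈ 𝓝 x := by
    intro d d' ε ε' hε hε' h1 h2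
    filter_upwards [chart_source_mem_nhds (EuclideanSpace ℝ (Fin 1)) x,
      hcoord.preimage_mem_nhds (Icc_mem_nhds (sub_lt_self _ hε') (lt_add_of_pos_right _ hε))]
      with z hz hz'
    rcases le_total (lineCoord x x) (lineCoord x z) with h3 | h3
    · exact Or.inl (h1 z hz ⟨h3, hz'.2⟩)
    · exact Or.inr (h2 z hz ⟨hz'.1, h3⟩)
  -- Arcs on the same side of `x` would have infinitely many common points, so they leave `x` on
  -- opposite sides.
  rcases hd.covers_side hx with ⟨ε, hε, h1⟩ | ⟨ε, hε, h1⟩ <;>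
    rcases hd'.covers_side hx' with ⟨ε', hε', h2⟩ | ⟨ε', hε', h2⟩
  · exfalso
    refine infinite_lineCoord_preimage x (U := Ioo (lineCoord x x) (lineCoord x x + min ε ε'))
      isOpen_Ioo ?_ (h.subset ?_)
    · have hm : 0 < min ε ε' := lt_min hε hε'
      rw [closure_Ioo (by linarith)]
      exact ⟨le_rfl, by linarith⟩
    · rintro z ⟨hz, hz'⟩
      exact ⟨h1 z hz ⟨hz'.1.le, hz'.2.le.trans (by gcongr; exact min_le_left _ _)⟩,
        h2 z hz ⟨hz'.1.le, hz'.2.le.trans (by gcongr; exact min_le_right _ _)⟩⟩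
  · exact key hε hε' h1 h2
  · rw [union_comm]
    exact key hε' hε h2 h1
  · exfalso
    refine infinite_lineCoord_preimage x (U := Ioo (lineCoord x x - min ε ε') (lineCoord x x))
      isOpen_Ioo ?_ (h.subset ?_)
    · have hm : 0 < min ε ε' := lt_min hε hε'
      rw [closure_Ioo (by linarith)]
      exact ⟨by linarith, le_rfl⟩
    · rintro z ⟨hz, hz'⟩
      exact ⟨h1 z hz ⟨le_trans (by gcongr; exact min_le_left _ _) hz'.1.le, hz'.2.le⟩,
        h2 z hz ⟨le_trans (by gcongr; exact min_le_right _ _) hz'.1.le, hz'.2.le⟩⟩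

/-- An arc which represents the edge `e` and starts at the given end point. -/
theorem exists_arc_of_mem_endpoints {n : ℕ} {M : Type*} [TopologicalSpace M] [T2Space M]
    [ChartedSpace (EuclideanSpace ℝ (Fin n)) M] [IsManifold (𝓡 n) ω M] {e : Set M} {v : M}
    (hv : v ∈ endpoints n e) : ∃ c, IsAnalyticArc n c ∧ c '' Icc 0 1 = e ∧ c 0 = v := by
  obtain ⟨c, hc, rfl, rfl | rfl⟩ := hv
  · exact ⟨c, hc, rfl, rfl⟩
  · refine ⟨_, hc.comp_affine (a := 1) (b := 0) ⟨zero_le_one, le_rfl⟩ ⟨le_rfl, zero_le_one⟩ (by simp),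
      ?_, by simp⟩
    have : (fun t : ℝ => c (1 + t * (0 - 1))) = c ∘ fun t => 1 - t := by
      funext t; simp [sub_eq_add_neg]
    rw [this, image_comp]
    simp

/-- In dimension one a graph covers the manifold. -/
theorem Graph.iUnion_edges_eq_univ [PreconnectedSpace M] (γ : Graph 1 M) :
    ⋃ e ∈ γ.edges, e = univ := by
  have hcl : IsClosed (⋃ e ∈ γ.edges, e) :=
    γ.edges.finite_toSet.isClosed_biUnion fun e he => (γ.isEdge e he).isClosed
  -- At a vertex use the edge and its neighbour, at an interior point the two halves of the edge.
  -- The union is then open and closed.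
  have hop : IsOpen (⋃ e ∈ γ.edges, e) := by
    rw [isOpen_iff_mem_nhds]
    intro x hx
    obtain ⟨e, he, hxe⟩ := mem_iUnion₂.1 hx
    by_cases hv : x ∈ endpoints 1 e
    · obtain ⟨e', he', hne, hv'⟩ := γ.closed e he x hv
      obtain ⟨d, hd, hde, hdx⟩ := exists_arc_of_mem_endpoints hv
      obtain ⟨d', hd', hde', hdx'⟩ := exists_arc_of_mem_endpoints hv'
      refine Filter.mem_of_superset (union_mem_nhds hd hd' hdx hdx' ?_) ?_
      · rw [hde, hde']
        exact (finite_endpoints (γ.isEdge e he)).subset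
          ((γ.inter_subset e he e' he' hne.symm).trans inter_subset_left)
      · rw [hde, hde']
        exact union_subset (subset_biUnion_of_mem (u := id) he) (subset_biUnion_of_mem (u := id) he')
    · obtain ⟨c, hc, rfl⟩ := γ.isEdge e he
      obtain ⟨t, ht, rfl⟩ := hxe
      rw [hc.endpoints_eq] at hv
      have ht0 : 0 < t := lt_of_le_of_ne ht.1 (by rintro rfl; exact hv (by simp))
      have ht1 : t < 1 := lt_of_le_of_ne ht.2 (by rintro rfl; exact hv (by simp))
      obtain ⟨d₁, hd₁, hd₁e, -, hd₁1, -⟩ := hc.exists_subarc (a := 0) (b := t) le_rfl ht0 ht1.le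
      obtain ⟨d₂, hd₂, hd₂e, hd₂0, -, -⟩ := hc.exists_subarc (a := t) (b := 1) ht0.le ht1 le_rfl
      obtain ⟨d, hd, hde, hd0⟩ := exists_arc_of_mem_endpoints
        (v := c t) ⟨d₁, hd₁, hd₁e, Or.inr hd₁1.symm⟩
      refine Filter.mem_of_superset (union_mem_nhds hd hd₂ hd0 hd₂0 ?_) ?_
      · rw [hde, hd₂e, ← hc.injOn.image_inter (Icc_subset_unit le_rfl ht1.le)
          (Icc_subset_unit ht0.le le_rfl)]
        refine Set.Finite.image _ ((finite_singleton t).subset ?_)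
        rintro s ⟨hs, hs'⟩
        exact le_antisymm hs.2 hs'.1
      · rw [hde, hd₂e]
        refine Subset.trans ?_ (subset_biUnion_of_mem (u := id) he)
        exact union_subset (image_mono (Icc_subset_unit le_rfl ht1.le))
          (image_mono (Icc_subset_unit ht0.le le_rfl))
  refine IsClopen.eq_univ ⟨hcl, hop⟩ ?_
  obtain ⟨e, he⟩ := γ.nonempty
  obtain ⟨x, hx⟩ := (γ.isEdge e he).infinite.nonempty
  exact ⟨x, mem_biUnion he hx⟩

end Line

end GenConn

end

noncomputable section

set_option linter.unusedSectionVars false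
set_option linter.unusedVariables false

namespace GenConn

/-! ### Decomposition of edges and directedness of the set of graphs -/

section Walks

variable {n : ℕ} {M : Type*} [TopologicalSpace M] [T2Space M]
  [ChartedSpace (EuclideanSpace ℝ (Fin n)) M] [IsManifold (𝓡 n) ω M] {c : ℝ → M}

namespace Graph

variable {γ γ' γ'' Γ : Graph n M}

theorem isAnalyticArc_param (γ : Graph n M) (e : γ.Edge) : IsAnalyticArc n (γ.param e) :=
  (γ.isEdge e.1 e.2).choose_spec.1

theorem image_param (γ : Graph n M) (e : γ.Edge) : γ.param e '' Icc 0 1 = e.1 :=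
  (γ.isEdge e.1 e.2).choose_spec.2

theorem endpoints_edge (γ : Graph n M) (e : γ.Edge) :
    endpoints n e.1 = {γ.src e, γ.tgt e} := by
  rw [← γ.image_param e]
  exact (γ.isAnalyticArc_param e).endpoints_eq

theorem src_ne_tgt (γ : Graph n M) (e : γ.Edge) : γ.src e ≠ γ.tgt e := fun h =>
  zero_ne_one ((γ.isAnalyticArc_param e).injOn (left_mem_Icc.2 zero_le_one)
    (right_mem_Icc.2 zero_le_one) h)

theorem src_mem_endpoints (γ : Graph n M) (e : γ.Edge) : γ.src e ∈ endpoints n e.1 := by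
  rw [endpoints_edge]; simp

theorem tgt_mem_endpoints (γ : Graph n M) (e : γ.Edge) : γ.tgt e ∈ endpoints n e.1 := by
  rw [endpoints_edge]; simp

theorem infinite_edge (γ : Graph n M) (e : γ.Edge) : e.1.Infinite := (γ.isEdge e.1 e.2).infinite

theorem finite_inter (γ : Graph n M) {e e' : γ.Edge} (h : e ≠ e') : (e.1 ∩ e'.1).Finite :=
  (finite_endpoints (γ.isEdge e.1 e.2)).subset
    ((γ.inter_subset e.1 e.2 e'.1 e'.2 fun h' => h (Subtype.ext h')).trans inter_subset_left)

theorem eq_of_infinite_inter (γ : Graph n M) {e e' : γ.Edge} (h : (e.1 ∩ e'.1).Infinite) :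
    e = e' :=
  by_contra fun hne => h (γ.finite_inter hne)

theorem finite_inter_of_notMem (γ : Graph n M) {e : γ.Edge} {L : List γ.Edge} (h : e ∉ L) (x : M) :
    (e.1 ∩ ((⋃ d ∈ L, d.1) ∪ {x})).Finite := by
  classical
  have h1 : ((⋃ d ∈ L, e.1 ∩ d.1) ∪ {x}).Finite := by
    refine Set.Finite.union ?_ (finite_singleton x)
    refine (List.finite_toSet L).biUnion fun d hd => γ.finite_inter ?_
    rintro rfl
    exact h hd
  refine h1.subset ?_
  rintro y ⟨hy, hy' | hy'⟩
  · obtain ⟨d, hd, hyd⟩ := mem_iUnion₂.1 hy'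
    exact Or.inl (mem_iUnion₂.2 ⟨d, hd, hy, hyd⟩)
  · exact Or.inr hy'

/-- An edge inside an arc which starts where a list of other edges stops. -/
theorem exists_step (hc : IsAnalyticArc n c) {L : List Γ.Edge} {r : ℝ} (hr : r ∈ Icc (0 : ℝ) 1)
    (hL : (⋃ d ∈ L, d.1) ∪ {c 0} = c '' Icc 0 r) {e : Γ.Edge} (heL : e ∉ L)
    (he : e.1 ⊆ c '' Icc 0 1) {q : M} (hq : endpoints n e.1 = {c r, q}) :
    ∃ s, r < s ∧ s ≤ 1 ∧ q = c s ∧ e.1 = c '' Icc r s ∧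
      (⋃ d ∈ e :: L, d.1) ∪ {c 0} = c '' Icc 0 s := by
  obtain ⟨a, b, ha, hab, hb, h1, h2⟩ := (Γ.isEdge e.1 e.2).exists_Icc_of_subset hc he
  have hI := Icc_subset_unit ha hb
  have haI := hI (left_mem_Icc.2 hab.le)
  have hbI := hI (right_mem_Icc.2 hab.le)
  have hne : c a ≠ c b := fun h => hab.ne (hc.injOn haI hbI h)
  have hrm : c r ∈ ({c a, c b} : Set M) := by rw [← h2, hq]; simp
  have hqm : q ∈ ({c a, c b} : Set M) := by rw [← h2, hq]; simp
  have ham : c a ∈ ({c r, q} : Set M) := by rw [← hq, h2]; simp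
  have hbm : c b ∈ ({c r, q} : Set M) := by rw [← hq, h2]; simp
  rcases hrm with hra | hrb
  · obtain rfl := hc.injOn hr haI hra
    have hqb : q = c b := by
      rcases hbm with h | h
      · exact absurd h.symm hne
      · exact h.symm
    refine ⟨b, hab, hb, hqb, h1, ?_⟩
    have h3 : (⋃ d ∈ e :: L, d.1) = e.1 ∪ ⋃ d ∈ L, d.1 := by
      ext x; simp
    rw [h3, union_assoc, hL, h1, ← image_union, union_comm, Icc_union_Icc_eq_Icc ha hab.le]
  -- Here the edge would run backwards into the part already covered by the other edges, which it
  -- meets in finitely many points only.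
  · obtain rfl := hc.injOn hr hbI hrb
    refine absurd ((Γ.finite_inter_of_notMem heL (c 0)).subset ?_) (Γ.infinite_edge e)
    rw [hL, h1]
    exact subset_inter Subset.rfl (image_mono (Icc_subset_Icc_left ha))

theorem endpoints_edge' (γ : Graph n M) (e : γ.Edge) :
    endpoints n e.1 = {γ.tgt e, γ.src e} := by rw [endpoints_edge, pair_comm]

/-- The edge path `w` has no repeated edges and runs inside the arc `c`. -/
def Walk.InArc {x y : M} (c : ℝ → M) (w : Γ.Walk x y) : Prop :=
  w.edgeList.Nodup ∧ ∀ d ∈ w.edgeList, d.1 ⊆ c '' Icc 0 1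

/-- An edge path inside an arc, which starts at the initial point of the arc, covers an initial
segment of the arc. -/
theorem Walk.InArc.exists_end (hc : IsAnalyticArc n c) {x y : M} (w : Γ.Walk x y)
    (hx : x = c 0) (hw : w.InArc c) :
    ∃ s ∈ Icc (0 : ℝ) 1, y = c s ∧ (⋃ d ∈ w.edgeList, d.1) ∪ {c 0} = c '' Icc 0 s := by
  induction w with
  | nil => exact ⟨0, by simp, hx, by simp [Walk.edgeList]⟩
  | forward e w ih =>
    obtain ⟨hnd, hsub⟩ := hw
    simp only [Walk.edgeList, List.nodup_cons, List.mem_cons, forall_eq_or_imp] at hnd hsub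
    obtain ⟨r, hr, hyr, hu⟩ := ih ⟨hnd.2, hsub.2⟩
    obtain ⟨s, hrs, hs, h1, -, h2⟩ := exists_step hc hr hu hnd.1 hsub.1 (hyr ▸ Γ.endpoints_edge e)
    exact ⟨s, ⟨hr.1.trans hrs.le, hs⟩, h1, h2⟩
  | backward e w ih =>
    obtain ⟨hnd, hsub⟩ := hw
    simp only [Walk.edgeList, List.nodup_cons, List.mem_cons, forall_eq_or_imp] at hnd hsub
    obtain ⟨r, hr, hyr, hu⟩ := ih ⟨hnd.2, hsub.2⟩
    obtain ⟨s, hrs, hs, h1, -, h2⟩ := exists_step hc hr hu hnd.1 hsub.1 (hyr ▸ Γ.endpoints_edge' e)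
    exact ⟨s, ⟨hr.1.trans hrs.le, hs⟩, h1, h2⟩

theorem Walk.InArc.exists_last (hc : IsAnalyticArc n c) {x p : M} (w : Γ.Walk x p) {e : Γ.Edge}
    {q : M} (hx : x = c 0) (hnd : (e :: w.edgeList).Nodup)
    (hsub : ∀ d ∈ e :: w.edgeList, d.1 ⊆ c '' Icc 0 1) (hpq : endpoints n e.1 = {p, q}) :
    ∃ r s, 0 ≤ r ∧ r < s ∧ s ≤ 1 ∧ p = c r ∧ q = c s ∧ e.1 = c '' Icc r s := by
  simp only [List.nodup_cons, List.mem_cons, forall_eq_or_imp] at hnd hsub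
  obtain ⟨r, hr, hyr, hu⟩ := Walk.InArc.exists_end hc w hx ⟨hnd.2, hsub.2⟩
  obtain ⟨s, hrs, hs, h1, h2, -⟩ := exists_step hc hr hu hnd.1 hsub.1 (hyr ▸ hpq)
  exact ⟨r, s, hr.1, hrs, hs, hyr, h1, h2⟩

theorem Walk.InArc.last_ne (hc : IsAnalyticArc n c) {x p : M} (w : Γ.Walk x p) {e : Γ.Edge}
    {q : M} (hx : x = c 0) (hnd : (e :: w.edgeList).Nodup)
    (hsub : ∀ d ∈ e :: w.edgeList, d.1 ⊆ c '' Icc 0 1) (hpq : endpoints n e.1 = {p, q}) :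
    q ≠ x := by
  obtain ⟨r, s, hr, hrs, hs, -, hq, -⟩ := Walk.InArc.exists_last hc w hx hnd hsub hpq
  rw [hq, hx]
  intro h
  exact (hr.trans_lt hrs).ne' (hc.injOn ⟨hr.trans hrs.le, hs⟩ (left_mem_Icc.2 zero_le_one) h)

theorem Walk.InArc.last_eq (hc : IsAnalyticArc n c) {x p p' : M} (w : Γ.Walk x p)
    (w' : Γ.Walk x p') {e e' : Γ.Edge} {q q' : M} (hx : x = c 0) (hnd : (e :: w.edgeList).Nodup)
    (hsub : ∀ d ∈ e :: w.edgeList, d.1 ⊆ c '' Icc 0 1) (hpq : endpoints n e.1 = {p, q})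
    (hnd' : (e' :: w'.edgeList).Nodup) (hsub' : ∀ d ∈ e' :: w'.edgeList, d.1 ⊆ c '' Icc 0 1)
    (hpq' : endpoints n e'.1 = {p', q'}) (hqq : q = q') : e = e' := by
  obtain ⟨r, s, hr, hrs, hs, -, hq, he⟩ := Walk.InArc.exists_last hc w hx hnd hsub hpq
  obtain ⟨r', s', hr', hrs', hs', -, hq', he'⟩ := Walk.InArc.exists_last hc w' hx hnd' hsub' hpq'
  obtain rfl : s = s' := hc.injOn ⟨hr.trans hrs.le, hs⟩ ⟨hr'.trans hrs'.le, hs'⟩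
    (hq.symm.trans (hqq.trans hq'))
  refine Γ.eq_of_infinite_inter ?_
  have h1 : (c '' Icc (max r r') s).Infinite :=
    (Icc_infinite (max_lt hrs hrs')).image
      (hc.injOn.mono (Icc_subset_unit (le_max_of_le_left hr) hs))
  refine h1.mono ?_
  rw [he, he']
  exact subset_inter (image_mono (Icc_subset_Icc_left (le_max_left _ _)))
    (image_mono (Icc_subset_Icc_left (le_max_right _ _)))

/-- Edge paths inside an arc are determined by their end points. -/
theorem Walk.InArc.sigma_eq (hc : IsAnalyticArc n c) {x : M} (hx : x = c 0) {y : M}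
    (w : Γ.Walk x y) (hw : w.InArc c) {y' : M} (w' : Γ.Walk x y') (hw' : w'.InArc c)
    (hy : y = y') : (⟨y, w⟩ : Σ y, Γ.Walk x y) = ⟨y', w'⟩ := by
  -- The end point is part of the compared data: after the last edges are removed, the end points of
  -- the shorter walks agree only because these edges are shown to be equal.
  induction w generalizing y' with
  | nil =>
    cases w' with
    | nil => rfl
    | forward e' w' =>
      exact absurd hy.symm (Walk.InArc.last_ne hc w' hx hw'.1 hw'.2 (Γ.endpoints_edge e'))
    | backward e' w' =>
      exact absurd hy.symm (Walk.InArc.last_ne hc w' hx hw'.1 hw'.2 (Γ.endpoints_edge' e'))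
  | forward e w ih =>
    cases w' with
    | nil => exact absurd hy (Walk.InArc.last_ne hc w hx hw.1 hw.2 (Γ.endpoints_edge e))
    | forward e' w' =>
      obtain rfl := Walk.InArc.last_eq hc w w' hx hw.1 hw.2 (Γ.endpoints_edge e) hw'.1 hw'.2
        (Γ.endpoints_edge e') hy
      have h := ih ⟨(List.nodup_cons.1 hw.1).2, fun d hd => hw.2 d (List.mem_cons_of_mem _ hd)⟩ w'
        ⟨(List.nodup_cons.1 hw'.1).2, fun d hd => hw'.2 d (List.mem_cons_of_mem _ hd)⟩ rfl
      obtain rfl : w = w' := eq_of_heq (Sigma.mk.inj h).2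
      rfl
    | backward e' w' =>
      obtain rfl := Walk.InArc.last_eq hc w w' hx hw.1 hw.2 (Γ.endpoints_edge e) hw'.1 hw'.2
        (Γ.endpoints_edge' e') hy
      exact absurd hy.symm (Γ.src_ne_tgt e)
  | backward e w ih =>
    cases w' with
    | nil => exact absurd hy (Walk.InArc.last_ne hc w hx hw.1 hw.2 (Γ.endpoints_edge' e))
    | forward e' w' =>
      obtain rfl := Walk.InArc.last_eq hc w w' hx hw.1 hw.2 (Γ.endpoints_edge' e) hw'.1 hw'.2
        (Γ.endpoints_edge e') hy
      exact absurd hy (Γ.src_ne_tgt e)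
    | backward e' w' =>
      obtain rfl := Walk.InArc.last_eq hc w w' hx hw.1 hw.2 (Γ.endpoints_edge' e) hw'.1 hw'.2
        (Γ.endpoints_edge' e') hy
      have h := ih ⟨(List.nodup_cons.1 hw.1).2, fun d hd => hw.2 d (List.mem_cons_of_mem _ hd)⟩ w'
        ⟨(List.nodup_cons.1 hw'.1).2, fun d hd => hw'.2 d (List.mem_cons_of_mem _ hd)⟩ rfl
      obtain rfl : w = w' := eq_of_heq (Sigma.mk.inj h).2
      rfl

theorem Walk.Composes.subset {x y : M} {w : Γ.Walk x y} {e : Set M} (hw : w.Composes e)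
    {d : Γ.Edge} (hd : d ∈ w.edgeList) : d.1 ⊆ e := by
  rw [← hw.2]
  exact subset_biUnion_of_mem (s := {d | d ∈ w.edgeList}) (u := fun d : Γ.Edge => d.1) hd

theorem Walk.Composes.inArc {x y : M} {w : Γ.Walk x y} {e : Set M} (hw : w.Composes e)
    (he : c '' Icc 0 1 = e) : w.InArc c :=
  ⟨hw.1, fun d hd => he ▸ hw.subset hd⟩

/-- The decomposition of an edge is unique. -/
theorem Walk.Composes.unique {e : γ.Edge} {w w' : Γ.Walk (γ.src e) (γ.tgt e)}
    (hw : w.Composes e.1) (hw' : w'.Composes e.1) : w = w' :=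
  eq_of_heq (Sigma.mk.inj (Walk.InArc.sigma_eq (γ.isAnalyticArc_param e) rfl w
    (hw.inArc (γ.image_param e)) w' (hw'.inArc (γ.image_param e)) rfl)).2

theorem composes_walk (h : γ ≤ γ') (e : γ.Edge) : (walk h e).Composes e.1 := (h.1 e).choose_spec

/-- An arc which is a union of edges is a composition of edges. -/
theorem exists_composes (hc : IsAnalyticArc n c)
    (hcov : ∀ x ∈ c '' Icc 0 1, ∃ d ∈ Γ.edges, x ∈ d ∧ d ⊆ c '' Icc 0 1) :
    ∃ w : Γ.Walk (c 0) (c 1), w.Composes (c '' Icc 0 1) := by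
  -- A walk inside the arc either reaches the end or can be prolonged. As it repeats no edge, its
  -- length cannot exceed the number of edges.
  have key : ∀ k : ℕ, (∃ w : Γ.Walk (c 0) (c 1), w.Composes (c '' Icc 0 1)) ∨
      ∃ (y : M) (w : Γ.Walk (c 0) y), w.InArc c ∧ w.edgeList.length = k := by
    intro k
    induction k with
    | zero => exact Or.inr ⟨_, .nil, ⟨by simp [Walk.edgeList], by simp [Walk.edgeList]⟩, rfl⟩
    | succ k ih =>
      rcases ih with h | ⟨y, w, hw, hk⟩
      · exact Or.inl h
      obtain ⟨s, hs, rfl, hu⟩ := Walk.InArc.exists_end hc w rfl hw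
      rcases eq_or_lt_of_le hs.2 with rfl | hs1
      · left
        refine ⟨w, hw.1, ?_⟩
        have hne : w.edgeList ≠ [] := by
          intro h
          rw [h] at hu
          have h1 : c 1 ∈ c '' Icc 0 1 := ⟨1, right_mem_Icc.2 zero_le_one, rfl⟩
          rw [← hu] at h1
          simp only [List.not_mem_nil, iUnion_of_empty, iUnion_empty, empty_union,
            mem_singleton_iff] at h1
          exact one_ne_zero (hc.injOn (right_mem_Icc.2 zero_le_one) (left_mem_Icc.2 zero_le_one) h1)
        have hcl : IsClosed (⋃ d ∈ w.edgeList, d.1) :=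
          (List.finite_toSet w.edgeList).isClosed_biUnion fun d _ => (Γ.isEdge d.1 d.2).isClosed
        refine Subset.antisymm (iUnion₂_subset hw.2) ?_
        -- The description of the covered part includes the point `c 0` separately; taking closures
        -- shows that the edges themselves contain it.
        have hsub : c '' Ioo 0 1 ⊆ ⋃ d ∈ w.edgeList, d.1 := by
          rintro _ ⟨t, ht, rfl⟩
          have h1 : c t ∈ c '' Icc 0 1 := ⟨t, Ioo_subset_Icc_self ht, rfl⟩
          rw [← hu] at h1
          rcases h1 with h1 | h1
          · exact h1
          · exact absurd (hc.injOn (Ioo_subset_Icc_self ht) (left_mem_Icc.2 zero_le_one) h1) ht.1.ne'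
        have h2 := ContinuousOn.image_closure (s := Ioo (0 : ℝ) 1) (f := c) (by
          rw [closure_Ioo zero_ne_one]
          exact hc.continuousOn)
        rw [closure_Ioo zero_ne_one] at h2
        exact h2.trans (closure_minimal hsub hcl)
      · right
        have hex : ∃ d : Γ.Edge, ∃ a b, 0 ≤ a ∧ a ≤ s ∧ s < b ∧ b ≤ 1 ∧ d.1 = c '' Icc a b ∧
            endpoints n d.1 = {c a, c b} := by
          -- Otherwise each of the finitely many edges inside the arc misses an interval to the
          -- right of `s`; a point in the shortest such interval is not covered.
          by_contra hno
          push Not at hno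
          have hfin : ∀ d : Γ.Edge, ∃ t, s < t ∧ t ≤ 1 ∧
              (d.1 ⊆ c '' Icc 0 1 → ∀ r, s < r → r < t → c r ∉ d.1) := by
            intro d
            by_cases hd : d.1 ⊆ c '' Icc 0 1
            · obtain ⟨a, b, ha, hab, hb, h1, h2⟩ :=
                (Γ.isEdge d.1 d.2).exists_Icc_of_subset hc hd
              rcases le_or_gt a s with has | has
              · have hbs : b ≤ s := by
                  by_contra hbs
                  exact hno d a b ha has (not_le.1 hbs) hb h1 h2
                refine ⟨1, hs1, le_rfl, fun _ r hr hr1 hrd => ?_⟩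
                rw [h1] at hrd
                obtain ⟨t, ht, htr⟩ := hrd
                have := hc.injOn (Icc_subset_unit ha hb ht) ⟨hs.1.trans hr.le, hr1.le⟩ htr
                linarith [ht.2]
              · refine ⟨a, has, hab.le.trans hb, fun _ r hr hra hrd => ?_⟩
                rw [h1] at hrd
                obtain ⟨t, ht, htr⟩ := hrd
                have := hc.injOn (Icc_subset_unit ha hb ht)
                  ⟨hs.1.trans hr.le, hra.le.trans (hab.le.trans hb)⟩ htr
                linarith [ht.1]
            · exact ⟨1, hs1, le_rfl, fun h => absurd h hd⟩
          choose t ht ht1 htd using hfin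
          have hm : ∃ m, s < m ∧ m ≤ 1 ∧ ∀ d, m ≤ t d := by
            rcases isEmpty_or_nonempty Γ.Edge with hE | hE
            · exact ⟨1, hs1, le_rfl, fun d => hE.elim d⟩
            · obtain ⟨d, hd⟩ := Finite.exists_min t
              exact ⟨t d, ht d, ht1 d, hd⟩
          obtain ⟨m, hsm, hm1, hmt⟩ := hm
          obtain ⟨d, hd, hxd, hdc⟩ := hcov (c ((s + m) / 2)) ⟨(s + m) / 2, ⟨by linarith [hs.1],
            by linarith⟩, rfl⟩
          exact htd ⟨d, hd⟩ hdc ((s + m) / 2) (by linarith) (by linarith [hmt ⟨d, hd⟩]) hxd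
        obtain ⟨d, a, b, ha, has, hsb, hb, hd, hend⟩ := hex
        have hdL : d ∉ w.edgeList := by
          intro hdw
          have h1 : c b ∈ c '' Icc 0 s := by
            rw [← hu]
            exact Or.inl (mem_iUnion₂.2 ⟨d, hdw, hd ▸ ⟨b, ⟨(has.trans hsb.le), le_rfl⟩, rfl⟩⟩)
          obtain ⟨t, ht, htb⟩ := h1
          have := hc.injOn (Icc_subset_unit le_rfl hs.2 ht) ⟨ha.trans (has.trans hsb.le), hb⟩ htb
          linarith [ht.2]
        have has' : a = s := by
          by_contra hne
          have hlt := lt_of_le_of_ne has hne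
          have h1 : (c '' Icc a s).Infinite := (Icc_infinite hlt).image
            (hc.injOn.mono (Icc_subset_unit ha hs.2))
          refine h1 ((Γ.finite_inter_of_notMem hdL (c 0)).subset (subset_inter ?_ ?_))
          · rw [hd]; exact image_mono (Icc_subset_Icc_right hsb.le)
          · rw [hu]; exact image_mono (Icc_subset_Icc_left ha)
        subst has'
        have hdsub : d.1 ⊆ c '' Icc 0 1 := by rw [hd]; exact image_mono (Icc_subset_unit ha hb)
        have hgood : (d :: w.edgeList).Nodup ∧ ∀ f ∈ d :: w.edgeList, f.1 ⊆ c '' Icc 0 1 := by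
          refine ⟨List.nodup_cons.2 ⟨hdL, hw.1⟩, fun f hf => ?_⟩
          rcases List.mem_cons.1 hf with rfl | hf
          · exact hdsub
          · exact hw.2 f hf
        have hmem : c a ∈ ({Γ.src d, Γ.tgt d} : Set M) := by
          rw [← Γ.endpoints_edge, hend]; simp
        rcases hmem with h | h
        · refine ⟨_, Walk.forward d (h ▸ w), ?_⟩
          have hl : (h ▸ w : Γ.Walk (c 0) (Γ.src d)).edgeList = w.edgeList := by
            clear * -
            generalize Γ.src d = y at h
            subst h; rfl
          refine ⟨?_, by simp [Walk.edgeList, hl, hk]⟩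
          unfold Walk.InArc
          simp only [Walk.edgeList, hl]
          exact hgood
        · rw [mem_singleton_iff] at h
          refine ⟨_, Walk.backward d (h ▸ w), ?_⟩
          have hl : (h ▸ w : Γ.Walk (c 0) (Γ.tgt d)).edgeList = w.edgeList := by
            clear * -
            generalize Γ.tgt d = y at h
            subst h; rfl
          refine ⟨?_, by simp [Walk.edgeList, hl, hk]⟩
          unfold Walk.InArc
          simp only [Walk.edgeList, hl]
          exact hgood
  rcases key (Fintype.card Γ.Edge + 1) with h | ⟨y, w, hw, hk⟩
  · exact h
  · have := hw.1.length_le_card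
    omega

/-- `γ ≤ γ'` if and only if each edge of `γ` is a union of edges of `γ'`. -/
theorem le_iff : γ ≤ γ' ↔ ∀ e ∈ γ.edges, ∀ x ∈ e, ∃ d ∈ γ'.edges, x ∈ d ∧ d ⊆ e := by
  constructor
  · intro h e he x hx
    have hw := composes_walk h ⟨e, he⟩
    have hx' : x ∈ ⋃ d ∈ (walk h ⟨e, he⟩).edgeList, d.1 := by rw [hw.2]; exact hx
    obtain ⟨d, hd, hxd⟩ := mem_iUnion₂.1 hx'
    exact ⟨d.1, d.2, hxd, hw.subset hd⟩
  · intro h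
    refine ⟨fun e => ?_, ?_⟩
    · have := exists_composes (Γ := γ') (γ.isAnalyticArc_param e) (by
        rw [γ.image_param]; exact h e.1 e.2)
      rw [γ.image_param] at this
      exact this
    · rintro v ⟨e, he, hv⟩
      obtain ⟨d, hd, hvd, hde⟩ := h e he v (endpoints_subset e hv)
      obtain ⟨c, hc, rfl, hc0⟩ := exists_arc_of_mem_endpoints hv
      obtain ⟨a, b, ha, hab, hb, h1, h2⟩ := (γ'.isEdge d hd).exists_Icc_of_subset hc hde
      refine ⟨d, hd, ?_⟩
      rw [h1, ← hc0] at hvd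
      obtain ⟨t, ht, ht0⟩ := hvd
      have h3 := hc.injOn (Icc_subset_unit ha hb ht) (left_mem_Icc.2 zero_le_one) ht0
      have h4 : a = 0 := le_antisymm (h3 ▸ ht.1) ha
      rw [h2, ← hc0, h4]
      simp

theorem le_refl (γ : Graph n M) : γ ≤ γ := le_iff.2 fun e he x hx => ⟨e, he, hx, Subset.rfl⟩

theorem le_trans (h : γ ≤ γ') (h' : γ' ≤ γ'') : γ ≤ γ'' :=
  le_iff.2 fun e he x hx => by
    obtain ⟨d, hd, hxd, hde⟩ := le_iff.1 h e he x hx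
    obtain ⟨f, hf, hxf, hfd⟩ := le_iff.1 h' d hd x hxd
    exact ⟨f, hf, hxf, hfd.trans hde⟩

/-- The edges in `S` can be cut into the edges of a graph. -/
theorem exists_refinement {S : Set (Set M)} (hfin : S.Finite) (hne : S.Nonempty)
    (hedge : ∀ e ∈ S, IsEdge n e)
    (hcl : ∀ e ∈ S, ∀ v ∈ endpoints n e, ∃ e' ∈ S, v ∈ endpoints n e' ∧ (e ∩ e').Finite)
    {V₀ : Set M} (hV₀ : V₀.Finite) :
    ∃ γ : Graph n M, (∀ e ∈ S, ∀ x ∈ e, ∃ d ∈ γ.edges, x ∈ d ∧ d ⊆ e) ∧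
      (∀ d ∈ γ.edges, ∃ e ∈ S, d ⊆ e) ∧ ∀ d ∈ γ.edges, d ∩ V₀ ⊆ endpoints n d := by
  obtain ⟨V, hV, hV0, hS⟩ := exists_cuts hfin hedge hV₀
  obtain ⟨γ, hγ⟩ := exists_graph_of_pieces hfin hne hS hV hcl
  refine ⟨γ, fun e he x hx => ?_, fun d hd => ((hγ d).1 hd).2, fun d hd => ?_⟩
  · obtain ⟨p, hp, hpe, hxp⟩ := exists_piece_mem hS hV he hx
    exact ⟨p, (hγ p).2 ⟨hp, e, he, hpe⟩, hxp, hpe⟩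
  · rw [← ((hγ d).1 hd).1.2]
    exact inter_subset_inter_right _ hV0

/-- Cut all edges of both graphs at their mutual intersections; the neighbours needed at the end
points are those of the original graphs. -/
theorem exists_ge_pair (γ γ' : Graph n M) : ∃ Γ : Graph n M, γ ≤ Γ ∧ γ' ≤ Γ := by
  obtain ⟨Γ, h1, -, -⟩ := exists_refinement (n := n)
    (S := (γ.edges : Set (Set M)) ∪ γ'.edges) (V₀ := ∅) (γ.edges.finite_toSet.union
    γ'.edges.finite_toSet) (γ.nonempty.to_set.mono subset_union_left) (by
      rintro e (he | he)
      · exact γ.isEdge e he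
      · exact γ'.isEdge e he) (by
      rintro e (he | he) v hv
      · obtain ⟨e', he', hne, hv'⟩ := γ.closed e he v hv
        exact ⟨e', Or.inl he', hv', γ.finite_inter (e := ⟨e, he⟩) (e' := ⟨e', he'⟩)
          fun h => hne (congrArg Subtype.val h).symm⟩
      · obtain ⟨e', he', hne, hv'⟩ := γ'.closed e he v hv
        exact ⟨e', Or.inr he', hv', γ'.finite_inter (e := ⟨e, he⟩) (e' := ⟨e', he'⟩)
          fun h => hne (congrArg Subtype.val h).symm⟩) finite_empty
  exact ⟨Γ, le_iff.2 fun e he => h1 e (Or.inl he), le_iff.2 fun e he => h1 e (Or.inr he)⟩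

/-- Concatenation of edge paths. -/
def Walk.append {x y : M} (w : Γ.Walk x y) : {z : M} → Γ.Walk y z → Γ.Walk x z
  | _, .nil => w
  | _, .forward e w' => .forward e (w.append w')
  | _, .backward e w' => .backward e (w.append w')

/-- Reversal of edge paths. -/
def Walk.reverse {x : M} : {y : M} → Γ.Walk x y → Γ.Walk y x
  | _, .nil => .nil
  | _, .forward e w => (Walk.backward e .nil).append w.reverse
  | _, .backward e w => (Walk.forward e .nil).append w.reverse

theorem Walk.edgeList_append {x y z : M} (w : Γ.Walk x y) (w' : Γ.Walk y z) :
    (w.append w').edgeList = w'.edgeList ++ w.edgeList := by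
  induction w' with
  | nil => rfl
  | forward e w' ih => simp [Walk.append, Walk.edgeList, ih]
  | backward e w' ih => simp [Walk.append, Walk.edgeList, ih]

theorem Walk.edgeList_reverse {x y : M} (w : Γ.Walk x y) :
    w.reverse.edgeList = w.edgeList.reverse := by
  induction w with
  | nil => rfl
  | forward e w ih => simp [Walk.reverse, Walk.edgeList, Walk.edgeList_append, ih]
  | backward e w ih => simp [Walk.reverse, Walk.edgeList, Walk.edgeList_append, ih]

/-- The decomposition of an edge path of `γ` into edges of a larger graph. -/
def Walk.refine (h : γ ≤ γ') {x : M} : {y : M} → γ.Walk x y → γ'.Walk x y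
  | _, .nil => .nil
  | _, .forward e w => (w.refine h).append (walk h e)
  | _, .backward e w => (w.refine h).append (walk h e).reverse

theorem Walk.mem_edgeList_refine (h : γ ≤ γ') {x y : M} (w : γ.Walk x y) (d : γ'.Edge) :
    d ∈ (w.refine h).edgeList ↔ ∃ f ∈ w.edgeList, d ∈ (walk h f).edgeList := by
  induction w with
  | nil => simp [Walk.refine, Walk.edgeList]
  | forward e w ih => simp [Walk.refine, Walk.edgeList, Walk.edgeList_append, ih]
  | backward e w ih =>
    simp [Walk.refine, Walk.edgeList, Walk.edgeList_append, Walk.edgeList_reverse, ih]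

theorem eq_of_mem_walk (h : γ ≤ γ') {e f : γ.Edge} {d : γ'.Edge} (he : d ∈ (walk h e).edgeList)
    (hf : d ∈ (walk h f).edgeList) : e = f :=
  γ.eq_of_infinite_inter ((γ'.infinite_edge d).mono
    (subset_inter ((composes_walk h e).subset he) ((composes_walk h f).subset hf)))

theorem Walk.nodup_refine (h : γ ≤ γ') {x y : M} (w : γ.Walk x y) (hw : w.edgeList.Nodup) :
    (w.refine h).edgeList.Nodup := by
  have hdis : ∀ {y : M} (e : γ.Edge) (w : γ.Walk x y), e ∉ w.edgeList →
      ∀ d ∈ (walk h e).edgeList, d ∉ (w.refine h).edgeList := by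
    intro y e w he d hd hd'
    obtain ⟨f, hf, hdf⟩ := (w.mem_edgeList_refine h d).1 hd'
    exact he (eq_of_mem_walk h hd hdf ▸ hf)
  induction w with
  | nil => simp [Walk.refine, Walk.edgeList]
  | forward e w ih =>
    have hw' := List.nodup_cons.1 hw
    simp only [Walk.refine, Walk.edgeList_append]
    exact (composes_walk h e).1.append (ih hw'.2) fun d hd hd' => hdis e w hw'.1 d hd hd'
  | backward e w ih =>
    have hw' := List.nodup_cons.1 hw
    simp only [Walk.refine, Walk.edgeList_append, Walk.edgeList_reverse]
    exact (List.nodup_reverse.2 (composes_walk h e).1).append (ih hw'.2)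
      fun d hd hd' => hdis e w hw'.1 d (List.mem_reverse.1 hd) hd'

theorem Walk.Composes.refine (h : γ ≤ γ') {x y : M} {w : γ.Walk x y} {e : Set M}
    (hw : w.Composes e) : (w.refine h).Composes e := by
  refine ⟨w.nodup_refine h hw.1, ?_⟩
  rw [← hw.2]
  ext p
  simp only [mem_iUnion, Walk.mem_edgeList_refine, exists_prop]
  constructor
  · rintro ⟨d, ⟨f, hf, hd⟩, hp⟩
    exact ⟨f, hf, (composes_walk h f).subset hd hp⟩
  · rintro ⟨f, hf, hp⟩
    rw [← (composes_walk h f).2] at hp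
    obtain ⟨d, hd, hpd⟩ := mem_iUnion₂.1 hp
    exact ⟨d, ⟨f, hf, hd⟩, hpd⟩

/-- Both walks decompose the same edge, and decompositions are unique. This makes the projections
compose. -/
theorem walk_trans (h : γ ≤ γ') (h' : γ' ≤ γ'') (e : γ.Edge) :
    (walk h e).refine h' = walk (le_trans h h') e :=
  ((composes_walk h e).refine h').unique (composes_walk _ e)

/-- The chosen parametrization depends only on the edge as a set, so both graphs orient a common
edge alike. -/
theorem walk_eq_single (h : γ ≤ γ') {e : Set M} (he : e ∈ γ.edges) (he' : e ∈ γ'.edges) :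
    walk h ⟨e, he⟩ = Walk.forward (γ := γ') (x := γ'.src ⟨e, he'⟩) ⟨e, he'⟩ .nil := by
  refine (composes_walk h ⟨e, he⟩).unique (w' := Walk.forward (γ := γ') (x := γ'.src ⟨e, he'⟩)
    ⟨e, he'⟩ .nil) ⟨by simp [Walk.edgeList], ?_⟩
  simp [Walk.edgeList]

theorem edgeList_walk_ne_nil (h : γ ≤ γ') (e : γ.Edge) : (walk h e).edgeList ≠ [] := by
  intro hn
  have h1 := (composes_walk h e).2
  rw [hn] at h1
  simp only [List.not_mem_nil, iUnion_of_empty, iUnion_empty] at h1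
  exact (γ.infinite_edge e).nonempty.ne_empty h1.symm

end Graph

end Walks

end GenConn

end

noncomputable section

set_option linter.unusedSectionVars false
set_option linter.unusedVariables false

namespace GenConn

/-! ### Fibre isomorphisms as a Lie group with Haar measure -/

section FiberIsoGroup

open PrincipalBundle

variable {n : ℕ} {M : Type*} [TopologicalSpace M] [ChartedSpace (EuclideanSpace ℝ (Fin n)) M]
  {E : Type*} [NormedAddCommGroup E] [NormedSpace ℝ E]
  {G : Type*} [Group G] [TopologicalSpace G] [ChartedSpace E G]
  {F : Type*} [NormedAddCommGroup F] [NormedSpace ℝ F]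
  {P : Type*} [TopologicalSpace P] [ChartedSpace F P]
  {B : PrincipalBundle n M E G F P} {x y z : M}

namespace PrincipalBundle.FiberIso

theorem chart_refl (B : PrincipalBundle n M E G F P) (x : M) : chart B x x (refl B x) = 1 :=
  B.fiberDiv_eq (Subtype.ext (B.act_one _))

/-- The order is reversed: the chart multiplies base points from the right, while `trans` applies
its first argument first. -/
theorem chart_trans (φ : B.FiberIso x y) (ψ : B.FiberIso y z) :
    chart B x z (φ.trans ψ) = chart B y z ψ * chart B x y φ := by
  apply B.fiberDiv_eq
  rw [B.actFiber_mul]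
  change B.actFiber (B.actFiber _ (B.fiberDiv _ _)) (B.fiberDiv _ _) = _
  rw [B.act_fiberDiv, ← ψ.map_act, B.act_fiberDiv]
  rfl

theorem symm_trans_self (φ : B.FiberIso x y) : φ.symm.trans φ = refl B y := by
  ext p : 2; simp [trans, symm, refl]

theorem trans_symm_self (φ : B.FiberIso x y) : φ.trans φ.symm = refl B x := by
  ext p : 2; simp [trans, symm, refl]

theorem trans_assoc {w : M} (φ : B.FiberIso x y) (ψ : B.FiberIso y z) (χ : B.FiberIso z w) :
    (φ.trans ψ).trans χ = φ.trans (ψ.trans χ) := rfl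

theorem refl_trans (φ : B.FiberIso x y) : (refl B x).trans φ = φ := rfl

theorem symm_symm (φ : B.FiberIso x y) : φ.symm.symm = φ := rfl

theorem symm_trans (φ : B.FiberIso x y) (ψ : B.FiberIso y z) :
    (φ.trans ψ).symm = ψ.symm.trans φ.symm := rfl

theorem chart_symm (φ : B.FiberIso x y) : chart B y x φ.symm = (chart B x y φ)⁻¹ := by
  rw [eq_inv_iff_mul_eq_one, ← chart_trans, trans_symm_self, chart_refl]

/-- The group structure transported by the group valued chart. -/
instance : Group (B.FiberIso x y) := (chart B x y).group

variable (B x y) in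
/-- The group valued chart as an isomorphism of groups. -/
def chartMulEquiv : B.FiberIso x y ≃* G := (chart B x y).mulEquiv

theorem chart_mul (φ ψ : B.FiberIso x y) : chart B x y (φ * ψ) = chart B x y φ * chart B x y ψ :=
  map_mul (chartMulEquiv B x y) φ ψ

theorem chart_inv (φ : B.FiberIso x y) : chart B x y φ⁻¹ = (chart B x y φ)⁻¹ :=
  map_inv (chartMulEquiv B x y) φ

/-- Left multiplication is composition with an automorphism of the final fibre. -/
theorem mul_eq_trans (k φ : B.FiberIso x y) :
    k * φ = φ.trans ((chart B y y).symm (chart B x y k)) := by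
  apply (chart B x y).injective
  rw [chart_mul, chart_trans, Equiv.apply_symm_apply]

/-- Right multiplication is composition with an automorphism of the initial fibre. -/
theorem mul_eq_trans' (φ k : B.FiberIso x y) :
    φ * k = ((chart B x x).symm (chart B x y k)).trans φ := by
  apply (chart B x y).injective
  rw [chart_mul, chart_trans, Equiv.apply_symm_apply]

theorem trans_eq_mul (φ : B.FiberIso x y) (κ : B.FiberIso y y) :
    φ.trans κ = (chart B x y).symm (chart B y y κ) * φ := by
  rw [mul_eq_trans, Equiv.apply_symm_apply, Equiv.symm_apply_apply]

theorem trans_eq_mul' (κ : B.FiberIso x x) (φ : B.FiberIso x y) :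
    κ.trans φ = φ * (chart B x y).symm (chart B x x κ) := by
  rw [mul_eq_trans', Equiv.apply_symm_apply, Equiv.symm_apply_apply]

/-- The charts of the source are those of `G` composed with this map, so in charts it is the
identity. -/
theorem contMDiff_chart {k : WithTop ℕ∞} : ContMDiff 𝓘(ℝ, E) 𝓘(ℝ, E) k (chart B x y) := by
  intro φ
  rw [contMDiffAt_iff]
  refine ⟨(chartHomeo B x y).continuous.continuousAt, ?_⟩
  refine (contDiffWithinAt_id (s := range 𝓘(ℝ, E))).congr_of_eventuallyEq ?_ ?_
  · filter_upwards [extChartAt_target_mem_nhdsWithin φ] with v hv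
    exact (extChartAt 𝓘(ℝ, E) φ).right_inv hv
  · exact (extChartAt 𝓘(ℝ, E) φ).right_inv (mem_extChartAt_target φ)

theorem contMDiff_chart_symm {k : WithTop ℕ∞} :
    ContMDiff 𝓘(ℝ, E) 𝓘(ℝ, E) k (chart B x y).symm := by
  intro g
  rw [contMDiffAt_iff]
  refine ⟨(chartHomeo B x y).symm.continuous.continuousAt, ?_⟩
  have key : ∀ v ∈ (extChartAt 𝓘(ℝ, E) g).target, extChartAt 𝓘(ℝ, E) ((chart B x y).symm g)
      ((chart B x y).symm ((extChartAt 𝓘(ℝ, E) g).symm v)) = v := by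
    intro v hv
    have h1 : extChartAt 𝓘(ℝ, E) ((chart B x y).symm g)
      ((chart B x y).symm ((extChartAt 𝓘(ℝ, E) g).symm v)) =
      extChartAt 𝓘(ℝ, E) (chart B x y ((chart B x y).symm g))
        (chart B x y ((chart B x y).symm ((extChartAt 𝓘(ℝ, E) g).symm v))) := rfl
    rw [h1, Equiv.apply_symm_apply, Equiv.apply_symm_apply]
    exact (extChartAt 𝓘(ℝ, E) g).right_inv hv
  refine (contDiffWithinAt_id (s := range 𝓘(ℝ, E))).congr_of_eventuallyEq ?_ ?_
  · filter_upwards [extChartAt_target_mem_nhdsWithin g] with v hv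
    exact key v hv
  · exact key _ (mem_extChartAt_target g)

instance [CompactSpace G] : CompactSpace (B.FiberIso x y) := (chartHomeo B x y).symm.compactSpace

instance [T2Space G] : T2Space (B.FiberIso x y) := (chartHomeo B x y).symm.t2Space

instance [SecondCountableTopology G] : SecondCountableTopology (B.FiberIso x y) :=
  (chartHomeo B x y).secondCountableTopology

instance [IsTopologicalGroup G] : IsTopologicalGroup (B.FiberIso x y) :=
  topologicalGroup_induced (chartMulEquiv B x y)

section Smooth

variable {E' : Type*} [NormedAddCommGroup E'] [NormedSpace ℝ E'] {H' : Type*} [TopologicalSpace H']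
  {I' : ModelWithCorners ℝ E' H'} {N : Type*} [TopologicalSpace N] [ChartedSpace H' N]

variable [LieGroup 𝓘(ℝ, E) ∞ G]

instance : LieGroup 𝓘(ℝ, E) ∞ (B.FiberIso x y) where
  contMDiff_mul := by
    have h : (fun p : B.FiberIso x y × B.FiberIso x y => p.1 * p.2) = fun p =>
        (chart B x y).symm (chart B x y p.1 * chart B x y p.2) := by
      funext p
      rw [← chart_mul, Equiv.symm_apply_apply]
    rw [h]
    exact contMDiff_chart_symm.comp
      ((contMDiff_chart.comp contMDiff_fst).mul (contMDiff_chart.comp contMDiff_snd))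
  contMDiff_inv := by
    have h : (fun p : B.FiberIso x y => p⁻¹) = fun p =>
        (chart B x y).symm (chart B x y p)⁻¹ := by
      funext p
      rw [← chart_inv, Equiv.symm_apply_apply]
    rw [h]
    exact contMDiff_chart_symm.comp contMDiff_chart.inv

theorem contMDiff_trans {f : N → B.FiberIso x y} {g : N → B.FiberIso y z}
    (hf : ContMDiff I' 𝓘(ℝ, E) ∞ f) (hg : ContMDiff I' 𝓘(ℝ, E) ∞ g) :
    ContMDiff I' 𝓘(ℝ, E) ∞ fun p => (f p).trans (g p) := by
  have h : (fun p => (f p).trans (g p)) = fun p =>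
      (chart B x z).symm (chart B y z (g p) * chart B x y (f p)) := by
    funext p
    rw [← chart_trans, Equiv.symm_apply_apply]
  rw [h]
  exact contMDiff_chart_symm.comp ((contMDiff_chart.comp hg).mul (contMDiff_chart.comp hf))

theorem contMDiff_symm {f : N → B.FiberIso x y} (hf : ContMDiff I' 𝓘(ℝ, E) ∞ f) :
    ContMDiff I' 𝓘(ℝ, E) ∞ fun p => (f p).symm := by
  have h : (fun p => (f p).symm) = fun p => (chart B y x).symm (chart B x y (f p))⁻¹ := by
    funext p
    rw [← chart_symm, Equiv.symm_apply_apply]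
  rw [h]
  exact contMDiff_chart_symm.comp (contMDiff_chart.comp hf).inv

end Smooth

section Haar

variable [IsTopologicalGroup G] [CompactSpace G] [MeasurableSpace G] [BorelSpace G]

instance : (haar B x y).IsHaarMeasure := by
  have : (haar B x y) = (Measure.haarMeasure (⊤ : TopologicalSpace.PositiveCompacts G)).map
    (chartMulEquiv B x y).symm := rfl
  rw [this]
  exact MulEquiv.isHaarMeasure_map _ _ (chartHomeo B x y).symm.continuous
    (chartHomeo B x y).continuous

instance : IsProbabilityMeasure (haar B x y) := by
  have h1 : IsProbabilityMeasure (Measure.haarMeasure (⊤ : TopologicalSpace.PositiveCompacts G)) :=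
    ⟨by rw [← TopologicalSpace.PositiveCompacts.coe_top (α := G)]; exact Measure.haarMeasure_self⟩
  exact Measure.isProbabilityMeasure_map (chartHomeo B x y).symm.continuous.measurable.aemeasurable

end Haar

end PrincipalBundle.FiberIso

end FiberIsoGroup

/-! ### Projections and gauge transformations on the spaces of connections -/

section Connections

open PrincipalBundle FiberIso GenConn.Graph

variable {n : ℕ} {M : Type*} [TopologicalSpace M] [ChartedSpace (EuclideanSpace ℝ (Fin n)) M]
  {E : Type*} [NormedAddCommGroup E] [NormedSpace ℝ E]
  {G : Type*} [Group G] [TopologicalSpace G] [ChartedSpace E G]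
  {F : Type*} [NormedAddCommGroup F] [NormedSpace ℝ F]
  {P : Type*} [TopologicalSpace P] [ChartedSpace F P]
  {B : PrincipalBundle n M E G F P} {x y z : M} {γ γ' γ'' : Graph n M}

theorem transport_append (a : Conn B γ) (w : γ.Walk x y) (w' : γ.Walk y z) :
    transport a (w.append w') = (transport a w).trans (transport a w') := by
  induction w' with
  | nil => rfl
  | forward e w' ih => simp only [Walk.append, transport, ih]; rfl
  | backward e w' ih => simp only [Walk.append, transport, ih]; rfl

theorem transport_reverse (a : Conn B γ) (w : γ.Walk x y) :
    transport a w.reverse = (transport a w).symm := by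
  induction w with
  | nil => rfl
  | forward e w ih => simp only [Walk.reverse, transport, transport_append, ih]; rfl
  | backward e w ih => simp only [Walk.reverse, transport, transport_append, ih]; rfl

theorem transport_refine (h : γ ≤ γ') (a : Conn B γ') (w : γ.Walk x y) :
    transport a (w.refine h) = transport (project B h a) w := by
  induction w with
  | nil => rfl
  | forward e w ih => simp only [Walk.refine, transport, transport_append, ih]; rfl
  | backward e w ih =>
    simp only [Walk.refine, transport, transport_append, transport_reverse, ih]; rfl

theorem transport_congr {a b : Conn B γ} (w : γ.Walk x y) (h : ∀ d ∈ w.edgeList, a d = b d) :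
    transport a w = transport b w := by
  induction w with
  | nil => rfl
  | forward e w ih =>
    simp only [Walk.edgeList, List.mem_cons, forall_eq_or_imp] at h
    simp only [transport, ih h.2, h.1]
  | backward e w ih =>
    simp only [Walk.edgeList, List.mem_cons, forall_eq_or_imp] at h
    simp only [transport, ih h.2, h.1]

theorem project_congr (h : γ ≤ γ') {a b : Conn B γ'} (e : γ.Edge)
    (hab : ∀ d ∈ (walk h e).edgeList, a d = b d) : project B h a e = project B h b e :=
  transport_congr _ hab

theorem continuous_limit_at (γ : Graph n M) : Continuous fun A : Limit B => A.at γ :=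
  (continuous_apply γ).comp continuous_subtype_val

theorem project_at (h : γ ≤ γ') (A : Limit B) : project B h (A.at γ') = A.at γ := A.2 γ γ' h

theorem at_gaugeAct (g : Gauge B) (A : Limit B) : (A.gaugeAct g).at γ = gaugeAct g (A.at γ) := rfl

section Hausdorff

variable [T2Space M] [IsManifold (𝓡 n) ω M]

theorem project_trans (h : γ ≤ γ') (h' : γ' ≤ γ'') (a : Conn B γ'') :
    project B h (project B h' a) = project B (Graph.le_trans h h') a := by
  funext e
  change transport _ _ = transport _ _
  rw [← transport_refine, walk_trans]

theorem project_common (h : γ ≤ γ') (a : Conn B γ') {e : Set M} (he : e ∈ γ.edges)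
    (he' : e ∈ γ'.edges) : project B h a ⟨e, he⟩ = a ⟨e, he'⟩ := by
  change transport a _ = _
  rw [walk_eq_single h he he']
  rfl

theorem project_refl (h : γ ≤ γ) (a : Conn B γ) : project B h a = a :=
  funext fun e => project_common h a e.2 e.2

variable [IsTopologicalGroup G]

open Classical in
-- Only the last edge of the walk is changed, and it does not occur elsewhere in the walk. If it is
-- traversed forwards the change is a left translation, if backwards a right translation.
theorem exists_lift_walk (w : γ.Walk x y) (hw : w.edgeList.Nodup) (hne : w.edgeList ≠ []) :
    ∃ d ∈ w.edgeList, ∀ κ : B.FiberIso y y, ∃ k : B.FiberIso (γ.src d) (γ.tgt d),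
      (∀ a : Conn B γ, transport (Pi.mulSingle d k * a) w = (transport a w).trans κ) ∨
      ∀ a : Conn B γ, transport (a * Pi.mulSingle d k) w = (transport a w).trans κ := by
  have hmem : ∀ {y : M} (d : γ.Edge) (w : γ.Walk x y), (d :: w.edgeList).Nodup →
      ∀ d' ∈ w.edgeList, d' ≠ d := fun d w hnd d' hd' hdd =>
    (List.nodup_cons.1 hnd).1 (hdd ▸ hd')
  cases w with
  | nil => exact absurd rfl hne
  | forward d w =>
    refine ⟨d, by simp [Walk.edgeList], fun κ =>
      ⟨(chart B _ _).symm (chart B _ _ κ), Or.inl fun a => ?_⟩⟩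
    simp only [transport, Pi.mul_apply, Pi.mulSingle_eq_same, ← trans_eq_mul]
    rw [transport_congr (b := a) w fun d' hd' => by
      rw [Pi.mul_apply, Pi.mulSingle_eq_of_ne (hmem d w hw d' hd'), one_mul]]
    rfl
  | backward d w =>
    refine ⟨d, by simp [Walk.edgeList], fun κ =>
      ⟨(chart B _ _).symm (chart B _ _ κ.symm), Or.inr fun a => ?_⟩⟩
    simp only [transport, Pi.mul_apply, Pi.mulSingle_eq_same, ← trans_eq_mul']
    rw [transport_congr (b := a) w fun d' hd' => by
      rw [Pi.mul_apply, Pi.mulSingle_eq_of_ne (hmem d w hw d' hd'), mul_one]]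
    rfl

open Classical in
/-- A translation at one edge lifts to a translation at one edge of a larger graph. -/
theorem exists_lift (h : γ ≤ γ') (e : γ.Edge) :
    ∃ d ∈ (walk h e).edgeList, ∀ k : B.FiberIso (γ.src e) (γ.tgt e),
      ∃ l : B.FiberIso (γ'.src d) (γ'.tgt d),
      (∀ a : Conn B γ', project B h (Pi.mulSingle d l * a) = Pi.mulSingle e k * project B h a) ∨
      ∀ a : Conn B γ', project B h (a * Pi.mulSingle d l) = Pi.mulSingle e k * project B h a := by
  obtain ⟨d, hd, hlift⟩ := exists_lift_walk (B := B) (walk h e) (composes_walk h e).1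
    (edgeList_walk_ne_nil h e)
  refine ⟨d, hd, fun k => ?_⟩
  obtain ⟨l, hl⟩ := hlift ((chart B _ _).symm (chart B _ _ k))
  refine ⟨l, ?_⟩
  have hother : ∀ (f : γ.Edge), f ≠ e → ∀ d' ∈ (walk h f).edgeList, d' ≠ d := by
    rintro f hf d' hd' rfl
    exact hf (eq_of_mem_walk h hd' hd)
  rcases hl with hl | hl
  · left
    intro a
    funext f
    by_cases hf : f = e
    · subst hf
      rw [Pi.mul_apply, Pi.mulSingle_eq_same, mul_eq_trans]
      exact hl a
    · rw [Pi.mul_apply, Pi.mulSingle_eq_of_ne hf, one_mul]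
      refine project_congr h f fun d' hd' => ?_
      rw [Pi.mul_apply, Pi.mulSingle_eq_of_ne (hother f hf d' hd'), one_mul]
  · right
    intro a
    funext f
    by_cases hf : f = e
    · subst hf
      rw [Pi.mul_apply, Pi.mulSingle_eq_same, mul_eq_trans]
      exact hl a
    · rw [Pi.mul_apply, Pi.mulSingle_eq_of_ne hf, one_mul]
      refine project_congr h f fun d' hd' => ?_
      rw [Pi.mul_apply, Pi.mulSingle_eq_of_ne (hother f hf d' hd'), mul_one]

/-- The elements whose left translation preserves the range form a submonoid. It contains the
translations at single edges by `exists_lift`, and these generate everything. -/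
theorem surjective_project (B : PrincipalBundle n M E G F P) (h : γ ≤ γ') :
    Function.Surjective (project B h) := by
  classical
  let S : Submonoid (Conn B γ) :=
    { carrier := {k | ∀ b ∈ range (project B h), k * b ∈ range (project B h)}
      one_mem' := fun b hb => by rwa [one_mul]
      mul_mem' := fun {k k'} hk hk' b hb => by rw [mul_assoc]; exact hk _ (hk' b hb) }
  have hS : ∀ k, k ∈ S := by
    intro k
    refine Submonoid.pi_mem_of_mulSingle_mem k fun e => ?_
    obtain ⟨d, -, hd⟩ := exists_lift (B := B) h e
    obtain ⟨l, hl | hl⟩ := hd (k e)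
    · rintro _ ⟨a, rfl⟩
      exact ⟨_, hl a⟩
    · rintro _ ⟨a, rfl⟩
      exact ⟨_, hl a⟩
  intro b
  have := hS (b * (project B h 1)⁻¹) _ ⟨1, rfl⟩
  rwa [inv_mul_cancel_right] at this

end Hausdorff

section Smooth

variable [LieGroup 𝓘(ℝ, E) ∞ G]

theorem contMDiff_transport (w : γ.Walk x y) :
    ContMDiff (model E γ) 𝓘(ℝ, E) ∞ fun a : Conn B γ => transport a w := by
  induction w with
  | nil => exact contMDiff_const
  | forward e w ih => exact contMDiff_trans ih (contMDiff_eval e)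
  | backward e w ih => exact contMDiff_trans ih (contMDiff_symm (contMDiff_eval e))

theorem contMDiff_project (h : γ ≤ γ') :
    ContMDiff (model E γ') (model E γ) ∞ (project B h) :=
  contMDiff_pi_iff.2 fun e => contMDiff_transport _

theorem contMDiff_gaugeAct (g : Gauge B) :
    ContMDiff (model E γ) (model E γ) ∞ (gaugeAct (γ := γ) g) :=
  contMDiff_pi_iff.2 fun e =>
    contMDiff_trans (contMDiff_trans contMDiff_const (contMDiff_eval e)) contMDiff_const

end Smooth

section Haar

variable [LieGroup 𝓘(ℝ, E) ∞ G] [IsTopologicalGroup G] [T2Space G] [CompactSpace G]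
  [SecondCountableTopology G] [MeasurableSpace G] [BorelSpace G]

instance : (haarOn B γ).IsHaarMeasure := by unfold haarOn; infer_instance

instance : IsProbabilityMeasure (haarOn B γ) := by unfold haarOn; infer_instance

theorem continuous_project (h : γ ≤ γ') : Continuous (project B h) :=
  (contMDiff_project h).continuous

theorem continuous_gaugeAct (g : Gauge B) : Continuous (gaugeAct (γ := γ) g) :=
  (contMDiff_gaugeAct g).continuous

/-- The same submonoid argument, applied to the translations that preserve the image measure:
translations at one edge lift, and Haar measure upstairs is invariant on both sides. The image is
thus a Haar probability measure. -/
theorem map_project [T2Space M] [IsManifold (𝓡 n) ω M] (h : γ ≤ γ') :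
    (haarOn B γ').map (project B h) = haarOn B γ := by
  classical
  have hm := (continuous_project (B := B) h).measurable
  have hr := isMulRightInvariant_of_compact (haarOn B γ')
  set ν := (haarOn B γ').map (project B h) with hν
  have hprob : IsProbabilityMeasure ν := Measure.isProbabilityMeasure_map hm.aemeasurable
  let S : Submonoid (Conn B γ) :=
    { carrier := {k | ν.map (k * ·) = ν}
      one_mem' := by simp [Measure.map_id']
      mul_mem' := fun {k k'} hk hk' => by
        have : (fun b : Conn B γ => k * k' * b) = (k * ·) ∘ (k' * ·) := by
          funext b; exact mul_assoc _ _ _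
        change ν.map _ = ν
        rw [this, ← Measure.map_map (measurable_const_mul k) (measurable_const_mul k'), hk', hk] }
  have hS : ∀ k, k ∈ S := by
    intro k
    refine Submonoid.pi_mem_of_mulSingle_mem k fun e => ?_
    obtain ⟨d, -, hd⟩ := exists_lift (B := B) h e
    change ν.map _ = ν
    rw [hν, Measure.map_map (measurable_const_mul _) hm]
    obtain ⟨l, hl | hl⟩ := hd (k e)
    · have h1 : ((Pi.mulSingle e (k e) : Conn B γ) * ·) ∘ project B h =
          project B h ∘ ((Pi.mulSingle d l : Conn B γ') * ·) := by
        funext a; exact (hl a).symm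
      rw [h1, ← Measure.map_map hm (measurable_const_mul _), map_mul_left_eq_self]
    · have h1 : ((Pi.mulSingle e (k e) : Conn B γ) * ·) ∘ project B h =
          project B h ∘ (· * (Pi.mulSingle d l : Conn B γ')) := by
        funext a; exact (hl a).symm
      rw [h1, ← Measure.map_map hm (measurable_mul_const _), map_mul_right_eq_self]
  have : ν.IsMulLeftInvariant := ⟨hS⟩
  have : ν.IsHaarMeasure := Measure.isHaarMeasure_of_isCompact_nonempty_interior _ univ
      isCompact_univ (by simp) (by simp) (by simp)
  exact Measure.isHaarMeasure_eq_of_isProbabilityMeasure _ _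

/-- A left translation combined with a right one, whence the invariance of Haar measure. -/
theorem gaugeAct_eq_mul (g : Gauge B) (a : Conn B γ) :
    gaugeAct g a = (fun e => (chart B _ _).symm (chart B _ _ (g (γ.tgt e)).symm)) * a *
      fun e => (chart B _ _).symm (chart B _ _ (g (γ.src e))) := by
  funext e
  rw [Pi.mul_apply, Pi.mul_apply, mul_assoc, ← trans_eq_mul', ← trans_eq_mul]
  rfl

theorem map_gaugeAct (g : Gauge B) : (haarOn B γ).map (gaugeAct g) = haarOn B γ := by
  have hr := isMulRightInvariant_of_compact (haarOn B γ)
  have h1 : gaugeAct (γ := γ) g = (fun a => a * fun e => (chart B _ _).symm (chart B _ _ (g (γ.src e)))) ∘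
      fun a => (fun e => (chart B _ _).symm (chart B _ _ (g (γ.tgt e)).symm)) * a := by
    funext a
    exact gaugeAct_eq_mul g a
  rw [h1, ← Measure.map_map (measurable_mul_const _) (measurable_const_mul _), map_mul_left_eq_self,
    map_mul_right_eq_self]

end Haar

end Connections

end GenConn

end

noncomputable section

set_option linter.unusedSectionVars false
set_option linter.unusedVariables false

namespace GenConn

/-! ### Measures from positive functionals -/

section Functionals

variable {X : Type*} [TopologicalSpace X] [T2Space X] [CompactSpace X] [MeasurableSpace X]
  [BorelSpace X]

/-- The integral of a continuous function on a compact space, as a functional. -/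
def toCompactlySupported (f : C(X, ℝ)) : CompactlySupportedContinuousMap X ℝ :=
  ⟨f, HasCompactSupport.of_compactSpace f⟩

theorem exists_measure_of_functional (Λ : C(X, ℝ) →ₗ[ℝ] ℝ) (hΛ : ∀ f, (∀ x, 0 ≤ f x) → 0 ≤ Λ f)
    (h1 : Λ 1 = 1) : ∃ μ : Measure X, IsProbabilityMeasure μ ∧ μ.Regular ∧
      ∀ f : C(X, ℝ), ∫ x, f x ∂μ = Λ f := by
  let L : CompactlySupportedContinuousMap X ℝ →ₗ[ℝ] ℝ :=
    { toFun := fun f => Λ f.toContinuousMap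
      map_add' := fun f g => map_add Λ f.toContinuousMap g.toContinuousMap
      map_smul' := fun c f => map_smul Λ c f.toContinuousMap }
  let L' : CompactlySupportedContinuousMap X ℝ →ₚ[ℝ] ℝ :=
    PositiveLinearMap.mk₀ L fun f hf => hΛ _ fun x => hf x
  have hint : ∀ f : C(X, ℝ), ∫ x, f x ∂(RealRMK.rieszMeasure L') = Λ f := fun f =>
    RealRMK.integral_rieszMeasure L' (toCompactlySupported f)
  refine ⟨RealRMK.rieszMeasure L', ⟨?_⟩, inferInstance, hint⟩
  have h2 := hint 1
  rw [h1] at h2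
  simp only [ContinuousMap.one_apply, integral_const, smul_eq_mul, mul_one] at h2
  rw [Measure.real, ENNReal.toReal_eq_one_iff] at h2
  exact h2

theorem ext_of_integral_continuous {μ ν : Measure X} [μ.Regular] [ν.Regular]
    (h : ∀ f : C(X, ℝ), ∫ x, f x ∂μ = ∫ x, f x ∂ν) : μ = ν :=
  Measure.ext_of_integral_eq_on_compactlySupported fun f => h f.toContinuousMap

theorem regular_of_compact_secondCountable [SecondCountableTopology X] (μ : Measure X)
    [IsFiniteMeasure μ] : μ.Regular := by
  let _ := TopologicalSpace.metrizableSpaceMetric X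
  infer_instance

end Functionals

/-! ### The projective limit and its induced Haar measure -/

section LimitSpace

open PrincipalBundle FiberIso GenConn.Graph

variable {n : ℕ} {M : Type*} [TopologicalSpace M] [ChartedSpace (EuclideanSpace ℝ (Fin n)) M]
  {E : Type*} [NormedAddCommGroup E] [NormedSpace ℝ E]
  {G : Type*} [Group G] [TopologicalSpace G] [ChartedSpace E G]
  {F : Type*} [NormedAddCommGroup F] [NormedSpace ℝ F]
  {P : Type*} [TopologicalSpace P] [ChartedSpace F P]
  {B : PrincipalBundle n M E G F P} {γ γ' γ'' : Graph n M}
  [T2Space M] [IsManifold (𝓡 n) ω M]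
  [LieGroup 𝓘(ℝ, E) ∞ G] [IsTopologicalGroup G] [T2Space G] [CompactSpace G]

instance : T2Space (Limit B) :=
  inferInstanceAs (T2Space {A : ∀ γ : Graph n M, Conn B γ //
    ∀ (γ γ' : Graph n M) (h : γ ≤ γ'), project B h (A γ') = A γ})

instance : CompactSpace (Limit B) := by
  refine isCompact_iff_compactSpace.1 (IsClosed.isCompact (s := {A : ∀ γ : Graph n M, Conn B γ |
    ∀ (γ γ' : Graph n M) (h : γ ≤ γ'), project B h (A γ') = A γ}) ?_)
  simp only [Set.ofPred_forall]
  exact isClosed_iInter fun γ => isClosed_iInter fun γ' => isClosed_iInter fun h =>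
    isClosed_eq ((contMDiff_project h).continuous.comp (continuous_apply γ')) (continuous_apply γ)

/-- Compactness: for `Γ ≥ γ` consider the families that lie over `a` and are consistent below `Γ`.
These closed sets are non-empty because projections are onto, and directed; a common point is
consistent everywhere. -/
theorem surjective_at (γ : Graph n M) : Function.Surjective fun A : Limit B => A.at γ := by
  classical
  intro a
  let C : {Γ : Graph n M // γ ≤ Γ} → Set (∀ γ : Graph n M, Conn B γ) := fun Γ =>
    {A | project B Γ.2 (A Γ.1) = a ∧
      ∀ (γ' : Graph n M) (h : γ' ≤ Γ.1), project B h (A Γ.1) = A γ'}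
  have hclosed : ∀ Γ, IsClosed (C Γ) := by
    intro Γ
    have h1 : C Γ = {A | project B Γ.2 (A Γ.1) = a} ∩
        ⋂ γ', ⋂ h : γ' ≤ Γ.1, {A | project B h (A Γ.1) = A γ'} := by
      ext A; simp [C]
    rw [h1]
    exact (isClosed_eq ((contMDiff_project _).continuous.comp (continuous_apply _))
      continuous_const).inter (isClosed_iInter fun γ' => isClosed_iInter fun h =>
      isClosed_eq ((contMDiff_project h).continuous.comp (continuous_apply _)) (continuous_apply γ'))
  have hne : ∀ Γ, (C Γ).Nonempty := by
    intro Γ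
    obtain ⟨b, hb⟩ := surjective_project B Γ.2 a
    -- Families are constrained only below `Γ`; elsewhere `1` is a mere filler.
    refine ⟨fun γ' => if h : γ' ≤ Γ.1 then project B h b else 1, ?_, fun γ' h => ?_⟩
    · beta_reduce
      rw [dif_pos (Graph.le_refl _), project_refl, hb]
    · beta_reduce
      rw [dif_pos (Graph.le_refl _), dif_pos h, project_refl]
  have : Nonempty {Γ : Graph n M // γ ≤ Γ} := ⟨⟨γ, Graph.le_refl γ⟩⟩
  obtain ⟨A, hA⟩ := IsCompact.nonempty_iInter_of_directed_nonempty_isCompact_isClosed C (by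
    intro Γ₁ Γ₂
    obtain ⟨Γ, h1, h2⟩ := exists_ge_pair Γ₁.1 Γ₂.1
    have key : ∀ Γ' : {Γ : Graph n M // γ ≤ Γ}, ∀ h : Γ'.1 ≤ Γ,
        C ⟨Γ, Graph.le_trans Γ₁.2 h1⟩ ⊆ C Γ' := by
      rintro Γ' h A ⟨hA1, hA2⟩
      refine ⟨?_, fun γ' h' => ?_⟩
      · rw [← hA2 _ h, project_trans]
        exact hA1
      · rw [← hA2 _ h, project_trans]
        exact hA2 γ' _
    exact ⟨⟨Γ, Graph.le_trans Γ₁.2 h1⟩, key Γ₁ h1, key Γ₂ h2⟩) hne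
    (fun Γ => (hclosed Γ).isCompact) hclosed
  rw [mem_iInter] at hA
  have hcons : ∀ (γ₁ γ₂ : Graph n M) (h : γ₁ ≤ γ₂), project B h (A γ₂) = A γ₁ := by
    intro γ₁ γ₂ h
    obtain ⟨Γ, h1, h2⟩ := exists_ge_pair γ γ₂
    rw [← (hA ⟨Γ, h1⟩).2 γ₂ h2, project_trans]
    exact (hA ⟨Γ, h1⟩).2 γ₁ _
  refine ⟨⟨A, hcons⟩, ?_⟩
  have := (hA ⟨γ, Graph.le_refl γ⟩).1
  rwa [project_refl] at this

theorem at_injective {A A' : Limit B} (h : ∀ γ, A.at γ = A'.at γ) : A = A' :=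
  Subtype.ext (funext h)

variable (B) in
/-- The continuous cylindrical functions. -/
def cylContinuous (𝕜 : Type*) [RCLike 𝕜] [Nonempty (Graph n M)] : StarSubalgebra 𝕜 C(Limit B, 𝕜) where
  carrier := {φ | ∃ (γ : Graph n M) (u : C(Conn B γ, 𝕜)), ∀ A, φ A = u (A.at γ)}
  mul_mem' := by
    rintro φ ψ ⟨γ, u, hu⟩ ⟨γ', v, hv⟩
    obtain ⟨Γ, h, h'⟩ := exists_ge_pair γ γ'
    refine ⟨Γ, (u.comp ⟨project B h, (contMDiff_project h).continuous⟩) *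
      (v.comp ⟨project B h', (contMDiff_project h').continuous⟩), fun A => ?_⟩
    simp [hu, hv, project_at]
  add_mem' := by
    rintro φ ψ ⟨γ, u, hu⟩ ⟨γ', v, hv⟩
    obtain ⟨Γ, h, h'⟩ := exists_ge_pair γ γ'
    refine ⟨Γ, (u.comp ⟨project B h, (contMDiff_project h).continuous⟩) +
      (v.comp ⟨project B h', (contMDiff_project h').continuous⟩), fun A => ?_⟩
    simp [hu, hv, project_at]
  algebraMap_mem' r := ⟨Classical.arbitrary _, algebraMap _ _ r, fun A => rfl⟩
  star_mem' := by
    rintro φ ⟨γ, u, hu⟩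
    exact ⟨γ, star u, fun A => congrArg star (hu A)⟩

/-- Stone–Weierstrass: distinct points of the limit differ at some graph, where a continuous
function separates them. -/
theorem dense_cylContinuous (𝕜 : Type*) [RCLike 𝕜] [Nonempty (Graph n M)] :
    Dense (cylContinuous B 𝕜 : Set C(Limit B, 𝕜)) := by
  have h := ContinuousMap.starSubalgebra_topologicalClosure_eq_top_of_separatesPoints
    (cylContinuous B 𝕜) (by
      intro A A' hne
      obtain ⟨γ, hγ⟩ : ∃ γ, A.at γ ≠ A'.at γ := by
        by_contra h
        push Not at h
        exact hne (at_injective h)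
      obtain ⟨f, hf0, hf1, -⟩ := exists_continuous_zero_one_of_isClosed
        (isClosed_singleton (x := A.at γ)) (isClosed_singleton (x := A'.at γ)) (by simpa using hγ)
      let u : C(Conn B γ, 𝕜) := ⟨fun a => (f a : 𝕜), RCLike.continuous_ofReal.comp f.continuous⟩
      refine ⟨_, ⟨u.comp ⟨_, continuous_limit_at γ⟩, ⟨γ, u, fun _ => rfl⟩, rfl⟩, ?_⟩
      have h0 : f (A.at γ) = 0 := hf0 rfl
      have h1 : f (A'.at γ) = 1 := hf1 rfl
      simp [u, h0, h1])
  have h2 := congrArg (fun S : StarSubalgebra 𝕜 C(Limit B, 𝕜) => (S : Set C(Limit B, 𝕜))) h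
  simp only [StarSubalgebra.topologicalClosure_coe, StarSubalgebra.coe_top] at h2
  exact dense_iff_closure_eq.2 h2

variable [SecondCountableTopology G] [MeasurableSpace G] [BorelSpace G]

theorem integral_comp_project (h : γ ≤ γ') {F' : Type*} [NormedAddCommGroup F'] [NormedSpace ℝ F']
    {u : Conn B γ → F'} (hu : AEStronglyMeasurable u (haarOn B γ)) :
    ∫ a, u (project B h a) ∂(haarOn B γ') = ∫ a, u a ∂(haarOn B γ) := by
  rw [← map_project h, integral_map (continuous_project h).measurable.aemeasurable]
  rwa [map_project]

/-- Independence of the representative: compare on a common refinement, where every connection comes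
from the limit. -/
theorem integral_eq_of_at_eq {u : Conn B γ → ℝ} {v : Conn B γ' → ℝ} (hu : Continuous u)
    (hv : Continuous v) (h : ∀ A : Limit B, u (A.at γ) = v (A.at γ')) :
    ∫ a, u a ∂(haarOn B γ) = ∫ a, v a ∂(haarOn B γ') := by
  obtain ⟨Γ, h1, h2⟩ := exists_ge_pair γ γ'
  rw [← integral_comp_project h1 hu.aestronglyMeasurable,
    ← integral_comp_project h2 hv.aestronglyMeasurable]
  refine integral_congr_ae (Filter.Eventually.of_forall fun a => ?_)
  obtain ⟨A, rfl⟩ := surjective_at Γ a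
  beta_reduce
  rw [project_at, project_at]
  exact h A

/-- Integration of continuous cylindrical functions is linear and bounded by the supremum. It
extends to all continuous functions, and the extension is represented by a regular measure. -/
theorem exists_isInducedHaar (B : PrincipalBundle n M E G F P) : ∃ μ, IsInducedHaar B μ := by
  classical
  -- Without graphs the limit is a point and the condition on marginals is void; evaluation serves
  -- as functional.
  rcases isEmpty_or_nonempty (Graph n M) with hE | hE
  · let A₀ : Limit B := ⟨fun γ => hE.elim γ, fun γ => hE.elim γ⟩
    obtain ⟨μ, hμ, hr, -⟩ := exists_measure_of_functional (X := Limit B)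
      { toFun := fun f => f A₀
        map_add' := fun f g => rfl
        map_smul' := fun c f => rfl } (fun f hf => hf A₀) rfl
    exact ⟨μ, hμ, hr, fun γ => hE.elim γ⟩
  have hneL : Nonempty (Limit B) := ⟨(surjective_at (B := B) hE.some 1).choose⟩
  let D : Submodule ℝ C(Limit B, ℝ) := (cylContinuous B ℝ).toSubalgebra.toSubmodule
  have hrep : ∀ φ : D, ∃ (γ : Graph n M) (u : C(Conn B γ, ℝ)), ∀ A, φ.1 A = u (A.at γ) :=
    fun φ => φ.2
  choose g u hu using hrep
  have hval : ∀ (φ : D) (γ : Graph n M) (v : Conn B γ → ℝ), Continuous v →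
      (∀ A, φ.1 A = v (A.at γ)) →
      ∫ a, u φ a ∂(haarOn B (g φ)) = ∫ a, v a ∂(haarOn B γ) := fun φ γ v hv h =>
    integral_eq_of_at_eq (u φ).continuous hv fun A => by rw [← hu, h]
  let L : C(Limit B, ℝ) →ₗ.[ℝ] ℝ :=
    { domain := D
      toFun :=
        { toFun := fun φ => ∫ a, u φ a ∂(haarOn B (g φ))
          map_add' := fun φ ψ => by
            obtain ⟨Γ, h, h'⟩ := exists_ge_pair (g φ) (g ψ)
            have hc := (u φ).continuous.comp (continuous_project (B := B) h)
            have hc' := (u ψ).continuous.comp (continuous_project (B := B) h')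
            rw [hval (φ + ψ) Γ (fun a => u φ (project B h a) + u ψ (project B h' a)) (hc.add hc')
              fun A => by
                rw [project_at, project_at, ← hu, ← hu]; rfl]
            refine (integral_add (integrable_of_continuous hc) (integrable_of_continuous hc')).trans ?_
            simp only [Function.comp_apply]
            rw [integral_comp_project h (u φ).continuous.aestronglyMeasurable,
              integral_comp_project h' (u ψ).continuous.aestronglyMeasurable]
          map_smul' := fun c φ => by
            rw [hval (c • φ) (g φ) (fun a => c * u φ a) (continuous_const.mul (u φ).continuous)
              fun A => by rw [← hu]; rfl, integral_const_mul]
            rfl } }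
  have hbdd : ∀ f : C(Limit B, ℝ), BddAbove (range f) := fun f =>
    (isCompact_range f.continuous).bddAbove
  -- Domination by the supremum, rather than by the norm, makes the extension positive: apply it to
  -- `-f`.
  obtain ⟨Λ, hΛ, hle⟩ := exists_extension_of_le_sublinear L (fun f => ⨆ A, f A)
    (fun c hc f => (Real.mul_iSup_of_nonneg hc.le _).symm)
    (fun f f' => ciSup_le fun A => add_le_add (le_ciSup (hbdd f) A) (le_ciSup (hbdd f') A))
    (fun φ => by
      change ∫ a, u φ a ∂(haarOn B (g φ)) ≤ _
      have h1 : ∀ a, u φ a ≤ ⨆ A, (φ : C(Limit B, ℝ)) A := by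
        intro a
        obtain ⟨A, rfl⟩ := surjective_at (g φ) a
        beta_reduce
        rw [← hu]
        exact le_ciSup (hbdd _) A
      calc ∫ a, u φ a ∂(haarOn B (g φ)) ≤ ∫ a, (⨆ A, (φ : C(Limit B, ℝ)) A) ∂(haarOn B (g φ)) :=
            integral_mono (integrable_of_continuous (u φ).continuous) (integrable_const _) h1
        _ = _ := by simp)
  have hcyl : ∀ (γ : Graph n M) (v : C(Conn B γ, ℝ)),
      Λ (v.comp ⟨_, continuous_limit_at γ⟩) = ∫ a, v a ∂(haarOn B γ) := by
    intro γ v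
    let φ : D := ⟨v.comp ⟨_, continuous_limit_at γ⟩, ⟨γ, v, fun _ => rfl⟩⟩
    exact (hΛ φ).trans (hval φ γ v v.continuous fun A => rfl)
  obtain ⟨μ, hμ, hr, hint⟩ := exists_measure_of_functional Λ (fun f hf => by
      have h1 := hle (-f)
      rw [map_neg] at h1
      have h2 : ⨆ A, (-f) A ≤ 0 := ciSup_le fun A => neg_nonpos.2 (hf A)
      linarith) (by
      have h1 := hcyl hE.some 1
      simp only [ContinuousMap.one_apply, integral_const, probReal_univ, smul_eq_mul, mul_one] at h1
      exact h1)
  refine ⟨μ, hμ, hr, fun γ => ?_⟩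
  have hm := (continuous_limit_at (B := B) γ).measurable
  have : IsProbabilityMeasure (μ.map fun A => A.at γ) :=
    Measure.isProbabilityMeasure_map hm.aemeasurable
  have := regular_of_compact_secondCountable (μ.map fun A : Limit B => A.at γ)
  have := regular_of_compact_secondCountable (haarOn B γ)
  refine ext_of_integral_continuous fun v => ?_
  rw [integral_map hm.aemeasurable v.continuous.aestronglyMeasurable, ← hcyl, ← hint]
  rfl

theorem isInducedHaar_inducedHaar (B : PrincipalBundle n M E G F P) :
    IsInducedHaar B (inducedHaar B) := by
  have h := exists_isInducedHaar B
  rw [inducedHaar, dif_pos h]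
  exact h.choose_spec

instance : IsProbabilityMeasure (inducedHaar B) := (isInducedHaar_inducedHaar B).prob

instance : (inducedHaar B).Regular := (isInducedHaar_inducedHaar B).regular

theorem map_at (γ : Graph n M) : (inducedHaar B).map (fun A => A.at γ) = haarOn B γ :=
  (isInducedHaar_inducedHaar B).marginal γ

theorem measurePreserving_at (γ : Graph n M) :
    MeasurePreserving (fun A : Limit B => A.at γ) (inducedHaar B) (haarOn B γ) :=
  ⟨(continuous_limit_at γ).measurable, map_at γ⟩

theorem integral_comp_at (γ : Graph n M) {F' : Type*} [NormedAddCommGroup F'] [NormedSpace ℝ F']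
    {u : Conn B γ → F'} (hu : AEStronglyMeasurable u (haarOn B γ)) :
    ∫ A, u (A.at γ) ∂(inducedHaar B) = ∫ a, u a ∂(haarOn B γ) := by
  rw [← map_at γ, integral_map (continuous_limit_at γ).measurable.aemeasurable]
  rwa [map_at]

/-- The marginals fix the integrals of continuous cylindrical functions, which are dense, and
regularity does the rest. -/
theorem IsInducedHaar.unique {μ : Measure (Limit B)} (hμ : IsInducedHaar B μ) :
    μ = inducedHaar B := by
  have := hμ.prob
  have := hμ.regular
  refine ext_of_integral_continuous fun f => ?_
  rcases isEmpty_or_nonempty (Graph n M) with hE | hE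
  · have hs : Subsingleton (Limit B) := ⟨fun A A' => at_injective fun γ => hE.elim γ⟩
    let A₀ : Limit B := ⟨fun γ => hE.elim γ, fun γ => hE.elim γ⟩
    have : ∀ A, f A = f A₀ := fun A => congrArg f (Subsingleton.elim A A₀)
    simp [this]
  · have hcont : ∀ (ν : Measure (Limit B)) [IsProbabilityMeasure ν],
        Continuous fun f : C(Limit B, ℝ) => ∫ A, f A ∂ν := by
      intro ν _
      have h : ∀ f : C(Limit B, ℝ), ∫ A, f A ∂ν = ∫ A, ContinuousMap.toLp (E := ℝ) 1 ν ℝ f A ∂ν :=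
        fun f => integral_congr_ae (ContinuousMap.coeFn_toLp (𝕜 := ℝ) ν f).symm
      simp only [h]
      exact continuous_integral.comp (ContinuousMap.toLp (E := ℝ) 1 ν ℝ).continuous
    refine congrFun ((hcont μ).ext_on (dense_cylContinuous (B := B) ℝ) (hcont _) ?_) f
    rintro φ ⟨γ, u, hu⟩
    simp only [hu]
    rw [integral_comp_at γ u.continuous.aestronglyMeasurable, ← hμ.marginal γ,
      integral_map (continuous_limit_at γ).measurable.aemeasurable
        u.continuous.aestronglyMeasurable]

theorem gaugeAct_symm_gaugeAct (g : Gauge B) (a : Conn B γ) :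
    gaugeAct (fun x => (g x).symm) (gaugeAct g a) = a := by
  funext e
  ext p : 2
  simp [gaugeAct, FiberIso.trans, FiberIso.symm]

theorem gaugeAct_gaugeAct_symm (g : Gauge B) (a : Conn B γ) :
    gaugeAct g (gaugeAct (fun x => (g x).symm) a) = a :=
  gaugeAct_symm_gaugeAct (fun x => (g x).symm) a

theorem continuous_limit_gaugeAct (g : Gauge B) : Continuous (Limit.gaugeAct g) := by
  refine Continuous.subtype_mk (continuous_pi fun γ => ?_) _
  exact (continuous_gaugeAct g).comp (continuous_limit_at γ)

/-- A gauge transformation as a homeomorphism of the limit. -/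
def gaugeHomeo (g : Gauge B) : Limit B ≃ₜ Limit B where
  toFun := Limit.gaugeAct g
  invFun := Limit.gaugeAct fun x => (g x).symm
  left_inv A := at_injective fun γ => gaugeAct_symm_gaugeAct g (A.at γ)
  right_inv A := at_injective fun γ => gaugeAct_gaugeAct_symm g (A.at γ)
  continuous_toFun := continuous_limit_gaugeAct g
  continuous_invFun := continuous_limit_gaugeAct _

/-- The image measure has the same marginals, so uniqueness applies. -/
theorem measurePreserving_limit_gaugeAct (g : Gauge B) :
    MeasurePreserving (Limit.gaugeAct g) (inducedHaar B) (inducedHaar B) := by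
  have hm := (continuous_limit_gaugeAct g).measurable
  refine ⟨hm, IsInducedHaar.unique ⟨Measure.isProbabilityMeasure_map hm.aemeasurable,
    Measure.Regular.map (gaugeHomeo g), fun γ => ?_⟩⟩
  rw [Measure.map_map (continuous_limit_at γ).measurable hm]
  have : (fun A : Limit B => A.at γ) ∘ Limit.gaugeAct g = gaugeAct g ∘ fun A => A.at γ := rfl
  rw [this, ← Measure.map_map (continuous_gaugeAct g).measurable (continuous_limit_at γ).measurable,
    map_at, map_gaugeAct]

end LimitSpace

end GenConn

end

noncomputable section

set_option linter.unusedSectionVars false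
set_option linter.unusedVariables false

namespace GenConn

/-! ### Refinements into short edges -/

section FineGraphs

open GenConn.Graph

variable {n : ℕ} {M : Type*} [TopologicalSpace M] [T2Space M]
  [ChartedSpace (EuclideanSpace ℝ (Fin n)) M] [IsManifold (𝓡 n) ω M] {c : ℝ → M}

/-- An arc can be cut into pieces which lie in coordinate balls. -/
theorem IsAnalyticArc.exists_cut_times (hc : IsAnalyticArc n c) : ∃ T : Set ℝ, T.Finite ∧
    T ⊆ Icc 0 1 ∧ ∀ a b, 0 ≤ a → a < b → b ≤ 1 → (∀ t ∈ Ioo a b, t ∉ T) → (0 < a ∨ b < 1) ∧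
      ∃ (x₀ : M) (r : ℝ),
        Metric.ball (extChartAt (𝓡 n) x₀ x₀) r ⊆ (extChartAt (𝓡 n) x₀).target ∧
        ∀ t ∈ Icc a b, c t ∈ (extChartAt (𝓡 n) x₀).source ∧
          extChartAt (𝓡 n) x₀ (c t) ∈ Metric.ball (extChartAt (𝓡 n) x₀ x₀) r := by
  have hball : ∀ x₀ : M, ∃ r > 0,
      Metric.ball (extChartAt (𝓡 n) x₀ x₀) r ⊆ (extChartAt (𝓡 n) x₀).target := fun x₀ =>
    Metric.mem_nhds_iff.1 (extChartAt_target_mem_nhds x₀)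
  choose r hr hrt using hball
  let U : M → Set M := fun x₀ => (extChartAt (𝓡 n) x₀).source ∩
    extChartAt (𝓡 n) x₀ ⁻¹' Metric.ball (extChartAt (𝓡 n) x₀ x₀) (r x₀)
  have hU : ∀ x₀, IsOpen (U x₀) := fun x₀ =>
    (continuousOn_extChartAt x₀).isOpen_inter_preimage (isOpen_extChartAt_source x₀)
      Metric.isOpen_ball
  have hW : ∀ x₀, ∃ W : Set ℝ, IsOpen W ∧ c ⁻¹' U x₀ ∩ Icc 0 1 = W ∩ Icc 0 1 := fun x₀ =>
    (continuousOn_iff'.1 hc.continuousOn) (U x₀) (hU x₀)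
  choose W hWo hW using hW
  obtain ⟨δ, hδ, hδW⟩ := lebesgue_number_lemma_of_metric (isCompact_Icc (a := (0 : ℝ)) (b := 1))
    hWo (fun t ht => by
      have h1 : t ∈ c ⁻¹' U (c t) ∩ Icc 0 1 :=
        ⟨⟨mem_extChartAt_source _, Metric.mem_ball_self (hr _)⟩, ht⟩
      rw [hW] at h1
      exact mem_iUnion.2 ⟨c t, h1.1⟩)
  -- Gaps shorter than the Lebesgue number stay in one coordinate ball; gaps shorter than one cannot
  -- be the whole arc.
  obtain ⟨N, hN⟩ := exists_nat_one_div_lt (lt_min hδ (zero_lt_one (α := ℝ)))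
  have hN0 : (0 : ℝ) < N + 1 := by positivity
  refine ⟨Icc 0 1 ∩ range fun k : Fin (N + 2) => (k : ℝ) / (N + 1),
    (finite_range _).inter_of_right _, inter_subset_left, fun a b ha hab hb hno => ?_⟩
  have hlen : b - a ≤ 1 / (N + 1) := by
    by_contra hlt
    rw [not_le] at hlt
    set k := ⌊a * (N + 1)⌋₊ with hk
    have h1 : a * (N + 1) < k + 1 := Nat.lt_floor_add_one _
    have h2 : (k : ℝ) ≤ a * (N + 1) := Nat.floor_le (by positivity)
    have h3 : a < ((k : ℝ) + 1) / (N + 1) := by rwa [lt_div_iff₀ hN0]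
    have h4 : ((k : ℝ) + 1) / (N + 1) < b := by
      have : ((k : ℝ) + 1) / (N + 1) ≤ a + 1 / (N + 1) := by
        rw [add_div]
        gcongr
        rwa [div_le_iff₀ hN0]
      linarith
    have h5 : (k : ℝ) + 1 < N + 1 := by
      have := (h4.trans_le hb)
      rwa [div_lt_one hN0] at this
    have h6 : k + 1 < N + 2 := by
      have : k + 1 < N + 1 := by exact_mod_cast h5
      omega
    exact hno _ ⟨h3, h4⟩ ⟨⟨ha.trans h3.le, (h4.trans_le hb).le⟩, ⟨⟨k + 1, h6⟩, by simp⟩⟩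
  refine ⟨?_, ?_⟩
  · by_contra hno
    rw [not_or, not_lt, not_lt] at hno
    linarith [hN.trans_le (min_le_right _ _)]
  · obtain ⟨x₀, hx₀⟩ := hδW a ⟨ha, hab.le.trans hb⟩
    refine ⟨x₀, r x₀, hrt x₀, fun t ht => ?_⟩
    have h1 : t ∈ W x₀ ∩ Icc 0 1 := by
      refine ⟨hx₀ ?_, Icc_subset_unit ha hb ht⟩
      rw [Metric.mem_ball, Real.dist_eq, abs_of_nonneg (sub_nonneg.2 ht.1)]
      linarith [ht.2, hN.trans_le (min_le_left _ _)]
    rw [← hW] at h1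
    exact h1.1

/-- Two edges of a graph which meet in an interior point of one of them are equal. -/
theorem Graph.eq_of_mem_interior (γ : Graph n M) {f f' : Set M} (hf : f ∈ γ.edges)
    (hf' : f' ∈ γ.edges) {x : M} (hx : x ∈ f) (hx' : x ∈ f') (hxe : x ∉ endpoints n f) : f' = f :=
  by_contra fun hne => hxe (γ.inter_subset f hf f' hf' (Ne.symm hne) ⟨hx, hx'⟩).1

/-- A graph can be refined in such a way that each edge lies in a coordinate ball, so that it can be
replaced with another one, and has a vertex at which there is just one other edge. -/
theorem exists_fine_refinement (hn : 2 ≤ n) (γ : Graph n M) : ∃ Γ : Graph n M, γ ≤ Γ ∧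
    (∀ d ∈ Γ.edges, ∃ f ∈ γ.edges, d ⊆ f) ∧ ∀ f ∈ γ.edges, ∀ e ∈ Γ.edges, e ⊆ f →
      (∃ e'', IsEdge n e'' ∧ endpoints n e'' = endpoints n e ∧ ∀ d ∈ Γ.edges, (d ∩ e'').Finite) ∧
      ∃ v ∈ endpoints n e, ∃ e' ∈ Γ.edges, e' ⊆ f ∧ e' ≠ e ∧
        ∀ d ∈ Γ.edges, v ∈ endpoints n d → d = e ∨ d = e' := by
  choose T hTfin hT01 hT using fun e : γ.Edge => (γ.isAnalyticArc_param e).exists_cut_times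
  set V : Set M := ⋃ e : γ.Edge, γ.param e '' (T e ∪ {0, 1}) with hVdef
  have hV : V.Finite := finite_iUnion fun e => ((hTfin e).union (toFinite _)).image _
  have hVmem : ∀ (e : γ.Edge) {t : ℝ}, t ∈ T e ∪ {0, 1} → γ.param e t ∈ V := fun e t ht =>
    mem_iUnion.2 ⟨e, t, ht, rfl⟩
  -- Distinct edges of a graph meet only in end points, so the frontiers contribute nothing but end
  -- parameters.
  have hS : CutsIntersections n (γ.edges : Set (Set M)) V := by
    intro e he
    set f : γ.Edge := ⟨e, he⟩
    have hc := γ.isAnalyticArc_param f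
    have himg := γ.image_param f
    refine ⟨γ.param f, hc, himg, hVmem f (by simp), hVmem f (by simp), fun e' he' t ht => ?_⟩
    refine hVmem f (Or.inr ?_)
    by_cases hee : e' = e
    · have h1 : {t : ℝ | t ∈ Icc (0 : ℝ) 1 ∧ γ.param f t ∈ e'} = Icc 0 1 := by
        ext s
        refine ⟨fun h => h.1, fun h => ⟨h, ?_⟩⟩
        rw [hee, show e = f.1 from rfl, ← himg]
        exact ⟨s, h, rfl⟩
      rw [h1, frontier_Icc zero_le_one] at ht
      exact ht
    · have h1 : {t : ℝ | t ∈ Icc (0 : ℝ) 1 ∧ γ.param f t ∈ e'} ⊆ {0, 1} := by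
        rintro s ⟨hs, hse⟩
        have hsf : γ.param f s ∈ f.1 := by rw [← himg]; exact ⟨s, hs, rfl⟩
        have h2 := (γ.inter_subset e he e' he' (Ne.symm hee) ⟨hsf, hse⟩).1
        rw [show e = f.1 from rfl, ← himg, hc.endpoints_eq] at h2
        rcases h2 with h2 | h2
        · exact Or.inl (hc.injOn hs (left_mem_Icc.2 zero_le_one) h2)
        · exact Or.inr (hc.injOn hs (right_mem_Icc.2 zero_le_one) h2)
      have h2 := (toFinite ({0, 1} : Set ℝ)).isClosed.closure_subset_iff.2 h1
      exact h2 ht.1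
  obtain ⟨Γ, hΓ⟩ := exists_graph_of_pieces γ.edges.finite_toSet γ.nonempty.to_set hS hV
    (fun e he v hv => by
      obtain ⟨e', he', hne, hv'⟩ := γ.closed e he v hv
      exact ⟨e', he', hv', γ.finite_inter (e := ⟨e, he⟩) (e' := ⟨e', he'⟩)
          fun h => hne (congrArg Subtype.val h).symm⟩)
  refine ⟨Γ, le_iff.2 fun e he x hx => ?_, fun d hd => ((hΓ d).1 hd).2, fun f hf e he hef => ?_⟩
  · obtain ⟨p, hp, hpe, hxp⟩ := exists_piece_mem hS hV he hx
    exact ⟨p, (hΓ p).2 ⟨hp, e, he, hpe⟩, hxp, hpe⟩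
  set fE : γ.Edge := ⟨f, hf⟩
  set c := γ.param fE with hcdef
  have hc : IsAnalyticArc n c := γ.isAnalyticArc_param fE
  have himg : c '' Icc 0 1 = f := γ.image_param fE
  have h0V : c 0 ∈ V := hVmem fE (by simp)
  have h1V : c 1 ∈ V := hVmem fE (by simp)
  obtain ⟨a, b, ha, hab, hb, rfl, hend, hVa, hVb, hno⟩ :=
    ((hΓ e).1 he).1.exists_Icc hc (himg.symm ▸ hef)
  obtain ⟨hor, x₀, r, hball, hsmall⟩ := hT fE a b ha hab hb fun t ht htT =>
    hno t ht (hVmem fE (Or.inl htT))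
  have haI : a ∈ Icc (0 : ℝ) 1 := ⟨ha, hab.le.trans hb⟩
  have hbI : b ∈ Icc (0 : ℝ) 1 := ⟨ha.trans hab.le, hb⟩
  have hsub : ∀ {a' b' : ℝ}, 0 ≤ a' → b' ≤ 1 → c '' Icc a' b' ⊆ f := fun h h' =>
    himg ▸ image_mono (Icc_subset_unit h h')
  refine ⟨?_, ?_⟩
  · obtain ⟨e'', h1, h2, h3⟩ := exists_edge_finite_inter hn hball
      (hsmall a (left_mem_Icc.2 hab.le)).1 (hsmall b (right_mem_Icc.2 hab.le)).1
      (hsmall a (left_mem_Icc.2 hab.le)).2 (hsmall b (right_mem_Icc.2 hab.le)).2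
      (fun h => hab.ne (hc.injOn haI hbI h)) Γ.edges.finite_toSet Γ.isEdge
    exact ⟨e'', h1, h2.trans hend.symm, h3⟩
  -- At an interior point of `f` no other edge of `γ` passes, so every edge of `Γ` ending there is a
  -- gap of `f` to its left or right.
  have hloc : ∀ t, 0 < t → t < 1 → ∀ d ∈ Γ.edges, c t ∈ endpoints n d → ∃ x y, 0 ≤ x ∧ x < y ∧
      y ≤ 1 ∧ d = c '' Icc x y ∧ c x ∈ V ∧ c y ∈ V ∧ (∀ s ∈ Ioo x y, c s ∉ V) ∧
        (t = x ∨ t = y) := by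
    intro t ht0 ht1 d hd htd
    obtain ⟨hdp, f', hf', hdf'⟩ := (hΓ d).1 hd
    have htI : t ∈ Icc (0 : ℝ) 1 := ⟨ht0.le, ht1.le⟩
    have hff : f' = f := γ.eq_of_mem_interior hf hf' (by rw [← himg]; exact ⟨t, htI, rfl⟩)
      (hdf' (endpoints_subset d htd)) (by
        rw [← himg, hc.endpoints_eq]
        rintro (h | h)
        · exact ht0.ne' (hc.injOn htI (left_mem_Icc.2 zero_le_one) h)
        · exact ht1.ne (hc.injOn htI (right_mem_Icc.2 zero_le_one) h))
    rw [hff, ← himg] at hdf'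
    obtain ⟨x, y, hx, hxy, hy, rfl, hend', hVx, hVy, hno'⟩ := hdp.exists_Icc hc hdf'
    rw [hend'] at htd
    refine ⟨x, y, hx, hxy, hy, rfl, hVx, hVy, hno', ?_⟩
    rcases htd with h | h
    · exact Or.inl (hc.injOn htI ⟨hx, hxy.le.trans hy⟩ h)
    · exact Or.inr (hc.injOn htI ⟨hx.trans hxy.le, hy⟩ h)
  have hright : ∀ {x y y' : ℝ}, x < y → x < y' → c y ∈ V → c y' ∈ V → (∀ s ∈ Ioo x y, c s ∉ V) →
      (∀ s ∈ Ioo x y', c s ∉ V) → y = y' := by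
    intro x y y' h h' hV hV' hno hno'
    rcases lt_trichotomy y y' with hlt | heq | hlt
    · exact absurd hV (hno' y ⟨h, hlt⟩)
    · exact heq
    · exact absurd hV' (hno y' ⟨h', hlt⟩)
  have hleft : ∀ {x x' y : ℝ}, x < y → x' < y → c x ∈ V → c x' ∈ V → (∀ s ∈ Ioo x y, c s ∉ V) →
      (∀ s ∈ Ioo x' y, c s ∉ V) → x = x' := by
    intro x x' y h h' hV hV' hno hno'
    rcases lt_trichotomy x x' with hlt | heq | hlt
    · exact absurd hV' (hno x' ⟨hlt, h'⟩)
    · exact heq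
    · exact absurd hV (hno' x ⟨hlt, h⟩)
  -- The edge is a proper part of `f`, so one of its ends is interior to `f`; there exactly one
  -- other piece arrives.
  rcases hor with ha0 | hb1
  · obtain ⟨a', b', ha', hat, htb, hb', hq, hbt⟩ := exists_piece_left hc hV h0V h1V ⟨ha0, haI.2⟩
    obtain rfl := hbt hVa
    obtain ⟨a₁, b₁, ha₁, hab₁, hb₁, heq₁, -, hVa₁, -, hno₁⟩ :=
      hq.exists_Icc hc (image_mono (Icc_subset_unit ha' hb'))
    have h2 := (hc.injOn.image_eq_image_iff (Icc_subset_unit ha' hb')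
      (Icc_subset_unit ha₁ hb₁)).1 heq₁
    rw [Icc_eq_Icc_iff hat.le] at h2
    obtain ⟨rfl, rfl⟩ := h2
    refine ⟨c b', by rw [hend]; simp, _, (hΓ _).2 ⟨hq, f, hf, hsub ha' hb'⟩, hsub ha' hb',
      fun h => ?_, fun d hd hvd => ?_⟩
    · have h3 := (hc.injOn.image_eq_image_iff (Icc_subset_unit ha' hb')
        (Icc_subset_unit ha hb)).1 h
      rw [Icc_eq_Icc_iff hat.le] at h3
      exact hat.ne h3.1
    · obtain ⟨x, y, hx, hxy, hy, rfl, hVx, hVy, hno', rfl | rfl⟩ := hloc b' ha0 (hab.trans_le hb) d hd hvd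
      · left; rw [hright hab hxy hVb hVy hno hno']
      · right; rw [hleft hxy hat hVx hVa₁ hno' hno₁]
  · obtain ⟨a', b', ha', hat, htb, hb', hq, hbt⟩ := exists_piece_right hc hV h0V h1V ⟨hbI.1, hb1⟩
    obtain rfl := hbt hVb
    obtain ⟨a₁, b₁, ha₁, hab₁, hb₁, heq₁, -, -, hVb₁, hno₁⟩ :=
      hq.exists_Icc hc (image_mono (Icc_subset_unit ha' hb'))
    have h2 := (hc.injOn.image_eq_image_iff (Icc_subset_unit ha' hb')
      (Icc_subset_unit ha₁ hb₁)).1 heq₁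
    rw [Icc_eq_Icc_iff htb.le] at h2
    obtain ⟨rfl, rfl⟩ := h2
    refine ⟨c a', by rw [hend]; simp, _, (hΓ _).2 ⟨hq, f, hf, hsub ha' hb'⟩, hsub ha' hb',
      fun h => ?_, fun d hd hvd => ?_⟩
    · have h3 := (hc.injOn.image_eq_image_iff (Icc_subset_unit ha' hb')
        (Icc_subset_unit ha hb)).1 h
      rw [Icc_eq_Icc_iff htb.le] at h3
      exact htb.ne' h3.2
    · obtain ⟨x, y, hx, hxy, hy, rfl, hVx, hVy, hno', rfl | rfl⟩ := hloc a' (ha.trans_lt hab) hb1 d hd hvd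
      · right; rw [hright hxy htb hVy hVb₁ hno' hno₁]
      · left; rw [hleft hab hxy hVa hVx hno hno']

end FineGraphs

end GenConn

end

noncomputable section

set_option linter.unusedSectionVars false
set_option linter.unusedVariables false

namespace GenConn

/-! ### Replacing edges of a graph -/

section Removal

open GenConn.Graph

/-- The derivative of an arc is non-zero, which is impossible in a space of dimension zero. -/
theorem isEmpty_graph_zero {M : Type*} [TopologicalSpace M]
    [ChartedSpace (EuclideanSpace ℝ (Fin 0)) M] : IsEmpty (Graph 0 M) := by
  refine ⟨fun γ => ?_⟩
  obtain ⟨e, he⟩ := γ.nonempty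
  obtain ⟨c, hc, -⟩ := γ.isEdge e he
  refine hc.2.1 0 (by simp) (ContinuousLinearMap.ext fun v => ?_)
  exact Subsingleton.elim (α := EuclideanSpace ℝ (Fin 0)) _ _

variable {n : ℕ} {M : Type*} [TopologicalSpace M] [T2Space M]
  [ChartedSpace (EuclideanSpace ℝ (Fin n)) M] [IsManifold (𝓡 n) ω M] {γ Γ : Graph n M}

/-- An edge which is not contained in an edge of `γ` can be replaced with another one that has the
same end points. -/
theorem exists_replacement (h : γ ≤ Γ) {e' e'' : Set M} (he' : e' ∈ Γ.edges)
    (hout : ∀ f ∈ γ.edges, ¬ e' ⊆ f) (he'' : IsEdge n e'') (hend : endpoints n e'' = endpoints n e')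
    (hfin : ∀ d ∈ Γ.edges, (d ∩ e'').Finite) :
    ∃ γ₁ : Graph n M, γ ≤ γ₁ ∧
      (∀ e ∈ Γ.edges, e ≠ e' → ∀ x ∈ e, ∃ d ∈ γ₁.edges, x ∈ d ∧ d ⊆ e) ∧
      ∀ d ∈ γ₁.edges, (d ∩ e').Finite := by
  have hΓfin : ∀ {d f}, d ∈ Γ.edges → f ∈ Γ.edges → d ≠ f → (d ∩ f).Finite := fun {d f} hd hf hne =>
    Γ.finite_inter (e := ⟨d, hd⟩) (e' := ⟨f, hf⟩) fun h => hne (congrArg Subtype.val h)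
  -- Exchange `e'` for `e''` and cut again. Equality of the end points keeps the edges that had `e'`
  -- as neighbour connected.
  obtain ⟨γ₁, h1, h2, -⟩ := exists_refinement (n := n)
    (S := ((Γ.edges : Set (Set M)) \ {e'}) ∪ {e''}) (V₀ := ∅)
    ((Γ.edges.finite_toSet.subset sdiff_subset).union (finite_singleton _)) ⟨e'', Or.inr rfl⟩ (by
      rintro e (he | rfl)
      · exact Γ.isEdge e he.1
      · exact he'') (by
      rintro e (he | rfl) v hv
      · obtain ⟨f, hf, hne, hvf⟩ := Γ.closed e he.1 v hv
        by_cases hfe : f = e'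
        · exact ⟨e'', Or.inr rfl, by rw [hend, ← hfe]; exact hvf, hfin e he.1⟩
        · exact ⟨f, Or.inl ⟨hf, hfe⟩, hvf, hΓfin he.1 hf hne.symm⟩
      · rw [hend] at hv
        obtain ⟨f, hf, hne, hvf⟩ := Γ.closed e' he' v hv
        exact ⟨f, Or.inl ⟨hf, hne⟩, hvf, by rw [inter_comm]; exact hfin f hf⟩) finite_empty
  refine ⟨γ₁, le_iff.2 fun f hf x hx => ?_, fun e he hne => h1 e (Or.inl ⟨he, hne⟩), fun d hd => ?_⟩
  · obtain ⟨d, hd, hxd, hdf⟩ := le_iff.1 h f hf x hx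
    obtain ⟨d₁, hd₁, hx₁, hdd⟩ := h1 d (Or.inl ⟨hd, by rintro rfl; exact hout f hf hdf⟩) x hxd
    exact ⟨d₁, hd₁, hx₁, hdd.trans hdf⟩
  · obtain ⟨e, he | rfl, hde⟩ := h2 d hd
    · exact (hΓfin he.1 he' he.2).subset (inter_subset_inter_left _ hde)
    · exact (hfin e' he').subset (by rw [inter_comm]; exact inter_subset_inter_right _ hde)

/-- `f` is a union of finitely many edges of `Γ`, and distinct edges of `Γ` meet in finite sets; so
`e` is one of these edges. -/
theorem Graph.exists_edge_of_subset (h : γ ≤ Γ) {e f : Set M} (he : e ∈ Γ.edges) (hf : f ∈ γ.edges)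
    (hinf : (e ∩ f).Infinite) : e ⊆ f := by
  have h1 : e ∩ f ⊆ ⋃ d ∈ {d | d ∈ Γ.edges ∧ d ⊆ f}, e ∩ d := by
    rintro x ⟨hxe, hxf⟩
    obtain ⟨d, hd, hxd, hdf⟩ := le_iff.1 h f hf x hxf
    exact mem_biUnion (show d ∈ {d | d ∈ Γ.edges ∧ d ⊆ f} from ⟨hd, hdf⟩) ⟨hxe, hxd⟩
  by_contra hne
  refine hinf (Set.Finite.subset (Set.Finite.biUnion
    (Γ.edges.finite_toSet.subset fun d hd => hd.1) fun d hd => ?_) h1)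
  exact Γ.finite_inter (e := ⟨e, he⟩) (e' := ⟨d, hd.1⟩) fun h => hne (by
    rw [show e = d from congrArg Subtype.val h]; exact hd.2)

end Removal

/-! ### Consistency of divergences -/

section Divergence

open PrincipalBundle FiberIso GenConn.Graph

variable {n : ℕ} {M : Type*} [TopologicalSpace M] [ChartedSpace (EuclideanSpace ℝ (Fin n)) M]
  {E : Type*} [NormedAddCommGroup E] [NormedSpace ℝ E] [FiniteDimensional ℝ E]
  {G : Type*} [Group G] [TopologicalSpace G] [ChartedSpace E G]
  {F : Type*} [NormedAddCommGroup F] [NormedSpace ℝ F]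
  {P : Type*} [TopologicalSpace P] [ChartedSpace F P]
  {B : PrincipalBundle n M E G F P} {γ γ' γ₀ γ₁ Γ Γ' : Graph n M}
  [T2Space M] [IsManifold (𝓡 n) ω M]
  [LieGroup 𝓘(ℝ, E) ∞ G] [IsTopologicalGroup G] [T2Space G] [CompactSpace G]
  [SecondCountableTopology G] [MeasurableSpace G] [BorelSpace G]

theorem integral_dirDeriv_eq {V : ∀ a : Conn B γ, TangentSpace (model E γ) a} {d : Conn B γ → ℝ}
    (hd : IsDivergenceOn V d) {f : Conn B γ → ℝ} (hf : ContMDiff (model E γ) 𝓘(ℝ, ℝ) ∞ f) :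
    ∫ a, dirDeriv (model E γ) V f a ∂(haarOn B γ) = - ∫ a, f a * d a ∂(haarOn B γ) := by
  rw [hd.2 f hf, neg_neg]
  rfl

/-- The difference `u` is orthogonal to smooth functions, hence to their uniform limit `u`; so `u *
u` has integral zero and vanishes, since Haar measure charges open sets. -/
theorem eq_of_integral_mul_eq {d d' : Conn B γ → ℝ} (hd : Continuous d) (hd' : Continuous d')
    (h : ∀ f : Conn B γ → ℝ, ContMDiff (model E γ) 𝓘(ℝ, ℝ) ∞ f →
      ∫ a, f a * d a ∂(haarOn B γ) = ∫ a, f a * d' a ∂(haarOn B γ)) : d = d' := by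
  set u : Conn B γ → ℝ := fun a => d a - d' a with hu
  have huc : Continuous u := hd.sub hd'
  have hint : ∀ {v : Conn B γ → ℝ}, Continuous v → Integrable v (haarOn B γ) := fun hv =>
    integrable_of_continuous hv
  have h0 : ∀ f : Conn B γ → ℝ, ContMDiff (model E γ) 𝓘(ℝ, ℝ) ∞ f →
      ∫ a, f a * u a ∂(haarOn B γ) = 0 := by
    intro f hf
    have hfc := hf.continuous
    simp only [hu, mul_sub]
    refine (integral_sub (hint (hfc.mul hd)) (hint (hfc.mul hd'))).trans ?_
    exact sub_eq_zero.2 (h f hf)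
  have hsq : ∫ a, u a * u a ∂(haarOn B γ) = 0 := by
    refine le_antisymm (le_of_forall_pos_le_add fun ε hε => ?_)
      (integral_nonneg fun a => mul_self_nonneg _)
    set C := ∫ a, |u a| ∂(haarOn B γ) with hC
    have hC0 : 0 ≤ C := integral_nonneg fun a => abs_nonneg _
    obtain ⟨f, hf, -⟩ := huc.exists_contMDiff_approx (model E γ) ⊤ (ε := fun _ => ε / (C + 1))
      continuous_const (fun _ => by positivity)
    have hfc : Continuous f := f.contMDiff.continuous
    have h1 : ∫ a, u a * u a ∂(haarOn B γ) = ∫ a, (u a - f a) * u a ∂(haarOn B γ) := by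
      simp only [sub_mul]
      refine Eq.trans ?_ (integral_sub (hint (huc.mul huc)) (hint (hfc.mul huc))).symm
      exact (sub_eq_self.2 (h0 f f.contMDiff)).symm
    rw [h1, zero_add]
    calc ∫ a, (u a - f a) * u a ∂(haarOn B γ) ≤ ∫ a, ε / (C + 1) * |u a| ∂(haarOn B γ) := by
          refine integral_mono (hint ((huc.sub hfc).mul huc)) (hint (continuous_const.mul huc.abs))
            fun a => ?_
          refine (le_abs_self _).trans ?_
          rw [abs_mul]
          refine mul_le_mul_of_nonneg_right ?_ (abs_nonneg _)
          rw [abs_sub_comm]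
          exact (hf a).le
      _ = ε / (C + 1) * C := integral_const_mul _ _
      _ ≤ ε := by
          rw [div_mul_eq_mul_div, div_le_iff₀ (by positivity)]
          nlinarith
  have h2 : (fun a => u a * u a) = 0 := by
    have h3 := (integral_eq_zero_iff_of_nonneg (fun a => mul_self_nonneg (u a))
      (hint (huc.mul huc))).1 hsq
    exact (Continuous.ae_eq_iff_eq (haarOn B γ) (huc.mul huc) continuous_const).1 h3
  funext a
  exact sub_eq_zero.1 (mul_self_eq_zero.1 (congrFun h2 a))

theorem IsDivergenceOn.unique {V : ∀ a : Conn B γ, TangentSpace (model E γ) a} {d d' : Conn B γ → ℝ}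
    (hd : IsDivergenceOn V d) (hd' : IsDivergenceOn V d') : d = d' :=
  eq_of_integral_mul_eq hd.1 hd'.1 fun f hf => (hd.2 f hf).trans (hd'.2 f hf).symm

theorem exists_isDivergenceOn {V : ∀ a : Conn B γ, TangentSpace (model E γ) a}
    (hV : SmoothField (model E γ) V) : ∃ d : Conn B γ → ℝ, ContMDiff (model E γ) 𝓘(ℝ, ℝ) ∞ d ∧
      IsDivergenceOn V d ∧ ∀ f : Conn B γ → ℂ, ContMDiff (model E γ) 𝓘(ℝ, ℂ) 1 f →
        ∫ a, dirDeriv (model E γ) V f a ∂(haarOn B γ) = - ∫ a, d a • f a ∂(haarOn B γ) := by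
  obtain ⟨d, hd, h⟩ := exists_divergence (haarOn B γ) hV
  refine ⟨d, hd, ⟨hd.continuous, fun f hf => ?_⟩, h ℂ⟩
  have h1 := h ℝ f (hf.of_le (by simp))
  have h2 : ∫ a, f a * d a ∂(haarOn B γ) = ∫ a, d a • f a ∂(haarOn B γ) :=
    integral_congr_ae (Filter.Eventually.of_forall fun a => mul_comm _ _)
  rw [h2, ← neg_eq_iff_eq_neg.2 h1]
  rfl

/-- The divergence of a related vector field. -/
theorem IsDivergenceOn.of_comp {V : ∀ a : Conn B Γ, TangentSpace (model E Γ) a}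
    {W : ∀ a : Conn B γ, TangentSpace (model E γ) a} {φ : Conn B Γ → Conn B γ}
    (hφ : ContMDiff (model E Γ) (model E γ) ∞ φ) (hmp : (haarOn B Γ).map φ = haarOn B γ)
    (hrel : ∀ a, mfderiv (model E Γ) (model E γ) φ a (V a) = W (φ a)) {d : Conn B Γ → ℝ}
    {D : Conn B γ → ℝ} (hd : IsDivergenceOn V d) (hD : Continuous D) (h : ∀ a, d a = D (φ a))
    (hW : SmoothField (model E γ) W) : IsDivergenceOn W D := by
  refine ⟨hD, fun f hf => ?_⟩
  have hfc := hf.continuous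
  have hWf : Continuous (dirDeriv (model E γ) W f) :=
    (contMDiff_dirDeriv hW hf (m := ∞) (by simp) le_rfl).continuous
  have h1 := integral_dirDeriv_eq hd (hf.comp hφ)
  have h2 : ∀ a, dirDeriv (model E Γ) V (f ∘ φ) a = dirDeriv (model E γ) W f (φ a) := fun a =>
    dirDeriv_comp (hφ.mdifferentiableAt (by simp)) (hrel a) (hf.mdifferentiableAt (by simp))
  simp only [h2, h] at h1
  have hm := hφ.continuous.measurable.aemeasurable (μ := haarOn B Γ)
  have h3 := integral_map hm (f := dirDeriv (model E γ) W f) hWf.aestronglyMeasurable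
  have h4 := integral_map hm (f := fun a => f a * D a) (hfc.mul hD).aestronglyMeasurable
  rw [hmp] at h3 h4
  rw [h4, eq_neg_iff_add_eq_zero, add_comm, ← eq_neg_iff_add_eq_zero]
  exact h3.trans h1

/-- The divergence of an invariant vector field is invariant. -/
theorem IsDivergenceOn.comp_eq {V : ∀ a : Conn B γ, TangentSpace (model E γ) a}
    (hV : SmoothField (model E γ) V) {d : Conn B γ → ℝ} (hd : IsDivergenceOn V d)
    {φ ψ : Conn B γ → Conn B γ} (hφ : ContMDiff (model E γ) (model E γ) ∞ φ) (hψ : Continuous ψ)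
    (hmp : (haarOn B γ).map φ = haarOn B γ)
    (hrel : ∀ a, mfderiv (model E γ) (model E γ) φ a (V a) = V (φ a)) (h : ∀ a, ψ (φ a) = a)
    (h' : ∀ a, φ (ψ a) = a) (a : Conn B γ) : d (φ a) = d a := by
  -- `φ` carries `V` to itself, so `d ∘ ψ` is a divergence of `V` as well, and uniqueness gives the
  -- claim.
  have h1 := hd.of_comp hφ hmp hrel (D := d ∘ ψ) (hd.1.comp hψ)
    (fun a => by rw [Function.comp_apply, h]) hV
  have h2 := congrFun (h1.unique hd) (φ a)
  rwa [Function.comp_apply, h, eq_comm] at h2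

theorem IsVectorField.smoothField {X : Field B} (hX : IsVectorField γ₀ X) (h : γ₀ ≤ γ) :
    SmoothField (model E γ) (X γ) := hX.smooth γ h

theorem IsDivergenceOn.gaugeAct_eq {X : Field B} (hX : IsVectorField γ₀ X) (hinv : IsInvariant γ₀ X)
    (h : γ₀ ≤ γ) {d : Conn B γ → ℝ} (hd : IsDivergenceOn (X γ) d) (g : Gauge B) (a : Conn B γ) :
    d (gaugeAct g a) = d a :=
  hd.comp_eq (hX.smoothField h) (contMDiff_gaugeAct g) (continuous_gaugeAct _) (map_gaugeAct g)
    (hinv γ h g) (gaugeAct_symm_gaugeAct g) (gaugeAct_gaugeAct_symm g) a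

/-- The component at an edge is determined by any graph of which the edge is a composition. -/
theorem component_eq {X : Field B} (hX : IsVectorField γ₀ X) (h0 : γ₀ ≤ Γ) (h01 : γ₀ ≤ γ₁)
    (h : Γ ≤ Γ') (h1 : γ₁ ≤ Γ') {e : Γ.Edge} {w : γ₁.Walk (Γ.src e) (Γ.tgt e)}
    (hw : w.Composes e.1) (a : Conn B Γ') :
    (X Γ (project B h a) : Γ.Edge → E) e =
      (mfderiv (model E γ₁) 𝓘(ℝ, E) (fun b : Conn B γ₁ => transport b w) (project B h1 a) :
        (γ₁.Edge → E) →L[ℝ] E) (X γ₁ (project B h1 a)) := by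
  have k1 := congrFun (hX.consistent Γ Γ' h h0 a) e
  have k2 := mfderiv_pi_apply ((contMDiff_project (B := B) h).mdifferentiableAt (by simp)
    (x := a)) (X Γ' a) e
  have k3 : ∀ y : Conn B Γ', transport (project B h1 y) w = project B h y e := by
    intro y
    rw [← transport_refine, (hw.refine h1).unique (composes_walk h e)]
    rfl
  have k4 := mfderiv_comp_model ((contMDiff_transport (B := B) w).mdifferentiableAt (by simp)
    (x := project B h1 a)) ((contMDiff_project (B := B) h1).mdifferentiableAt (by simp) (x := a))
    rfl k3
  have k5 := hX.consistent γ₁ Γ' h1 h01 a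
  refine k1.symm.trans (k2.symm.trans ?_)
  refine (congrArg (fun L : (Γ'.Edge → E) →L[ℝ] E => L (X Γ' a)) k4).trans ?_
  exact congrArg _ k5

open Classical in
/-- The component at an edge does not depend on the value at an edge which can be avoided. -/
theorem component_update {X : Field B} (hX : IsVectorField γ₀ X) (h0 : γ₀ ≤ Γ) (h01 : γ₀ ≤ γ₁)
    {e e' : Γ.Edge} (hcov : ∀ x ∈ e.1, ∃ d ∈ γ₁.edges, x ∈ d ∧ d ⊆ e.1)
    (hfin : ∀ d ∈ γ₁.edges, (d ∩ e'.1).Finite) (a : Conn B Γ)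
    (φ : B.FiberIso (Γ.src e') (Γ.tgt e')) :
    (X Γ (Function.update a e' φ) : Γ.Edge → E) e = (X Γ a : Γ.Edge → E) e := by
  obtain ⟨Γ', h, h1⟩ := exists_ge_pair Γ γ₁
  obtain ⟨a', rfl⟩ := surjective_project B h a
  obtain ⟨w, hw⟩ := exists_composes (Γ := γ₁) (Γ.isAnalyticArc_param e) (by
    rw [Γ.image_param]; exact hcov)
  rw [Γ.image_param] at hw
  obtain ⟨d, hd, hlift⟩ := exists_lift (B := B) h e'
  set a := project B h a'
  obtain ⟨l, hl⟩ := hlift (φ * (a e')⁻¹)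
  have hupd : (Pi.mulSingle e' (φ * (a e')⁻¹) : Conn B Γ) * a = Function.update a e' φ := by
    funext f
    by_cases hf : f = e'
    · subst hf; simp
    · simp [Pi.mulSingle_eq_of_ne hf, Function.update_of_ne hf]
  -- The change at `e'` is lifted to a single edge `d` inside `e'`. The edges of `γ₁` do not overlap
  -- with `e'`, so none of their decompositions uses `d`, and the projection to `γ₁`, which
  -- determines the component at `e`, is unchanged.
  have hne : ∀ (f : γ₁.Edge), ∀ d' ∈ (walk h1 f).edgeList, d' ≠ d := by
    rintro f d' hd' rfl
    refine Γ'.infinite_edge d' ((hfin f.1 f.2).subset (subset_inter ?_ ?_))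
    · exact (composes_walk h1 f).subset hd'
    · exact (composes_walk h e').subset hd
  have key : ∀ b' : Conn B Γ', (∀ d', d' ≠ d → b' d' = a' d') →
      project B h b' = Function.update a e' φ →
      (X Γ (Function.update a e' φ) : Γ.Edge → E) e = (X Γ a : Γ.Edge → E) e := by
    intro b' hb' hb
    have hp : project B h1 b' = project B h1 a' := funext fun f =>
      project_congr h1 f fun d' hd' => hb' d' (hne f d' hd')
    have k1 := component_eq hX h0 h01 h h1 hw b'
    have k2 := component_eq hX h0 h01 h h1 hw a'
    rw [hb, hp] at k1
    exact k1.trans k2.symm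
  rcases hl with hl | hl
  · exact key _ (fun d' hd' => by simp [Pi.mulSingle_eq_of_ne hd']) ((hl a').trans hupd)
  · exact key _ (fun d' hd' => by simp [Pi.mulSingle_eq_of_ne hd']) ((hl a').trans hupd)

open Classical in
/-- A gauge transformation which acts on one edge only. -/
def edgeAct (g : Gauge B) (e : γ.Edge) (a : Conn B γ) : Conn B γ :=
  Function.update a e (gaugeAct g a e)

theorem contMDiff_edgeAct (g : Gauge B) (e : γ.Edge) :
    ContMDiff (model E γ) (model E γ) ∞ (edgeAct (B := B) g e) := by
  classical
  refine contMDiff_pi_iff.2 fun f => ?_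
  by_cases hf : f = e
  · subst hf
    simp only [edgeAct, Function.update_self]
    exact contMDiff_pi_iff.1 (contMDiff_gaugeAct g) f
  · simp only [edgeAct, Function.update_of_ne hf]
    exact contMDiff_eval f

theorem edgeAct_symm_edgeAct (g : Gauge B) (e : γ.Edge) (a : Conn B γ) :
    edgeAct (fun x => (g x).symm) e (edgeAct g e a) = a := by
  classical
  have h := congrFun (gaugeAct_symm_gaugeAct g a) e
  funext f
  by_cases hf : f = e
  · subst hf
    simp only [edgeAct, Function.update_self]
    simp only [gaugeAct, Function.update_self]
    exact h
  · simp [edgeAct, Function.update_of_ne hf]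

theorem map_edgeAct (g : Gauge B) (e : γ.Edge) :
    (haarOn B γ).map (edgeAct g e) = haarOn B γ := by
  classical
  have hr := isMulRightInvariant_of_compact (haarOn B γ)
  have h1 : edgeAct (γ := γ) g e =
      (fun a => a * Pi.mulSingle e ((chart B _ _).symm (chart B _ _ (g (γ.src e))))) ∘
      fun a => Pi.mulSingle e ((chart B _ _).symm (chart B _ _ (g (γ.tgt e)).symm)) * a := by
    funext a f
    by_cases hf : f = e
    · subst hf
      have := congrFun (gaugeAct_eq_mul g a) f
      simpa [edgeAct] using this
    · simp [edgeAct, Function.update_of_ne hf, Pi.mulSingle_eq_of_ne hf]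
  rw [h1, ← Measure.map_map (measurable_mul_const _) (measurable_const_mul _), map_mul_left_eq_self,
    map_mul_right_eq_self]

open Classical in
/-- The divergence does not depend on the value at an edge with a vertex at which there is just one
other edge, if the components of the vector field do not depend on the values at these edges. -/
theorem divergence_update {X : Field B} (hX : IsVectorField γ₀ X) (hinv : IsInvariant γ₀ X)
    (h0 : γ₀ ≤ Γ) {d : Conn B Γ → ℝ} (hd : IsDivergenceOn (X Γ) d) {e e' : Γ.Edge} (hne : e' ≠ e)
    {v : M} (hv : v ∈ endpoints n e.1)
    (hdeg : ∀ f : Γ.Edge, v ∈ endpoints n f.1 → f = e ∨ f = e')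
    (hind : ∀ a φ f, f ≠ e → (X Γ (Function.update a e φ) : Γ.Edge → E) f = (X Γ a : Γ.Edge → E) f)
    (hind' : ∀ a φ, (X Γ (Function.update a e' φ) : Γ.Edge → E) e = (X Γ a : Γ.Edge → E) e)
    (a : Conn B Γ) (ψ : B.FiberIso (Γ.src e) (Γ.tgt e)) : d (Function.update a e ψ) = d a := by
  have key : ∀ κ : B.FiberIso v v, d (edgeAct (Function.update (fun x => refl B x) v κ) e a) = d a := by
    intro κ
    set g : Gauge B := Function.update (fun x => refl B x) v κ with hg
    have hgne : ∀ x, x ≠ v → g x = refl B x := fun x hx => by rw [hg, Function.update_of_ne hx]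
    have hoff : ∀ (a : Conn B Γ) (f : Γ.Edge), f ≠ e → f ≠ e' → gaugeAct g a f = a f := by
      intro a f hf hf'
      have hvf : v ∉ endpoints n f.1 := fun h => (hdeg f h).elim hf hf'
      have h1 : Γ.src f ≠ v := fun h => hvf (h ▸ Γ.src_mem_endpoints f)
      have h2 : Γ.tgt f ≠ v := fun h => hvf (h ▸ Γ.tgt_mem_endpoints f)
      simp only [gaugeAct, hgne _ h1, hgne _ h2]
      rfl
    -- The full gauge transformation at `v` acts on `e` and `e'` only and preserves the field;
    -- restricted to `e` it still does, by the two independence hypotheses.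
    have hrel : ∀ a, mfderiv (model E Γ) (model E Γ) (edgeAct g e) a (X Γ a) =
        X Γ (edgeAct g e a) := by
      intro a
      refine funext (β := fun _ : Γ.Edge => E) fun f => ?_
      refine (mfderiv_pi_apply ((contMDiff_edgeAct g e).mdifferentiableAt (by simp) (x := a))
        (X Γ a) f).symm.trans ?_
      by_cases hf : f = e
      · subst hf
        have h1 : (fun y : Conn B Γ => edgeAct g f y f) = fun y => gaugeAct g y f := by
          funext y; simp [edgeAct]
        have h2 := mfderiv_pi_apply ((contMDiff_gaugeAct (B := B) g).mdifferentiableAt (by simp)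
          (x := a)) (X Γ a) f
        have h3 := congrFun (hinv Γ h0 g a) f
        -- The two actions differ only at `e'`, to which the component considered is indifferent.
        have h4 : gaugeAct g a = Function.update (edgeAct g f a) e' (gaugeAct g a e') := by
          funext k
          by_cases hk' : k = e'
          · subst hk'; simp
          · rw [Function.update_of_ne hk']
            by_cases hk : k = f
            · subst hk; simp [edgeAct]
            · rw [edgeAct, Function.update_of_ne hk, hoff a k hk hk']
        have h5 : (X Γ (gaugeAct g a) : Γ.Edge → E) f = (X Γ (edgeAct g f a) : Γ.Edge → E) f := by
          rw [h4]; exact hind' _ _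
        refine Eq.trans ?_ (h2.trans (h3.trans h5))
        exact congrArg (fun φ : Conn B Γ → B.FiberIso (Γ.src f) (Γ.tgt f) =>
          (mfderiv (model E Γ) 𝓘(ℝ, E) φ a (X Γ a) : E)) h1
      · have h1 : (fun y : Conn B Γ => edgeAct g e y f) = fun y => y f := by
          funext y; simp [edgeAct, Function.update_of_ne hf]
        refine (congrArg (fun φ : Conn B Γ → B.FiberIso (Γ.src f) (Γ.tgt f) =>
          (mfderiv (model E Γ) 𝓘(ℝ, E) φ a (X Γ a) : E)) h1).trans ?_
        refine (congrArg (fun L : (Γ.Edge → E) →L[ℝ] E => L (X Γ a))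
          (hasMFDerivAt_eval a f).mfderiv).trans ?_
        exact (hind a _ f hf).symm
    exact hd.comp_eq (hX.smoothField h0) (contMDiff_edgeAct g e) (contMDiff_edgeAct _ e).continuous
      (map_edgeAct g e) hrel (edgeAct_symm_edgeAct g e)
      (edgeAct_symm_edgeAct (fun x => (g x).symm) e) a
  rw [Γ.endpoints_edge] at hv
  -- At either end of `e`, some automorphism of the fibre over `v` carries the value `a e` to `ψ`.
  rcases hv with rfl | hv
  · have := key (ψ.trans (a e).symm)
    rw [edgeAct] at this
    convert this using 3
    simp only [gaugeAct, Function.update_self, Function.update_of_ne (Γ.src_ne_tgt e).symm]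
    change ψ = ψ.trans ((a e).symm.trans (a e))
    rw [symm_trans_self]
    rfl
  · rw [mem_singleton_iff] at hv
    subst hv
    have := key (ψ.symm.trans (a e))
    rw [edgeAct] at this
    convert this using 3
    simp only [gaugeAct, Function.update_self, Function.update_of_ne (Γ.src_ne_tgt e)]
    rw [symm_trans, symm_symm, refl_trans, ← trans_assoc, trans_symm_self]
    rfl

/-- Two connections with the same projection are related by a gauge transformation, on the edges
which are contained in edges of the smaller graph. -/
theorem exists_gauge_of_project_eq (h : γ ≤ Γ) {a b : Conn B Γ}
    (hab : project B h a = project B h b) :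
    ∃ g : Gauge B, ∀ e : Γ.Edge, (∃ f ∈ γ.edges, e.1 ⊆ f) → gaugeAct g a e = b e := by
  classical
  -- The discrepancy at `x` between the transports of `b` and `a` along the initial part of an edge
  -- of `γ`; taken as gauge transformation it carries `a` to `b` edge by edge.
  let val : ∀ {y x : M}, Γ.Walk y x → B.FiberIso x x := fun u =>
    (transport b u).symm.trans (transport a u)
  have hinA : ∀ f : γ.Edge, (walk h f).InArc (γ.param f) := fun f =>
    (composes_walk h f).inArc (γ.image_param f)
  have huniq : ∀ (f : γ.Edge) {x y : M} (u : Γ.Walk (γ.src f) x) (u' : Γ.Walk (γ.src f) y)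
      (hxy : x = y), u.InArc (γ.param f) → u'.InArc (γ.param f) → hxy ▸ u = u' := by
    intro f x y u u' hxy hu hu'
    subst hxy
    exact eq_of_heq (Sigma.mk.inj (Walk.InArc.sigma_eq (γ.isAnalyticArc_param f) rfl u hu u' hu'
      rfl)).2
  -- Equality of the projections makes the discrepancy trivial at the ends, the only points shared
  -- by several edges of `γ`. Hence it does not depend on the edge used.
  have hend : ∀ (f : γ.Edge) {x : M} (u : Γ.Walk (γ.src f) x), u.InArc (γ.param f) →
      x ∈ endpoints n f.1 → val u = refl B x := by
    intro f x u hu hx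
    rw [γ.endpoints_edge] at hx
    rcases hx with rfl | hx
    · have h1 := huniq f u .nil rfl hu ⟨by simp [Walk.edgeList], by simp [Walk.edgeList]⟩
      simp only at h1
      rw [h1]
      rfl
    · rw [mem_singleton_iff] at hx
      subst hx
      have h1 := huniq f u (walk h f) rfl hu (hinA f)
      simp only at h1
      rw [h1]
      have h2 : transport a (walk h f) = transport b (walk h f) := congrFun hab f
      change (transport b _).symm.trans (transport a _) = _
      rw [h2, symm_trans_self]
  have hmem : ∀ (f : γ.Edge) {x : M} (u : Γ.Walk (γ.src f) x), u.InArc (γ.param f) → x ∈ f.1 := by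
    intro f x u hu
    obtain ⟨s, hs, hx, -⟩ := Walk.InArc.exists_end (γ.isAnalyticArc_param f) u rfl hu
    rw [← γ.image_param f, hx]
    exact ⟨s, hs, rfl⟩
  have hwd : ∀ (f f' : γ.Edge) {x : M} (u : Γ.Walk (γ.src f) x) (u' : Γ.Walk (γ.src f') x),
      u.InArc (γ.param f) → u'.InArc (γ.param f') → val u = val u' := by
    intro f f' x u u' hu hu'
    by_cases hff : f = f'
    · subst hff
      have h1 := huniq f u u' rfl hu hu'
      simp only at h1
      rw [h1]
    · have h1 := γ.inter_subset f.1 f.2 f'.1 f'.2 (fun h => hff (Subtype.ext h))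
        ⟨hmem f u hu, hmem f' u' hu'⟩
      rw [hend f u hu h1.1, hend f' u' hu' h1.2]
  let g : Gauge B := fun x =>
    if hx : ∃ f : γ.Edge, ∃ u : Γ.Walk (γ.src f) x, u.InArc (γ.param f) then
      val hx.choose_spec.choose else refl B x
  have hg : ∀ (f : γ.Edge) {x : M} (u : Γ.Walk (γ.src f) x), u.InArc (γ.param f) → g x = val u := by
    intro f x u hu
    have hx : ∃ f : γ.Edge, ∃ u : Γ.Walk (γ.src f) x, u.InArc (γ.param f) := ⟨f, u, hu⟩
    change dite _ _ _ = _
    rw [dif_pos hx]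
    exact hwd _ _ _ _ hx.choose_spec.choose_spec hu
  have hsplit : ∀ (f : γ.Edge) (e : Γ.Edge) {x : M} (w : Γ.Walk (γ.src f) x),
      w.InArc (γ.param f) → e ∈ w.edgeList →
      (∃ u : Γ.Walk (γ.src f) (Γ.src e), u.InArc (γ.param f) ∧ (Walk.forward e u).InArc (γ.param f)) ∨
      ∃ u : Γ.Walk (γ.src f) (Γ.tgt e), u.InArc (γ.param f) ∧
        (Walk.backward e u).InArc (γ.param f) := by
    intro f e x w hw he
    induction w with
    | nil => simp [Walk.edgeList] at he
    | forward e' w ih =>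
      have hw' : w.InArc (γ.param f) :=
        ⟨(List.nodup_cons.1 hw.1).2, fun d hd => hw.2 d (List.mem_cons_of_mem _ hd)⟩
      rcases List.mem_cons.1 he with rfl | he'
      · exact Or.inl ⟨w, hw', hw⟩
      · exact ih hw' he'
    | backward e' w ih =>
      have hw' : w.InArc (γ.param f) :=
        ⟨(List.nodup_cons.1 hw.1).2, fun d hd => hw.2 d (List.mem_cons_of_mem _ hd)⟩
      rcases List.mem_cons.1 he with rfl | he'
      · exact Or.inr ⟨w, hw', hw⟩
      · exact ih hw' he'
  refine ⟨g, fun e ⟨f, hf, hef⟩ => ?_⟩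
  have hew : e ∈ (walk h ⟨f, hf⟩).edgeList := by
    by_contra hno
    refine Γ.infinite_edge e ((Γ.finite_inter_of_notMem hno (Γ.src e)).subset
      (subset_inter Subset.rfl ?_))
    rw [(composes_walk h ⟨f, hf⟩).2]
    exact hef.trans subset_union_left
  rcases hsplit ⟨f, hf⟩ e _ (hinA _) hew with ⟨u, hu, hu'⟩ | ⟨u, hu, hu'⟩
  · simp only [gaugeAct]
    rw [hg _ u hu, hg _ _ hu']
    ext p : 2
    simp [val, transport, FiberIso.trans, FiberIso.symm]
  · simp only [gaugeAct]
    rw [hg _ u hu, hg _ _ hu']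
    ext p : 2
    simp [val, transport, FiberIso.trans, FiberIso.symm]

/-- The divergences of the members of an invariant vector field are consistent. -/
theorem divergence_consistent (hM : n = 1 → PreconnectedSpace M) {X : Field B}
    (hX : IsVectorField γ₀ X) (hinv : IsInvariant γ₀ X) (h0 : γ₀ ≤ γ) (h : γ ≤ γ')
    {d : Conn B γ → ℝ} {d' : Conn B γ' → ℝ} (hd : IsDivergenceOn (X γ) d)
    (hd' : IsDivergenceOn (X γ') d') (a : Conn B γ') : d' a = d (project B h a) := by
  classical
  -- Each edge outside `γ` gets a neighbour outside `γ` at a vertex with no further edges, and both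
  -- are replaceable. In dimension one there is no edge outside `γ`, since `γ` covers the manifold.
  obtain ⟨Γ, hΓ, hfree⟩ : ∃ Γ : Graph n M, γ' ≤ Γ ∧ ∀ e : Γ.Edge, (∀ f ∈ γ.edges, ¬ e.1 ⊆ f) →
      ∃ e' : Γ.Edge, e' ≠ e ∧ (∃ v ∈ endpoints n e.1, ∀ f : Γ.Edge, v ∈ endpoints n f.1 →
        f = e ∨ f = e') ∧ ∀ k : Γ.Edge, k = e ∨ k = e' → (∀ f ∈ γ.edges, ¬ k.1 ⊆ f) ∧
        ∃ e'', IsEdge n e'' ∧ endpoints n e'' = endpoints n k.1 ∧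
          ∀ d ∈ Γ.edges, (d ∩ e'').Finite := by
    rcases lt_or_ge n 2 with hn | hn
    · interval_cases n
      · exact (isEmpty_graph_zero.false γ).elim
      · have := hM rfl
        refine ⟨γ', Graph.le_refl _, fun e he => absurd (γ'.infinite_edge e) ?_⟩
        rw [not_infinite]
        have h1 : e.1 ⊆ ⋃ f ∈ γ.edges, e.1 ∩ f := by
          intro x hx
          have h2 : x ∈ ⋃ f ∈ γ.edges, f := by rw [γ.iUnion_edges_eq_univ]; trivial
          obtain ⟨f, hf, hxf⟩ := mem_iUnion₂.1 h2
          exact mem_iUnion₂.2 ⟨f, hf, hx, hxf⟩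
        refine Set.Finite.subset (γ.edges.finite_toSet.biUnion fun f hf => ?_) h1
        by_contra hinf
        exact he f hf (Graph.exists_edge_of_subset h e.2 hf hinf)
    · obtain ⟨Γ, hΓ, hsub, hfine⟩ := exists_fine_refinement hn γ'
      refine ⟨Γ, hΓ, fun e he => ?_⟩
      obtain ⟨f, hf, hef⟩ := hsub e.1 e.2
      obtain ⟨hrep, v, hv, e', he', hef', hne, hdeg⟩ := hfine f hf e.1 e.2 hef
      have hfout : ∀ k ∈ γ.edges, ¬ f ⊆ k := fun k hk hfk => he k hk (hef.trans hfk)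
      refine ⟨⟨e', he'⟩, fun h => hne (congrArg Subtype.val h), ⟨v, hv, fun k hk => ?_⟩, ?_⟩
      · exact (hdeg k.1 k.2 hk).imp (fun h => Subtype.ext h) fun h => Subtype.ext h
      · have hkout : ∀ k ∈ Γ.edges, k ⊆ f → ∀ q ∈ γ.edges, ¬ k ⊆ q := by
          intro k hk hkf q hq hkq
          refine hfout q hq (Graph.exists_edge_of_subset h hf hq ?_)
          exact ((Γ.isEdge k hk).infinite).mono (subset_inter hkf hkq)
        rintro k (rfl | rfl)
        · exact ⟨hkout _ k.2 hef, hrep⟩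
        · exact ⟨hkout _ he' hef', (hfine f hf e' he' hef').1⟩
  have hγΓ := Graph.le_trans h hΓ
  have h0Γ := Graph.le_trans h0 hγΓ
  obtain ⟨δ, hδs, hδ, -⟩ := exists_isDivergenceOn (hX.smoothField h0Γ)
  -- Replacing `k` produces a graph above `γ`, where the field is still defined, that avoids `k` but
  -- covers the other edges.
  have hind : ∀ k : Γ.Edge, ((∀ f ∈ γ.edges, ¬ k.1 ⊆ f) ∧
      ∃ e'', IsEdge n e'' ∧ endpoints n e'' = endpoints n k.1 ∧ ∀ d ∈ Γ.edges, (d ∩ e'').Finite) →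
      ∀ (a : Conn B Γ) φ f, f ≠ k →
        (X Γ (Function.update a k φ) : Γ.Edge → E) f = (X Γ a : Γ.Edge → E) f := by
    rintro k ⟨hk, e'', he'', hend, hfin⟩ a φ f hf
    obtain ⟨γ₁, h1, hcov, hfin1⟩ := exists_replacement hγΓ k.2 hk he'' hend hfin
    exact component_update hX h0Γ (Graph.le_trans h0 h1)
      (hcov f.1 f.2 fun h => hf (Subtype.ext h)) hfin1 a φ
  have hupd : ∀ e : Γ.Edge, (∀ f ∈ γ.edges, ¬ e.1 ⊆ f) → ∀ a ψ, δ (Function.update a e ψ) = δ a := by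
    intro e he a ψ
    obtain ⟨e', hne, ⟨v, hv, hdeg⟩, hk⟩ := hfree e he
    exact divergence_update hX hinv h0Γ hδ hne hv hdeg (hind e (hk e (Or.inl rfl)))
      (fun a φ => hind e' (hk e' (Or.inr rfl)) a φ e hne.symm) a ψ
  have hagree : ∀ a b : Conn B Γ, (∀ e : Γ.Edge, (∃ f ∈ γ.edges, e.1 ⊆ f) → a e = b e) →
      δ a = δ b := by
    intro a b hab
    -- The values at the edges outside `γ` are exchanged one at a time.
    have key : ∀ s : Finset Γ.Edge, (∀ e ∈ s, ∀ f ∈ γ.edges, ¬ e.1 ⊆ f) →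
        δ (fun e => if e ∈ s then b e else a e) = δ a := by
      intro s
      induction s using Finset.induction_on with
      | empty => simp
      | insert e s hes ih =>
        intro hs
        refine Eq.trans ?_ ((hupd e (hs e (Finset.mem_insert_self e s))
          (fun k => if k ∈ s then b k else a k) (b e)).trans
          (ih fun k hk => hs k (Finset.mem_insert_of_mem hk)))
        congr 1
        funext k
        by_cases hk : k = e
        · subst hk; simp
        · simp [hk]
    rw [← key (Finset.univ.filter fun e : Γ.Edge => ∀ f ∈ γ.edges, ¬ e.1 ⊆ f) fun e he =>
      (Finset.mem_filter.1 he).2]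
    congr 1
    funext e
    by_cases he : ∀ f ∈ γ.edges, ¬ e.1 ⊆ f
    · simp only [Finset.mem_filter, Finset.mem_univ, true_and]
      rw [if_pos he]
    · simp only [Finset.mem_filter, Finset.mem_univ, true_and]
      rw [if_neg he]
      push Not at he
      exact hab e he
  have hfib : ∀ a b : Conn B Γ, project B hγΓ a = project B hγΓ b → δ a = δ b := by
    intro a b hab
    obtain ⟨g, hg⟩ := exists_gauge_of_project_eq hγΓ hab
    rw [← hδ.gaugeAct_eq hX hinv h0Γ g a]
    exact hagree _ _ hg
  -- An arbitrary section is enough to define the descended function; it is continuous because the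
  -- projection of compact Hausdorff spaces is a quotient map.
  set s := Function.surjInv (surjective_project B hγΓ)
  have hs : ∀ b, project B hγΓ (s b) = b := Function.surjInv_eq _
  have hDp : ∀ a, δ a = δ (s (project B hγΓ a)) := fun a => hfib _ _ (hs _).symm
  have hquot : Topology.IsQuotientMap (project B hγΓ) :=
    ((continuous_project (B := B) hγΓ).isClosedMap).isQuotientMap (continuous_project hγΓ)
      (surjective_project B hγΓ)
  have hDc : Continuous (δ ∘ s) := by
    rw [hquot.continuous_iff]
    have : (δ ∘ s) ∘ project B hγΓ = δ := funext fun a => (hDp a).symm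
    rw [this]
    exact hδs.continuous
  have hD := (hδ.of_comp (contMDiff_project hγΓ) (map_project hγΓ) (hX.consistent γ Γ hγΓ h0) hDc
    hDp (hX.smoothField h0)).unique hd
  -- The divergence at `Γ` is a pull-back from `γ`, so it also descends to `γ'`, where it has to be
  -- the divergence there.
  have hd'' := hδ.of_comp (contMDiff_project hΓ) (map_project hΓ)
    (hX.consistent γ' Γ hΓ (Graph.le_trans h0 h)) (D := d ∘ project B h)
    (hd.1.comp (continuous_project h)) (fun a => by
      rw [hDp a, Function.comp_apply, project_trans]
      exact congrFun hD _) (hX.smoothField (Graph.le_trans h0 h))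
  exact congrFun (hd'.unique hd'') a

end Divergence

end GenConn

end

noncomputable section

set_option linter.unusedSectionVars false
set_option linter.unusedVariables false

namespace GenConn

/-! ### Vector fields and momenta on cylindrical functions -/

section MomentumCalculus

open PrincipalBundle FiberIso GenConn.Graph

variable {n : ℕ} {M : Type*} [TopologicalSpace M] [ChartedSpace (EuclideanSpace ℝ (Fin n)) M]
  {E : Type*} [NormedAddCommGroup E] [NormedSpace ℝ E] [FiniteDimensional ℝ E]
  {G : Type*} [Group G] [TopologicalSpace G] [ChartedSpace E G]
  {F : Type*} [NormedAddCommGroup F] [NormedSpace ℝ F]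
  {P : Type*} [TopologicalSpace P] [ChartedSpace F P]
  {B : PrincipalBundle n M E G F P} {γ γ' γ₀ γ₁ γ₂ Γ : Graph n M}
  [T2Space M] [IsManifold (𝓡 n) ω M]
  [LieGroup 𝓘(ℝ, E) ∞ G] [IsTopologicalGroup G] [T2Space G] [CompactSpace G]
  [SecondCountableTopology G] [MeasurableSpace G] [BorelSpace G]

theorem dirDeriv_comp_project {X : Field B} (hX : IsVectorField γ₀ X) (h0 : γ₀ ≤ γ) (h : γ ≤ Γ)
    {F' : Type*} [NormedAddCommGroup F'] [NormedSpace ℝ F'] {u : Conn B γ → F'}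
    (hu : ContMDiff (model E γ) 𝓘(ℝ, F') 1 u) (a : Conn B Γ) :
    dirDeriv (model E Γ) (X Γ) (fun a => u (project B h a)) a =
      dirDeriv (model E γ) (X γ) u (project B h a) :=
  dirDeriv_comp ((contMDiff_project h).mdifferentiableAt (by simp)) (hX.consistent γ Γ h h0 a)
    (hu.mdifferentiableAt (by simp))

/-- Independence of the representative chosen in the definition: on a common refinement both pull
back to the same function, because `surjective_at` lets it be read off from the limit, and
consistency does the rest. -/
theorem deriv_eq {X : Field B} (hX : IsVectorField γ₀ X) (h0 : γ₀ ≤ γ) {f : Limit B → ℂ}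
    {u : Conn B γ → ℂ} (hu : ContMDiff (model E γ) 𝓘(ℝ, ℂ) 1 u) (hf : ∀ A, f A = u (A.at γ))
    (A : Limit B) : deriv γ₀ X f A = dirDeriv (model E γ) (X γ) u (A.at γ) := by
  have h : ∃ γ, γ₀ ≤ γ ∧ ∃ fγ : Conn B γ → ℂ,
      ContMDiff (model E γ) 𝓘(ℝ, ℂ) 1 fγ ∧ ∀ A, f A = fγ (A.at γ) := ⟨γ, h0, u, hu, hf⟩
  refine (congrFun (dif_pos h) A).trans ?_
  have hδ := h.choose_spec.1
  obtain ⟨hv, hfv⟩ := h.choose_spec.2.choose_spec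
  obtain ⟨Γ, h1, h2⟩ := exists_ge_pair h.choose γ
  have key : (fun a : Conn B Γ => h.choose_spec.2.choose (project B h1 a)) =
      fun a => u (project B h2 a) := by
    funext a
    obtain ⟨A, rfl⟩ := surjective_at Γ a
    beta_reduce
    rw [project_at, project_at, ← hfv, ← hf]
  have e1 := dirDeriv_comp_project hX hδ h1 hv (A.at Γ)
  rw [key, dirDeriv_comp_project hX h0 h2 hu, project_at, project_at] at e1
  exact e1.symm

theorem exists_rep_of_mem_cyl {k : WithTop ℕ∞} (hk : k ≤ ∞) {f : Limit B → ℂ} (hf : f ∈ Cyl B k)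
    (γ₀ : Graph n M) : ∃ Γ, γ₀ ≤ Γ ∧ ∃ u : Conn B Γ → ℂ, ContMDiff (model E Γ) 𝓘(ℝ, ℂ) k u ∧
      ∀ A, f A = u (A.at Γ) := by
  obtain ⟨γ, u, hu, hf⟩ := hf
  obtain ⟨Γ, h1, h2⟩ := exists_ge_pair γ γ₀
  exact ⟨Γ, h2, _, hu.comp ((contMDiff_project h1).of_le hk), fun A => by
    rw [hf, Function.comp_apply, project_at]⟩

theorem invariant_of_rep {f : Limit B → ℂ} (hf : ∀ (g : Gauge B) A, f (A.gaugeAct g) = f A)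
    {u : Conn B γ → ℂ} (h : ∀ A, f A = u (A.at γ)) (g : Gauge B) (a : Conn B γ) :
    u (gaugeAct g a) = u a := by
  obtain ⟨A, rfl⟩ := surjective_at γ a
  exact (h (A.gaugeAct g)).symm.trans ((hf g A).trans (h A))

theorem dirDeriv_gaugeAct {X : Field B} (hX : IsVectorField γ₀ X) (hinv : IsInvariant γ₀ X)
    (h0 : γ₀ ≤ γ) {F' : Type*} [NormedAddCommGroup F'] [NormedSpace ℝ F'] {u : Conn B γ → F'}
    (hu : ContMDiff (model E γ) 𝓘(ℝ, F') 1 u) (g : Gauge B) (a : Conn B γ) :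
    dirDeriv (model E γ) (X γ) (fun a => u (gaugeAct g a)) a =
      dirDeriv (model E γ) (X γ) u (gaugeAct g a) :=
  dirDeriv_comp ((contMDiff_gaugeAct g).mdifferentiableAt (by simp)) (hinv γ h0 g a)
    (hu.mdifferentiableAt (by simp))

theorem IsVectorField.bracket {X Y : Field B} (hX : IsVectorField γ₁ X) (hY : IsVectorField γ₂ Y)
    (h1 : γ₁ ≤ γ) (h2 : γ₂ ≤ γ) : IsVectorField γ (bracket X Y) where
  smooth δ hδ := smoothField_mlieBracket (hX.smoothField (Graph.le_trans h1 hδ))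
    (hY.smoothField (Graph.le_trans h2 hδ))
  consistent δ δ' h hδ a := by
    have : CompleteSpace E := FiniteDimensional.complete ℝ E
    have h1δ := Graph.le_trans h1 hδ
    have h2δ := Graph.le_trans h2 hδ
    exact mfderiv_mlieBracket_of_related (hX.smoothField (Graph.le_trans h1δ h))
      (hY.smoothField (Graph.le_trans h2δ h)) (hX.smoothField h1δ) (hY.smoothField h2δ)
      (contMDiff_project h) (hX.consistent δ δ' h h1δ) (hY.consistent δ δ' h h2δ) a

theorem IsInvariant.bracket {X Y : Field B} (hX : IsVectorField γ₁ X) (hY : IsVectorField γ₂ Y)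
    (hX' : IsInvariant γ₁ X) (hY' : IsInvariant γ₂ Y) (h1 : γ₁ ≤ γ) (h2 : γ₂ ≤ γ) :
    IsInvariant γ (bracket X Y) := by
  intro δ hδ g a
  have : CompleteSpace E := FiniteDimensional.complete ℝ E
  have h1δ := Graph.le_trans h1 hδ
  have h2δ := Graph.le_trans h2 hδ
  exact mfderiv_mlieBracket_of_related (hX.smoothField h1δ) (hY.smoothField h2δ)
    (hX.smoothField h1δ) (hY.smoothField h2δ) (contMDiff_gaugeAct g) (hX' δ h1δ g) (hY' δ h2δ g) a

theorem exists_isDivergence (hM : n = 1 → PreconnectedSpace M) {X : Field B}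
    (hX : IsVectorField γ₀ X) (hinv : IsInvariant γ₀ X) : ∃ d, IsDivergence γ₀ X d := by
  obtain ⟨d, -, hd, -⟩ := exists_isDivergenceOn (hX.smoothField (Graph.le_refl γ₀))
  refine ⟨fun A => d (A.at γ₀), fun γ h => ?_⟩
  obtain ⟨d', hs, hd', -⟩ := exists_isDivergenceOn (hX.smoothField h)
  refine ⟨d', hs, hd', fun A => ?_⟩
  rw [divergence_consistent hM hX hinv (Graph.le_refl γ₀) h hd hd', project_at]

theorem isDivergence_divergence (hM : n = 1 → PreconnectedSpace M) {X : Field B}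
    (hX : IsVectorField γ₀ X) (hinv : IsInvariant γ₀ X) : IsDivergence γ₀ X (divergence γ₀ X) := by
  have h := exists_isDivergence hM hX hinv
  rw [divergence, dif_pos h]
  exact h.choose_spec

theorem divergence_eq (hM : n = 1 → PreconnectedSpace M) {X : Field B}
    (hX : IsVectorField γ₀ X) (hinv : IsInvariant γ₀ X) (h : γ₀ ≤ γ) {d : Conn B γ → ℝ}
    (hd : IsDivergenceOn (X γ) d) (A : Limit B) : divergence γ₀ X A = d (A.at γ) := by
  obtain ⟨d', -, hd', h'⟩ := isDivergence_divergence hM hX hinv γ h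
  rw [h' A, hd'.unique hd]

theorem divergence_gaugeAct (hM : n = 1 → PreconnectedSpace M) {X : Field B}
    (hX : IsVectorField γ₀ X) (hinv : IsInvariant γ₀ X) (g : Gauge B) (A : Limit B) :
    divergence γ₀ X (A.gaugeAct g) = divergence γ₀ X A := by
  obtain ⟨d, -, hd, h⟩ := isDivergence_divergence hM hX hinv γ₀ (Graph.le_refl γ₀)
  rw [h, h, at_gaugeAct, hd.gaugeAct_eq hX hinv (Graph.le_refl γ₀)]

/-- `i (V u + ½ d u)`. -/
def levelMomentum (V : ∀ a : Conn B γ, TangentSpace (model E γ) a) (d : Conn B γ → ℝ)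
    (u : Conn B γ → ℂ) (a : Conn B γ) : ℂ :=
  Complex.I * (dirDeriv (model E γ) V u a + 1 / 2 * (d a : ℂ) * u a)

theorem momentum_eq (hM : n = 1 → PreconnectedSpace M) {X : Field B}
    (hX : IsVectorField γ₀ X) (hinv : IsInvariant γ₀ X) (h : γ₀ ≤ γ) {d : Conn B γ → ℝ}
    (hd : IsDivergenceOn (X γ) d) {f : Limit B → ℂ} {u : Conn B γ → ℂ}
    (hu : ContMDiff (model E γ) 𝓘(ℝ, ℂ) 1 u) (hf : ∀ A, f A = u (A.at γ)) (A : Limit B) :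
    momentum γ₀ X f A = levelMomentum (X γ) d u (A.at γ) := by
  rw [momentum, levelMomentum, deriv_eq hX h hu hf, divergence_eq hM hX hinv h hd, hf]

theorem contMDiff_mul_complex {k : WithTop ℕ∞} {u v : Conn B γ → ℂ}
    (hu : ContMDiff (model E γ) 𝓘(ℝ, ℂ) k u) (hv : ContMDiff (model E γ) 𝓘(ℝ, ℂ) k v) :
    ContMDiff (model E γ) 𝓘(ℝ, ℂ) k fun a => u a * v a :=
  (contDiff_mul (𝕜 := ℝ) (𝔸 := ℂ)).contMDiff.comp (hu.prodMk_space hv)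

theorem contMDiff_levelMomentum {V : ∀ a : Conn B γ, TangentSpace (model E γ) a}
    (hV : SmoothField (model E γ) V) {d : Conn B γ → ℝ} (hd : ContMDiff (model E γ) 𝓘(ℝ, ℝ) ∞ d)
    {k m : WithTop ℕ∞} (hm : m + 1 ≤ k) (hm' : m ≤ ∞) {u : Conn B γ → ℂ}
    (hu : ContMDiff (model E γ) 𝓘(ℝ, ℂ) k u) :
    ContMDiff (model E γ) 𝓘(ℝ, ℂ) m (levelMomentum V d u) := by
  have h1 := contMDiff_dirDeriv hV hu hm hm'
  have h2 : ContMDiff (model E γ) 𝓘(ℝ, ℂ) m fun a => (d a : ℂ) :=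
    (Complex.ofRealCLM.contMDiff.comp hd).of_le hm'
  exact contMDiff_mul_complex contMDiff_const (h1.add (contMDiff_mul_complex
    (contMDiff_mul_complex contMDiff_const h2) (hu.of_le (le_self_add.trans hm))))

theorem momentum_mem_cylInv (hM : n = 1 → PreconnectedSpace M) {X : Field B}
    (hX : IsVectorField γ₀ X) (hinv : IsInvariant γ₀ X) {k m : WithTop ℕ∞} (hm : m + 1 ≤ k)
    (hk : k ≤ ∞) {f : Limit B → ℂ} (hf : f ∈ CylInv B k) : momentum γ₀ X f ∈ CylInv B m := by
  obtain ⟨Γ, h, u, hu, hfu⟩ := exists_rep_of_mem_cyl hk hf.1 γ₀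
  obtain ⟨d, hds, hd, -⟩ := exists_isDivergenceOn (hX.smoothField h)
  have hu1 : ContMDiff (model E Γ) 𝓘(ℝ, ℂ) 1 u := hu.of_le (le_add_self.trans hm)
  have h1 := momentum_eq hM hX hinv h hd hu1 hfu
  refine ⟨⟨Γ, _, contMDiff_levelMomentum (hX.smoothField h) hds hm
    ((le_self_add.trans hm).trans hk) hu, h1⟩, fun g A => ?_⟩
  have h2 := invariant_of_rep hf.2 hfu g
  have h3 := dirDeriv_gaugeAct hX hinv h hu1 g (A.at Γ)
  rw [show (fun a => u (gaugeAct g a)) = u from funext h2] at h3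
  rw [h1, h1, at_gaugeAct, levelMomentum, levelMomentum, ← h3, hd.gaugeAct_eq hX hinv h, h2]

theorem integral_mul_dirDeriv {V : ∀ a : Conn B γ, TangentSpace (model E γ) a}
    (hV : SmoothField (model E γ) V) {d : Conn B γ → ℝ} (hd : IsDivergenceOn V d)
    {u v : Conn B γ → ℝ} (hu : ContMDiff (model E γ) 𝓘(ℝ, ℝ) ∞ u)
    (hv : ContMDiff (model E γ) 𝓘(ℝ, ℝ) ∞ v) :
    ∫ a, u a * dirDeriv (model E γ) V v a ∂(haarOn B γ) =
      - (∫ a, u a * v a * d a ∂(haarOn B γ)) -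
        ∫ a, dirDeriv (model E γ) V u a * v a ∂(haarOn B γ) := by
  have h1 := integral_dirDeriv_eq hd (hu.smul hv)
  have h2 : ∀ a, dirDeriv (model E γ) V (u • v) a =
      u a * dirDeriv (model E γ) V v a + dirDeriv (model E γ) V u a * v a := fun a =>
    dirDeriv_smul (hu.mdifferentiableAt (by simp)) (hv.mdifferentiableAt (by simp))
  have hc1 := (contMDiff_dirDeriv hV hu (m := ∞) (by simp) le_rfl).continuous
  have hc2 := (contMDiff_dirDeriv hV hv (m := ∞) (by simp) le_rfl).continuous
  simp only [h2] at h1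
  rw [eq_sub_iff_add_eq]
  exact (integral_add (integrable_of_continuous (hu.continuous.mul hc2))
    (integrable_of_continuous (hc1.mul hv.continuous))).symm.trans h1

/-- The divergence of a commutator. -/
theorem IsDivergenceOn.mlieBracket {V W : ∀ a : Conn B γ, TangentSpace (model E γ) a}
    (hV : SmoothField (model E γ) V) (hW : SmoothField (model E γ) W) {d e : Conn B γ → ℝ}
    (hds : ContMDiff (model E γ) 𝓘(ℝ, ℝ) ∞ d) (hes : ContMDiff (model E γ) 𝓘(ℝ, ℝ) ∞ e)
    (hd : IsDivergenceOn V d) (he : IsDivergenceOn W e) :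
    IsDivergenceOn (VectorField.mlieBracket (model E γ) V W) fun a =>
      dirDeriv (model E γ) V e a - dirDeriv (model E γ) W d a := by
  have : CompleteSpace E := FiniteDimensional.complete ℝ E
  have hs : ∀ {V : ∀ a : Conn B γ, TangentSpace (model E γ) a} {u : Conn B γ → ℝ},
      SmoothField (model E γ) V → ContMDiff (model E γ) 𝓘(ℝ, ℝ) ∞ u →
      ContMDiff (model E γ) 𝓘(ℝ, ℝ) ∞ (dirDeriv (model E γ) V u) := fun hV hu =>
    contMDiff_dirDeriv hV hu (m := ∞) (by simp) le_rfl
  have hint : ∀ {v : Conn B γ → ℝ}, Continuous v → Integrable v (haarOn B γ) := fun hv =>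
    integrable_of_continuous hv
  refine ⟨(hs hV hes).continuous.sub (hs hW hds).continuous, fun f hf => ?_⟩
  have hfc := hf.continuous
  have hVf := hs hV hf
  have hWf := hs hW hf
  have e1 : ∫ a, (show ℝ from mfderiv (model E γ) 𝓘(ℝ, ℝ) f a
      (VectorField.mlieBracket (model E γ) V W a)) ∂(haarOn B γ) =
      (∫ a, dirDeriv (model E γ) V (dirDeriv (model E γ) W f) a ∂(haarOn B γ)) -
        ∫ a, dirDeriv (model E γ) W (dirDeriv (model E γ) V f) a ∂(haarOn B γ) := by
    refine Eq.trans ?_ (integral_sub (hint (hs hV hWf).continuous) (hint (hs hW hVf).continuous))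
    exact congrArg (fun v : Conn B γ → ℝ => ∫ a, v a ∂(haarOn B γ))
      (dirDeriv_mlieBracket hV hW (hf.of_le two_le_infty))
  rw [e1, integral_dirDeriv_eq hd hWf, integral_dirDeriv_eq he hVf]
  -- Integration by parts takes the derivatives off `e` and `d`; the integral of `f e d` then occurs
  -- twice and cancels.
  have e2 := integral_mul_dirDeriv hV hd hf hes
  have e3 := integral_mul_dirDeriv hW he hf hds
  have e4 : ∫ a, f a * (dirDeriv (model E γ) V e a - dirDeriv (model E γ) W d a) ∂(haarOn B γ) =
      (∫ a, f a * dirDeriv (model E γ) V e a ∂(haarOn B γ)) -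
        ∫ a, f a * dirDeriv (model E γ) W d a ∂(haarOn B γ) := by
    simp only [mul_sub]
    exact integral_sub (hint (hfc.mul (hs hV hes).continuous))
      (hint (hfc.mul (hs hW hds).continuous))
  have e5 : ∫ a, f a * e a * d a ∂(haarOn B γ) = ∫ a, f a * d a * e a ∂(haarOn B γ) :=
    integral_congr_ae (Filter.Eventually.of_forall fun a => mul_right_comm _ _ _)
  rw [e4, e2, e3, e5]
  ring

/-- In the commutator the terms pairing `d` or `e` with a first derivative of `u`, and the product
of `d` and `e`, cancel. What remains is the bracket and half of `V e - W d`, its divergence. -/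
theorem levelMomentum_commutator {V W : ∀ a : Conn B γ, TangentSpace (model E γ) a}
    (hV : SmoothField (model E γ) V) (hW : SmoothField (model E γ) W) {d e : Conn B γ → ℝ}
    (hds : ContMDiff (model E γ) 𝓘(ℝ, ℝ) ∞ d) (hes : ContMDiff (model E γ) 𝓘(ℝ, ℝ) ∞ e)
    {u : Conn B γ → ℂ} (hu : ContMDiff (model E γ) 𝓘(ℝ, ℂ) 2 u) (a : Conn B γ) :
    levelMomentum (VectorField.mlieBracket (model E γ) V W) (fun a =>
      dirDeriv (model E γ) V e a - dirDeriv (model E γ) W d a) u a =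
      -Complex.I * (levelMomentum V d (levelMomentum W e u) a -
        levelMomentum W e (levelMomentum V d u) a) := by
  have : CompleteSpace E := FiniteDimensional.complete ℝ E
  have key : ∀ {V W : ∀ a : Conn B γ, TangentSpace (model E γ) a} {e : Conn B γ → ℝ},
      SmoothField (model E γ) V → SmoothField (model E γ) W →
      ContMDiff (model E γ) 𝓘(ℝ, ℝ) ∞ e →
      dirDeriv (model E γ) V (levelMomentum W e u) a = Complex.I *
        (dirDeriv (model E γ) V (dirDeriv (model E γ) W u) a + 1 / 2 *
          ((e a : ℂ) * dirDeriv (model E γ) V u a + ((dirDeriv (model E γ) V e a : ℝ) : ℂ) * u a)) := by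
    intro V W e hV hW hes
    have m1 : MDifferentiableAt (model E γ) 𝓘(ℝ, ℂ) (dirDeriv (model E γ) W u) a :=
      (contMDiff_dirDeriv hW hu (m := 1) (by norm_num) (by simp)).mdifferentiableAt (by simp)
    have m2 : MDifferentiableAt (model E γ) 𝓘(ℝ, ℂ) u a := hu.mdifferentiableAt (by simp)
    have m3 : MDifferentiableAt (model E γ) 𝓘(ℝ, ℝ) e a := hes.mdifferentiableAt (by simp)
    have m4 : MDifferentiableAt (model E γ) 𝓘(ℝ, ℂ) (fun a => e a • u a) a :=
      ((hes.of_le two_le_infty).smul hu).mdifferentiableAt (by simp)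
    have m5 : MDifferentiableAt (model E γ) 𝓘(ℝ, ℂ)
        (fun a => ContinuousLinearMap.mul ℝ ℂ (1 / 2) (e a • u a)) a :=
      ((ContinuousLinearMap.mul ℝ ℂ (1 / 2)).contMDiff.comp
        ((hes.of_le two_le_infty).smul hu)).mdifferentiableAt (by simp)
    have e0 : levelMomentum W e u = fun a => ContinuousLinearMap.mul ℝ ℂ Complex.I
        (dirDeriv (model E γ) W u a + ContinuousLinearMap.mul ℝ ℂ (1 / 2) (e a • u a)) := by
      funext a
      simp [levelMomentum, mul_assoc]
    rw [e0]
    refine (dirDeriv_clm _ (m1.add m5)).trans ?_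
    refine (congrArg _ (dirDeriv_add m1 m5)).trans ?_
    rw [dirDeriv_clm _ m4, dirDeriv_smul m3 m2]
    simp
  have h1 := congrFun (dirDeriv_mlieBracket hV hW hu) a
  have k1 := key hV hW hes
  have k2 := key hW hV hds
  rw [levelMomentum.eq_def (VectorField.mlieBracket (model E γ) V W),
    levelMomentum.eq_def V d (levelMomentum W e u), levelMomentum.eq_def W e (levelMomentum V d u),
    h1, k1, k2, levelMomentum, levelMomentum]
  push_cast
  ring_nf
  simp only [show Complex.I ^ 3 = -Complex.I by rw [pow_succ, Complex.I_sq]; ring]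
  ring

theorem momentum_bracket (hM : n = 1 → PreconnectedSpace M) {X Y : Field B}
    (hX : IsVectorField γ₁ X) (hY : IsVectorField γ₂ Y) (hX' : IsInvariant γ₁ X)
    (hY' : IsInvariant γ₂ Y) (h1 : γ₁ ≤ γ) (h2 : γ₂ ≤ γ) {f : Limit B → ℂ} (hf : f ∈ CylInv B 2) :
    momentum γ (bracket X Y) f = (-Complex.I) • (momentum γ₁ X (momentum γ₂ Y f) -
      momentum γ₂ Y (momentum γ₁ X f)) := by
  funext A
  obtain ⟨Γ, h, u, hu, hfu⟩ := exists_rep_of_mem_cyl two_le_infty hf.1 γ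
  have h1Γ := Graph.le_trans h1 h
  have h2Γ := Graph.le_trans h2 h
  have hVX := hX.smoothField h1Γ
  have hVY := hY.smoothField h2Γ
  obtain ⟨d, hds, hd, -⟩ := exists_isDivergenceOn hVX
  obtain ⟨e, hes, he, -⟩ := exists_isDivergenceOn hVY
  have hu1 := hu.of_le (show (1 : WithTop ℕ∞) ≤ 2 by norm_num)
  have eX := momentum_eq hM hX hX' h1Γ hd hu1 hfu
  have eY := momentum_eq hM hY hY' h2Γ he hu1 hfu
  have eXY := momentum_eq hM hX hX' h1Γ hd (contMDiff_levelMomentum hVY hes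
    (m := 1) (by norm_num) (by simp) hu) eY
  have eYX := momentum_eq hM hY hY' h2Γ he (contMDiff_levelMomentum hVX hds
    (m := 1) (by norm_num) (by simp) hu) eX
  rw [momentum_eq hM (hX.bracket hY h1 h2) (IsInvariant.bracket hX hY hX' hY' h1 h2) h
    (IsDivergenceOn.mlieBracket hVX hVY hds hes hd he) hu1 hfu, Pi.smul_apply, Pi.sub_apply, eXY,
    eYX, smul_eq_mul]
  exact levelMomentum_commutator hVX hVY hds hes hu (A.at Γ)

end MomentumCalculus

end GenConn

end

noncomputable section

set_option linter.unusedSectionVars false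
set_option linter.unusedVariables false

namespace GenConn

/-! ### The criterion for essential self-adjointness -/

section SelfAdjointness

variable {H : Type*} [NormedAddCommGroup H] [InnerProductSpace ℂ H]

/-- The hypothesis says that the pairing is real, so multiplication by `± i` makes the cross term
purely imaginary. Symmetric operators satisfy it with `x = T y`. -/
theorem norm_add_I_smul_sq {x y : H} (c : ℂ) (hc : c = Complex.I ∨ c = -Complex.I)
    (h : (starRingEnd ℂ) (inner ℂ y x) = inner ℂ y x) :
    ‖x + c • y‖ ^ 2 = ‖x‖ ^ 2 + ‖y‖ ^ 2 := by
  have h1 : (inner ℂ x y).im = 0 := by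
    rw [← inner_conj_symm, h]
    exact Complex.conj_eq_iff_im.1 h
  have hcn : ‖c‖ = 1 := by rcases hc with rfl | rfl <;> simp
  have h2 : RCLike.re (inner ℂ x (c • y)) = 0 := by
    rw [inner_smul_right]
    rcases hc with rfl | rfl <;> simp [h1]
  rw [norm_add_sq (𝕜 := ℂ), h2, norm_smul, hcn]
  ring

variable [CompleteSpace H]

/-- A densely defined symmetric operator `T` such that the ranges of `T + i` and `T - i` are dense
is essentially self-adjoint. -/
theorem isEssentiallySelfAdjoint_of_dense_range {T : H →ₗ.[ℂ] H}
    (hdense : Dense (T.domain : Set H)) (hsymm : T.IsFormalAdjoint T)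
    (hplus : ∀ z : H, (∀ x : T.domain, inner ℂ z (T x + Complex.I • (x : H)) = 0) → z = 0)
    (hminus : ∀ z : H, (∀ x : T.domain, inner ℂ z (T x - Complex.I • (x : H)) = 0) → z = 0) :
    IsEssentiallySelfAdjoint T := by
  have hle : T ≤ T.adjoint := hsymm.le_adjoint hdense
  have hcl := LinearPMap.adjoint_isClosed hdense
  have hclosable : T.IsClosable :=
    LinearPMap.isClosable_iff_exists_closed_extension.2 ⟨_, hcl, hle⟩
  refine ⟨hdense, hclosable, ?_⟩
  have hgr := hclosable.graph_closure_eq_closure_graph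
  have hS : T.closure = T.adjoint := by
    refine LinearPMap.eq_of_eq_graph (le_antisymm ?_ ?_)
    · rw [← hgr]
      exact Submodule.topologicalClosure_minimal _ (LinearPMap.le_graph_of_le hle) hcl
    · rintro ⟨z, w⟩ hzw
      -- Approximate `w + i z` by values of `T + i`. The norm identity makes the arguments and their
      -- images under `T` Cauchy, with limit `(y, v)` in the closure of the graph; it remains to see
      -- `z = y`.
      have hrange : DenseRange fun x : T.domain => T x + Complex.I • (x : H) := by
        let L : T.domain →ₗ[ℂ] H := T.toFun + Complex.I • T.domain.subtype
        have h1 : (LinearMap.range L).topologicalClosure = ⊤ := by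
          rw [Submodule.topologicalClosure_eq_top_iff, Submodule.eq_bot_iff]
          intro z hz
          exact hplus z fun x => (Submodule.mem_orthogonal' _ _).1 hz _ ⟨x, rfl⟩
        exact dense_iff_closure_eq.2 (congrArg (fun S : Submodule ℂ H => (S : Set H)) h1)
      obtain ⟨s, hs, hlim⟩ := mem_closure_iff_seq_limit.1 (hrange (w + Complex.I • z))
      choose x hx using hs
      have hnorm : ∀ x y : T.domain, ‖(T x + Complex.I • (x : H)) - (T y + Complex.I • (y : H))‖ ^ 2 =
          ‖T x - T y‖ ^ 2 + ‖(x : H) - y‖ ^ 2 := by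
        intro x y
        have h1 := norm_add_I_smul_sq (x := T (x - y)) (y := ((x - y : T.domain) : H)) Complex.I
          (Or.inl rfl) (by rw [inner_conj_symm, hsymm])
        rw [← AddSubgroupClass.coe_sub, ← LinearPMap.map_sub, ← h1, LinearPMap.map_sub,
          AddSubgroupClass.coe_sub]
        congr 2
        module
      have hc := hlim.cauchySeq
      have hle1 : ∀ i j, dist (T (x i)) (T (x j)) ≤ dist (s i) (s j) := by
        intro i j
        rw [dist_eq_norm, dist_eq_norm, ← hx, ← hx]
        refine (sq_le_sq₀ (norm_nonneg _) (norm_nonneg _)).1 ?_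
        rw [hnorm]
        linarith [sq_nonneg ‖(x i : H) - x j‖]
      have hle2 : ∀ i j, dist (x i : H) (x j) ≤ dist (s i) (s j) := by
        intro i j
        rw [dist_eq_norm, dist_eq_norm, ← hx, ← hx]
        refine (sq_le_sq₀ (norm_nonneg _) (norm_nonneg _)).1 ?_
        rw [hnorm]
        linarith [sq_nonneg ‖T (x i) - T (x j)‖]
      have hcauchy : ∀ u : ℕ → H, (∀ i j, dist (u i) (u j) ≤ dist (s i) (s j)) → CauchySeq u := by
        intro u hu
        rw [Metric.cauchySeq_iff] at hc ⊢
        intro ε hε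
        obtain ⟨N, hN⟩ := hc ε hε
        exact ⟨N, fun i hi j hj => (hu i j).trans_lt (hN i hi j hj)⟩
      obtain ⟨v, hv⟩ := cauchySeq_tendsto_of_complete (hcauchy _ hle1)
      obtain ⟨y, hy⟩ := cauchySeq_tendsto_of_complete (hcauchy _ hle2)
      have hyv : (y, v) ∈ T.closure.graph := by
        rw [← hgr]
        exact mem_closure_of_tendsto (hy.prodMk_nhds hv)
          (Filter.Eventually.of_forall fun i => T.mem_graph (x i))
      have hyv' : (y, v) ∈ T.adjoint.graph := by
        have : T.graph.topologicalClosure ≤ T.adjoint.graph :=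
          Submodule.topologicalClosure_minimal _ (LinearPMap.le_graph_of_le hle) hcl
        rw [hgr] at this
        exact this hyv
      have hsum : v + Complex.I • y = w + Complex.I • z := by
        refine tendsto_nhds_unique ?_ hlim
        refine (hv.add (hy.const_smul Complex.I)).congr fun i => hx i
      have hdiff := T.adjoint.graph.sub_mem hzw hyv'
      rw [LinearPMap.mem_graph_iff] at hdiff
      obtain ⟨d, hd1, hd2⟩ := hdiff
      simp only [Prod.mk_sub_mk] at hd1 hd2
      -- The adjoint multiplies `z - y` by `-i`, so `z - y` is orthogonal to the range of `T - i`.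
      have hzy : z - y = 0 := hminus _ fun x => by
        have h1 := LinearPMap.adjoint_isFormalAdjoint hdense d x
        rw [hd1, hd2] at h1
        rw [inner_sub_right, ← h1, inner_smul_right]
        have h2 : w - v = -Complex.I • (z - y) := by
          have : w - v = Complex.I • y - Complex.I • z := by
            rw [sub_eq_sub_iff_add_eq_add, ← hsum, add_comm]
          rw [this]
          module
        rw [h2, inner_smul_left]
        simp
      have hzy' : z = y := sub_eq_zero.1 hzy
      subst hzy'
      rw [add_left_inj] at hsum
      rwa [← hsum]
  -- An operator and its closure have the same adjoint: the adjoint relation is a closed condition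
  -- on the graph.
  have hS' : T.closure.adjoint = T.adjoint := by
    refine le_antisymm ?_ ?_
    · refine LinearPMap.IsFormalAdjoint.le_adjoint hdense fun x y => ?_
      have h1 := LinearPMap.adjoint_isFormalAdjoint
        (hdense.mono (LinearPMap.le_closure T).1) y ⟨x, (LinearPMap.le_closure T).1 x.2⟩
      have h2 : T x = T.closure ⟨x, (LinearPMap.le_closure T).1 x.2⟩ :=
        (LinearPMap.le_closure T).2 rfl
      rw [h2, ← inner_conj_symm, ← inner_conj_symm (x : H)]
      exact congrArg _ h1.symm
    · refine LinearPMap.IsFormalAdjoint.le_adjoint (hdense.mono (LinearPMap.le_closure T).1) ?_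
      intro x y
      have hx : ((x : H), T.closure x) ∈ T.graph.topologicalClosure := by
        rw [hgr]; exact T.closure.mem_graph x
      have hclosed : IsClosed {p : H × H | inner ℂ p.2 (y : H) = inner ℂ p.1 (T.adjoint y)} :=
        isClosed_eq (by fun_prop) (by fun_prop)
      refine closure_minimal (s := (T.graph : Set (H × H))) ?_ hclosed hx
      rintro ⟨a, b⟩ hab
      obtain ⟨d, hd1, hd2⟩ := (LinearPMap.mem_graph_iff _).1 hab
      have h1 := LinearPMap.adjoint_isFormalAdjoint hdense y d
      simp only at hd1 hd2
      rw [hd1, hd2] at h1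
      change inner ℂ b (y : H) = inner ℂ a (T.adjoint y)
      rw [← inner_conj_symm, ← inner_conj_symm a, h1]
  rw [LinearPMap.isSelfAdjoint_def, hS', hS]

end SelfAdjointness

end GenConn

end

noncomputable section

set_option linter.unusedSectionVars false
set_option linter.unusedVariables false

namespace GenConn

/-! ### Averaging over gauge transformations at the vertices -/

section GaugeAverage

open PrincipalBundle FiberIso GenConn.Graph

variable {n : ℕ} {M : Type*} [TopologicalSpace M] [ChartedSpace (EuclideanSpace ℝ (Fin n)) M]
  {E : Type*} [NormedAddCommGroup E] [NormedSpace ℝ E] [FiniteDimensional ℝ E]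
  {G : Type*} [Group G] [TopologicalSpace G] [ChartedSpace E G]
  {F : Type*} [NormedAddCommGroup F] [NormedSpace ℝ F]
  {P : Type*} [TopologicalSpace P] [ChartedSpace F P]
  {B : PrincipalBundle n M E G F P} {γ γ₀ Γ : Graph n M}
  [T2Space M] [IsManifold (𝓡 n) ω M]
  [LieGroup 𝓘(ℝ, E) ∞ G] [IsTopologicalGroup G] [T2Space G] [CompactSpace G]
  [SecondCountableTopology G] [MeasurableSpace G] [BorelSpace G]

/-- The vertices of a graph, as a finite type. -/
abbrev Graph.Vertex (γ : Graph n M) : Type _ := {v : M // v ∈ range γ.src ∪ range γ.tgt}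

instance (γ : Graph n M) : Fintype γ.Vertex :=
  ((finite_range γ.src).union (finite_range γ.tgt)).fintype

variable (B) in
/-- The gauge transformations at the vertices of a graph. -/
abbrev VertexGauge (γ : Graph n M) : Type _ := ∀ v : γ.Vertex, B.FiberIso v.1 v.1

open Classical in
/-- The trivial extension of a gauge transformation at the vertices. -/
def VertexGauge.extend (k : VertexGauge B γ) : Gauge B := fun x =>
  if h : x ∈ range γ.src ∪ range γ.tgt then k ⟨x, h⟩ else FiberIso.refl B x

theorem gaugeAct_extend (k : VertexGauge B γ) (a : Conn B γ) (e : γ.Edge) :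
    gaugeAct k.extend a e =
      ((k ⟨γ.src e, mem_union_left _ (mem_range_self e)⟩).trans (a e)).trans
        (k ⟨γ.tgt e, mem_union_right _ (mem_range_self e)⟩).symm := by
  have h1 : γ.src e ∈ range γ.src ∪ range γ.tgt := mem_union_left _ (mem_range_self e)
  have h2 : γ.tgt e ∈ range γ.src ∪ range γ.tgt := mem_union_right _ (mem_range_self e)
  simp only [gaugeAct, VertexGauge.extend, dif_pos h1, dif_pos h2]

/-- A preceding gauge transformation becomes a left translation in the group at the vertices, so
that invariance of its Haar measure makes averages gauge invariant. -/
theorem gaugeAct_extend_gaugeAct (k : VertexGauge B γ) (g : Gauge B) (a : Conn B γ) :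
    gaugeAct k.extend (gaugeAct g a) =
      gaugeAct (VertexGauge.extend ((fun v => g v.1 : VertexGauge B γ) * k)) a := by
  have h : ∀ v : γ.Vertex, ((fun v => g v.1 : VertexGauge B γ) * k) v = (k v).trans (g v.1) := by
    intro v
    rw [trans_eq_mul, Equiv.symm_apply_apply]
    rfl
  funext e
  rw [gaugeAct_extend, gaugeAct_extend, h, h]
  ext p : 2
  simp [gaugeAct, FiberIso.trans, FiberIso.symm]

theorem contMDiff_gaugeAct_extend : ContMDiff ((model E γ).prod (piModel γ.Vertex E)) (model E γ) ∞
    fun z : Conn B γ × VertexGauge B γ => gaugeAct z.2.extend z.1 := by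
  refine contMDiff_pi_iff.2 fun e => ?_
  simp only [gaugeAct_extend]
  have h1 : ∀ v : γ.Vertex, ContMDiff ((model E γ).prod (piModel γ.Vertex E)) 𝓘(ℝ, E) ∞
      fun z : Conn B γ × VertexGauge B γ => z.2 v := fun v =>
    (contMDiff_eval v).comp contMDiff_snd
  have h2 : ContMDiff ((model E γ).prod (piModel γ.Vertex E)) 𝓘(ℝ, E) ∞
      fun z : Conn B γ × VertexGauge B γ => z.1 e := (contMDiff_eval e).comp contMDiff_fst
  exact contMDiff_trans (contMDiff_trans (h1 _) h2) (contMDiff_symm (h1 _))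

variable (B γ) in
/-- The Haar measure of the group of gauge transformations at the vertices. -/
def haarVertex : Measure (VertexGauge B γ) := Measure.pi fun v : γ.Vertex => FiberIso.haar B v.1 v.1

instance : (haarVertex B γ).IsHaarMeasure := by unfold haarVertex; infer_instance

instance : IsProbabilityMeasure (haarVertex B γ) := by unfold haarVertex; infer_instance

/-- The average of a function over the gauge transformations. -/
def gaugeAverage (u : Conn B γ → ℂ) (a : Conn B γ) : ℂ :=
  ∫ k, u (gaugeAct k.extend a) ∂(haarVertex B γ)

theorem gaugeAverage_gaugeAct (u : Conn B γ → ℂ) (g : Gauge B) (a : Conn B γ) :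
    gaugeAverage u (gaugeAct g a) = gaugeAverage u a := by
  simp only [gaugeAverage, gaugeAct_extend_gaugeAct]
  exact integral_mul_left_eq_self (fun k : VertexGauge B γ => u (gaugeAct k.extend a)) _

theorem contMDiff_gaugeAverage {u : Conn B γ → ℂ} (hu : ContMDiff (model E γ) 𝓘(ℝ, ℂ) ∞ u) :
    ContMDiff (model E γ) 𝓘(ℝ, ℂ) ∞ (gaugeAverage u) := by
  have h := contMDiffOn_parametric_integral (𝕜 := ℝ) (ν := haarVertex B γ)
    (w := fun _ : VertexGauge B γ => (1 : ℝ)) (integrable_const _) isOpen_univ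
    (hu.comp contMDiff_gaugeAct_extend).contMDiffOn
  simp only [one_smul] at h
  exact contMDiffOn_univ.1 h

theorem dirDeriv_gaugeAverage {X : Field B} (hX : IsVectorField γ₀ X) (hinv : IsInvariant γ₀ X)
    (h0 : γ₀ ≤ γ) {u : Conn B γ → ℂ} (hu : ContMDiff (model E γ) 𝓘(ℝ, ℂ) ∞ u) (a : Conn B γ) :
    dirDeriv (model E γ) (X γ) (gaugeAverage u) a =
      gaugeAverage (dirDeriv (model E γ) (X γ) u) a := by
  have hu1 : ContMDiff (model E γ) 𝓘(ℝ, ℂ) 1 u := hu.of_le (by simp)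
  have hs : ContMDiff ((model E γ).prod (piModel γ.Vertex E)) 𝓘(ℝ, ℂ) 1
      fun z : Conn B γ × VertexGauge B γ => u (gaugeAct z.2.extend z.1) :=
    hu1.comp (contMDiff_gaugeAct_extend.of_le (by simp))
  have h := dirDeriv_parametric_integral (𝕜 := ℝ) (ν := haarVertex B γ)
    (f := fun z : Conn B γ × VertexGauge B γ => u (gaugeAct z.2.extend z.1))
    (w := fun _ : VertexGauge B γ => (1 : ℝ)) (integrable_const _) isOpen_univ
    hs.contMDiffOn (mem_univ a) (X γ)
  simp only [one_smul] at h
  refine h.trans (integral_congr_ae (Filter.Eventually.of_forall fun k => ?_))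
  exact dirDeriv_gaugeAct hX hinv h0 hu1 _ a

/-- Fubini. Invariance of `w` is assumed only after pairing with continuous functions, because `w`
is an almost everywhere class. -/
theorem integral_mul_gaugeAverage {w : Conn B γ → ℂ} (hw : Integrable w (haarOn B γ))
    (hinv : ∀ (g : Gauge B) (v : C(Conn B γ, ℂ)),
      ∫ a, w a * v (gaugeAct g a) ∂(haarOn B γ) = ∫ a, w a * v a ∂(haarOn B γ))
    (u : C(Conn B γ, ℂ)) :
    ∫ a, w a * gaugeAverage u a ∂(haarOn B γ) = ∫ a, w a * u a ∂(haarOn B γ) := by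
  have hc : Continuous fun z : Conn B γ × VertexGauge B γ => u (gaugeAct z.2.extend z.1) :=
    u.continuous.comp contMDiff_gaugeAct_extend.continuous
  obtain ⟨C, hC⟩ := isCompact_univ.exists_bound_of_continuousOn u.continuous.continuousOn
  have hint : Integrable (Function.uncurry fun (a : Conn B γ) (k : VertexGauge B γ) =>
      w a * u (gaugeAct k.extend a)) ((haarOn B γ).prod (haarVertex B γ)) :=
    (hw.comp_fst (haarVertex B γ)).mul_bdd (c := C) hc.aestronglyMeasurable
      (Filter.Eventually.of_forall fun z => hC _ trivial)
  simp only [gaugeAverage, ← integral_const_mul]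
  rw [integral_integral_swap hint]
  simp only [hinv]
  simp

end GaugeAverage

end GenConn

end

noncomputable section

set_option linter.unusedSectionVars false
set_option linter.unusedVariables false

namespace GenConn

/-! ### Cylindrical functions in the Hilbert space of the quotient -/

section MomentumOperator

open PrincipalBundle FiberIso GenConn.Graph

variable {n : ℕ} {M : Type*} [TopologicalSpace M] [ChartedSpace (EuclideanSpace ℝ (Fin n)) M]
  {E : Type*} [NormedAddCommGroup E] [NormedSpace ℝ E] [FiniteDimensional ℝ E]
  {G : Type*} [Group G] [TopologicalSpace G] [ChartedSpace E G]
  {F : Type*} [NormedAddCommGroup F] [NormedSpace ℝ F]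
  {P : Type*} [TopologicalSpace P] [ChartedSpace F P]
  {B : PrincipalBundle n M E G F P} {γ γ₀ Γ : Graph n M}
  [T2Space M] [IsManifold (𝓡 n) ω M]
  [LieGroup 𝓘(ℝ, E) ∞ G] [IsTopologicalGroup G] [T2Space G] [CompactSpace G]
  [SecondCountableTopology G] [MeasurableSpace G] [BorelSpace G]

theorem measurePreserving_toQuotient :
    MeasurePreserving (toQuotient (B := B)) (inducedHaar B) (quotientHaar B) := by
  have h : Continuous (toQuotient (B := B)) := continuous_quot_mk
  exact ⟨h.measurable, rfl⟩

instance : IsProbabilityMeasure (quotientHaar B) :=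
  Measure.isProbabilityMeasure_map measurePreserving_toQuotient.measurable.aemeasurable

/-- The pull-back of square integrable functions on the quotient. -/
def pullback : L2Quotient B →ₗᵢ[ℂ] Lp ℂ 2 (inducedHaar B) :=
  Lp.compMeasurePreservingₗᵢ ℂ _ measurePreserving_toQuotient

theorem coeFn_pullback (ψ : L2Quotient B) :
    (pullback ψ : Limit B → ℂ) =ᵐ[inducedHaar B] fun A => ψ (toQuotient A) :=
  Lp.coeFn_compMeasurePreserving ψ measurePreserving_toQuotient

theorem isClassOf_iff {ψ : L2Quotient B} {f : Limit B → ℂ} :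
    IsClassOf ψ f ↔ (pullback ψ : Limit B → ℂ) =ᵐ[inducedHaar B] f :=
  ⟨(coeFn_pullback ψ).trans, (coeFn_pullback ψ).symm.trans⟩

theorem IsClassOf.unique {ψ ψ' : L2Quotient B} {f : Limit B → ℂ} (h : IsClassOf ψ f)
    (h' : IsClassOf ψ' f) : ψ = ψ' :=
  pullback.injective (Lp.ext ((isClassOf_iff.1 h).trans (isClassOf_iff.1 h').symm))

theorem IsClassOf.add {ψ ψ' : L2Quotient B} {f f' : Limit B → ℂ} (h : IsClassOf ψ f)
    (h' : IsClassOf ψ' f') : IsClassOf (ψ + ψ') (f + f') := by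
  rw [isClassOf_iff, map_add]
  exact (Lp.coeFn_add _ _).trans ((isClassOf_iff.1 h).add (isClassOf_iff.1 h'))

theorem IsClassOf.smul {ψ : L2Quotient B} {f : Limit B → ℂ} (c : ℂ) (h : IsClassOf ψ f) :
    IsClassOf (c • ψ) (c • f) := by
  rw [isClassOf_iff, map_smul]
  exact (Lp.coeFn_smul _ _).trans ((isClassOf_iff.1 h).const_smul c)

theorem inner_eq_of_isClassOf {ψ' ψ : L2Quotient B} {f : Limit B → ℂ} (h : IsClassOf ψ f) :
    inner ℂ ψ' ψ = ∫ A, (starRingEnd ℂ) (ψ' (toQuotient A)) * f A ∂(inducedHaar B) := by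
  rw [← pullback.inner_map_map, L2.inner_def]
  refine integral_congr_ae ?_
  filter_upwards [coeFn_pullback ψ', isClassOf_iff.1 h] with A h1 h2
  rw [h1, h2, RCLike.inner_apply, mul_comm]

theorem continuous_of_mem_cyl {k : WithTop ℕ∞} {f : Limit B → ℂ} (hf : f ∈ Cyl B k) :
    Continuous f := by
  obtain ⟨γ, u, hu, h⟩ := hf
  rw [show f = fun A => u (A.at γ) from funext h]
  exact hu.continuous.comp (continuous_limit_at γ)

theorem exists_isClassOf {k : WithTop ℕ∞} {f : Limit B → ℂ} (hf : f ∈ CylInv B k) :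
    ∃ ψ : L2Quotient B, IsClassOf ψ f := by
  have hfc := continuous_of_mem_cyl hf.1
  let f' : Quotient B → ℂ := Quot.lift f fun A A' ⟨g, hg⟩ => by rw [hg, hf.2]
  have hf' : Continuous f' := continuous_quot_lift _ hfc
  obtain ⟨C, hC⟩ := isCompact_univ.exists_bound_of_continuousOn hfc.continuousOn
  have hm : MemLp f' 2 (quotientHaar B) :=
    MemLp.of_bound hf'.aestronglyMeasurable C (Filter.Eventually.of_forall fun q => by
      induction q using Quot.ind with
      | mk A => exact hC A trivial)
  exact ⟨hm.toLp f', measurePreserving_toQuotient.quasiMeasurePreserving.ae hm.coeFn_toLp⟩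

/-- Both functions are continuous at a common graph, where Haar measure charges open sets. This
makes the operator well defined on classes. -/
theorem eq_of_ae_eq {f f' : Limit B → ℂ} (hf : f ∈ Cyl B 0) (hf' : f' ∈ Cyl B 0)
    (h : f =ᵐ[inducedHaar B] f') : f = f' := by
  obtain ⟨γ, v, hv, hv'⟩ := hf'
  obtain ⟨Γ, hγ, u, hu, hu'⟩ := exists_rep_of_mem_cyl (by simp) hf γ
  have hc : Continuous fun a => v (project B hγ a) :=
    hv.continuous.comp (continuous_project (B := B) hγ)
  have h1 : ∀ᵐ a ∂(haarOn B Γ), u a = v (project B hγ a) := by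
    rw [← map_at, ae_map_iff (continuous_limit_at Γ).measurable.aemeasurable
      (isClosed_eq hu.continuous hc).measurableSet]
    filter_upwards [h] with A hA
    rw [project_at, ← hu', ← hv', hA]
  have h2 := (Continuous.ae_eq_iff_eq (haarOn B Γ) hu.continuous hc).1 h1
  funext A
  rw [hu', hv', h2]
  exact congrArg v (project_at hγ A)

theorem cylInv_mono {k m : WithTop ℕ∞} (h : m ≤ k) : CylInv B k ⊆ CylInv B m :=
  fun _ ⟨⟨γ, u, hu, hf⟩, hinv⟩ => ⟨⟨γ, u, hu.of_le h, hf⟩, hinv⟩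

/-- Linear combinations of elements of `Cyl¹`, and the action of the momentum on them. -/
theorem momentum_add_smul (hM : n = 1 → PreconnectedSpace M) {X : Field B}
    (hX : IsVectorField γ₀ X) (hinv : IsInvariant γ₀ X) {f f' : Limit B → ℂ} (hf : f ∈ CylInv B 1)
    (hf' : f' ∈ CylInv B 1) (c : ℂ) : f + c • f' ∈ CylInv B 1 ∧
      momentum γ₀ X (f + c • f') = momentum γ₀ X f + c • momentum γ₀ X f' := by
  obtain ⟨γ, hγ, v, hv, hv'⟩ := exists_rep_of_mem_cyl (by simp) hf'.1 γ₀
  obtain ⟨Γ, hΓ, u, hu, hu'⟩ := exists_rep_of_mem_cyl (by simp) hf.1 γ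
  have hw : ContMDiff (model E Γ) 𝓘(ℝ, ℂ) 1 fun a => v (project B hΓ a) :=
    hv.comp ((contMDiff_project hΓ).of_le (by simp))
  have hcw : ContMDiff (model E Γ) 𝓘(ℝ, ℂ) 1 fun a => c * v (project B hΓ a) :=
    contMDiff_mul_complex contMDiff_const hw
  have hw' : ∀ A, f' A = v (project B hΓ (A.at Γ)) := fun A => by rw [project_at, hv']
  have hs : ∀ A, (f + c • f') A = u (A.at Γ) + c * v (project B hΓ (A.at Γ)) := fun A => by
    rw [Pi.add_apply, Pi.smul_apply, hu', hw', smul_eq_mul]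
  have h0 := Graph.le_trans hγ hΓ
  obtain ⟨d, hds, hd, -⟩ := exists_isDivergenceOn (hX.smoothField h0)
  refine ⟨⟨⟨Γ, _, hu.add hcw, hs⟩, fun g A => ?_⟩, funext fun A => ?_⟩
  · rw [Pi.add_apply, Pi.smul_apply, hf.2, hf'.2]
    rfl
  · rw [momentum_eq hM hX hinv h0 hd (hu.add hcw) hs, Pi.add_apply, Pi.smul_apply,
      momentum_eq hM hX hinv h0 hd hu hu', momentum_eq hM hX hinv h0 hd hw hw']
    simp only [levelMomentum]
    have e1 := dirDeriv_add (V := X Γ) (hu.mdifferentiableAt (by simp) (x := A.at Γ))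
      (hcw.mdifferentiableAt (by simp))
    have e2 : dirDeriv (model E Γ) (X Γ) (fun a => c * v (project B hΓ a)) (A.at Γ) =
        c * dirDeriv (model E Γ) (X Γ) (fun a => v (project B hΓ a)) (A.at Γ) :=
      dirDeriv_clm (ContinuousLinearMap.mul ℝ ℂ c) (hw.mdifferentiableAt (by simp))
    refine (congrArg (fun z : ℂ => Complex.I * (z + _)) (e1.trans (congrArg _ e2))).trans ?_
    simp only [Pi.add_apply, smul_eq_mul]
    ring

/-- The momentum is symmetric on `Cyl¹`. -/
theorem integral_conj_momentum (hM : n = 1 → PreconnectedSpace M) {X : Field B}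
    (hX : IsVectorField γ₀ X) (hinv : IsInvariant γ₀ X) {f f' : Limit B → ℂ} (hf : f ∈ CylInv B 1)
    (hf' : f' ∈ CylInv B 1) :
    ∫ A, (starRingEnd ℂ) (momentum γ₀ X f A) * f' A ∂(inducedHaar B) =
      ∫ A, (starRingEnd ℂ) (f A) * momentum γ₀ X f' A ∂(inducedHaar B) := by
  obtain ⟨γ, hγ, v, hv, hv'⟩ := exists_rep_of_mem_cyl (by simp) hf'.1 γ₀
  obtain ⟨Γ, hΓ, u, hu, hu'⟩ := exists_rep_of_mem_cyl (by simp) hf.1 γ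
  set w : Conn B Γ → ℂ := fun a => v (project B hΓ a) with hwdef
  have hw : ContMDiff (model E Γ) 𝓘(ℝ, ℂ) 1 w :=
    hv.comp ((contMDiff_project hΓ).of_le (by simp))
  have hw' : ∀ A, f' A = w (A.at Γ) := fun A => by
    change f' A = v (project B hΓ (A.at Γ))
    rw [project_at, hv']
  have h0 := Graph.le_trans hγ hΓ
  have hV := hX.smoothField h0
  obtain ⟨d, hds, hd, hdiv⟩ := exists_isDivergenceOn hV
  simp only [momentum_eq hM hX hinv h0 hd hu hu', momentum_eq hM hX hinv h0 hd hw hw', hu', hw']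
  have hP : ∀ {u : Conn B Γ → ℂ}, ContMDiff (model E Γ) 𝓘(ℝ, ℂ) 1 u →
      Continuous (levelMomentum (X Γ) d u) := fun hu =>
    (contMDiff_levelMomentum hV hds (m := 0) (by simp) (by simp) hu).continuous
  have hconj := Complex.continuous_conj
  have hPu := hP hu
  have hPw := hP hw
  have huc := hu.continuous
  have hwc := hw.continuous
  have c1 : Continuous fun a => (starRingEnd ℂ) (levelMomentum (X Γ) d u a) * w a := by fun_prop
  have c2 : Continuous fun a => (starRingEnd ℂ) (u a) * levelMomentum (X Γ) d w a := by fun_prop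
  rw [integral_comp_at Γ (u := fun a => (starRingEnd ℂ) (levelMomentum (X Γ) d u a) * w a)
    c1.aestronglyMeasurable, integral_comp_at Γ
    (u := fun a => (starRingEnd ℂ) (u a) * levelMomentum (X Γ) d w a) c2.aestronglyMeasurable,
    eq_comm, ← sub_eq_zero]
  refine (integral_sub (integrable_of_continuous c2) (integrable_of_continuous c1)).symm.trans ?_
  have hcu : ContMDiff (model E Γ) 𝓘(ℝ, ℂ) 1 fun a => (starRingEnd ℂ) (u a) :=
    Complex.conjCLE.contDiff.contMDiff.comp hu
  have hp := contMDiff_mul_complex hcu hw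
  have h1 := hdiv _ hp
  have hDc : Continuous (dirDeriv (model E Γ) (X Γ) fun a => (starRingEnd ℂ) (u a) * w a) :=
    (contMDiff_dirDeriv hV hp (m := 0) (by simp) (by simp)).continuous
  have h2 : ∫ a, Complex.I * (dirDeriv (model E Γ) (X Γ) (fun a => (starRingEnd ℂ) (u a) * w a) a +
      d a • ((starRingEnd ℂ) (u a) * w a)) ∂(haarOn B Γ) = 0 := by
    rw [integral_const_mul]
    refine mul_eq_zero_of_right _ ?_
    refine (integral_add (integrable_of_continuous hDc) (integrable_of_continuous
      (hds.continuous.smul hp.continuous))).trans ?_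
    rw [h1]
    exact neg_add_cancel _
  refine Eq.trans (integral_congr_ae (Filter.Eventually.of_forall fun a => ?_)) h2
  have h3 : dirDeriv (model E Γ) (X Γ) (fun a => (starRingEnd ℂ) (u a) * w a) a =
      (starRingEnd ℂ) (u a) * dirDeriv (model E Γ) (X Γ) w a +
        (starRingEnd ℂ) (dirDeriv (model E Γ) (X Γ) u a) * w a := by
    rw [dirDeriv_mul (hcu.mdifferentiable (by simp) a) (hw.mdifferentiable (by simp) a)]
    congr 2
    exact dirDeriv_clm (Complex.conjCLE : ℂ →L[ℝ] ℂ) (hu.mdifferentiable (by simp) a)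
  have h4 : (starRingEnd ℂ) 2 = 2 := by exact_mod_cast Complex.conj_ofReal 2
  simp only [h3, levelMomentum, map_mul, map_add, Complex.conj_I, map_div₀, map_one, h4,
    Complex.conj_ofReal, Complex.real_smul]
  ring

/-- The component of a square integrable function on the quotient in `L²` of `A_γ`. -/
def levelPart (γ : Graph n M) (ψ : L2Quotient B) : Lp ℂ 2 (haarOn B γ) :=
  ContinuousLinearMap.adjoint
    (Lp.compMeasurePreservingₗᵢ ℂ _ (measurePreserving_at (B := B) γ)).toContinuousLinearMap
    (pullback ψ)

theorem inner_levelPart (ψ : L2Quotient B) (v : C(Conn B γ, ℂ)) :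
    inner ℂ (levelPart γ ψ) (ContinuousMap.toLp 2 (haarOn B γ) ℂ v) =
      ∫ A, (starRingEnd ℂ) (ψ (toQuotient A)) * v (A.at γ) ∂(inducedHaar B) := by
  rw [levelPart, ContinuousLinearMap.adjoint_inner_left, L2.inner_def]
  refine integral_congr_ae ?_
  have h1 : (Lp.compMeasurePreservingₗᵢ ℂ _ (measurePreserving_at (B := B) γ)
      (ContinuousMap.toLp 2 (haarOn B γ) ℂ v) : Limit B → ℂ) =ᵐ[inducedHaar B]
      fun A => v (A.at γ) :=
    (Lp.coeFn_compMeasurePreserving _ (measurePreserving_at γ)).trans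
      ((measurePreserving_at γ).quasiMeasurePreserving.ae
        (ContinuousMap.coeFn_toLp (𝕜 := ℂ) (haarOn B γ) v))
  filter_upwards [coeFn_pullback ψ, h1] with A h2 h3
  rw [RCLike.inner_apply, mul_comm]
  exact congrArg₂ (fun x y : ℂ => (starRingEnd ℂ) x * y) h2 h3

theorem inner_toLp_eq {w : Lp ℂ 2 (haarOn B γ)} (v : C(Conn B γ, ℂ)) :
    inner ℂ w (ContinuousMap.toLp 2 (haarOn B γ) ℂ v) =
      ∫ a, (starRingEnd ℂ) (w a) * v a ∂(haarOn B γ) := by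
  rw [L2.inner_def]
  refine integral_congr_ae ?_
  filter_upwards [ContinuousMap.coeFn_toLp (𝕜 := ℂ) (p := 2) (haarOn B γ) v] with a h
  rw [h, RCLike.inner_apply, mul_comm]

/-- Averaging over the gauge group does not change the pairing with a function on the quotient. -/
theorem integral_gaugeAverage_at (ψ : L2Quotient B) (v v' : C(Conn B γ, ℂ))
    (hv' : ∀ a, v' a = gaugeAverage v a) :
    ∫ A, (starRingEnd ℂ) (ψ (toQuotient A)) * v' (A.at γ) ∂(inducedHaar B) =
      ∫ A, (starRingEnd ℂ) (ψ (toQuotient A)) * v (A.at γ) ∂(inducedHaar B) := by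
  rw [← inner_levelPart, ← inner_levelPart, inner_toLp_eq, inner_toLp_eq]
  simp only [hv']
  have hint : Integrable (fun a => (starRingEnd ℂ) (levelPart γ ψ a)) (haarOn B γ) :=
    Complex.conjCLE.toContinuousLinearMap.integrable_comp (integrable_L2 (levelPart γ ψ))
  refine integral_mul_gaugeAverage hint (fun g u => ?_) v
  have h1 := inner_levelPart ψ (u.comp ⟨_, continuous_gaugeAct (γ := γ) g⟩)
  have h2 := inner_levelPart ψ u
  rw [inner_toLp_eq] at h1 h2
  refine h1.trans (Eq.trans ?_ h2.symm)
  -- `ψ` is a function on the quotient and the measure is gauge invariant, so a gauge transformation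
  -- of the test function does not change the pairing.
  have h3 := (measurePreserving_limit_gaugeAct g).integral_comp
    (gaugeHomeo (B := B) g).measurableEmbedding
    (fun A => (starRingEnd ℂ) (ψ (toQuotient A)) * u (A.at γ))
  refine Eq.trans (integral_congr_ae (Filter.Eventually.of_forall fun A => ?_)) h3
  have h4 : toQuotient (A.gaugeAct g) = toQuotient A := (Quot.sound ⟨g, rfl⟩).symm
  simp only [h4]
  rfl

/-- Cylindrical functions are dense in `L²`, and each of them is represented at some graph above
`γ₀`. -/
theorem eq_zero_of_levelPart (γ₀ : Graph n M) {ψ : L2Quotient B}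
    (h : ∀ γ, γ₀ ≤ γ → levelPart γ ψ = 0) : ψ = 0 := by
  have hne : Nonempty (Graph n M) := ⟨γ₀⟩
  have hd := (ContinuousMap.toLp_denseRange (α := Limit B) (p := 2) ℂ (inducedHaar B) ℂ
    (by simp)).dense_image (ContinuousMap.toLp 2 (inducedHaar B) ℂ).continuous
    (dense_cylContinuous (B := B) ℂ)
  have h0 : pullback ψ = 0 := by
    refine hd.eq_zero_of_inner_left ℂ ?_
    rintro _ ⟨φ, ⟨γ, u, hu⟩, rfl⟩
    obtain ⟨Γ, h1, h2⟩ := exists_ge_pair γ₀ γ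
    have e1 := inner_levelPart ψ (u.comp ⟨_, continuous_project (B := B) h2⟩)
    rw [h Γ h1, inner_zero_left] at e1
    rw [L2.inner_def]
    refine Eq.trans (integral_congr_ae ?_) e1.symm
    filter_upwards [coeFn_pullback ψ, ContinuousMap.coeFn_toLp (𝕜 := ℂ) (p := 2) (inducedHaar B) φ]
      with A h3 h4
    rw [h3, h4, hu, RCLike.inner_apply, mul_comm]
    simp [project_at]
  exact pullback.injective (h0.trans (map_zero _).symm)

theorem cylInv_gaugeAverage {u : Conn B γ → ℂ} (hu : ContMDiff (model E γ) 𝓘(ℝ, ℂ) ∞ u) :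
    (fun A : Limit B => gaugeAverage u (A.at γ)) ∈ CylInv B ∞ :=
  ⟨⟨γ, _, contMDiff_gaugeAverage hu, fun _ => rfl⟩, fun g A => gaugeAverage_gaugeAct u g (A.at γ)⟩

/-- Averaging turns any smooth test function into an invariant one without changing its pairing with
`ψ`. -/
theorem eq_zero_of_orthogonal_cylInv (γ₀ : Graph n M) {ψ : L2Quotient B}
    (h : ∀ f ∈ CylInv B 1, ∫ A, (starRingEnd ℂ) (ψ (toQuotient A)) * f A ∂(inducedHaar B) = 0) :
    ψ = 0 := by
  refine eq_zero_of_levelPart γ₀ fun γ hγ => ?_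
  refine (denseRange_smoothToL2 (I := model E γ) (μ := haarOn B γ)).eq_zero_of_inner_left ℂ ?_
  intro u
  refine (inner_levelPart ψ (smoothToContinuous (model E γ) u)).trans ?_
  rw [← integral_gaugeAverage_at ψ _ ⟨_, (contMDiff_gaugeAverage u.2).continuous⟩ fun _ => rfl]
  exact h _ (cylInv_mono (by simp) (cylInv_gaugeAverage u.2))

/-- The average commutes with the invariant field and with multiplication by its invariant
divergence. So orthogonality to the range on invariant functions gives orthogonality of each
component to the full range at that graph, and `eq_zero_of_orthogonal_range` applies. -/
theorem eq_zero_of_orthogonal_momentum (hM : n = 1 → PreconnectedSpace M) {X : Field B}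
    (hX : IsVectorField γ₀ X) (hinv : IsInvariant γ₀ X) {ψ : L2Quotient B} {c : ℂ}
    (hc : c = 1 ∨ c = -1)
    (h : ∀ f ∈ CylInv B 1, ∫ A, (starRingEnd ℂ) (ψ (toQuotient A)) *
      (momentum γ₀ X f A + c * Complex.I * f A) ∂(inducedHaar B) = 0) : ψ = 0 := by
  refine eq_zero_of_levelPart γ₀ fun γ hγ => ?_
  have hV := hX.smoothField hγ
  obtain ⟨d, hds, hd, hdiv⟩ := exists_isDivergenceOn hV
  have key : ∀ u : smoothFunctions (Conn B γ) (model E γ),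
      inner ℂ (levelPart γ ψ) (smoothToL2 (model E γ) (haarOn B γ) (momentumOp hV hds u + c • u)) =
        0 := by
    intro u
    have hU := contMDiff_gaugeAverage u.2
    set U : smoothFunctions (Conn B γ) (model E γ) := ⟨gaugeAverage u, hU⟩
    have hav : ∀ a, (momentumOp hV hds U + c • U : smoothFunctions (Conn B γ) (model E γ)).1 a =
        gaugeAverage (momentumOp hV hds u + c • u :
          smoothFunctions (Conn B γ) (model E γ)).1 a := by
      intro a
      have e1 := dirDeriv_gaugeAverage hX hinv hγ u.2 a
      change dirDeriv (model E γ) (X γ) (gaugeAverage u) a +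
        (1 / 2 : ℂ) * (d a • gaugeAverage u a) + c * gaugeAverage u a = _
      rw [e1, gaugeAverage, gaugeAverage, gaugeAverage]
      have hi : ∀ v : smoothFunctions (Conn B γ) (model E γ),
          Integrable (fun k : VertexGauge B γ => (v : Conn B γ → ℂ) (gaugeAct k.extend a))
            (haarVertex B γ) := fun v => integrable_of_continuous (v.2.continuous.comp
          (contMDiff_gaugeAct_extend.continuous.comp (by fun_prop : Continuous fun k => (a, k))))
      have hi1 := hi (fieldOp hV u)
      have hi2 := hi u
      have e2 : ∀ k : VertexGauge B γ, (momentumOp hV hds u + c • u :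
          smoothFunctions (Conn B γ) (model E γ)).1 (gaugeAct k.extend a) =
          dirDeriv (model E γ) (X γ) (u : Conn B γ → ℂ) (gaugeAct k.extend a) +
            ((1 / 2 : ℂ) * d a + c) * (u : Conn B γ → ℂ) (gaugeAct k.extend a) := by
        intro k
        change dirDeriv (model E γ) (X γ) (u : Conn B γ → ℂ) (gaugeAct k.extend a) +
          (1 / 2 : ℂ) * (d (gaugeAct k.extend a) • (u : Conn B γ → ℂ) (gaugeAct k.extend a)) +
          c * (u : Conn B γ → ℂ) (gaugeAct k.extend a) = _
        rw [hd.gaugeAct_eq hX hinv hγ, Complex.real_smul]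
        ring
      simp only [e2]
      refine Eq.trans ?_ (integral_add hi1 (hi2.const_mul _)).symm
      rw [integral_const_mul, Complex.real_smul]
      change _ = (∫ k, dirDeriv (model E γ) (X γ) (u : Conn B γ → ℂ) (gaugeAct k.extend a) ∂(haarVertex B γ)) + _
      ring
    have h1 := h _ (cylInv_mono (by simp) (cylInv_gaugeAverage u.2))
    simp only [momentum_eq hM hX hinv hγ hd (hU.of_le (by simp)) fun _ => rfl] at h1
    -- Taking out `i` turns the operator plus `c i` into the skew operator plus `c`, with `c = ± 1`.
    have h2 : ∀ a : Conn B γ, levelMomentum (X γ) d (gaugeAverage u) a +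
        c * Complex.I * gaugeAverage u a = Complex.I *
          (momentumOp hV hds U + c • U : smoothFunctions (Conn B γ) (model E γ)).1 a := by
      intro a
      change Complex.I * (dirDeriv (model E γ) (X γ) (gaugeAverage u) a +
        1 / 2 * (d a : ℂ) * gaugeAverage u a) + c * Complex.I * gaugeAverage u a =
        Complex.I * (dirDeriv (model E γ) (X γ) (gaugeAverage u) a +
        (1 / 2 : ℂ) * (d a • gaugeAverage u a) + c * gaugeAverage u a)
      rw [Complex.real_smul]
      ring
    simp only [h2, mul_left_comm _ Complex.I] at h1
    rw [integral_const_mul, mul_eq_zero, or_iff_right Complex.I_ne_zero] at h1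
    refine (inner_levelPart ψ (smoothToContinuous (model E γ) (momentumOp hV hds u + c • u))).trans ?_
    rw [← integral_gaugeAverage_at ψ
      (smoothToContinuous (model E γ) (momentumOp hV hds u + c • u))
      (smoothToContinuous (model E γ) (momentumOp hV hds U + c • U)) hav]
    exact h1
  refine eq_zero_of_orthogonal_range hV hds (fun f hf => hdiv f (hf.of_le (by simp))) ?_
  rcases hc with rfl | rfl
  · refine Or.inl fun u => ?_
    have := key u
    rwa [one_smul, map_add] at this
  · refine Or.inr fun u => ?_
    have := key u
    rwa [map_add, map_smul, neg_smul, one_smul, ← sub_eq_add_neg] at this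

end MomentumOperator

end GenConn

end

noncomputable section

set_option linter.unusedSectionVars false
set_option linter.unusedVariables false

namespace GenConn

/-! ### The momentum operator on the quotient -/

section EssentialSelfAdjointness

open PrincipalBundle FiberIso GenConn.Graph

variable {n : ℕ} {M : Type*} [TopologicalSpace M] [ChartedSpace (EuclideanSpace ℝ (Fin n)) M]
  {E : Type*} [NormedAddCommGroup E] [NormedSpace ℝ E] [FiniteDimensional ℝ E]
  {G : Type*} [Group G] [TopologicalSpace G] [ChartedSpace E G]
  {F : Type*} [NormedAddCommGroup F] [NormedSpace ℝ F]
  {P : Type*} [TopologicalSpace P] [ChartedSpace F P]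
  {B : PrincipalBundle n M E G F P} {γ₀ : Graph n M}
  [T2Space M] [IsManifold (𝓡 n) ω M]
  [LieGroup 𝓘(ℝ, E) ∞ G] [IsTopologicalGroup G] [T2Space G] [CompactSpace G]
  [SecondCountableTopology G] [MeasurableSpace G] [BorelSpace G]

theorem zero_mem_cylInv (γ₀ : Graph n M) {k : WithTop ℕ∞} : (0 : Limit B → ℂ) ∈ CylInv B k :=
  ⟨⟨γ₀, fun _ => 0, contMDiff_const, fun _ => rfl⟩, fun _ _ => rfl⟩

theorem momentum_zero (hM : n = 1 → PreconnectedSpace M) {X : Field B}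
    (hX : IsVectorField γ₀ X) (hinv : IsInvariant γ₀ X) : momentum γ₀ X 0 = 0 := by
  have h0 := zero_mem_cylInv (B := B) γ₀ (k := 1)
  have h := (momentum_add_smul hM hX hinv h0 h0 (-1)).2
  rwa [smul_zero, add_zero, neg_smul, one_smul, add_neg_cancel] at h

theorem isClassOf_zero : IsClassOf (0 : L2Quotient B) 0 := by
  rw [isClassOf_iff, map_zero]
  exact Lp.coeFn_zero _ _ _

/-- The graph of the momentum operator. -/
def momentumGraph (hM : n = 1 → PreconnectedSpace M) {X : Field B}
    (hX : IsVectorField γ₀ X) (hinv : IsInvariant γ₀ X) :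
    Submodule ℂ (L2Quotient B × L2Quotient B) where
  carrier := {p | ∃ f ∈ CylInv B 1, IsClassOf p.1 f ∧ IsClassOf p.2 (momentum γ₀ X f)}
  zero_mem' := ⟨0, zero_mem_cylInv γ₀, isClassOf_zero, by
    rw [momentum_zero hM hX hinv]; exact isClassOf_zero⟩
  add_mem' := by
    rintro p q ⟨f, hf, h1, h2⟩ ⟨f', hf', h1', h2'⟩
    have h := momentum_add_smul hM hX hinv hf hf' 1
    rw [one_smul, one_smul] at h
    exact ⟨_, h.1, h1.add h1', by rw [h.2]; exact h2.add h2'⟩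
  smul_mem' := by
    rintro c p ⟨f, hf, h1, h2⟩
    have h := momentum_add_smul hM hX hinv (zero_mem_cylInv γ₀) hf c
    rw [zero_add, momentum_zero hM hX hinv, zero_add] at h
    exact ⟨_, h.1, h1.smul c, by rw [h.2]; exact h2.smul c⟩

/-- The momentum operator of an invariant vector field is essentially self-adjoint. -/
theorem exists_isMomentumOperator (hM : n = 1 → PreconnectedSpace M) {X : Field B}
    (hX : IsVectorField γ₀ X) (hinv : IsInvariant γ₀ X) :
    ∃ T : L2Quotient B →ₗ.[ℂ] L2Quotient B,
      IsMomentumOperator γ₀ X T ∧ IsEssentiallySelfAdjoint T := by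
  have huniq : ∀ {ψ : L2Quotient B} {f f' : Limit B → ℂ}, f ∈ CylInv B 1 → f' ∈ CylInv B 1 →
      IsClassOf ψ f → IsClassOf ψ f' → f = f' := fun hf hf' h h' =>
    eq_of_ae_eq (cylInv_mono (by simp) hf).1 (cylInv_mono (by simp) hf').1 (h.symm.trans h')
  set T := (momentumGraph hM hX hinv).toLinearPMap with hT
  -- The relation is single valued: a representative of the zero class vanishes identically by
  -- `eq_of_ae_eq`, and so does its momentum.
  have hgraph : T.graph = momentumGraph hM hX hinv := by
    refine Submodule.toLinearPMap_graph_eq _ ?_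
    rintro ⟨p, q⟩ ⟨f, hf, h1, h2⟩ (rfl : p = 0)
    rw [huniq hf (zero_mem_cylInv γ₀) h1 isClassOf_zero, momentum_zero hM hX hinv] at h2
    exact h2.unique isClassOf_zero
  have hdom : ∀ ψ, ψ ∈ T.domain ↔ ∃ f ∈ CylInv B 1, IsClassOf ψ f := by
    intro ψ
    rw [LinearPMap.mem_domain_iff, hgraph]
    constructor
    · rintro ⟨χ, f, hf, h1, -⟩
      exact ⟨f, hf, h1⟩
    · rintro ⟨f, hf, h1⟩
      obtain ⟨χ, hχ⟩ := exists_isClassOf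
        (momentum_mem_cylInv hM hX hinv (m := 0) (by simp) (by simp) hf)
      exact ⟨χ, f, hf, h1, hχ⟩
  have happly : ∀ ψ : T.domain, ∀ f ∈ CylInv B 1, IsClassOf ψ.1 f →
      IsClassOf (T ψ) (momentum γ₀ X f) := by
    intro ψ f hf h
    have h1 := T.mem_graph ψ
    rw [hgraph] at h1
    obtain ⟨f', hf', h2, h3⟩ := h1
    rwa [huniq hf hf' h h2]
  have hclass : ∀ f ∈ CylInv B 1, ∃ ψ : T.domain, IsClassOf ψ.1 f := by
    intro f hf
    obtain ⟨ψ, hψ⟩ := exists_isClassOf hf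
    exact ⟨⟨ψ, (hdom ψ).2 ⟨f, hf, hψ⟩⟩, hψ⟩
  refine ⟨T, ⟨hdom, happly⟩, isEssentiallySelfAdjoint_of_dense_range ?_ ?_ ?_ ?_⟩
  · have h1 : T.domain.topologicalClosure = ⊤ := by
      rw [Submodule.topologicalClosure_eq_top_iff, Submodule.eq_bot_iff]
      intro z hz
      refine eq_zero_of_orthogonal_cylInv γ₀ fun f hf => ?_
      obtain ⟨ψ, hψ⟩ := hclass f hf
      rw [← inner_eq_of_isClassOf hψ]
      exact (Submodule.mem_orthogonal' _ _).1 hz _ ψ.2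
    exact dense_iff_closure_eq.2 (congrArg (fun S : Submodule ℂ (L2Quotient B) =>
      (S : Set (L2Quotient B))) h1)
  · intro x y
    obtain ⟨f, hf, hx⟩ := (hdom x).1 x.2
    obtain ⟨f', hf', hy⟩ := (hdom y).1 y.2
    have hTx := happly x f hf hx
    rw [inner_eq_of_isClassOf hy, inner_eq_of_isClassOf (happly y f' hf' hy)]
    have e1 : ∫ A, (starRingEnd ℂ) (T x (toQuotient A)) * f' A ∂(inducedHaar B) =
        ∫ A, (starRingEnd ℂ) (momentum γ₀ X f A) * f' A ∂(inducedHaar B) := by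
      refine integral_congr_ae ?_
      filter_upwards [hTx] with A hA
      rw [hA]
    have e2 : ∫ A, (starRingEnd ℂ) (x.1 (toQuotient A)) * momentum γ₀ X f' A ∂(inducedHaar B) =
        ∫ A, (starRingEnd ℂ) (f A) * momentum γ₀ X f' A ∂(inducedHaar B) := by
      refine integral_congr_ae ?_
      filter_upwards [hx] with A hA
      rw [hA]
    rw [e1, e2, integral_conj_momentum hM hX hinv hf hf']
  · intro z hz
    refine eq_zero_of_orthogonal_momentum hM hX hinv (Or.inl rfl) fun f hf => ?_
    obtain ⟨ψ, hψ⟩ := hclass f hf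
    have h1 := hz ψ
    rw [inner_eq_of_isClassOf ((happly ψ f hf hψ).add (hψ.smul Complex.I))] at h1
    simpa using h1
  · intro z hz
    refine eq_zero_of_orthogonal_momentum hM hX hinv (Or.inr rfl) fun f hf => ?_
    obtain ⟨ψ, hψ⟩ := hclass f hf
    have h1 := hz ψ
    rw [sub_eq_add_neg, ← neg_smul,
      inner_eq_of_isClassOf ((happly ψ f hf hψ).add (hψ.smul (-Complex.I)))] at h1
    simpa using h1

end EssentialSelfAdjointness

end GenConn

end

theorem theorem4
    {n : ℕ} {M : Type*} [TopologicalSpace M] [T2Space M] [SecondCountableTopology M]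
    [ChartedSpace (EuclideanSpace ℝ (Fin n)) M] [IsManifold (𝓡 n) ω M]
    (hM : n = 1 → PreconnectedSpace M)
    {E : Type*} [NormedAddCommGroup E] [NormedSpace ℝ E] [FiniteDimensional ℝ E]
    {G : Type*} [Group G] [TopologicalSpace G] [ChartedSpace E G] [LieGroup 𝓘(ℝ, E) ∞ G]
    [IsTopologicalGroup G] [T2Space G] [CompactSpace G] [ConnectedSpace G]
    [MeasurableSpace G] [BorelSpace G]
    {F : Type*} [NormedAddCommGroup F] [NormedSpace ℝ F] [FiniteDimensional ℝ F]
    {P : Type*} [TopologicalSpace P] [ChartedSpace F P] [IsManifold 𝓘(ℝ, F) ∞ P]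
    (B : GenConn.PrincipalBundle n M E G F P) :
    GenConn.IsInducedHaar B (GenConn.inducedHaar B) ∧
    (∀ (γ₀ : GenConn.Graph n M) (X : GenConn.Field B),
      GenConn.IsVectorField γ₀ X → GenConn.IsInvariant γ₀ X →
      GenConn.IsDivergence γ₀ X (GenConn.divergence γ₀ X) ∧
      (∀ (g : GenConn.Gauge B) (A : GenConn.Limit B),
        GenConn.divergence γ₀ X (A.gaugeAct g) = GenConn.divergence γ₀ X A) ∧
      ∃ T : GenConn.L2Quotient B →ₗ.[ℂ] GenConn.L2Quotient B,
        GenConn.IsMomentumOperator γ₀ X T ∧ GenConn.IsEssentiallySelfAdjoint T) ∧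
    (∀ (γ₁ γ₂ : GenConn.Graph n M) (X Y : GenConn.Field B),
      GenConn.IsVectorField γ₁ X → GenConn.IsInvariant γ₁ X →
      GenConn.IsVectorField γ₂ Y → GenConn.IsInvariant γ₂ Y →
      (∃ γ₃, γ₁ ≤ γ₃ ∧ γ₂ ≤ γ₃) ∧
      ∀ γ₃, γ₁ ≤ γ₃ → γ₂ ≤ γ₃ →
        GenConn.IsVectorField γ₃ (GenConn.bracket X Y) ∧
        GenConn.IsInvariant γ₃ (GenConn.bracket X Y) ∧
        ∀ f ∈ GenConn.CylInv B 2,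
          GenConn.momentum γ₁ X f ∈ GenConn.CylInv B 1 ∧
          GenConn.momentum γ₂ Y f ∈ GenConn.CylInv B 1 ∧
          GenConn.momentum γ₃ (GenConn.bracket X Y) f =
            (-Complex.I) • (GenConn.momentum γ₁ X (GenConn.momentum γ₂ Y f) -
              GenConn.momentum γ₂ Y (GenConn.momentum γ₁ X f))) := by
  -- Second countability need not be assumed: a compact manifold has it.
  have : SecondCountableTopology G := ChartedSpace.secondCountable_of_sigmaCompact E G
  refine ⟨GenConn.isInducedHaar_inducedHaar B, fun γ₀ X hX hinv =>
    ⟨GenConn.isDivergence_divergence hM hX hinv, GenConn.divergence_gaugeAct hM hX hinv,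
      GenConn.exists_isMomentumOperator hM hX hinv⟩, fun γ₁ γ₂ X Y hX hX' hY hY' =>
    ⟨GenConn.Graph.exists_ge_pair γ₁ γ₂, fun γ₃ h1 h2 => ⟨hX.bracket hY h1 h2,
      GenConn.IsInvariant.bracket hX hY hX' hY' h1 h2, fun f hf =>
      ⟨GenConn.momentum_mem_cylInv hM hX hX' (by norm_num) GenConn.two_le_infty hf,
        GenConn.momentum_mem_cylInv hM hY hY' (by norm_num) GenConn.two_le_infty hf,
        GenConn.momentum_bracket hM hX hY hX' hY' h1 h2 hf⟩⟩⟩⟩
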